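/- **Setting.** Let $\epsilon,\rho$ be real constants with $\epsilon>0$, $0<\rho<1$ and $(1+\rho)\epsilon\le 1$. For a finite graph $G=(V,E)$ let $N[v]$ be the closed neighbourhood of $v$, $d[v]$ its degree, $d_{\max}(u,v)=\max\{d[u],d[v]\}$, and for an edge $(u,v)$ let $\sigma(u,v)=\frac{|N[u]\cap N[v]|}{|N[u]\cup N[v]|}$ (Jaccard similarity). A labelling of the edges as similar/dissimilar is *valid $\rho$-approximate* if each edge with $\sigma(u,v)\ge(1+\rho)\epsilon$ is labelled similar and each edge with $\sigma(u,v)<(1-\rho)\epsilon$ is labelled dissimilar. For an integer $\mu\ge1$, the clustering $\mathcal C(\mathcal L,\mu)$ of a labelling $\mathcal L$ is as follows: a vertex with at least $\mu$ similar neighbours (neighbours along similar edges) is a core vertex; each connected component of the graph of the core vertices and the similar edges between them gives one cluster, formed by its vertices and all their similar neighbours. A clustering is *correct under the $\rho$-approximate notion* if it is $\mathcal C(\mathcal L,\mu)$ for some valid $\rho$-approximate labelling $\mathcal L$. **The algorithm DynELM.** It processes a sequence of updates, each an insertion of a new edge or a deletion of an existing edge, starting from $n$ vertices and no edges. The *labelling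 strategy*, in its $i$-th invocation ($i=1,2,\dots$), on an edge $(u,v)$, draws $L_i$ independent samples: a coin selects $u$ with probability $\frac{|N[u]|}{|N[u]|+|N[v]|}$ and $v$ otherwise, and a uniformly random vertex of the closed neighbourhood of the selected endpoint is picked. If $\bar X$ is the fraction of picked vertices lying in $N[u]\cap N[v]$, the edge is labelled similar iff $\frac{\bar X}{2-\bar X}\ge\epsilon$. Whenever an edge is labelled, a new tracking instance for it is started with threshold $\tau(u,v)=\lfloor\frac12\rho\epsilon\, d_{\max}(u,v)\rfloor+1$; it counts the later *affecting updates* (updates of other edges that share an endpoint with $(u,v)$) and is mature when the count is $\tau(u,v)$. On an update $(u,w)$ the graph is changed and the update is counted for all affected edges; an inserted edge is labelled; then the edges at $u$ whose instances are mature are relabelled one by one, in any order, and then those at $w$. The set $F$ of edges whose labels flipped is returned (an inserted edge belongs to $F$ if it is labelled similar, a deleted one if it was labelled similar). **Machine.** Word RAM with unit-cost arithmetic, memory access, tests, output of a pair of words, and random draws (a uniform element of $\{0,\dots,y-1\}$ for a word $y$); it can also round $\epsilon y$ and $\frac12\rho\epsilon\, y$ down and up for a word $y$. Registers and memory are zero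 at first, and the space is the size of the initial segment of the memory that is in use. Words have $O(\log(n+M+\log\frac1{\delta^*}))$ bits. **Theorem.** There is a constant $C$ depending only on $\epsilon,\rho$ such that for every $\delta^*\in(0,1)$ there are sample sizes $L_i$ with $$\tfrac{2}{(\rho\epsilon/2)^2}\ln\tfrac{2}{\delta_i}\ \le\ L_i\ \le\ C\cdot\tfrac{2}{(\rho\epsilon/2)^2}\ln\tfrac{2}{\delta_i},\qquad \delta_i=\tfrac{\delta^*}{i(i+1)},$$ and an implementation of DynELM with these sample sizes on the machine (programs for the updates and for looking up the label of an edge, which know neither $n$ nor $M$) such that for all $n$, $M$ and every sequence of $M$ updates on $n$ vertices that is fixed in advance: * for all random choices, the total cost of the $M$ updates is at most $C\cdot M\cdot\left(\log^2 n+\log n\cdot\log\frac{M}{\delta^*}\right)$, i.e. the amortized cost of each update is $O(\log^2 n+\log n\cdot\log\frac M{\delta^*})$; * for all random choices, the space consumption is always at most $C(n+m)$, where $m$ is the current number of edges (during an update, the number after it); * with probability at least $1-\delta^*$, the labelling that is maintained is a valid $\rho$-approximate edge labelling after every update, and hence its clustering is correct under the $\rho$-approximate notion for every $\mu\ge1$.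 That the machine implements DynELM means: for all random choices, after every update its output is the set $F$ of a run of DynELM on samples that are independent and have the law above, and the label that this run gives to any current edge can be looked up from the memory in at most $C\log n$ steps. -/

import Mathlib

open MeasureTheory ProbabilityTheory

namespace DynELM

/-! ### Structural similarity and edge labellings -/

section Graphs

/-- The closed neighbourhood `N[v]`: the neighbours of `v` together with `v`. -/
noncomputable def closedNbr {V : Type} [Fintype V] (G : SimpleGraph V) (v : V) : Finset V :=
  (insert v (G.neighborSet v)).toFinite.toFinset

/-- The degree `d[v]`: the number of neighbours of `v`. -/
noncomputable def deg {V : Type} (G : SimpleGraph V) (v : V) : ℕ := (G.neighborSet v).ncard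

/-- `d_max(u, v)`. -/
noncomputable def degMax {V : Type} (G : SimpleGraph V) (u v : V) : ℕ := max (deg G u) (deg G v)

open scoped Classical in
/-- The structural (Jaccard) similarity `σ(u, v)`; it is `0` for non-adjacent vertices. -/
noncomputable def sim {V : Type} [Fintype V] (G : SimpleGraph V) (u v : V) : ℝ :=
  if G.Adj u v then
    ((closedNbr G u ∩ closedNbr G v).card : ℝ) / ((closedNbr G u ∪ closedNbr G v).card : ℝ)
  else 0

/-- An edge labelling; `true` means "similar" and `false` means "dissimilar". Only the values on the
edges of the graph matter. -/
abbrev Labelling (V : Type) : Type := Sym2 V → Bool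

/-- Valid `ρ`-approximate edge labelling for the similarity threshold `ε`. -/
def ValidLabelling {V : Type} [Fintype V] (G : SimpleGraph V) (ε ρ : ℝ) (l : Labelling V) : Prop :=
  ∀ u v : V, G.Adj u v →
    ((1 + ρ) * ε ≤ sim G u v → l s(u, v) = true) ∧
    (sim G u v < (1 - ρ) * ε → l s(u, v) = false)

/-- `u` and `v` are similar neighbours. -/
def SimilarNbr {V : Type} (G : SimpleGraph V) (l : Labelling V) (u v : V) : Prop :=
  G.Adj u v ∧ l s(u, v) = true

/-- A core vertex has at least `μ` similar neighbours. -/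
def IsCore {V : Type} (G : SimpleGraph V) (l : Labelling V) (μ : ℕ) (u : V) : Prop :=
  μ ≤ {v | SimilarNbr G l u v}.ncard

/-- The sim-core graph: the core vertices and the similar edges between them. -/
def simCoreGraph {V : Type} (G : SimpleGraph V) (l : Labelling V) (μ : ℕ) :
    SimpleGraph {u : V // IsCore G l μ u} where
  Adj a b := SimilarNbr G l a.1 b.1
  symm := ⟨fun a b h => ⟨h.1.symm, by rw [Sym2.eq_swap]; exact h.2⟩⟩
  loopless := ⟨fun a h => G.loopless.irrefl a.1 h.1⟩

/-- The clustering result: one cluster for each connected component of the sim-core graph, made of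
the vertices of the component and of all their similar neighbours. -/
def clusters {V : Type} (G : SimpleGraph V) (l : Labelling V) (μ : ℕ) : Set (Set V) :=
  Set.range fun c : (simCoreGraph G l μ).ConnectedComponent =>
    {v | ∃ u : {u : V // IsCore G l μ u},
      (simCoreGraph G l μ).connectedComponentMk u = c ∧ (v = u.1 ∨ SimilarNbr G l u.1 v)}

/-- A clustering that is correct under the `ρ`-approximate notion: it is the clustering result of
some valid `ρ`-approximate edge labelling. -/
def CorrectClustering {V : Type} [Fintype V] (G : SimpleGraph V) (ε ρ : ℝ) (μ : ℕ)
    (R : Set (Set V)) : Prop :=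
  ∃ l : Labelling V, ValidLabelling G ε ρ l ∧ R = clusters G l μ

end Graphs

/-! ### Update sequences -/

section Updates

/-- An update: the insertion (`ins = true`) or the deletion (`ins = false`) of the edge `(u, w)`. -/
structure Update (V : Type) where
  ins : Bool
  u : V
  w : V

/-- One inserts only new edges and deletes only existing ones. -/
def Update.Valid {V : Type} (G : SimpleGraph V) (x : Update V) : Prop :=
  x.u ≠ x.w ∧ (x.ins = true ↔ ¬ G.Adj x.u x.w)

/-- The graph after the update. -/
def Update.apply {V : Type} (G : SimpleGraph V) (x : Update V) : SimpleGraph V :=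
  if x.ins then G ⊔ SimpleGraph.fromEdgeSet {s(x.u, x.w)} else G.deleteEdges {s(x.u, x.w)}

/-- The graph after the first `t` updates, starting without edges. -/
def graphAt {V : Type} (upd : ℕ → Update V) : ℕ → SimpleGraph V
  | 0 => ⊥
  | t + 1 => (upd t).apply (graphAt upd t)

end Updates

/-! ### The algorithm

The abstract algorithm, driven by an array of samples: `smp i j` is the `j`-th sample drawn in the
`i`-th invocation (`i = 1, 2, …`) of the labelling strategy. A sample of an invocation on `(u, v)`
is an element of the disjoint union `V ⊕ V`: it is `inl x` if the coin selected the endpoint `u` and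
the vertex `x` of `N[u]` was picked, and `inr x` if the coin selected `v` and `x` of `N[v]` was
picked. Invocation `i` draws `L i` samples. -/

section Algorithm

open scoped Classical in
/-- The similarity estimate `X̄ / (2 - X̄)` obtained from `k` samples, where `X̄` is the fraction of
the samples that lie in `N[u] ∩ N[v]`. -/
noncomputable def estimate {V : Type} [Fintype V] (G : SimpleGraph V) (u v : V) (k : ℕ)
    (smp : ℕ → V ⊕ V) : ℝ :=
  let X : ℝ := (∑ j ∈ Finset.range k,
    if Sum.elim id id (smp j) ∈ closedNbr G u ∩ closedNbr G v then (1 : ℝ) else 0) / k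
  X / (2 - X)

/-- The state of the algorithm: the current graph, the labels, and for every edge its tracking
instance, with threshold `thr` and the number `cnt` of affecting updates since the edge was last
labelled; `calls` is the list of all invocations of the strategy so far (current graph, and the
edge as an ordered pair), and `flips` is the set `F` that the last update returned. -/
structure State (V : Type) where
  graph : SimpleGraph V
  label : Labelling V
  thr : Sym2 V → ℕ
  cnt : Sym2 V → ℕ
  calls : List (SimpleGraph V × V × V)
  flips : Set (Sym2 V)

/-- The state before the first update: no edges. -/
def State.initial (V : Type) : State V where
  graph := ⊥
  label := fun _ => false
  thr := fun _ => 0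
  cnt := fun _ => 0
  calls := []
  flips := ∅

open scoped Classical in
/-- Label the edge `e = (u, v)` by the strategy (similar iff the estimate is at least `ε`), record
whether the label flipped, and start a new tracking instance with the threshold
`⌊ρ ε d_max(u, v) / 2⌋ + 1`. -/
noncomputable def relabel {V : Type} [Fintype V] (ε ρ : ℝ) (L : ℕ → ℕ) (smp : ℕ → ℕ → V ⊕ V)
    (s : State V) (e : V × V) : State V :=
  let i := s.calls.length + 1
  let b : Bool := decide (ε ≤ estimate s.graph e.1 e.2 (L i) (smp i))
  { graph := s.graph
    label := Function.update s.label s(e.1, e.2) b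
    thr := Function.update s.thr s(e.1, e.2) (⌊ρ * ε / 2 * (degMax s.graph e.1 e.2 : ℝ)⌋₊ + 1)
    cnt := Function.update s.cnt s(e.1, e.2) 0
    calls := s.calls ++ [(s.graph, e)]
    flips := if b = s.label s(e.1, e.2) then s.flips else insert s(e.1, e.2) s.flips }

open scoped Classical in
/-- Execute the update on the graph and count it for every affected edge, that is every other edge
at `u` or at `w`. A deleted edge that was labelled similar enters `F`; its label is dropped
(non-edges carry the label `false`). -/
noncomputable def arrive {V : Type} (s : State V) (x : Update V) : State V where
  graph := x.apply s.graph
  label := if x.ins then s.label else Function.update s.label s(x.u, x.w) false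
  thr := s.thr
  cnt := fun e => if (x.u ∈ e ∨ x.w ∈ e) ∧ e ≠ s(x.u, x.w) then s.cnt e + 1 else s.cnt e
  calls := s.calls
  flips := if x.ins = false ∧ s.label s(x.u, x.w) = true then {s(x.u, x.w)} else ∅

/-- The tracking instance of the edge `(a, v)` is mature. -/
def Mature {V : Type} (s : State V) (a v : V) : Prop :=
  s.graph.Adj a v ∧ s.cnt s(a, v) = s.thr s(a, v)

/-- `s'` results from `s` by relabelling, one after another and in any order, all edges at `a` whose
tracking instances are mature. -/
def RelabelAt {V : Type} [Fintype V] (ε ρ : ℝ) (L : ℕ → ℕ) (smp : ℕ → ℕ → V ⊕ V) (a : V)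
    (s s' : State V) : Prop :=
  ∃ vs : List V, vs.Nodup ∧ (∀ v, v ∈ vs ↔ Mature s a v) ∧
    s' = (vs.map fun v => (a, v)).foldl (relabel ε ρ L smp) s

/-- One update: execute it; label an inserted edge; relabel the mature edges at `u`, then those
at `w`. -/
def Step {V : Type} [Fintype V] (ε ρ : ℝ) (L : ℕ → ℕ) (smp : ℕ → ℕ → V ⊕ V) (x : Update V)
    (s s' : State V) : Prop :=
  ∃ s₁ s₂ : State V,
    s₁ = (if x.ins then relabel ε ρ L smp (arrive s x) (x.u, x.w) else arrive s x) ∧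
    RelabelAt ε ρ L smp x.u s₁ s₂ ∧ RelabelAt ε ρ L smp x.w s₂ s'

/-- `S t` is the state of the algorithm after `t` updates, for all `t ≤ M`. -/
def IsRun {V : Type} [Fintype V] (ε ρ : ℝ) (L : ℕ → ℕ) (smp : ℕ → ℕ → V ⊕ V)
    (upd : ℕ → Update V) (M : ℕ) (S : ℕ → State V) : Prop :=
  S 0 = State.initial V ∧ ∀ t < M, Step ε ρ L smp (upd t) (S t) (S (t + 1))

/-- The random array `smp` consists of independent samples with the prescribed law. For the `i`-th
invocation, on the edge `(u, v)`, each sample is uniform on the disjoint union of `N[u]` and `N[v]`: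
the coin selects `u` with probability `|N[u]| / (|N[u]| + |N[v]|)` and `v` otherwise, and then a
vertex of the selected neighbourhood is picked uniformly at random. (The invocations do not depend
on the random choices, since the tracking instances do not depend on the labels.) -/
def IsSampling {Ω : Type} [MeasurableSpace Ω] (P : Measure Ω) {V : Type} [Fintype V]
    [MeasurableSpace V] (L : ℕ → ℕ) (calls : List (SimpleGraph V × V × V))
    (smp : Ω → ℕ → ℕ → V ⊕ V) : Prop :=
  iIndepFun (fun (p : ℕ × ℕ) (ω : Ω) => smp ω p.1 p.2) P ∧
  ∀ (i : ℕ) (hi : i < calls.length), ∀ j < L (i + 1),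
    P.map (fun ω => smp ω (i + 1) j) =
      uniformOn (((closedNbr calls[i].1 calls[i].2.1).disjSum
        (closedNbr calls[i].1 calls[i].2.2) : Finset (V ⊕ V)) : Set (V ⊕ V))

end Algorithm

/-! ### The machine: a word RAM with random draws -/

section WordRAM

/-- The source of randomness. The draw number `j` from a range of size `k + 1` returns the entry
with index `(j, k)`. -/
abbrev Tape : Type := ∀ p : ℕ × ℕ, Fin (p.2 + 1)

/-- All entries of the tape are independent and uniform. -/
noncomputable def tapeMeasure : Measure Tape :=
  Measure.infinitePi fun p : ℕ × ℕ => (PMF.uniformOfFintype (Fin (p.2 + 1))).toMeasure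

/-- Binary word operations; comparisons return `1` or `0`. -/
inductive Op where
  | add | sub | mul | div | mod | lt | eq

def Op.eval : Op → ℕ → ℕ → ℕ
  | .add, a, b => a + b
  | .sub, a, b => a - b
  | .mul, a, b => a * b
  | .div, a, b => a / b
  | .mod, a, b => a % b
  | .lt, a, b => if a < b then 1 else 0
  | .eq, a, b => if a = b then 1 else 0

/-- Programs. `x`, `y`, `z` are numbers of registers.
* `const x k`: `x := k`;
* `op o x y z`: `x := y o z`;
* `scaleFloor c x y`, `scaleCeil c x y`: `x := ⌊θ c * y⌋`, `x := ⌈θ c * y⌉`, where `θ 0` and `θ 1`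
  are two fixed real constants (used for the real constants of the problem; for rational constants
  these are ordinary integer operations);
* `load x y`: `x := mem[y]`;  `store x y`: `mem[x] := y`;
* `draw x y`: `x :=` a fresh uniformly random element of `{0, …, y - 1}`;
* `emit x y`: append the pair `(x, y)` to the output;
* `ite x c d`: run `c` if `x ≠ 0` and `d` otherwise;  `loop x c`: while `x ≠ 0`, run `c`. -/
inductive Prog where
  | skip
  | const (x k : ℕ)
  | op (o : Op) (x y z : ℕ)
  | scaleFloor (c : Fin 2) (x y : ℕ)
  | scaleCeil (c : Fin 2) (x y : ℕ)
  | load (x y : ℕ)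
  | store (x y : ℕ)
  | draw (x y : ℕ)
  | emit (x y : ℕ)
  | seq (c d : Prog)
  | ite (x : ℕ) (c d : Prog)
  | loop (x : ℕ) (c : Prog)

/-- A configuration: registers, memory, number of random draws made so far, and output. -/
structure Conf where
  reg : ℕ → ℕ
  mem : ℕ → ℕ
  draws : ℕ
  out : List (ℕ × ℕ)

/-- The initial configuration: everything is zero. -/
def Conf.blank : Conf where
  reg := fun _ => 0
  mem := fun _ => 0
  draws := 0
  out := []

def Conf.setReg (s : Conf) (x k : ℕ) : Conf := { s with reg := Function.update s.reg x k }

/-- Supply an input of three words in the registers `0, 1, 2`, and clear the output. -/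
def Conf.input (s : Conf) (a b c : ℕ) : Conf :=
  { (((s.setReg 0 a).setReg 1 b).setReg 2 c) with out := [] }

/-- `Exec θ ω W K c s k s'`: with the random tape `ω`, on a machine with words `0, …, W - 1` and
memory cells `0, …, K - 1`, the program `c` started in `s` halts in `s'` after `k` steps. A value
that does not fit into a word and an address outside of the memory are faults: there is no rule
for them. Every instruction and every test of `ite` and `loop` costs one step. -/
inductive Exec (θ : Fin 2 → ℝ) (ω : Tape) (W K : ℕ) : Prog → Conf → ℕ → Conf → Prop where
  | skip (s : Conf) : Exec θ ω W K .skip s 1 s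
  | const (s : Conf) (x k : ℕ) (h : k < W) : Exec θ ω W K (.const x k) s 1 (s.setReg x k)
  | op (s : Conf) (o : Op) (x y z : ℕ) (h : o.eval (s.reg y) (s.reg z) < W) :
      Exec θ ω W K (.op o x y z) s 1 (s.setReg x (o.eval (s.reg y) (s.reg z)))
  | scaleFloor (s : Conf) (c : Fin 2) (x y : ℕ) (h : ⌊θ c * (s.reg y : ℝ)⌋₊ < W) :
      Exec θ ω W K (.scaleFloor c x y) s 1 (s.setReg x ⌊θ c * (s.reg y : ℝ)⌋₊)
  | scaleCeil (s : Conf) (c : Fin 2) (x y : ℕ) (h : ⌈θ c * (s.reg y : ℝ)⌉₊ < W) :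
      Exec θ ω W K (.scaleCeil c x y) s 1 (s.setReg x ⌈θ c * (s.reg y : ℝ)⌉₊)
  | load (s : Conf) (x y : ℕ) (h : s.reg y < K) :
      Exec θ ω W K (.load x y) s 1 (s.setReg x (s.mem (s.reg y)))
  | store (s : Conf) (x y : ℕ) (h : s.reg x < K) :
      Exec θ ω W K (.store x y) s 1
        { s with mem := Function.update s.mem (s.reg x) (s.reg y) }
  | draw (s : Conf) (x y : ℕ) (h : 0 < s.reg y) :
      Exec θ ω W K (.draw x y) s 1
        { s.setReg x (ω (s.draws, s.reg y - 1) : ℕ) with draws := s.draws + 1 }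
  | emit (s : Conf) (x y : ℕ) :
      Exec θ ω W K (.emit x y) s 1 { s with out := s.out ++ [(s.reg x, s.reg y)] }
  | seq (c d : Prog) (s s' s'' : Conf) (k k' : ℕ) (h : Exec θ ω W K c s k s')
      (h' : Exec θ ω W K d s' k' s'') : Exec θ ω W K (.seq c d) s (k + k') s''
  | ite_true (x : ℕ) (c d : Prog) (s s' : Conf) (k : ℕ) (hx : s.reg x ≠ 0)
      (h : Exec θ ω W K c s k s') : Exec θ ω W K (.ite x c d) s (k + 1) s'
  | ite_false (x : ℕ) (c d : Prog) (s s' : Conf) (k : ℕ) (hx : s.reg x = 0)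
      (h : Exec θ ω W K d s k s') : Exec θ ω W K (.ite x c d) s (k + 1) s'
  | loop_done (x : ℕ) (c : Prog) (s : Conf) (hx : s.reg x = 0) :
      Exec θ ω W K (.loop x c) s 1 s
  | loop_more (x : ℕ) (c : Prog) (s s' s'' : Conf) (k k' : ℕ) (hx : s.reg x ≠ 0)
      (h : Exec θ ω W K c s k s') (h' : Exec θ ω W K (.loop x c) s' k' s'') :
      Exec θ ω W K (.loop x c) s (k + k' + 1) s''

/-- A dynamic data structure on the machine: a program `update`, which gets an update as
`(1, u, w)` for an insertion and `(0, u, w)` for a deletion, and a program `lookup`, which gets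
an edge as `(0, u, v)` and answers in the register `0`. -/
structure Implementation where
  update : Prog
  lookup : Prog

/-- `conf t` is the configuration after `t` updates, for all `t ≤ M`, and `time t` is the number of
steps spent on the update number `t` (from `0`). The memory that is at hand during an update,
and that may be nonzero after it, is `mem G` cells, where `G` is the graph after the update. -/
def Implementation.IsRun (A : Implementation) (θ : Fin 2 → ℝ) (ω : Tape) (W : ℕ) {n : ℕ}
    (mem : SimpleGraph (Fin n) → ℕ) (upd : ℕ → Update (Fin n)) (M : ℕ) (conf : ℕ → Conf)
    (time : ℕ → ℕ) : Prop :=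
  conf 0 = Conf.blank ∧
  ∀ t < M,
    Exec θ ω W (mem (graphAt upd (t + 1))) A.update
      ((conf t).input (if (upd t).ins then 1 else 0) (upd t).u (upd t).w) (time t)
      (conf (t + 1)) ∧
    ∀ a, mem (graphAt upd (t + 1)) ≤ a → (conf (t + 1)).mem a = 0

end WordRAM

end DynELM

open DynELM

/-!
# Dynamic structural clustering on a word RAM

**The algorithm.** One update changes the sizes of `N[u] ∩ N[v]` and `N[u] ∪ N[v]` by at most one in
total (`Close`), so `k` affecting updates move the similarity by at most `k / total`
(`Close.jac_sub_le`). By Hoeffding's inequality an invocation of the labelling strategy errs by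
more than `ρε/2` with probability at most `δᵢ` (`estimate_fail`), and `∑ δᵢ ≤ δ*` bounds the failure
of any invocation (`sampling_fail`). As long as none fails, a label that was right up to `ρε/2` when
it was computed stays valid until the tracking instance of its edge is mature
(`Live.valid`). The invocations are paid for by a progress measure: an update affects the edges at
two vertices, and a threshold is proportional to the larger degree of the edge, so an update
creates only a constant amount of progress while each relabelling consumes one unit (`Live.step`).
Hence `M` updates cause `O(M)` invocations.

**Tracking.** An update must not touch all the edges that it affects. A vertex `v` only counts
the updates at `v`; an edge is tracked by alarms at its two ends, which ring when the counter there
has grown by half of what the edge still lacks. An alarm that rings before maturity halves the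
number of missing updates, so that `O(log n)` alarms ring per invocation; see `Aux.pot` and
`Inv.update`.

**The machine.** The programs are written for a virtual machine whose memory is a finitely supported
function on keys; a digital search tree implements it (`search_spec`, `delete_spec`), with
deletions that move the last node into the gap, so that the used segment of the memory stays linear
in the number of non-zero cells and an access costs the length of a key. The predicate `Tr` states
that a program maps one state to another at a given cost on a machine with given words and memory,
and is composed along the programs; `Fit.update` and `Fit.lookup` are its instances
for the update and for the lookup of a label, and `Inv.sz` bounds the number of cells by the number
of vertices and edges.

**Agreement.** The run of the machine on a tape is a run of the algorithm on the samples that are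
read from the tape (`Sim.update`). The counters, and with them the arguments of the `i`-th
invocation, do not depend on labels, hence not on the tape; the samples of different invocations
therefore read different, independent parts of it (`sampler_isSampling`). `exists_run` follows
the whole update sequence, `machine_fit` provides the word length, and `cost_le` adds up the cost.
-/

namespace DynELM

/-! ### Compiling arithmetic expressions -/

/-- Arithmetic expressions over registers and memory cells. The instances below provide the usual
notation; numerals stand for constants. The registers from `100` on are scratch registers for the
evaluation. -/
inductive Expr where
  | const (k : ℕ)
  | reg (r : ℕ)
  | bin (o : Op) (a b : Expr)
  | ld (a : Expr)

namespace Expr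

instance : Add Expr := ⟨.bin .add⟩
instance : Sub Expr := ⟨.bin .sub⟩
instance : Mul Expr := ⟨.bin .mul⟩
instance : Div Expr := ⟨.bin .div⟩
instance : Mod Expr := ⟨.bin .mod⟩
instance (k : ℕ) : OfNat Expr k := ⟨.const k⟩

/-- The value of an expression for the register contents `ρ` and the memory contents `μ`. -/
def eval (ρ μ : ℕ → ℕ) : Expr → ℕ
  | const k => k
  | reg r => ρ r
  | bin o a b => o.eval (a.eval ρ μ) (b.eval ρ μ)
  | ld a => μ (a.eval ρ μ)

/-- The number of steps that the compiled expression takes. -/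
def cost : Expr → ℕ
  | const _ => 1
  | reg _ => 2
  | bin _ a b => a.cost + b.cost + 1
  | ld a => a.cost + 1

/-- The evaluation of an expression never faults on a machine with words `0, …, W - 1` and `K` memory
cells. -/
def Ok (W K : ℕ) (ρ μ : ℕ → ℕ) : Expr → Prop
  | const k => k < W
  | reg r => r < 100 ∧ ρ r < W
  | bin o a b => a.Ok W K ρ μ ∧ b.Ok W K ρ μ ∧ o.eval (a.eval ρ μ) (b.eval ρ μ) < W
  | ld a => a.Ok W K ρ μ ∧ a.eval ρ μ < K

/-- Evaluate the expression into the register `t`, with scratch registers above `t`. -/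
def comp (t : ℕ) : Expr → Prog
  | const k => .const t k
  -- there is no instruction that copies a register
  | reg r => .seq (.const (t + 1) 0) (.op .add t r (t + 1))
  | bin o a b => .seq (a.comp t) (.seq (b.comp (t + 1)) (.op o t t (t + 1)))
  | ld a => .seq (a.comp t) (.load t t)

variable (ρ μ : ℕ → ℕ) (a b : Expr) (k r : ℕ)
@[simp] lemma eval_const : (const k).eval ρ μ = k := rfl
@[simp] lemma eval_ofNat : (ofNat(k) : Expr).eval ρ μ = k := rfl
@[simp] lemma eval_reg : (reg r).eval ρ μ = ρ r := rfl
@[simp] lemma eval_add : (a + b).eval ρ μ = a.eval ρ μ + b.eval ρ μ := rfl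
@[simp] lemma eval_sub : (a - b).eval ρ μ = a.eval ρ μ - b.eval ρ μ := rfl
@[simp] lemma eval_mul : (a * b).eval ρ μ = a.eval ρ μ * b.eval ρ μ := rfl
@[simp] lemma eval_div : (a / b).eval ρ μ = a.eval ρ μ / b.eval ρ μ := rfl
@[simp] lemma eval_mod : (a % b).eval ρ μ = a.eval ρ μ % b.eval ρ μ := rfl
@[simp] lemma eval_lt : (bin .lt a b).eval ρ μ = if a.eval ρ μ < b.eval ρ μ then 1 else 0 := rfl
@[simp] lemma eval_eq : (bin .eq a b).eval ρ μ = if a.eval ρ μ = b.eval ρ μ then 1 else 0 := rfl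
@[simp] lemma eval_ld : (ld a).eval ρ μ = μ (a.eval ρ μ) := rfl

@[simp] lemma cost_const : (const k).cost = 1 := rfl
@[simp] lemma cost_ofNat : (ofNat(k) : Expr).cost = 1 := rfl
@[simp] lemma cost_reg : (reg r).cost = 2 := rfl
@[simp] lemma cost_add : (a + b).cost = a.cost + b.cost + 1 := rfl
@[simp] lemma cost_sub : (a - b).cost = a.cost + b.cost + 1 := rfl
@[simp] lemma cost_mul : (a * b).cost = a.cost + b.cost + 1 := rfl
@[simp] lemma cost_div : (a / b).cost = a.cost + b.cost + 1 := rfl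
@[simp] lemma cost_mod : (a % b).cost = a.cost + b.cost + 1 := rfl
@[simp] lemma cost_bin (o : Op) : (bin o a b).cost = a.cost + b.cost + 1 := rfl
@[simp] lemma cost_ld : (ld a).cost = a.cost + 1 := rfl

variable (W K : ℕ)
@[simp] lemma ok_const : (const k).Ok W K ρ μ ↔ k < W := Iff.rfl
@[simp] lemma ok_ofNat : (ofNat(k) : Expr).Ok W K ρ μ ↔ k < W := Iff.rfl
@[simp] lemma ok_reg : (reg r).Ok W K ρ μ ↔ r < 100 ∧ ρ r < W := Iff.rfl
@[simp] lemma ok_add : (a + b).Ok W K ρ μ ↔ a.Ok W K ρ μ ∧ b.Ok W K ρ μ ∧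
    a.eval ρ μ + b.eval ρ μ < W := Iff.rfl
@[simp] lemma ok_mul : (a * b).Ok W K ρ μ ↔ a.Ok W K ρ μ ∧ b.Ok W K ρ μ ∧
    a.eval ρ μ * b.eval ρ μ < W := Iff.rfl
@[simp] lemma ok_sub : (a - b).Ok W K ρ μ ↔ a.Ok W K ρ μ ∧ b.Ok W K ρ μ ∧
    a.eval ρ μ - b.eval ρ μ < W := Iff.rfl
@[simp] lemma ok_div : (a / b).Ok W K ρ μ ↔ a.Ok W K ρ μ ∧ b.Ok W K ρ μ ∧
    a.eval ρ μ / b.eval ρ μ < W := Iff.rfl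
@[simp] lemma ok_mod : (a % b).Ok W K ρ μ ↔ a.Ok W K ρ μ ∧ b.Ok W K ρ μ ∧
    a.eval ρ μ % b.eval ρ μ < W := Iff.rfl
@[simp] lemma ok_bin (o : Op) : (bin o a b).Ok W K ρ μ ↔ a.Ok W K ρ μ ∧ b.Ok W K ρ μ ∧
    o.eval (a.eval ρ μ) (b.eval ρ μ) < W := Iff.rfl
@[simp] lemma ok_ld : (ld a).Ok W K ρ μ ↔ a.Ok W K ρ μ ∧ a.eval ρ μ < K := Iff.rfl

end Expr

lemma Expr.eval_congr {ρ ρ' μ : ℕ → ℕ} {W K : ℕ} {e : Expr} (h : e.Ok W K ρ μ)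
    (h' : ∀ r < 100, ρ' r = ρ r) : e.eval ρ' μ = e.eval ρ μ ∧ e.Ok W K ρ' μ := by
  induction e with
  | const k => exact ⟨rfl, h⟩
  | reg r => exact ⟨h' r h.1, h.1, by rw [h' r h.1]; exact h.2⟩
  | bin o a b iha ihb =>
    obtain ⟨h1, h2, h3⟩ := h
    obtain ⟨e1, o1⟩ := iha h1
    obtain ⟨e2, o2⟩ := ihb h2
    simp only [Expr.eval, Expr.Ok, e1, e2]
    exact ⟨trivial, o1, o2, h3⟩
  | ld a ih =>
    obtain ⟨h1, h2⟩ := h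
    obtain ⟨e1, o1⟩ := ih h1
    simp only [Expr.eval, Expr.Ok, e1]
    exact ⟨trivial, o1, h2⟩

section Exec
variable {θ : Fin 2 → ℝ} {ω : Tape} {W K : ℕ}

/-- The compiled expression computes its value and leaves the registers below `t` alone. -/
lemma exec_comp (e : Expr) {t : ℕ} (ht : 100 ≤ t) (s : Conf) (h : e.Ok W K s.reg s.mem)
    (hW : 0 < W) :
    ∃ ρ : ℕ → ℕ, Exec θ ω W K (e.comp t) s e.cost { s with reg := ρ } ∧
      ρ t = e.eval s.reg s.mem ∧ ∀ r < t, ρ r = s.reg r := by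
  induction e generalizing t s with
  | const k =>
    exact ⟨_, Exec.const s t k h, by simp, fun r hr => by
      simp [Function.update_of_ne hr.ne]⟩
  | reg r =>
    have hr : r < 100 := h.1
    have h2 := Exec.op (θ := θ) (ω := ω) (W := W) (K := K) (s.setReg (t + 1) 0) .add t r (t + 1)
      (by simpa [Op.eval, Conf.setReg, Function.update_of_ne (show r ≠ t + 1 by omega)] using h.2)
    refine ⟨_, Exec.seq _ _ _ _ _ _ _ (Exec.const s (t + 1) 0 hW) h2, ?_, ?_⟩
    · simp [Op.eval, Conf.setReg, Function.update_of_ne (show r ≠ t + 1 by omega)]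
    · intro x hx
      simp [Conf.setReg, Function.update_of_ne (show x ≠ t by omega),
        Function.update_of_ne (show x ≠ t + 1 by omega)]
  | bin o a b iha ihb =>
    obtain ⟨h1, h2, h3⟩ := h
    obtain ⟨ρ1, x1, v1, f1⟩ := iha ht s h1
    obtain ⟨e2, o2⟩ := Expr.eval_congr (ρ' := ρ1) h2 fun r hr => f1 r (by omega)
    obtain ⟨ρ2, x2, v2, f2⟩ := ihb (t := t + 1) (by omega) { s with reg := ρ1 } o2
    have a1 : ρ2 t = a.eval s.reg s.mem := (f2 t (by omega)).trans v1
    have a2 : ρ2 (t + 1) = b.eval s.reg s.mem := by rw [v2]; exact e2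
    have x3 := Exec.op (θ := θ) (ω := ω) (W := W) (K := K) { s with reg := ρ2 } o t t (t + 1)
      (by simpa [a1, a2] using h3)
    refine ⟨_, by
      have := Exec.seq _ _ _ _ _ _ _ x1 (Exec.seq _ _ _ _ _ _ _ x2 x3)
      rwa [← add_assoc] at this, ?_, ?_⟩
    · simp [a1, a2, Expr.eval]
    · intro x hx
      simp only [Function.update_of_ne (show x ≠ t by omega)]
      exact (f2 x (by omega)).trans (f1 x hx)
  | ld a ih =>
    obtain ⟨h1, h2⟩ := h
    obtain ⟨ρ1, x1, v1, f1⟩ := ih ht s h1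
    have x3 := Exec.load (θ := θ) (ω := ω) (W := W) (K := K) { s with reg := ρ1 } t t
      (by simpa [v1] using h2)
    refine ⟨_, Exec.seq _ _ _ _ _ _ _ x1 x3, ?_, ?_⟩
    · simp [v1, Expr.eval]
    · intro x hx
      simp only [Function.update_of_ne (show x ≠ t by omega)]
      rw [f1 x hx]

end Exec

/-! ### Program combinators and simulation triples -/

/-- `x := e`. -/
def set (x : ℕ) (e : Expr) : Prog := .seq (e.comp 100) (.seq (.const 101 0) (.op .add x 100 101))

/-- `mem[a] := e`. -/
def st (a e : Expr) : Prog := .seq (a.comp 100) (.seq (e.comp 101) (.store 100 101))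

/-- Branch on `e ≠ 0`. -/
def iff (e : Expr) (c d : Prog) : Prog := .seq (e.comp 100) (.ite 100 c d)

/-- While `e ≠ 0`, run `c`. -/
def whl (e : Expr) (c : Prog) : Prog := .seq (e.comp 100) (.loop 100 (.seq c (e.comp 100)))

/-- Sequential composition. -/
infixr:60 " ;; " => Prog.seq

/-- The parameters of an execution: the constants `θ`, the random tape `ω`, the word size `W`, and
the memory size `K`. -/
structure Mach where
  θ : Fin 2 → ℝ
  ω : Tape
  W : ℕ
  K : ℕ

/-- Execution with the parameters `m`. -/
abbrev Mach.Ex (m : Mach) : Prog → Conf → ℕ → Conf → Prop := Exec m.θ m.ω m.W m.K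

/-- `R p a` says that the configuration `p` represents the abstract state `a`. The triple says that
`c` takes each configuration representing `a` to one that represents `a'`, in at most `k` steps. -/
def Tr (m : Mach) {α : Type} (R : Conf → α → Prop) (c : Prog) (k : ℕ) (a a' : α) : Prop :=
  ∀ p, R p a → ∃ k' ≤ k, ∃ p', R p' a' ∧ m.Ex c p k' p'

/-- The expression `e` takes the value `v` in the abstract state `a`, in at most `k` steps. -/
def Val (m : Mach) {α : Type} (R : Conf → α → Prop) (e : Expr) (k : ℕ) (a : α) (v : ℕ) : Prop :=
  ∀ p, R p a → ∃ k' ≤ k, ∃ p', R p' a ∧ m.Ex (e.comp 100) p k' p' ∧ p'.reg 100 = v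

namespace Tr
variable {m : Mach} {α : Type} {R : Conf → α → Prop} {c d : Prog} {e : Expr} {k k1 k2 ke v : ℕ}
  {a a1 a2 : α}

lemma skip : Tr m R .skip 1 a a := fun p h => ⟨1, le_rfl, p, h, Exec.skip p⟩

lemma mono (h : Tr m R c k a a1) (hk : k ≤ k1 := by omega) : Tr m R c k1 a a1 := fun p hp => by
  obtain ⟨k', h1, p', h2, h3⟩ := h p hp
  exact ⟨k', h1.trans hk, p', h2, h3⟩

lemma seq (h : Tr m R c k1 a a1) (h' : Tr m R d k2 a1 a2) : Tr m R (c ;; d) (k1 + k2) a a2 :=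
  fun p hp => by
    obtain ⟨i, hi, p1, r1, x1⟩ := h p hp
    obtain ⟨j, hj, p2, r2, x2⟩ := h' p1 r1
    exact ⟨i + j, by omega, p2, r2, Exec.seq _ _ _ _ _ _ _ x1 x2⟩

lemma ite_true (he : Val m R e ke a v) (hv : v ≠ 0) (h : Tr m R c k a a1) :
    Tr m R (iff e c d) (ke + k + 1) a a1 := fun p hp => by
  obtain ⟨i, hi, p1, r1, x1, rfl⟩ := he p hp
  obtain ⟨j, hj, p2, r2, x2⟩ := h p1 r1
  exact ⟨_, by omega, p2, r2, Exec.seq _ _ _ _ _ _ _ x1 (Exec.ite_true _ _ d _ _ _ hv x2)⟩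

lemma ite_false (he : Val m R e ke a 0) (h : Tr m R d k a a1) :
    Tr m R (iff e c d) (ke + k + 1) a a1 := fun p hp => by
  obtain ⟨i, hi, p1, r1, x1, hv⟩ := he p hp
  obtain ⟨j, hj, p2, r2, x2⟩ := h p1 r1
  exact ⟨_, by omega, p2, r2, Exec.seq _ _ _ _ _ _ _ x1 (Exec.ite_false _ c _ _ _ _ hv x2)⟩

lemma ite (he : Val m R e ke a v) (h : v ≠ 0 → Tr m R c k a a1) (h' : v = 0 → Tr m R d k a a1) :
    Tr m R (iff e c d) (ke + k + 1) a a1 := by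
  by_cases hv : v = 0
  · subst hv; exact ite_false he (h' rfl)
  · exact ite_true he hv (h hv)

lemma while_done (he : Val m R e ke a 0) : Tr m R (whl e c) (ke + 1) a a := fun p hp => by
  obtain ⟨i, hi, p1, r1, x1, hv⟩ := he p hp
  exact ⟨_, by omega, p1, r1, Exec.seq _ _ _ _ _ _ _ x1 (Exec.loop_done _ _ _ hv)⟩

lemma while_more (he : Val m R e ke a v) (hv : v ≠ 0) (h : Tr m R c k1 a a1)
    (h' : Tr m R (whl e c) k2 a1 a2) : Tr m R (whl e c) (ke + k1 + k2 + 1) a a2 := fun p hp => by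
  obtain ⟨i, hi, p1, r1, x1, rfl⟩ := he p hp
  obtain ⟨j, hj, p2, r2, x2⟩ := h p1 r1
  obtain ⟨l, hl, p3, r3, x3⟩ := h' p2 r2
  cases x3 with
  | seq _ _ _ q _ ka kb y z =>
    exact ⟨_, by omega, p3, r3, Exec.seq _ _ _ _ _ _ _ x1
      (Exec.loop_more _ _ _ _ _ _ _ hv (Exec.seq _ _ _ _ _ _ _ x2 y) z)⟩

end Tr

/-! ### Configurations up to scratch registers -/

/-- Two configurations agree up to the scratch registers of the expressions. -/
structure Agree (p q : Conf) : Prop where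
  reg : ∀ r < 100, p.reg r = q.reg r
  mem : p.mem = q.mem
  draws : p.draws = q.draws
  out : p.out = q.out

lemma Agree.refl (p : Conf) : Agree p p := ⟨fun _ _ => rfl, rfl, rfl, rfl⟩

lemma Agree.ok {p q : Conf} (h : Agree p q) {W K : ℕ} {e : Expr} (he : e.Ok W K q.reg q.mem) :
    e.eval p.reg p.mem = e.eval q.reg q.mem ∧ e.Ok W K p.reg p.mem := by
  rw [h.mem]
  exact Expr.eval_congr he h.reg

section Raw
variable {m : Mach} {e e' : Expr} {x : ℕ} {s : Conf}

/-- Write a word into a memory cell. -/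
def _root_.DynELM.Conf.setMem (s : Conf) (a v : ℕ) : Conf :=
  { s with mem := Function.update s.mem a v }

lemma Val.raw (hW : 0 < m.W) (he : e.Ok m.W m.K s.reg s.mem) :
    Val m Agree e e.cost s (e.eval s.reg s.mem) := fun p hp => by
  obtain ⟨v, o⟩ := hp.ok he
  obtain ⟨ρ, h1, h2, h3⟩ := exec_comp (θ := m.θ) (ω := m.ω) e le_rfl p o hW
  exact ⟨_, le_rfl, { p with reg := ρ }, ⟨fun r hr => (h3 r hr).trans (hp.reg r hr), hp.mem,
    hp.draws, hp.out⟩, h1, h2.trans v⟩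

lemma Tr.rawSet (hx : x < 100) (he : e.Ok m.W m.K s.reg s.mem) (hv : e.eval s.reg s.mem < m.W) :
    Tr m Agree (set x e) (e.cost + 2) s (s.setReg x (e.eval s.reg s.mem)) := fun p hp => by
  obtain ⟨k, hk, p1, h1, x1, v1⟩ := Val.raw (m := m) (by omega) he p hp
  refine ⟨_, ?_, _, ?_, Exec.seq _ _ _ _ _ _ _ x1 (Exec.seq _ _ _ _ _ _ _
    (Exec.const _ 101 0 (by omega)) (Exec.op _ .add x 100 101 ?_))⟩
  · omega
  · refine ⟨fun r hr => ?_, h1.mem, h1.draws, h1.out⟩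
    by_cases hrx : r = x
    · subst hrx
      simp [Conf.setReg, Op.eval, v1]
    · simp [Conf.setReg, hrx, h1.reg r hr, show r ≠ 101 by omega]
  · simpa [Conf.setReg, Op.eval, v1] using hv

lemma Tr.rawStore (he : e.Ok m.W m.K s.reg s.mem) (he' : e'.Ok m.W m.K s.reg s.mem) (hW : 0 < m.W)
    (hv : e.eval s.reg s.mem < m.K) :
    Tr m Agree (st e e') (e.cost + e'.cost + 1) s
      (s.setMem (e.eval s.reg s.mem) (e'.eval s.reg s.mem)) := fun p hp => by
  obtain ⟨v, o⟩ := hp.ok he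
  obtain ⟨v', o'⟩ := hp.ok he'
  obtain ⟨ρ, h1, h2, h3⟩ := exec_comp (θ := m.θ) (ω := m.ω) e le_rfl p o hW
  obtain ⟨v2, o2⟩ := Expr.eval_congr (ρ' := ρ) o' h3
  obtain ⟨ρ', h1', h2', h3'⟩ := exec_comp (θ := m.θ) (ω := m.ω) e' (t := 101) (by omega)
    { p with reg := ρ } o2 hW
  have e1 : ρ' 100 = e.eval s.reg s.mem := (h3' 100 (by omega)).trans (h2.trans v)
  have e2 : ρ' 101 = e'.eval s.reg s.mem := h2'.trans (v2.trans v')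
  refine ⟨_, ?_, _, ?_, Exec.seq _ _ _ _ _ _ _ h1 (Exec.seq _ _ _ _ _ _ _
    h1' (Exec.store _ 100 101 ?_))⟩
  · omega
  · refine ⟨fun r hr => ?_, ?_, hp.draws, hp.out⟩
    · exact (h3' r (by omega)).trans ((h3 r hr).trans (hp.reg r hr))
    · simp [Conf.setMem, e1, e2, hp.mem]
  · simpa [e1] using hv

end Raw


@[simp] lemma Conf.setReg_reg (s : Conf) (x k y : ℕ) :
    (s.setReg x k).reg y = if y = x then k else s.reg y := by
  simp [Conf.setReg, Function.update_apply]
@[simp] lemma Conf.setReg_mem (s : Conf) (x k : ℕ) : (s.setReg x k).mem = s.mem := rfl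
@[simp] lemma Conf.setReg_draws (s : Conf) (x k : ℕ) : (s.setReg x k).draws = s.draws := rfl
@[simp] lemma Conf.setReg_out (s : Conf) (x k : ℕ) : (s.setReg x k).out = s.out := rfl
@[simp] lemma Conf.setMem_mem (s : Conf) (x k y : ℕ) :
    (s.setMem x k).mem y = if y = x then k else s.mem y := by
  simp [Conf.setMem, Function.update_apply]
@[simp] lemma Conf.setMem_reg (s : Conf) (x k : ℕ) : (s.setMem x k).reg = s.reg := rfl
@[simp] lemma Conf.setMem_draws (s : Conf) (x k : ℕ) : (s.setMem x k).draws = s.draws := rfl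
@[simp] lemma Conf.setMem_out (s : Conf) (x k : ℕ) : (s.setMem x k).out = s.out := rfl

/-! ### Digital search trees

The tree is a binary tree in which each node holds a key, and the way from the root to the node is
given by the lowest bits of the key. Hence its height is bounded by the length of the keys, without any
rebalancing, and every search is a walk along the bits of the key. -/

/-- The `d` lowest bits of `x`, the lowest one last. -/
def path (x : ℕ) : ℕ → List ℕ
  | 0 => []
  | d + 1 => (x / 2 ^ d % 2) :: path x d

@[simp] lemma path_length (x d : ℕ) : (path x d).length = d := by
  induction d with
  | zero => rfl
  | succ d ih => simp [path, ih]

lemma path_eq_iff (x y d : ℕ) : path x d = path y d ↔ x % 2 ^ d = y % 2 ^ d := by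
  induction d with
  | zero => simp [path, Nat.mod_one]
  | succ d ih =>
    simp only [path, List.cons.injEq, ih]
    rw [Nat.mod_pow_succ, Nat.mod_pow_succ (x := y)]
    constructor
    · rintro ⟨h1, h2⟩
      rw [h1, h2]
    · intro h
      have hx := Nat.mod_lt x (show 0 < 2 ^ d by positivity)
      have hy := Nat.mod_lt y (show 0 < 2 ^ d by positivity)
      have h1 := congrArg (· % 2 ^ d) h
      have h2 := congrArg (· / 2 ^ d) h
      simp only [Nat.add_mul_mod_self_left, Nat.mod_mod] at h1
      simp only [Nat.add_mul_div_left _ _ (show 0 < 2 ^ d by positivity), Nat.div_eq_of_lt hx,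
        Nat.div_eq_of_lt hy, zero_add] at h2
      exact ⟨h2, h1⟩

/-- The node with the number `p ∈ R` sits at the position `ps p` of the tree, given by the bits on
the way from the root. The content `c` of a pointer to the position `π` is right. -/
def NodeAt (R : Finset ℕ) (ps : ℕ → List ℕ) (π : List ℕ) (c : ℕ) : Prop :=
  (c = 0 ∧ ∀ q ∈ R, ps q ≠ π) ∨ (c ∈ R ∧ ps c = π)

/-- The memory cell `loc` holds the pointer to the position `π`. The node `p` occupies the cells
`4p, …, 4p + 3` (key, value, left and right child), and the cell `2` points to the root. -/
def IsSlot (R : Finset ℕ) (ps : ℕ → List ℕ) (π : List ℕ) (loc : ℕ) : Prop :=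
  (π = [] ∧ loc = 2) ∨ ∃ p ∈ R, ∃ b < 2, π = b :: ps p ∧ loc = 4 * p + 2 + b

/-- The memory holds a tree with the set `R` of nodes. -/
structure Shape (R : Finset ℕ) (ps : ℕ → List ℕ) (mem : ℕ → ℕ) : Prop where
  pos : ∀ p ∈ R, 1 ≤ p
  inj : ∀ p ∈ R, ∀ q ∈ R, ps p = ps q → p = q
  par : ∀ q ∈ R, ∀ b π, ps q = b :: π → ∃ p ∈ R, ps p = π
  slot : ∀ π loc, IsSlot R ps π loc → NodeAt R ps π (mem loc)

/-- The tree is a digital search tree for the function `g`: its keys are the arguments with nonzero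
values, and a key agrees with the position of its node in the lowest bits. The length of the
keys is bounded in terms of their residues modulo `16`. -/
structure Keys (B : ℕ → ℕ) (Bm : ℕ) (R : Finset ℕ) (ps : ℕ → List ℕ) (mem g : ℕ → ℕ) : Prop where
  pth : ∀ p ∈ R, ps p = path (mem (4 * p)) (ps p).length
  len : ∀ p ∈ R, (ps p).length ≤ Bm
  lt : ∀ p ∈ R, mem (4 * p) < 2 ^ B (mem (4 * p) % 16)
  val : ∀ p ∈ R, mem (4 * p + 1) = g (mem (4 * p))
  nz : ∀ p ∈ R, g (mem (4 * p)) ≠ 0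
  kinj : ∀ p ∈ R, ∀ q ∈ R, mem (4 * p) = mem (4 * q) → p = q
  sup : ∀ x, g x ≠ 0 → ∃ p ∈ R, mem (4 * p) = x

section Shape
variable {R : Finset ℕ} {ps : ℕ → List ℕ} {mem : ℕ → ℕ} {π π' : List ℕ} {loc loc' : ℕ}

lemma IsSlot.inj (hR : ∀ p ∈ R, 1 ≤ p) (h : IsSlot R ps π loc) (h' : IsSlot R ps π' loc) :
    π = π' := by
  rcases h with ⟨rfl, rfl⟩ | ⟨p, hp, b, hb, rfl, rfl⟩ <;>
    rcases h' with ⟨rfl, e⟩ | ⟨q, hq, c, hc, rfl, e⟩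
  · rfl
  · have := hR q hq; omega
  · have := hR p hp; omega
  · obtain rfl : p = q := by omega
    obtain rfl : b = c := by omega
    rfl

/-- The ancestors of a node belong to the tree. -/
lemma Shape.anc (h : Shape R ps mem) {q x e d : ℕ} (hq : q ∈ R) (he : ps q = path x e)
    (hd : d ≤ e) : ∃ p ∈ R, ps p = path x d := by
  induction e generalizing q with
  | zero => obtain rfl : d = 0 := by omega
            exact ⟨q, hq, he⟩
  | succ e ih =>
    by_cases hde : d = e + 1
    · exact ⟨q, hq, hde ▸ he⟩
    · obtain ⟨p, hp, h1⟩ := h.par q hq _ _ he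
      exact ih hp h1 (by omega)

/-- A new node in place of a null pointer. -/
lemma Shape.add_leaf (h : Shape R ps mem) {p : ℕ} (hp : 1 ≤ p) (hpR : p ∉ R)
    (hs : IsSlot R ps π loc) (hn : ∀ q ∈ R, ps q ≠ π) {mem' : ℕ → ℕ}
    (h0 : mem' (4 * p + 2) = 0) (h1 : mem' (4 * p + 3) = 0) (hl : mem' loc = p)
    (hm : ∀ a, a / 4 ∉ ({p} : Finset ℕ) → a ≠ loc → mem' a = mem a) :
    Shape (insert p R) (Function.update ps p π) mem' := by
  set ps' := Function.update ps p π with hps'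
  have e1 : ps' p = π := by simp [hps']
  have e2 : ∀ q ∈ R, ps' q = ps q := fun q hq => by
    have : q ≠ p := fun e => hpR (e ▸ hq)
    simp [hps', this]
  have up : ∀ {ρ l}, IsSlot R ps ρ l → IsSlot (insert p R) ps' ρ l := by
    rintro ρ l (⟨rfl, rfl⟩ | ⟨q, hq, b, hb, rfl, rfl⟩)
    · exact Or.inl ⟨rfl, rfl⟩
    · exact Or.inr ⟨q, by simp [hq], b, hb, by rw [e2 q hq], rfl⟩
  have hpos : ∀ q ∈ insert p R, 1 ≤ q := by
    intro q hq
    rcases Finset.mem_insert.1 hq with rfl | hq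
    exacts [hp, h.pos q hq]
  -- a parent of the new position exists, so nothing lies below the new position
  have below : ∀ q ∈ R, ∀ b, ps q ≠ b :: π := fun q hq b e => by
    obtain ⟨r, hr, e'⟩ := h.par q hq _ _ e
    exact hn r hr e'
  have nself : ∀ b : ℕ, π ≠ b :: π := fun b e => by simpa using congrArg List.length e
  refine ⟨hpos, ?_, ?_, ?_⟩
  · intro q hq r hr e
    rcases Finset.mem_insert.1 hq with rfl | hq' <;> rcases Finset.mem_insert.1 hr with rfl | hr'
    · rfl
    · rw [e1, e2 r hr'] at e; exact absurd e.symm (hn r hr')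
    · rw [e1, e2 q hq'] at e; exact absurd e (hn q hq')
    · rw [e2 q hq', e2 r hr'] at e; exact h.inj q hq' r hr' e
  · intro q hq b ρ e
    rcases Finset.mem_insert.1 hq with rfl | hq'
    · rw [e1] at e
      rcases hs with ⟨rfl, _⟩ | ⟨r, hr, c, _, rfl, _⟩
      · simp at e
      · simp only [List.cons.injEq] at e
        exact ⟨r, by simp [hr], by rw [e2 r hr]; exact e.2⟩
    · rw [e2 q hq'] at e
      obtain ⟨r, hr, e'⟩ := h.par q hq' _ _ e
      exact ⟨r, by simp [hr], by rw [e2 r hr, e']⟩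
  · intro ρ l hl'
    by_cases hll : l = loc
    · subst hll
      rw [IsSlot.inj hpos hl' (up hs), hl]
      exact Or.inr ⟨by simp, e1⟩
    · rcases hl' with ⟨rfl, rfl⟩ | ⟨q, hq, b, hb, rfl, rfl⟩
      · rw [hm 2 (by simp; omega) hll]
        rcases h.slot [] 2 (Or.inl ⟨rfl, rfl⟩) with ⟨a1, a2⟩ | ⟨a1, a2⟩
        · refine Or.inl ⟨a1, fun q hq => ?_⟩
          rcases Finset.mem_insert.1 hq with rfl | hq'
          · rw [e1]; rintro rfl
            rcases hs with ⟨_, rfl⟩ | ⟨r, hr, c, _, e, _⟩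
            · exact hll rfl
            · simp at e
          · rw [e2 q hq']; exact a2 q hq'
        · exact Or.inr ⟨by simp [a1], by rw [e2 _ a1, a2]⟩
      · rcases Finset.mem_insert.1 hq with rfl | hq'
        · have : mem' (4 * q + 2 + b) = 0 := by
            obtain rfl | rfl : b = 0 ∨ b = 1 := by omega
            exacts [h0, h1]
          rw [this]
          refine Or.inl ⟨rfl, fun r hr => ?_⟩
          rw [e1]
          rcases Finset.mem_insert.1 hr with rfl | hr'
          · rw [e1]; exact nself b
          · rw [e2 r hr']; exact below r hr' b
        · have hne : q ≠ p := fun e => hpR (e ▸ hq')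
          rw [hm _ (by simp; omega) hll, e2 q hq']
          rcases h.slot _ _ (Or.inr ⟨q, hq', b, hb, rfl, rfl⟩) with ⟨a1, a2⟩ | ⟨a1, a2⟩
          · refine Or.inl ⟨a1, fun r hr => ?_⟩
            rcases Finset.mem_insert.1 hr with rfl | hr'
            · rw [e1]; rintro rfl
              rcases hs with ⟨e, _⟩ | ⟨r, hr, c, _, e, rfl⟩
              · simp at e
              · simp only [List.cons.injEq] at e
                obtain rfl := h.inj _ hq' _ hr e.2
                rw [e.1] at hll; exact hll rfl
            · rw [e2 r hr']; exact a2 r hr'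
          · exact Or.inr ⟨by simp [a1], by rw [e2 _ a1, a2]⟩

/-- Remove a leaf. -/
lemma Shape.erase_leaf (h : Shape R ps mem) {q : ℕ} (hq : q ∈ R) (hs : IsSlot R ps (ps q) loc)
    (hleaf : ∀ r ∈ R, ∀ b, ps r ≠ b :: ps q) {mem' : ℕ → ℕ} (hl : mem' loc = 0)
    (hm : ∀ a, 2 ≤ a % 4 → a ≠ loc → mem' a = mem a) :
    Shape (R.erase q) ps mem' := by
  refine ⟨fun p hp => h.pos p (Finset.mem_of_mem_erase hp), fun p hp r hr =>
    h.inj p (Finset.mem_of_mem_erase hp) r (Finset.mem_of_mem_erase hr), ?_, ?_⟩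
  · intro p hp b π e
    have hp' := Finset.mem_of_mem_erase hp
    obtain ⟨r, hr, e'⟩ := h.par p hp' _ _ e
    refine ⟨r, Finset.mem_erase.2 ⟨?_, hr⟩, e'⟩
    rintro rfl
    exact hleaf p hp' b (by rw [e, e'])
  · intro π l hl'
    have hl2 : IsSlot R ps π l := by
      rcases hl' with h1 | ⟨p, hp, hh⟩
      exacts [Or.inl h1, Or.inr ⟨p, Finset.mem_of_mem_erase hp, hh⟩]
    by_cases hll : l = loc
    · subst hll
      rw [hl]
      refine Or.inl ⟨rfl, fun r hr e => ?_⟩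
      obtain ⟨h1, h2⟩ := Finset.mem_erase.1 hr
      rw [IsSlot.inj h.pos hl2 hs] at e
      exact h1 (h.inj _ h2 _ hq e)
    · rw [hm l (by rcases hl2 with ⟨_, rfl⟩ | ⟨p, hp, b, hb, _, rfl⟩ <;> omega) hll]
      rcases h.slot _ _ hl2 with ⟨a1, a2⟩ | ⟨a1, a2⟩
      · exact Or.inl ⟨a1, fun r hr => a2 r (Finset.mem_of_mem_erase hr)⟩
      · refine Or.inr ⟨Finset.mem_erase.2 ⟨?_, a1⟩, a2⟩
        intro e
        rw [e] at a2
        -- the slot of a position is unique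
        apply hll
        rw [← a2] at hl2
        rcases hl2 with ⟨e1, e2⟩ | ⟨p, hp, b, hb, e1, e2⟩ <;>
          rcases hs with ⟨e3, e4⟩ | ⟨p', hp', b', hb', e3, e4⟩
        · omega
        · rw [e1] at e3; simp at e3
        · rw [e1] at e3; simp at e3
        · rw [e1] at e3; simp only [List.cons.injEq] at e3
          obtain rfl := h.inj _ hp _ hp' e3.2
          omega

/-- Move the node `N` to the free place `q`. -/
lemma Shape.rename (h : Shape R ps mem) {q N : ℕ} (hN : N ∈ R) (hq : q ∉ R) (hq1 : 1 ≤ q)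
    (hs : IsSlot R ps (ps N) loc) {mem' : ℕ → ℕ} (hl : mem' loc = q)
    (h0 : mem' (4 * q + 2) = mem (4 * N + 2)) (h1 : mem' (4 * q + 3) = mem (4 * N + 3))
    (hm : ∀ a, a / 4 ∉ ({q, N} : Finset ℕ) → a ≠ loc → mem' a = mem a) :
    Shape (insert q (R.erase N)) (Function.update ps q (ps N)) mem' := by
  set ps' := Function.update ps q (ps N) with hps'
  have e1 : ps' q = ps N := by simp [hps']
  have e2 : ∀ r ∈ R, ps' r = ps r := fun r hr => by
    have : r ≠ q := fun e => hq (e ▸ hr)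
    simp [hps', this]
  have mem_iff : ∀ r, r ∈ insert q (R.erase N) ↔ r = q ∨ r ≠ N ∧ r ∈ R := by simp
  -- every position is occupied by the same node as before, up to the renaming
  have back : ∀ r ∈ insert q (R.erase N), ∃ r' ∈ R, ps' r = ps r' ∧
      (r = q ∧ r' = N ∨ r ≠ q ∧ r = r' ∧ r ≠ N) := by
    intro r hr
    rcases (mem_iff r).1 hr with rfl | ⟨hrN, hr'⟩
    · exact ⟨N, hN, e1, Or.inl ⟨rfl, rfl⟩⟩
    · exact ⟨r, hr', e2 r hr', Or.inr ⟨fun e => hq (e ▸ hr'), rfl, hrN⟩⟩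
  have forth : ∀ r ∈ R, ∃ r' ∈ insert q (R.erase N), ps' r' = ps r := by
    intro r hr
    by_cases hrN : r = N
    · exact ⟨q, by simp, by rw [e1, hrN]⟩
    · exact ⟨r, by simp [hrN, hr], e2 r hr⟩
  have node : ∀ π c, NodeAt R ps π c → c ≠ N → NodeAt (insert q (R.erase N)) ps' π c := by
    rintro π c (⟨a1, a2⟩ | ⟨a1, a2⟩) hc
    · refine Or.inl ⟨a1, fun r hr => ?_⟩
      obtain ⟨r', hr', e, _⟩ := back r hr
      rw [e]; exact a2 r' hr'
    · exact Or.inr ⟨(mem_iff c).2 (Or.inr ⟨hc, a1⟩), by rw [e2 c a1, a2]⟩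
  have uniq : ∀ {π l l'}, IsSlot R ps π l → IsSlot R ps π l' → l = l' := by
    rintro π l l' (⟨rfl, rfl⟩ | ⟨p, hp, b, hb, rfl, rfl⟩) (⟨e3, e4⟩ | ⟨p', hp', b', hb', e3, e4⟩)
    · omega
    · simp at e3
    · simp at e3
    · simp only [List.cons.injEq] at e3
      obtain rfl := h.inj _ hp _ hp' e3.2
      omega
  refine ⟨?_, ?_, ?_, ?_⟩
  · intro r hr
    rcases (mem_iff r).1 hr with rfl | ⟨_, hr'⟩
    exacts [hq1, h.pos r hr']
  · intro r hr t ht e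
    obtain ⟨r', hr', er, hh⟩ := back r hr
    obtain ⟨t', ht', et, hh'⟩ := back t ht
    have := h.inj r' hr' t' ht' (by rw [← er, ← et, e])
    omega
  · intro r hr b π e
    obtain ⟨r', hr', er, _⟩ := back r hr
    obtain ⟨t, ht, et⟩ := h.par r' hr' b π (by rw [← er, e])
    obtain ⟨t', ht', et'⟩ := forth t ht
    exact ⟨t', ht', by rw [et', et]⟩
  · intro π l hl'
    -- the corresponding slot before the renaming
    obtain ⟨l0, hl0, hcase⟩ : ∃ l0, IsSlot R ps π l0 ∧
        (l = l0 ∧ l / 4 ≠ q ∧ l / 4 ≠ N ∨ l / 4 = q ∧ l ≠ loc ∧ mem' l = mem l0 ∧ l0 / 4 = N) := by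
      rcases hl' with ⟨rfl, rfl⟩ | ⟨r, hr, b, hb, rfl, rfl⟩
      · exact ⟨2, Or.inl ⟨rfl, rfl⟩, Or.inl ⟨rfl, by omega, by have := h.pos N hN; omega⟩⟩
      · obtain ⟨r', hr', er, hh⟩ := back r hr
        refine ⟨4 * r' + 2 + b, Or.inr ⟨r', hr', b, hb, by rw [er], rfl⟩, ?_⟩
        rcases hh with ⟨rfl, rfl⟩ | ⟨n1, rfl, n2⟩
        · refine Or.inr ⟨by omega, ?_, ?_, by omega⟩
          · rintro rfl
            rcases hs with ⟨_, e⟩ | ⟨t, ht, b', hb', _, e⟩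
            · omega
            · obtain rfl : r = t := by omega
              exact hq ht
          · obtain rfl | rfl : b = 0 ∨ b = 1 := by omega
            exacts [h0, h1]
        · exact Or.inl ⟨rfl, by omega, by omega⟩
    have key : ∀ l1, IsSlot R ps π l1 → l1 ≠ loc → mem l1 ≠ N := by
      intro l1 hl1 hne e
      rcases h.slot _ _ hl1 with ⟨a1, _⟩ | ⟨_, a2⟩
      · have := h.pos N hN; omega
      · rw [e] at a2; rw [← a2] at hl1
        exact hne (uniq hl1 hs)
    rcases hcase with ⟨rfl, n1, n2⟩ | ⟨n1, n2, n3, n4⟩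
    · by_cases hll : l = loc
      · subst hll
        rw [hl, IsSlot.inj h.pos hl0 hs]
        exact Or.inr ⟨by simp, e1⟩
      · rw [hm l (by simp [n1, n2]) hll]
        exact node _ _ (h.slot _ _ hl0) (key _ hl0 hll)
    · rw [n3]
      refine node _ _ (h.slot _ _ hl0) ?_
      by_cases hll : l0 = loc
      · -- the pointer to `N` is not stored in `N`
        exfalso
        subst hll
        rcases hs with ⟨_, e⟩ | ⟨t, ht, b', hb', e, e'⟩
        · have := h.pos N hN; omega
        · obtain rfl : N = t := by omega
          simpa using congrArg List.length e
      · exact key _ hl0 hll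

end Shape


section Keys
variable {B : ℕ → ℕ} {Bm : ℕ} {R : Finset ℕ} {ps : ℕ → List ℕ} {mem mem' g : ℕ → ℕ}

lemma Shape.congr (h : Shape R ps mem) (hm : ∀ a, 2 ≤ a % 4 → mem' a = mem a) :
    Shape R ps mem' :=
  ⟨h.pos, h.inj, h.par, fun π loc hs => by
    rw [hm loc (by rcases hs with ⟨_, rfl⟩ | ⟨p, hp, b, hb, _, rfl⟩ <;> omega)]
    exact h.slot π loc hs⟩

lemma path_trunc {x y l d : ℕ} (h : path x d = path y d) (hl : l ≤ d) : path x l = path y l := by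
  rw [path_eq_iff] at h ⊢
  have : 2 ^ l ∣ 2 ^ d := Nat.pow_dvd_pow 2 hl
  rw [← Nat.mod_mod_of_dvd x this, h, Nat.mod_mod_of_dvd y this]

lemma Keys.setVal (h : Keys B Bm R ps mem g) {p v : ℕ} (hp : p ∈ R) (hv : v ≠ 0)
    (hm : ∀ a, a ≠ 4 * p + 1 → mem' a = mem a) (h1 : mem' (4 * p + 1) = v) :
    Keys B Bm R ps mem' (Function.update g (mem (4 * p)) v) := by
  have e : ∀ q, mem' (4 * q) = mem (4 * q) := fun q => hm _ (by omega)
  refine ⟨fun q hq => by rw [e]; exact h.pth q hq, h.len, fun q hq => by rw [e]; exact h.lt q hq,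
    fun q hq => ?_, fun q hq => ?_, fun q hq r hr => by rw [e, e]; exact h.kinj q hq r hr,
    fun x hx => ?_⟩
  · rw [e]
    by_cases hqp : q = p
    · subst hqp; simp [h1]
    · rw [Function.update_of_ne (fun h' => hqp (h.kinj q hq p hp h')), hm _ (by omega)]
      exact h.val q hq
  · rw [e]
    by_cases hqp : mem (4 * q) = mem (4 * p)
    · rw [hqp]; simp [hv]
    · rw [Function.update_of_ne hqp]; exact h.nz q hq
  · by_cases hxp : x = mem (4 * p)
    · exact ⟨p, hp, by rw [e, hxp]⟩
    · rw [Function.update_of_ne hxp] at hx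
      obtain ⟨q, hq, e'⟩ := h.sup x hx
      exact ⟨q, hq, by rw [e, e']⟩

lemma Keys.add_leaf (h : Keys B Bm R ps mem g) {p x v d : ℕ} (hp : p ∉ R) (hv : v ≠ 0)
    (hd : d ≤ Bm) (hx : x < 2 ^ B (x % 16)) (hno : ∀ q ∈ R, mem (4 * q) ≠ x)
    (h0 : mem' (4 * p) = x) (h1 : mem' (4 * p + 1) = v)
    (hm : ∀ a, a / 4 ≠ p → a % 4 < 2 → mem' a = mem a) :
    Keys B Bm (insert p R) (Function.update ps p (path x d)) mem' (Function.update g x v) := by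
  have ne : ∀ q ∈ R, q ≠ p := fun q hq e => hp (e ▸ hq)
  have e : ∀ q ∈ R, mem' (4 * q) = mem (4 * q) := fun q hq =>
    hm _ (by have := ne q hq; omega) (by omega)
  refine ⟨fun q hq => ?_, fun q hq => ?_, fun q hq => ?_, fun q hq => ?_, fun q hq => ?_,
    fun q hq r hr he => ?_, fun y hy => ?_⟩
  · rcases Finset.mem_insert.1 hq with rfl | hq'
    · simp [h0]
    · rw [Function.update_of_ne (ne q hq'), e q hq']; exact h.pth q hq'
  · rcases Finset.mem_insert.1 hq with rfl | hq'
    · simpa using hd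
    · rw [Function.update_of_ne (ne q hq')]; exact h.len q hq'
  · rcases Finset.mem_insert.1 hq with rfl | hq'
    · rw [h0]; exact hx
    · rw [e q hq']; exact h.lt q hq'
  · rcases Finset.mem_insert.1 hq with rfl | hq'
    · rw [h0, h1]; simp
    · rw [e q hq', Function.update_of_ne (hno q hq'),
        hm _ (by have := ne q hq'; omega) (by omega)]
      exact h.val q hq'
  · rcases Finset.mem_insert.1 hq with rfl | hq'
    · rw [h0]; simpa using hv
    · rw [e q hq', Function.update_of_ne (hno q hq')]; exact h.nz q hq'
  · rcases Finset.mem_insert.1 hq with rfl | hq' <;> rcases Finset.mem_insert.1 hr with rfl | hr'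
    · rfl
    · rw [h0, e r hr'] at he; exact absurd he.symm (hno r hr')
    · rw [h0, e q hq'] at he; exact absurd he (hno q hq')
    · rw [e q hq', e r hr'] at he; exact h.kinj q hq' r hr' he
  · by_cases hyx : y = x
    · exact ⟨p, by simp, by rw [h0, hyx]⟩
    · rw [Function.update_of_ne hyx] at hy
      obtain ⟨q, hq, e'⟩ := h.sup y hy
      exact ⟨q, by simp [hq], by rw [e q hq, e']⟩

/-- Deletion: the contents of the leaf `q` replace those of the node `p`. -/
lemma Keys.erase_leaf (h : Keys B Bm R ps mem g) {p q : ℕ} (hp : p ∈ R) (hq : q ∈ R)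
    (hpq : path (mem (4 * q)) (ps p).length = ps p)
    (h0 : mem' (4 * p) = mem (4 * q)) (h1 : mem' (4 * p + 1) = mem (4 * q + 1))
    (hm : ∀ a, a / 4 ≠ p → a % 4 < 2 → mem' a = mem a) :
    Keys B Bm (R.erase q) ps mem' (Function.update g (mem (4 * p)) 0) := by
  -- the place where the contents of a remaining node were before
  have src : ∀ r ∈ R.erase q, ∃ r' ∈ R, r' ≠ p ∧ mem' (4 * r) = mem (4 * r') ∧
      mem' (4 * r + 1) = mem (4 * r' + 1) ∧ path (mem (4 * r')) (ps r).length = ps r ∧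
      (r = p ∧ r' = q ∨ r ≠ p ∧ r' = r) := by
    intro r hr
    obtain ⟨n1, hr'⟩ := Finset.mem_erase.1 hr
    by_cases hrp : r = p
    · subst hrp
      exact ⟨q, hq, fun e => n1 e.symm, h0, h1, hpq, Or.inl ⟨rfl, rfl⟩⟩
    · exact ⟨r, hr', hrp, hm _ (by omega) (by omega), hm _ (by omega) (by omega),
        (h.pth r hr').symm, Or.inr ⟨hrp, rfl⟩⟩
  have gne : ∀ r' ∈ R, r' ≠ p → Function.update g (mem (4 * p)) 0 (mem (4 * r')) =
      g (mem (4 * r')) := fun r' hr' hne =>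
    Function.update_of_ne (fun e => hne (h.kinj r' hr' p hp e)) _ _
  refine ⟨fun r hr => ?_, fun r hr => h.len r (Finset.mem_of_mem_erase hr), fun r hr => ?_,
    fun r hr => ?_, fun r hr => ?_, fun r hr t ht he => ?_, fun y hy => ?_⟩
  · obtain ⟨r', hr', n, a, b, c, _⟩ := src r hr
    rw [a, c]
  · obtain ⟨r', hr', n, a, b, c, _⟩ := src r hr
    rw [a]; exact h.lt r' hr'
  · obtain ⟨r', hr', n, a, b, c, _⟩ := src r hr
    rw [a, b, gne r' hr' n]; exact h.val r' hr'
  · obtain ⟨r', hr', n, a, b, c, _⟩ := src r hr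
    rw [a, gne r' hr' n]; exact h.nz r' hr'
  · obtain ⟨r', hr', n, a, b, c, d⟩ := src r hr
    obtain ⟨t', ht', n', a', b', c', d'⟩ := src t ht
    have := h.kinj r' hr' t' ht' (by rw [← a, ← a', he])
    have n1 := (Finset.mem_erase.1 hr).1
    have n2 := (Finset.mem_erase.1 ht).1
    omega
  · have hyp : y ≠ mem (4 * p) := by rintro rfl; simp at hy
    rw [Function.update_of_ne hyp] at hy
    obtain ⟨r, hr, e'⟩ := h.sup y hy
    have hrp : r ≠ p := by rintro rfl; exact hyp e'.symm
    by_cases hrq : r = q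
    · subst hrq
      exact ⟨p, Finset.mem_erase.2 ⟨fun e => hrp e.symm, hp⟩, by rw [h0, e']⟩
    · exact ⟨r, Finset.mem_erase.2 ⟨hrq, hr⟩, by rw [hm _ (by omega) (by omega), e']⟩

lemma Keys.rename (h : Keys B Bm R ps mem g) {q N : ℕ} (hN : N ∈ R) (hq : q ∉ R)
    (h0 : mem' (4 * q) = mem (4 * N)) (h1 : mem' (4 * q + 1) = mem (4 * N + 1))
    (hm : ∀ a, a / 4 ∉ ({q, N} : Finset ℕ) → a % 4 < 2 → mem' a = mem a) :
    Keys B Bm (insert q (R.erase N)) (Function.update ps q (ps N)) mem' g := by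
  have src : ∀ r ∈ insert q (R.erase N), ∃ r' ∈ R, mem' (4 * r) = mem (4 * r') ∧
      mem' (4 * r + 1) = mem (4 * r' + 1) ∧ Function.update ps q (ps N) r = ps r' ∧
      (r = q ∧ r' = N ∨ r ≠ N ∧ r' = r) := by
    intro r hr
    rcases Finset.mem_insert.1 hr with rfl | hr'
    · exact ⟨N, hN, h0, h1, by simp, Or.inl ⟨rfl, rfl⟩⟩
    · obtain ⟨n1, hr'⟩ := Finset.mem_erase.1 hr'
      have n2 : r ≠ q := fun e => hq (e ▸ hr')
      exact ⟨r, hr', hm _ (by simp; omega) (by omega), hm _ (by simp; omega) (by omega),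
        Function.update_of_ne n2 _ _, Or.inr ⟨n1, rfl⟩⟩
  refine ⟨fun r hr => ?_, fun r hr => ?_, fun r hr => ?_, fun r hr => ?_, fun r hr => ?_,
    fun r hr t ht he => ?_, fun y hy => ?_⟩
  · obtain ⟨r', hr', a, b, c, _⟩ := src r hr
    rw [a, c]; exact h.pth r' hr'
  · obtain ⟨r', hr', a, b, c, _⟩ := src r hr
    rw [c]; exact h.len r' hr'
  · obtain ⟨r', hr', a, b, c, _⟩ := src r hr
    rw [a]; exact h.lt r' hr'
  · obtain ⟨r', hr', a, b, c, _⟩ := src r hr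
    rw [a, b]; exact h.val r' hr'
  · obtain ⟨r', hr', a, b, c, _⟩ := src r hr
    rw [a]; exact h.nz r' hr'
  · obtain ⟨r', hr', a, b, c, d⟩ := src r hr
    obtain ⟨t', ht', a', b', c', d'⟩ := src t ht
    have := h.kinj r' hr' t' ht' (by rw [← a, ← a', he])
    omega
  · obtain ⟨r, hr, e'⟩ := h.sup y hy
    by_cases hrN : r = N
    · subst hrN
      exact ⟨q, by simp, by rw [h0, e']⟩
    · have n2 : r ≠ q := fun e => hq (e ▸ hr)
      exact ⟨r, by simp [hrN, hr], by rw [hm _ (by simp; omega) (by omega), e']⟩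

end Keys

lemma Tr.rawSet' {m : Mach} {e : Expr} {x v k : ℕ} {s : Conf}
    (hx : x < 100 := by omega) (he : e.Ok m.W m.K s.reg s.mem := by simp <;> omega)
    (hv : e.eval s.reg s.mem = v := by simp) (hW : v < m.W := by omega)
    (hk : e.cost + 2 = k := by rfl) :
    Tr m Agree (set x e) k s (s.setReg x v) := by
  subst hv hk; exact Tr.rawSet hx he hW

lemma Tr.rawStore' {m : Mach} {e e' : Expr} {a v k : ℕ} {s : Conf}
    (he : e.Ok m.W m.K s.reg s.mem := by simp <;> omega)
    (he' : e'.Ok m.W m.K s.reg s.mem := by simp <;> omega)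
    (ha : e.eval s.reg s.mem = a := by simp) (hv : e'.eval s.reg s.mem = v := by simp)
    (hW : 0 < m.W := by omega) (hK : a < m.K := by omega) (hk : e.cost + e'.cost + 1 = k := by rfl) :
    Tr m Agree (st e e') k s (s.setMem a v) := by
  subst ha hv hk; exact Tr.rawStore he he' hW hK

lemma Val.raw' {m : Mach} {e : Expr} {v k : ℕ} {s : Conf}
    (hW : 0 < m.W := by omega) (he : e.Ok m.W m.K s.reg s.mem := by simp <;> omega)
    (hv : e.eval s.reg s.mem = v := by simp) (hk : e.cost = k := by rfl) :
    Val m Agree e k s v := by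
  subst hv hk; exact Val.raw hW he

/-! ### Searching -/

/-- Search the key in register `0`: register `1` gets the address of the pointer at which the search
ends, register `2` its content. -/
def search : Prog :=
  set 1 2 ;; set 2 (.ld (.reg 1)) ;; set 3 (.reg 0) ;;
  whl (.reg 2 * (1 - .bin .eq (.ld (4 * .reg 2)) (.reg 0)))
    (set 1 (4 * .reg 2 + 2 + .reg 3 % 2) ;; set 3 (.reg 3 / 2) ;; set 2 (.ld (.reg 1)))

/-- A machine that is to hold a tree with at most `cap` nodes, with the bounds `B t` for the lengths of
the keys with the residue `t` modulo `16`. -/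
structure VM extends Mach where
  B : ℕ → ℕ
  Bm : ℕ
  cap : ℕ

/-- The words and the memory are large enough. -/
structure VM.Good (m : VM) : Prop where
  B_ge : ∀ t, 7 ≤ m.B t
  B_le : ∀ t, m.B t ≤ m.Bm
  hW : 2 ^ m.Bm ≤ m.W
  capK : 4 * m.cap + 8 ≤ m.K
  capW : 4 * m.cap + 8 ≤ m.W

lemma VM.Good.W16 {m : VM} (hm : m.Good) : 128 ≤ m.W :=
  le_trans (Nat.pow_le_pow_right (n := 2) (by norm_num) ((hm.B_ge 0).trans (hm.B_le 0))) hm.hW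

lemma VM.Good.pow_le {m : VM} (hm : m.Good) (t : ℕ) : 2 ^ m.B t ≤ m.W :=
  le_trans (Nat.pow_le_pow_right (n := 2) (by norm_num) (hm.B_le t)) hm.hW

section Search
variable {m : VM} (hm : m.Good) {R : Finset ℕ} {ps : ℕ → List ℕ} {g : ℕ → ℕ} {s : Conf} {x : ℕ}

/-- The outcome of a search for `x`. -/
structure Found (R : Finset ℕ) (ps : ℕ → List ℕ) (mem : ℕ → ℕ) (x d loc p : ℕ) : Prop where
  slot : IsSlot R ps (path x d) loc
  ptr : mem loc = p
  res : (p = 0 ∧ ∀ q ∈ R, mem (4 * q) ≠ x ∧ ps q ≠ path x d) ∨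
    (p ∈ R ∧ mem (4 * p) = x ∧ ps p = path x d)

include hm in
/-- The walk from the place `path x d` on; `n` bits of the key are left. -/
lemma search_loop (hS : Shape R ps s.mem) (hK : Keys m.B m.Bm R ps s.mem g)
    (hcap : ∀ p ∈ R, p ≤ m.cap) (hx : s.reg 0 = x) (hxB : x < 2 ^ m.B (x % 16)) (n : ℕ) :
    ∀ d loc, d + n = m.B (x % 16) → IsSlot R ps (path x d) loc →
      (∀ q ∈ R, s.mem (4 * q) = x → d ≤ (ps q).length) →
    ∃ d' loc' p' k', d' ≤ m.B (x % 16) ∧ Found R ps s.mem x d' loc' p' ∧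
      Tr m.toMach Agree (whl (.reg 2 * (1 - .bin .eq (.ld (4 * .reg 2)) (.reg 0)))
        (set 1 (4 * .reg 2 + 2 + .reg 3 % 2) ;; set 3 (.reg 3 / 2) ;; set 2 (.ld (.reg 1))))
        (14 + 38 * n) (((s.setReg 1 loc).setReg 2 (s.mem loc)).setReg 3 (x / 2 ^ d))
        (((s.setReg 1 loc').setReg 2 p').setReg 3 k') := by
  have hW := hm.W16
  have hcK := hm.capK
  have hcW := hm.capW
  have hxW : x < m.W := hxB.trans_le (hm.pow_le _)
  have hkW : ∀ q ∈ R, s.mem (4 * q) < m.W := fun q hq => (hK.lt q hq).trans_le (hm.pow_le _)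
  have hval : ∀ d loc, IsSlot R ps (path x d) loc →
      Val m.toMach Agree (.reg 2 * (1 - .bin .eq (.ld (4 * .reg 2)) (.reg 0))) 13
        (((s.setReg 1 loc).setReg 2 (s.mem loc)).setReg 3 (x / 2 ^ d))
        (s.mem loc * (1 - if s.mem (4 * s.mem loc) = x then 1 else 0)) := by
    intro d loc hs
    have hle : s.mem loc ≤ m.cap := by
      rcases hS.slot _ _ hs with ⟨h, _⟩ | ⟨h, _⟩
      · omega
      · exact hcap _ h
    refine Val.raw' (he := ?_) (hv := ?_)
    · simp only [Expr.ok_mul, Expr.ok_reg, Expr.ok_sub, Expr.ok_ofNat, Expr.ok_bin, Expr.ok_ld,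
        Expr.eval_mul, Expr.eval_reg, Expr.eval_sub, Expr.eval_ofNat, Expr.eval_eq, Expr.eval_ld,
        Conf.setReg_reg, Conf.setReg_mem, Op.eval]
      simp [hx]
      refine ⟨by omega, ⟨by omega, ⟨⟨⟨by omega, by omega, by omega⟩, by omega⟩, by omega, ?_⟩,
        by omega⟩, ?_⟩
      · split_ifs <;> omega
      · split_ifs <;> simp <;> omega
    · simp [hx]
  induction n with
  | zero =>
    intro d loc hd hs hlow
    rcases hS.slot _ _ hs with ⟨h1, h2⟩ | ⟨h1, h2⟩
    · refine ⟨d, loc, s.mem loc, x / 2 ^ d, by omega, ⟨hs, rfl, Or.inl ⟨h1, fun q hq => ⟨?_, h2 q hq⟩⟩⟩,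
        (Tr.while_done (by simpa [h1] using hval d loc hs)).mono⟩
      intro e
      have := hK.pth q hq
      rw [e] at this
      obtain ⟨p, hp, e'⟩ := hS.anc hq this (hlow q hq e)
      exact h2 p hp e'
    · have e : s.mem (4 * s.mem loc) = x := by
        have h3 := hK.pth _ h1
        rw [h2, path_length, path_eq_iff] at h3
        have h4 : 2 ^ 4 ∣ 2 ^ d := Nat.pow_dvd_pow 2 (by have := hm.B_ge (x % 16); omega)
        have h5 : s.mem (4 * s.mem loc) % 16 = x % 16 :=
          (Nat.mod_mod_of_dvd _ h4).symm.trans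
            ((congrArg (· % 2 ^ 4) h3.symm).trans (Nat.mod_mod_of_dvd x h4))
        have h6 := hK.lt _ h1
        rw [h5] at h6
        rw [show d = m.B (x % 16) by omega, Nat.mod_eq_of_lt hxB, Nat.mod_eq_of_lt h6] at h3
        exact h3.symm
      exact ⟨d, loc, s.mem loc, x / 2 ^ d, by omega, ⟨hs, rfl, Or.inr ⟨h1, e, h2⟩⟩,
        (Tr.while_done (by simpa [e] using hval d loc hs)).mono⟩
  | succ n ih =>
    intro d loc hd hs hlow
    rcases hS.slot _ _ hs with ⟨h1, h2⟩ | ⟨h1, h2⟩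
    · refine ⟨d, loc, s.mem loc, x / 2 ^ d, by omega, ⟨hs, rfl, Or.inl ⟨h1, fun q hq => ⟨?_, h2 q hq⟩⟩⟩,
        (Tr.while_done (by simpa [h1] using hval d loc hs)).mono⟩
      intro e
      have := hK.pth q hq
      rw [e] at this
      obtain ⟨p, hp, e'⟩ := hS.anc hq this (hlow q hq e)
      exact h2 p hp e'
    · by_cases e : s.mem (4 * s.mem loc) = x
      · exact ⟨d, loc, s.mem loc, x / 2 ^ d, by omega, ⟨hs, rfl, Or.inr ⟨h1, e, h2⟩⟩,
          (Tr.while_done (by simpa [e] using hval d loc hs)).mono⟩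
      · set p := s.mem loc with hp
        have hpc := hcap _ h1
        have hp1 := hS.pos _ h1
        set b := x / 2 ^ d % 2 with hb
        have hb2 : b < 2 := Nat.mod_lt _ (by norm_num)
        have hs' : IsSlot R ps (path x (d + 1)) (4 * p + 2 + b) :=
          Or.inr ⟨p, h1, b, hb2, by rw [h2]; rfl, rfl⟩
        have hlow' : ∀ q ∈ R, s.mem (4 * q) = x → d + 1 ≤ (ps q).length := by
          intro q hq hqx
          rcases (hlow q hq hqx).lt_or_eq with h | h
          · exact h
          · have h3 := hK.pth q hq
            rw [hqx, ← h, ← h2] at h3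
            exact absurd (hS.inj q hq _ h1 h3 ▸ hqx) e
        obtain ⟨d', loc', p', k', g1, g2, g3⟩ := ih (d + 1) (4 * p + 2 + b) (by omega) hs' hlow'
        refine ⟨d', loc', p', k', g1, g2, ?_⟩
        have hc : s.mem (4 * p + 2 + b) ≤ m.cap := by
          rcases hS.slot _ _ hs' with ⟨h, _⟩ | ⟨h, _⟩
          · omega
          · exact hcap _ h
        have hdiv : x / 2 ^ d < m.W := (Nat.div_le_self _ _).trans_lt hxW
        have hdiv2 : x / 2 ^ (d + 1) < m.W := (Nat.div_le_self _ _).trans_lt hxW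
        have t1 := Tr.rawSet' (m := m.toMach) (x := 1) (e := 4 * .reg 2 + 2 + .reg 3 % 2)
          (v := 4 * p + 2 + b) (s := ((s.setReg 1 loc).setReg 2 p).setReg 3 (x / 2 ^ d))
          (hv := by simp [hb])
        have t2 := Tr.rawSet' (m := m.toMach) (x := 3) (e := .reg 3 / 2) (v := x / 2 ^ (d + 1))
          (s := (((s.setReg 1 loc).setReg 2 p).setReg 3 (x / 2 ^ d)).setReg 1 (4 * p + 2 + b))
          (hv := by simp [pow_succ, Nat.div_div_eq_div_mul]) (hW := hdiv2)
        have t3 := Tr.rawSet' (m := m.toMach) (x := 2) (e := .ld (.reg 1))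
          (v := s.mem (4 * p + 2 + b))
          (s := ((((s.setReg 1 loc).setReg 2 p).setReg 3 (x / 2 ^ d)).setReg 1 (4 * p + 2 + b)).setReg
            3 (x / 2 ^ (d + 1)))
        have hst : (((((s.setReg 1 loc).setReg 2 p).setReg 3 (x / 2 ^ d)).setReg 1
            (4 * p + 2 + b)).setReg 3 (x / 2 ^ (d + 1))).setReg 2 (s.mem (4 * p + 2 + b)) =
            ((s.setReg 1 (4 * p + 2 + b)).setReg 2 (s.mem (4 * p + 2 + b))).setReg 3
              (x / 2 ^ (d + 1)) := by
          unfold Conf.setReg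
          congr 1
          funext r
          simp only [Function.update_apply]
          split_ifs <;> first | rfl | omega
        rw [hst] at t3
        have hv := hval d loc hs
        rw [← hp] at hv
        refine (Tr.while_more hv ?_ (t1.seq (t2.seq t3)) g3).mono ?_
        · simp [e]; omega
        · simp; omega

include hm in
/-- A search takes a number of steps that is linear in the length of the key. It writes only the
registers `1`, `2` and `3`. -/
lemma search_spec (hS : Shape R ps s.mem) (hK : Keys m.B m.Bm R ps s.mem g)
    (hcap : ∀ p ∈ R, p ≤ m.cap) (hx : s.reg 0 = x) (hxB : x < 2 ^ m.B (x % 16)) :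
    ∃ d' loc' p' k', d' ≤ m.B (x % 16) ∧ Found R ps s.mem x d' loc' p' ∧
      Tr m.toMach Agree search (26 + 38 * m.B (x % 16)) s
        (((s.setReg 1 loc').setReg 2 p').setReg 3 k') := by
  have hW := hm.W16
  have hcK := hm.capK
  have hcW := hm.capW
  have hxW : x < m.W := hxB.trans_le (hm.pow_le _)
  have hs : IsSlot R ps (path x 0) 2 := Or.inl ⟨rfl, rfl⟩
  obtain ⟨d', loc', p', k', g1, g2, g3⟩ := search_loop hm hS hK hcap hx hxB (m.B (x % 16)) 0 2
    (by omega) hs (fun _ _ _ => by omega)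
  refine ⟨d', loc', p', k', g1, g2, ?_⟩
  have hc : s.mem 2 ≤ m.cap := by
    rcases hS.slot _ _ hs with ⟨h, _⟩ | ⟨h, _⟩
    · omega
    · exact hcap _ h
  have t1 := Tr.rawSet' (m := m.toMach) (x := 1) (e := 2) (v := 2) (s := s) (hv := rfl)
  have t2 := Tr.rawSet' (m := m.toMach) (x := 2) (e := .ld (.reg 1)) (v := s.mem 2)
    (s := s.setReg 1 2)
  have t3 := Tr.rawSet' (m := m.toMach) (x := 3) (e := .reg 0) (v := x)
    (s := (s.setReg 1 2).setReg 2 (s.mem 2)) (hv := by simp [hx]) (hW := hxW)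
  simp only [pow_zero, Nat.div_one] at g3
  exact (t1.seq (t2.seq (t3.seq g3))).mono (by simp; omega)

end Search


/-! ### Deletion from the tree

The contents of a deleted node are replaced by those of a leaf below it, whose position has the position
of the node as a prefix. The nodes keep the numbers `1, …, N`: the node `N` moves to the place of the
leaf. Thus the memory in use is always proportional to the number of keys. -/

/-- From the node in register `2` (with the pointer at the address in register `1`), go down to a leaf;
registers `5` and `6` get the leaf and the address of the pointer to it. -/
def descend : Prog :=
  set 5 (.reg 2) ;; set 6 (.reg 1) ;;
  whl (.ld (4 * .reg 5 + 2) + .ld (4 * .reg 5 + 3))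
    (iff (.ld (4 * .reg 5 + 2)) (set 6 (4 * .reg 5 + 2)) (set 6 (4 * .reg 5 + 3)) ;;
      set 5 (.ld (.reg 6)))

/-- Remove the leaf, after moving its key and value to the node in register `2`. -/
def unlink : Prog :=
  st (4 * .reg 2) (.ld (4 * .reg 5)) ;; st (4 * .reg 2 + 1) (.ld (4 * .reg 5 + 1)) ;; st (.reg 6) 0

/-- Move the node with the largest number to the place of the removed one. -/
def compact : Prog :=
  iff (.bin .eq (.reg 5) (.reg 10)) .skip
    (set 0 (.ld (4 * .reg 10)) ;; search ;; st (.reg 1) (.reg 5) ;;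
      st (4 * .reg 5) (.ld (4 * .reg 10)) ;; st (4 * .reg 5 + 1) (.ld (4 * .reg 10 + 1)) ;;
      st (4 * .reg 5 + 2) (.ld (4 * .reg 10 + 2)) ;; st (4 * .reg 5 + 3) (.ld (4 * .reg 10 + 3)))

/-- Clear the node with the largest number. -/
def clearLast : Prog :=
  st (4 * .reg 10) 0 ;; st (4 * .reg 10 + 1) 0 ;; st (4 * .reg 10 + 2) 0 ;;
    st (4 * .reg 10 + 3) 0 ;; set 10 (.reg 10 - 1)

section Delete
variable {m : VM} (hm : m.Good) {R : Finset ℕ} {ps : ℕ → List ℕ} {g : ℕ → ℕ} {s : Conf} {x : ℕ}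

include hm in
lemma descend_loop (hS : Shape R ps s.mem) (hK : Keys m.B m.Bm R ps s.mem g)
    (hcap : ∀ p ∈ R, p ≤ m.cap) {p : ℕ} (n : ℕ) :
    ∀ q lq, q ∈ R → IsSlot R ps (ps q) lq → path (s.mem (4 * q)) (ps p).length = ps p →
      (ps p).length ≤ (ps q).length → m.Bm ≤ (ps q).length + n →
    ∃ q' lq', q' ∈ R ∧ IsSlot R ps (ps q') lq' ∧
      path (s.mem (4 * q')) (ps p).length = ps p ∧
      s.mem (4 * q' + 2) = 0 ∧ s.mem (4 * q' + 3) = 0 ∧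
      Tr m.toMach Agree (whl (.ld (4 * .reg 5 + 2) + .ld (4 * .reg 5 + 3))
        (iff (.ld (4 * .reg 5 + 2)) (set 6 (4 * .reg 5 + 2)) (set 6 (4 * .reg 5 + 3)) ;;
        set 5 (.ld (.reg 6)))) (16 + 40 * n) ((s.setReg 5 q).setReg 6 lq)
        ((s.setReg 5 q').setReg 6 lq') := by
  have hW := hm.W16
  have hcK := hm.capK
  have hcW := hm.capW
  have child : ∀ q ∈ R, ∀ b < 2, s.mem (4 * q + 2 + b) ≤ m.cap ∧ (s.mem (4 * q + 2 + b) ≠ 0 →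
      s.mem (4 * q + 2 + b) ∈ R ∧ ps (s.mem (4 * q + 2 + b)) = b :: ps q) := by
    intro q hq b hb
    rcases hS.slot _ _ (Or.inr ⟨q, hq, b, hb, rfl, rfl⟩) with ⟨h, _⟩ | ⟨h, h'⟩
    · exact ⟨by omega, fun h' => absurd h h'⟩
    · exact ⟨hcap _ h, fun _ => ⟨h, h'⟩⟩
  have hval : ∀ q ∈ R, ∀ lq, Val m.toMach Agree (.ld (4 * .reg 5 + 2) + .ld (4 * .reg 5 + 3)) 15
      ((s.setReg 5 q).setReg 6 lq) (s.mem (4 * q + 2) + s.mem (4 * q + 3)) := by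
    intro q hq lq
    have h1 := (child q hq 0 (by omega)).1
    have h2 := (child q hq 1 (by omega)).1
    have h3 := hcap q hq
    simp only [add_zero, add_assoc, Nat.reduceAdd] at h1 h2
    exact Val.raw'
  induction n with
  | zero =>
    intro q lq hq hs hp hl hB
    have e : ∀ b < 2, s.mem (4 * q + 2 + b) = 0 := by
      intro b hb
      by_contra hne
      obtain ⟨h1, h2⟩ := (child q hq b hb).2 hne
      have := hK.len _ h1
      rw [h2, List.length_cons] at this
      omega
    have e0 := e 0 (by omega)
    have e1 := e 1 (by omega)
    simp only [add_zero, add_assoc, Nat.reduceAdd] at e0 e1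
    refine ⟨q, lq, hq, hs, hp, e0, e1, (Tr.while_done (ke := 15) ?_).mono⟩
    simpa [e0, e1] using hval q hq lq
  | succ n ih =>
    intro q lq hq hs hp hl hB
    by_cases h0 : s.mem (4 * q + 2) = 0 ∧ s.mem (4 * q + 3) = 0
    · refine ⟨q, lq, hq, hs, hp, h0.1, h0.2, (Tr.while_done (ke := 15) ?_).mono⟩
      simpa [h0.1, h0.2] using hval q hq lq
    · obtain ⟨b, hb, hne, hbb⟩ : ∃ b < 2, s.mem (4 * q + 2 + b) ≠ 0 ∧
          (b = 0 ∧ s.mem (4 * q + 2) ≠ 0 ∨ b = 1 ∧ s.mem (4 * q + 2) = 0) := by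
        by_cases h : s.mem (4 * q + 2) = 0
        · exact ⟨1, by omega, fun e => h0 ⟨h, e⟩, Or.inr ⟨rfl, h⟩⟩
        · exact ⟨0, by omega, h, Or.inl ⟨rfl, h⟩⟩
      obtain ⟨hc, hcc⟩ := child q hq b hb
      obtain ⟨h1, h2⟩ := hcc hne
      have h3 := hcap q hq
      set c := s.mem (4 * q + 2 + b) with hcdef
      have hs' : IsSlot R ps (ps c) (4 * q + 2 + b) := Or.inr ⟨q, hq, b, hb, h2, rfl⟩
      have hpath : path (s.mem (4 * c)) (ps p).length = ps p := by
        have k1 := hK.pth c h1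
        rw [h2, List.length_cons] at k1
        have k2 := hK.pth q hq
        have k3 : path (s.mem (4 * c)) (ps q).length = path (s.mem (4 * q)) (ps q).length := by
          rw [← k2]
          exact (List.cons.inj k1).2.symm
        rw [path_trunc k3 hl, hp]
      obtain ⟨q', lq', g1, g2, g3, g4, g5, g6⟩ := ih c (4 * q + 2 + b) h1 hs' hpath
        (by rw [h2, List.length_cons]; omega) (by rw [h2, List.length_cons]; omega)
      refine ⟨q', lq', g1, g2, g3, g4, g5, ?_⟩
      have hv1 : Val m.toMach Agree (.ld (4 * .reg 5 + 2)) 7 ((s.setReg 5 q).setReg 6 lq)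
          (s.mem (4 * q + 2)) := by
        have h1 := (child q hq 0 (by omega)).1
        simp only [add_zero] at h1
        exact Val.raw'
      have t1 : Tr m.toMach Agree (iff (.ld (4 * .reg 5 + 2)) (set 6 (4 * .reg 5 + 2))
          (set 6 (4 * .reg 5 + 3))) (7 + 8 + 1) ((s.setReg 5 q).setReg 6 lq)
          (((s.setReg 5 q).setReg 6 lq).setReg 6 (4 * q + 2 + b)) := by
        refine Tr.ite hv1 (fun h => ?_) (fun h => ?_)
        · obtain ⟨rfl, _⟩ : b = 0 ∧ s.mem (4 * q + 2) ≠ 0 := by tauto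
          exact Tr.rawSet'
        · obtain ⟨rfl, _⟩ : b = 1 ∧ s.mem (4 * q + 2) = 0 := by tauto
          exact Tr.rawSet'
      have t2 := Tr.rawSet' (m := m.toMach) (x := 5) (e := .ld (.reg 6)) (v := c)
        (s := ((s.setReg 5 q).setReg 6 lq).setReg 6 (4 * q + 2 + b)) (hv := by simp [hcdef])
      have hst : (((s.setReg 5 q).setReg 6 lq).setReg 6 (4 * q + 2 + b)).setReg 5 c =
          (s.setReg 5 c).setReg 6 (4 * q + 2 + b) := by
        unfold Conf.setReg
        congr 1
        funext r
        simp only [Function.update_apply]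
        split_ifs <;> first | rfl | omega
      rw [hst] at t2
      refine (Tr.while_more (hval q hq lq) ?_ (t1.seq t2) g6).mono (by simp; omega)
      omega

/-- The nodes of the tree are `1, …, N`, with `N` in register `10`, and the memory that the tree does
not use is zero. -/
structure TreeRep (m : VM) (p : Conf) (g : ℕ → ℕ) : Prop where
  tree : ∃ ps, Shape (Finset.Icc 1 (p.reg 10)) ps p.mem ∧
    Keys m.B m.Bm (Finset.Icc 1 (p.reg 10)) ps p.mem g
  zero : ∀ a, a ≠ 2 → a / 4 ∉ Finset.Icc 1 (p.reg 10) → p.mem a = 0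
  cap : p.reg 10 ≤ m.cap

include hm in
/-- The deletion of the key `x`, after a search that has found the node `p`. -/
lemma delete_spec (h : TreeRep m s g) {d loc p : ℕ} (hr1 : s.reg 1 = loc) (hr2 : s.reg 2 = p)
    {ps : ℕ → List ℕ} (hS : Shape (Finset.Icc 1 (s.reg 10)) ps s.mem)
    (hK : Keys m.B m.Bm (Finset.Icc 1 (s.reg 10)) ps s.mem g)
    (hf : Found (Finset.Icc 1 (s.reg 10)) ps s.mem x d loc p) (hp0 : p ≠ 0) :
    ∃ s', Tr m.toMach Agree (descend ;; unlink ;; compact ;; clearLast) (300 + 80 * m.Bm) s s' ∧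
      TreeRep m s' (Function.update g x 0) ∧ (∀ r, 20 ≤ r → s'.reg r = s.reg r) ∧
      s'.draws = s.draws ∧ s'.out = s.out := by
  have hW := hm.W16
  have hcK := hm.capK
  have hcW := hm.capW
  set N := s.reg 10 with hN
  set R := Finset.Icc 1 N with hR
  have memR : ∀ q, q ∈ R ↔ 1 ≤ q ∧ q ≤ N := fun q => by rw [hR, Finset.mem_Icc]
  have hNc : N ≤ m.cap := h.cap
  have hcap : ∀ q ∈ R, q ≤ m.cap := fun q hq => ((memR q).1 hq).2.trans hNc
  have hbd : ∀ a, a ≤ 4 * N + 3 → a < m.K ∧ a < m.W := fun a ha => by omega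
  have slotle : ∀ π l, IsSlot R ps π l → l ≤ 4 * N + 3 := by
    rintro π l (⟨_, rfl⟩ | ⟨q, hq, b, hb, _, rfl⟩)
    · omega
    · have := (memR q).1 hq; omega
  have hpR : p ∈ R ∧ s.mem (4 * p) = x ∧ ps p = path x d := by
    rcases hf.res with ⟨h, _⟩ | h
    exacts [absurd h hp0, h]
  obtain ⟨hpR, hpx, hpp⟩ := hpR
  have hpN := (memR p).1 hpR
  have hslot : IsSlot R ps (ps p) loc := by rw [hpp]; exact hf.slot
  have hlocle := slotle _ _ hslot
  -- the leaf `q` that will be removed lies below the node `p`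
  obtain ⟨q, lq, hq, hslq, hpq, hq2, hq3, tD⟩ := descend_loop hm (p := p) hS hK hcap m.Bm p loc hpR
    hslot (hK.pth p hpR).symm le_rfl (by omega)
  have hqN := (memR q).1 hq
  have hlqle := slotle _ _ hslq
  have a1 := Tr.rawSet' (m := m.toMach) (x := 5) (e := .reg 2) (v := p) (s := s)
    (he := by simp [hr2]; omega) (hv := by simp [hr2])
  have a2 := Tr.rawSet' (m := m.toMach) (x := 6) (e := .reg 1) (v := loc) (s := s.setReg 5 p)
    (he := by simp [hr1]; omega) (hv := by simp [hr1])
  have tdesc := a1.seq (a2.seq tD)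
  -- the key and the value of the leaf replace those of `p`
  set s0 := (s.setReg 5 q).setReg 6 lq with hs0
  have b1 := Tr.rawStore' (m := m.toMach) (e := 4 * .reg 2) (e' := .ld (4 * .reg 5)) (s := s0)
    (a := 4 * p) (v := s.mem (4 * q)) (he := by simp [hs0, hr2]; omega)
    (he' := by simp [hs0]; omega) (ha := by simp [hs0, hr2]) (hv := by simp [hs0])
  have hval2 : (s0.setMem (4 * p) (s.mem (4 * q))).mem (4 * q + 1) = s.mem (4 * q + 1) := by
    simp [hs0]; omega
  have b2 := Tr.rawStore' (m := m.toMach) (e := 4 * .reg 2 + 1) (e' := .ld (4 * .reg 5 + 1))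
    (s := s0.setMem (4 * p) (s.mem (4 * q))) (a := 4 * p + 1) (v := s.mem (4 * q + 1))
    (he := by simp [hs0, hr2]; omega) (he' := by simp [hs0]; omega) (ha := by simp [hs0, hr2])
    (hv := by rw [← hval2]; simp [hs0])
  have b3 := Tr.rawStore' (m := m.toMach) (e := .reg 6) (e' := 0)
    (s := (s0.setMem (4 * p) (s.mem (4 * q))).setMem (4 * p + 1) (s.mem (4 * q + 1))) (a := lq)
    (v := 0) (he := by simp [hs0]; omega) (ha := by simp [hs0])
  have tunl := b1.seq (b2.seq b3)
  set s1 := ((s0.setMem (4 * p) (s.mem (4 * q))).setMem (4 * p + 1)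
    (s.mem (4 * q + 1))).setMem lq 0 with hs1
  have lqmod : 2 ≤ lq % 4 := by
    rcases hslq with ⟨_, rfl⟩ | ⟨q, hq, b, hb, _, rfl⟩ <;> omega
  have leaf : ∀ r ∈ R, ∀ b, ps r ≠ b :: ps q := by
    intro r hr b e
    have k := hK.pth r hr
    rw [e, List.length_cons] at k
    have hb : b < 2 := by
      rw [(List.cons.inj k).1]; exact Nat.mod_lt _ (by norm_num)
    have h0 : s.mem (4 * q + 2 + b) = 0 := by
      obtain rfl | rfl : b = 0 ∨ b = 1 := by omega
      exacts [hq2, hq3]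
    rcases hS.slot _ _ (Or.inr ⟨q, hq, b, hb, rfl, rfl⟩) with ⟨_, h'⟩ | ⟨h', _⟩
    · exact h' r hr e
    · have := hS.pos _ h'; omega
  have hs1mem : ∀ a, s1.mem a = if a = lq then 0 else if a = 4 * p + 1 then s.mem (4 * q + 1) else
      if a = 4 * p then s.mem (4 * q) else s.mem a := by
    intro a
    simp [hs1, hs0]
  have S1 : Shape (R.erase q) ps s1.mem := by
    refine hS.erase_leaf hq hslq leaf (by simp [hs1mem]) (fun a ha hne => ?_)
    rw [hs1mem, if_neg hne, if_neg (by omega), if_neg (by omega)]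
  have K1 : Keys m.B m.Bm (R.erase q) ps s1.mem (Function.update g x 0) := by
    rw [← hpx]
    refine hK.erase_leaf hpR hq hpq ?_ ?_ (fun a ha ha' => ?_)
    · rw [hs1mem, if_neg (by omega), if_neg (by omega), if_pos rfl]
    · rw [hs1mem, if_neg (by omega), if_pos rfl]
    · rw [hs1mem, if_neg (by omega), if_neg (by omega), if_neg (by omega)]
  have h10 : s1.reg 10 = N := by simp [hs1, hs0, hN]
  have h5 : s1.reg 5 = q := by simp [hs1, hs0]
  -- the last node is moved to the place of the leaf, unless it is the leaf itself
  obtain ⟨s2, t2, ps2, S2, K2, r2, z2, d2, o2⟩ : ∃ s2, Tr m.toMach Agree compact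
      (100 + 38 * m.Bm) s1 s2 ∧ ∃ ps2, Shape (Finset.Icc 1 (N - 1)) ps2 s2.mem ∧
      Keys m.B m.Bm (Finset.Icc 1 (N - 1)) ps2 s2.mem (Function.update g x 0) ∧
      (∀ r, 10 ≤ r → s2.reg r = s1.reg r) ∧
      (∀ a, a ≠ 2 → a / 4 = 0 ∨ N < a / 4 → s2.mem a = s1.mem a) ∧ s2.draws = s1.draws ∧ s2.out = s1.out := by
    have hv : Val m.toMach Agree (.bin .eq (.reg 5) (.reg 10)) 5 s1 (if q = N then 1 else 0) := by
      refine Val.raw' (he := ?_) (hv := by simp [h5, h10])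
      simp [h5, h10, Op.eval]
      refine ⟨by omega, by omega, ?_⟩
      split_ifs <;> omega
    by_cases hqn : q = N
    · refine ⟨s1, (Tr.ite_true hv (by simp [hqn]) Tr.skip).mono, ps, ?_, ?_,
        fun _ _ => rfl, fun _ _ _ => rfl, rfl, rfl⟩
      all_goals
        have : Finset.Icc 1 (N - 1) = R.erase q := by
          ext a; simp only [Finset.mem_Icc, Finset.mem_erase, memR]; omega
        rw [this]
      exacts [S1, K1]
    · have hNR : N ∈ R.erase q := Finset.mem_erase.2 ⟨fun e => hqn e.symm, (memR N).2 ⟨by omega, le_rfl⟩⟩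
      have hcap1 : ∀ r ∈ R.erase q, r ≤ m.cap := fun r hr => hcap r (Finset.mem_of_mem_erase hr)
      set y := s1.mem (4 * N) with hy
      have hylt := K1.lt N hNR
      have hyW : y < m.W := hylt.trans_le (hm.pow_le _)
      have c1 := Tr.rawSet' (m := m.toMach) (x := 0) (e := .ld (4 * .reg 10)) (v := y) (s := s1)
        (he := by simp [h10]; omega) (hv := by simp [h10, hy]) (hW := hyW)
      obtain ⟨d', l', p', k', g1, g2, g3⟩ := search_spec hm (s := s1.setReg 0 y) (x := y)
        (R := R.erase q) (ps := ps) (g := Function.update g x 0) S1 K1 hcap1 (by simp) hylt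
      have hp' : p' = N ∧ IsSlot (R.erase q) ps (ps N) l' := by
        rcases g2.res with ⟨_, hno⟩ | ⟨e1, e2, e3⟩
        · exact absurd rfl (hno N hNR).1
        · have := K1.kinj p' e1 N hNR e2
          subst this
          exact ⟨rfl, by rw [e3]; exact g2.slot⟩
      obtain ⟨rfl, hsl⟩ := hp'
      have hsl0 : IsSlot R ps (ps N) l' := by
        rcases hsl with h1 | ⟨p, hp, hh⟩
        exacts [Or.inl h1, Or.inr ⟨p, Finset.mem_of_mem_erase hp, hh⟩]
      have hl' := slotle _ _ hsl0
      have hl4 : l' / 4 ≠ q ∧ l' / 4 ≠ N ∧ 2 ≤ l' % 4 ∧ (l' = 2 ∨ 1 ≤ l' / 4) := by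
        rcases hsl with ⟨_, rfl⟩ | ⟨t, ht, b, hb, e, rfl⟩
        · omega
        · have h1 := Finset.mem_erase.1 ht
          have h2 : t ≠ N := by
            rintro rfl
            simpa using congrArg List.length e
          have h3 := hS.pos t h1.2
          omega
      set s2 := (((s1.setReg 0 y).setReg 1 l').setReg 2 N).setReg 3 k' with hs2
      have e5 : s2.reg 5 = q := by simp [hs2, h5]
      have e10 : s2.reg 10 = N := by simp [hs2, h10]
      have e1 : s2.reg 1 = l' := by simp [hs2]
      have em : s2.mem = s1.mem := rfl
      have c2 := Tr.rawStore' (m := m.toMach) (e := .reg 1) (e' := .reg 5) (s := s2) (a := l')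
        (v := q) (he := by simp [e1]; omega) (he' := by simp [e5]; omega) (ha := by simp [e1])
        (hv := by simp [e5])
      have c3 := Tr.rawStore' (m := m.toMach) (e := 4 * .reg 5) (e' := .ld (4 * .reg 10))
        (s := s2.setMem l' q) (a := 4 * q) (v := s1.mem (4 * N)) (he := by simp [e5]; omega)
        (he' := by simp [e10]; omega) (ha := by simp [e5])
        (hv := by simp [e10, em, show 4 * N ≠ l' by omega])
      have c4 := Tr.rawStore' (m := m.toMach) (e := 4 * .reg 5 + 1) (e' := .ld (4 * .reg 10 + 1))
        (s := (s2.setMem l' q).setMem (4 * q) (s1.mem (4 * N))) (a := 4 * q + 1)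
        (v := s1.mem (4 * N + 1)) (he := by simp [e5]; omega) (he' := by simp [e10]; omega)
        (ha := by simp [e5])
        (hv := by simp [e10, em, show 4 * N + 1 ≠ l' by omega, show 4 * N + 1 ≠ 4 * q by omega])
      have c5 := Tr.rawStore' (m := m.toMach) (e := 4 * .reg 5 + 2) (e' := .ld (4 * .reg 10 + 2))
        (s := ((s2.setMem l' q).setMem (4 * q) (s1.mem (4 * N))).setMem (4 * q + 1) (s1.mem (4 * N + 1)))
        (a := 4 * q + 2) (v := s1.mem (4 * N + 2)) (he := by simp [e5]; omega)
        (he' := by simp [e10]; omega) (ha := by simp [e5])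
        (hv := by simp [e10, em, show 4 * N + 2 ≠ l' by omega, show 4 * N + 2 ≠ 4 * q by omega,
          show 4 * N + 2 ≠ 4 * q + 1 by omega])
      have c6 := Tr.rawStore' (m := m.toMach) (e := 4 * .reg 5 + 3) (e' := .ld (4 * .reg 10 + 3))
        (s := (((s2.setMem l' q).setMem (4 * q) (s1.mem (4 * N))).setMem (4 * q + 1)
          (s1.mem (4 * N + 1))).setMem (4 * q + 2) (s1.mem (4 * N + 2)))
        (a := 4 * q + 3) (v := s1.mem (4 * N + 3)) (he := by simp [e5]; omega)
        (he' := by simp [e10]; omega) (ha := by simp [e5])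
        (hv := by simp [e10, em, show 4 * N + 3 ≠ l' by omega, show 4 * N + 3 ≠ 4 * q by omega,
          show 4 * N + 3 ≠ 4 * q + 1 by omega, show 4 * N + 3 ≠ 4 * q + 2 by omega])
      set s3 := ((((s2.setMem l' q).setMem (4 * q) (s1.mem (4 * N))).setMem (4 * q + 1)
          (s1.mem (4 * N + 1))).setMem (4 * q + 2) (s1.mem (4 * N + 2))).setMem (4 * q + 3)
          (s1.mem (4 * N + 3)) with hs3
      have hs3mem : ∀ a, s3.mem a = if a = 4 * q + 3 then s1.mem (4 * N + 3) else
          if a = 4 * q + 2 then s1.mem (4 * N + 2) else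
          if a = 4 * q + 1 then s1.mem (4 * N + 1) else
          if a = 4 * q then s1.mem (4 * N) else if a = l' then q else s1.mem a := by
        intro a
        simp [hs3, em]
      have hset : Finset.Icc 1 (N - 1) = insert q ((R.erase q).erase N) := by
        ext a; simp only [Finset.mem_Icc, Finset.mem_erase, Finset.mem_insert, memR]; omega
      have hqn' : q ∉ R.erase q := by simp
      have hcost := hm.B_le (y % 16)
      refine ⟨s3, (Tr.ite_false (ke := 5) (by simpa [hqn] using hv) (c1.seq (g3.seq (c2.seq (c3.seq (c4.seq
        (c5.seq c6))))))).mono (by simp; omega), Function.update ps q (ps N), ?_, ?_, ?_, ?_, rfl, rfl⟩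
      · rw [hset]
        refine S1.rename hNR hqn' (by omega) hsl ?_ ?_ ?_ (fun a ha ha' => ?_)
        · rw [hs3mem, if_neg (by omega), if_neg (by omega), if_neg (by omega), if_neg (by omega),
            if_pos rfl]
        · rw [hs3mem, if_neg (by omega), if_pos rfl]
        · rw [hs3mem, if_pos rfl]
        · simp only [Finset.mem_insert, Finset.mem_singleton, not_or] at ha
          rw [hs3mem, if_neg (by omega), if_neg (by omega), if_neg (by omega), if_neg (by omega),
            if_neg ha']
      · rw [hset]
        refine K1.rename hNR hqn' ?_ ?_ (fun a ha ha' => ?_)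
        · rw [hs3mem, if_neg (by omega), if_neg (by omega), if_neg (by omega), if_pos rfl]
        · rw [hs3mem, if_neg (by omega), if_neg (by omega), if_pos rfl]
        · simp only [Finset.mem_insert, Finset.mem_singleton, not_or] at ha
          rw [hs3mem, if_neg (by omega), if_neg (by omega), if_neg (by omega), if_neg (by omega),
            if_neg (by omega)]
      · intro r hr
        simp [hs3, hs2, show r ≠ 0 by omega, show r ≠ 1 by omega, show r ≠ 2 by omega,
          show r ≠ 3 by omega]
      · intro a ha2 ha
        rw [hs3mem, if_neg (by omega), if_neg (by omega), if_neg (by omega), if_neg (by omega),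
            if_neg (by omega)]
  -- the cells of the last node become zero again
  have f10 : s2.reg 10 = N := by rw [r2 10 (by omega), h10]
  have c1 := Tr.rawStore' (m := m.toMach) (e := 4 * .reg 10) (e' := 0) (s := s2) (a := 4 * N)
    (v := 0) (he := by simp [f10]; omega) (ha := by simp [f10])
  have c2 := Tr.rawStore' (m := m.toMach) (e := 4 * .reg 10 + 1) (e' := 0)
    (s := s2.setMem (4 * N) 0) (a := 4 * N + 1) (v := 0) (he := by simp [f10]; omega)
    (ha := by simp [f10])
  have c3 := Tr.rawStore' (m := m.toMach) (e := 4 * .reg 10 + 2) (e' := 0)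
    (s := (s2.setMem (4 * N) 0).setMem (4 * N + 1) 0) (a := 4 * N + 2) (v := 0)
    (he := by simp [f10]; omega) (ha := by simp [f10])
  have c4 := Tr.rawStore' (m := m.toMach) (e := 4 * .reg 10 + 3) (e' := 0)
    (s := ((s2.setMem (4 * N) 0).setMem (4 * N + 1) 0).setMem (4 * N + 2) 0) (a := 4 * N + 3)
    (v := 0) (he := by simp [f10]; omega) (ha := by simp [f10])
  have c5 := Tr.rawSet' (m := m.toMach) (x := 10) (e := .reg 10 - 1)
    (s := (((s2.setMem (4 * N) 0).setMem (4 * N + 1) 0).setMem (4 * N + 2) 0).setMem (4 * N + 3) 0)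
    (v := N - 1) (he := by simp [f10]; omega) (hv := by simp [f10])
  have hmem : ∀ a, a / 4 ≠ N → ((((s2.setMem (4 * N) 0).setMem (4 * N + 1) 0).setMem
      (4 * N + 2) 0).setMem (4 * N + 3) 0).mem a = s2.mem a := by
    intro a ha
    simp [show a ≠ 4 * N by omega, show a ≠ 4 * N + 1 by omega, show a ≠ 4 * N + 2 by omega,
      show a ≠ 4 * N + 3 by omega]
  refine ⟨_, (tdesc.seq (tunl.seq (t2.seq (c1.seq (c2.seq (c3.seq (c4.seq c5))))))).mono
    (by simp; omega), ⟨⟨ps2, ?_, ?_⟩, ?_, ?_⟩, ?_, ?_, ?_⟩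
  · simp only [Conf.setReg_reg, Conf.setReg_mem, if_true]
    refine ⟨S2.pos, S2.inj, S2.par, fun π l hl => ?_⟩
    rw [hmem l ?_]
    · exact S2.slot π l hl
    · rcases hl with ⟨_, rfl⟩ | ⟨q, hq, b, hb, _, rfl⟩
      · omega
      · have := (Finset.mem_Icc.1 hq); omega
  · simp only [Conf.setReg_reg, Conf.setReg_mem, if_true]
    have e : ∀ r ∈ Finset.Icc 1 (N - 1), ∀ b < 2, ((((s2.setMem (4 * N) 0).setMem (4 * N + 1) 0).setMem
      (4 * N + 2) 0).setMem (4 * N + 3) 0).mem (4 * r + b) = s2.mem (4 * r + b) := fun r hr b hb =>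
        hmem _ (by have := Finset.mem_Icc.1 hr; omega)
    have e0 := fun r hr => e r hr 0 (by omega)
    simp only [add_zero] at e0
    refine ⟨fun r hr => ?_, K2.len, fun r hr => ?_, fun r hr => ?_, fun r hr => ?_,
      fun r hr t ht => ?_, fun y hy => ?_⟩
    · rw [e0 r hr]; exact K2.pth r hr
    · rw [e0 r hr]; exact K2.lt r hr
    · rw [e0 r hr, e r hr 1 (by omega)]; exact K2.val r hr
    · rw [e0 r hr]; exact K2.nz r hr
    · rw [e0 r hr, e0 t ht]; exact K2.kinj r hr t ht
    · obtain ⟨r, hr, hh⟩ := K2.sup y hy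
      exact ⟨r, hr, by rw [e0 r hr, hh]⟩
  · intro a ha ha'
    simp only [Conf.setReg_reg, Conf.setReg_mem, if_true, Finset.mem_Icc] at ha' ⊢
    by_cases haN : a / 4 = N
    · obtain rfl | rfl | rfl | rfl : a = 4 * N ∨ a = 4 * N + 1 ∨ a = 4 * N + 2 ∨ a = 4 * N + 3 := by
        omega
      all_goals simp
    · have hz : s.mem a = 0 := h.zero a ha (by rw [Finset.mem_Icc]; omega)
      rw [hmem a haN]
      rw [z2 a ha (by omega), hs1mem, if_neg ?_, if_neg (by omega), if_neg (by omega), hz]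
      rcases hslq with ⟨_, rfl⟩ | ⟨q, hq, b, hb, _, rfl⟩
      · exact ha
      · have := (memR q).1 hq; omega
  · simp; omega
  · intro r hr
    simp only [Conf.setReg_reg, Conf.setMem_reg, show r ≠ 10 by omega, if_false]
    rw [r2 r (by omega)]
    simp [hs1, hs0, show r ≠ 5 by omega, show r ≠ 6 by omega]
  · simp [d2, hs1, hs0]
  · simp [o2, hs1, hs0]

end Delete


/-! ### Sparse virtual memory

The programs work on a virtual memory with cells `(t, x, i)`. Only the nonzero cells are stored, in the
digital search tree, so that the space is proportional to their number. The tag `t` is the residue of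
the key modulo `16`; it determines the bound for the length of the key. -/

/-- The cell that has the given key. -/
def cellOf (k : ℕ) : ℕ × ℕ × ℕ := (k % 16, (k / 16).unpair)

/-- The key of the cell `(t, x, i)`, for a tag `t < 16`. -/
def keyOf (t x i : ℕ) : ℕ := 16 * Nat.pair x i + t

lemma cellOf_keyOf {t : ℕ} (ht : t < 16) (x i : ℕ) : cellOf (keyOf t x i) = (t, x, i) := by
  have h1 : keyOf t x i % 16 = t := by unfold keyOf; omega
  have h2 : keyOf t x i / 16 = Nat.pair x i := by unfold keyOf; omega
  simp [cellOf, h1, h2]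

lemma cellOf_inj : Function.Injective cellOf := by
  intro a b h
  simp only [cellOf, Prod.mk.injEq] at h
  have h1 : a / 16 = b / 16 := by
    rw [← Nat.pair_unpair (a / 16), ← Nat.pair_unpair (b / 16), h.2]
  omega

/-- A virtual state: registers, a virtual memory with cells `(t, x, i)`, the number of draws, and the
output. -/
structure VS where
  reg : ℕ → ℕ
  f : ℕ × ℕ × ℕ → ℕ
  draws : ℕ
  out : List (ℕ × ℕ)

/-- Write a register. -/
def VS.setR (s : VS) (x v : ℕ) : VS := { s with reg := Function.update s.reg x v }

/-- Write a virtual memory cell. -/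
def VS.setF (s : VS) (c : ℕ × ℕ × ℕ) (v : ℕ) : VS := { s with f := Function.update s.f c v }

@[simp] lemma VS.setR_reg (s : VS) (x v y : ℕ) :
    (s.setR x v).reg y = if y = x then v else s.reg y := by
  simp [VS.setR, Function.update_apply]
@[simp] lemma VS.setR_f (s : VS) (x v : ℕ) : (s.setR x v).f = s.f := rfl
@[simp] lemma VS.setF_reg (s : VS) (c v) : (s.setF c v).reg = s.reg := rfl
@[simp] lemma VS.setF_f (s : VS) (c v c') :
    (s.setF c v).f c' = if c' = c then v else s.f c' := by
  simp [VS.setF, Function.update_apply]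

/-- The configuration `p` represents the virtual state `s`: the registers `20, …, 99` are those of
`s`, and the nonzero cells of the virtual memory are stored in a digital search tree. The registers
below `20` are used for the inputs and for the operations on the tree. -/
structure Rep (m : VM) (p : Conf) (s : VS) : Prop where
  reg : ∀ r, 20 ≤ r → r < 100 → p.reg r = s.reg r
  regW : ∀ r, 20 ≤ r → r < 100 → s.reg r < m.W
  fW : ∀ c, s.f c < m.W
  draws : p.draws = s.draws
  out : p.out = s.out
  tree : TreeRep m p (s.f ∘ cellOf)

/-- There are at most `k` nonzero cells. -/
def Sz (f : ℕ × ℕ × ℕ → ℕ) (k : ℕ) : Prop :=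
  ∃ S : Finset (ℕ × ℕ × ℕ), (∀ c, f c ≠ 0 → c ∈ S) ∧ S.card ≤ k

lemma Sz.mono {f : ℕ × ℕ × ℕ → ℕ} {k l : ℕ} (h : Sz f k) (hkl : k ≤ l) : Sz f l := by
  obtain ⟨S, h1, h2⟩ := h
  exact ⟨S, h1, h2.trans hkl⟩

lemma Sz.update {f : ℕ × ℕ × ℕ → ℕ} {k : ℕ} (h : Sz f k) (c v) :
    Sz (Function.update f c v) (k + 1) := by
  obtain ⟨S, h1, h2⟩ := h
  refine ⟨insert c S, fun d hd => ?_, (Finset.card_insert_le _ _).trans (by omega)⟩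
  by_cases hdc : d = c
  · simp [hdc]
  · rw [Function.update_of_ne hdc] at hd
    exact Finset.mem_insert_of_mem (h1 d hd)

lemma TreeRep.card_le {m : VM} {p : Conf} {f : ℕ × ℕ × ℕ → ℕ} (h : TreeRep m p (f ∘ cellOf)) {k : ℕ}
    (hk : Sz f k) : p.reg 10 ≤ k := by
  obtain ⟨S, h1, h2⟩ := hk
  obtain ⟨ps, _, hK⟩ := h.tree
  have : (Finset.Icc 1 (p.reg 10)).card ≤ S.card :=
    Finset.card_le_card_of_injOn (fun q => cellOf (p.mem (4 * q)))
      (fun q hq => h1 _ (hK.nz q hq))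
      (fun q hq r hr e => hK.kinj q hq r hr (cellOf_inj e))
  simp at this
  omega

/-! ### User expressions -/

/-- Expressions over the registers `20, …, 99` that do not overflow. -/
def Expr.UOk (W : ℕ) (ρ : ℕ → ℕ) : Expr → Prop
  | .const k => k < W
  | .reg r => 20 ≤ r ∧ r < 100
  | .bin o a b => a.UOk W ρ ∧ b.UOk W ρ ∧ (match o with
    | .add => a.eval ρ 0 + b.eval ρ 0 < W
    | .mul => a.eval ρ 0 * b.eval ρ 0 < W
    | _ => True)
  | .ld _ => False

namespace Expr
variable (W : ℕ) (ρ : ℕ → ℕ) (a b : Expr) (k r : ℕ)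
@[simp] lemma uok_const : (const k).UOk W ρ ↔ k < W := Iff.rfl
@[simp] lemma uok_ofNat : (ofNat(k) : Expr).UOk W ρ ↔ k < W := Iff.rfl
@[simp] lemma uok_reg : (reg r).UOk W ρ ↔ 20 ≤ r ∧ r < 100 := Iff.rfl
@[simp] lemma uok_add : (a + b).UOk W ρ ↔ a.UOk W ρ ∧ b.UOk W ρ ∧
    a.eval ρ 0 + b.eval ρ 0 < W := Iff.rfl
@[simp] lemma uok_mul : (a * b).UOk W ρ ↔ a.UOk W ρ ∧ b.UOk W ρ ∧
    a.eval ρ 0 * b.eval ρ 0 < W := Iff.rfl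
@[simp] lemma uok_sub : (a - b).UOk W ρ ↔ a.UOk W ρ ∧ b.UOk W ρ := by
  show _ ∧ _ ∧ True ↔ _; simp
@[simp] lemma uok_div : (a / b).UOk W ρ ↔ a.UOk W ρ ∧ b.UOk W ρ := by
  show _ ∧ _ ∧ True ↔ _; simp
@[simp] lemma uok_lt : (bin .lt a b).UOk W ρ ↔ a.UOk W ρ ∧ b.UOk W ρ := by
  show _ ∧ _ ∧ True ↔ _; simp
@[simp] lemma uok_eq : (bin .eq a b).UOk W ρ ↔ a.UOk W ρ ∧ b.UOk W ρ := by
  show _ ∧ _ ∧ True ↔ _; simp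
end Expr

lemma Expr.UOk.ok {W K : ℕ} {ρ ρ' μ : ℕ → ℕ} {e : Expr} (h : e.UOk W ρ) (hW : 1 < W)
    (h1 : ∀ r, 20 ≤ r → r < 100 → ρ' r = ρ r) (h2 : ∀ r, 20 ≤ r → r < 100 → ρ r < W) :
    e.eval ρ' μ = e.eval ρ 0 ∧ e.Ok W K ρ' μ ∧ e.eval ρ 0 < W := by
  induction e with
  | const k => exact ⟨rfl, h, h⟩
  | reg r =>
    obtain ⟨h3, h4⟩ := h
    exact ⟨h1 r h3 h4, ⟨h4, by rw [h1 r h3 h4]; exact h2 r h3 h4⟩, h2 r h3 h4⟩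
  | bin o a b iha ihb =>
    obtain ⟨k1, k2, k3⟩ := h
    obtain ⟨a1, a2, a3⟩ := iha k1
    obtain ⟨b1, b2, b3⟩ := ihb k2
    have : o.eval (a.eval ρ 0) (b.eval ρ 0) < W := by
      cases o with
      | add => exact k3
      | mul => exact k3
      | sub => exact (Nat.sub_le _ _).trans_lt a3
      | div => exact (Nat.div_le_self _ _).trans_lt a3
      | mod => exact (Nat.mod_le _ _).trans_lt a3
      | lt => simp only [Op.eval]; split_ifs <;> omega
      | eq => simp only [Op.eval]; split_ifs <;> omega
    simp only [Expr.eval, Expr.Ok, a1, b1]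
    exact ⟨trivial, ⟨a2, b2, this⟩, this⟩
  | ld a => exact absurd h id

lemma Rep.of_agree {m : VM} {p q : Conf} {s : VS} (h : Rep m q s) (hpq : Agree p q) : Rep m p s := by
  refine ⟨fun r h1 h2 => (hpq.reg r h2).trans (h.reg r h1 h2), h.regW, h.fW,
    hpq.draws.trans h.draws, hpq.out.trans h.out, ?_⟩
  obtain ⟨a, b, c⟩ := h.tree
  have e : p.reg 10 = q.reg 10 := hpq.reg 10 (by omega)
  exact ⟨by rw [e, hpq.mem]; exact a, by rw [e, hpq.mem]; exact b, by rw [e]; exact c⟩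

/-- Lift a statement about raw configurations to virtual states. -/
lemma Tr.lift {m : VM} {c : Prog} {k : ℕ} {s s' : VS}
    (h : ∀ p, Rep m p s → ∃ q, Tr m.toMach Agree c k p q ∧ Rep m q s') :
    Tr m.toMach (Rep m) c k s s' := fun p hp => by
  obtain ⟨q, h1, h2⟩ := h p hp
  obtain ⟨k', hk, p', h3, h4⟩ := h1 p (Agree.refl p)
  exact ⟨k', hk, p', h2.of_agree h3, h4⟩

section Rules
variable {m : VM} (hm : m.Good) {s : VS} {e e1 e2 e3 : Expr} {x y t v v1 v2 k : ℕ}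

include hm in
lemma Val.user (hv : e.eval s.reg 0 = v) (h : e.UOk m.W s.reg := by simp <;> omega)
    (hk : e.cost ≤ k := by simp) :
    Val m.toMach (Rep m) e k s v := fun p hp => by
  subst hv
  obtain ⟨h1, h2, h3⟩ := h.ok (K := m.K) (μ := p.mem) (by have := hm.W16; omega) hp.reg hp.regW
  obtain ⟨k', a, p', b, c, d⟩ := Val.raw (m := m.toMach) (by omega) h2 p (Agree.refl p)
  exact ⟨k', a.trans hk, p', hp.of_agree b, c, d.trans h1⟩

lemma Rep.setReg {p : Conf} (hp : Rep m p s) (hx : 20 ≤ x) (hv : v < m.W) :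
    Rep m (p.setReg x v) (s.setR x v) := by
  refine ⟨fun r h1 h2 => ?_, fun r h1 h2 => ?_, hp.fW, hp.draws, hp.out, ?_⟩
  · simp [hp.reg r h1 h2]
  · simp only [VS.setR_reg]
    split_ifs
    exacts [hv, hp.regW r h1 h2]
  · obtain ⟨a, b, c⟩ := hp.tree
    have e : (p.setReg x v).reg 10 = p.reg 10 := by simp; omega
    exact ⟨by rw [e]; exact a, by rw [e]; exact b, by rw [e]; exact c⟩

lemma Rep.setLow {p : Conf} (hp : Rep m p s) (hx : x < 10) (v : ℕ) :
    Rep m (p.setReg x v) s := by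
  refine ⟨fun r h1 h2 => ?_, hp.regW, hp.fW, hp.draws, hp.out, ?_⟩
  · simp [hp.reg r h1 h2, show r ≠ x by omega]
  · obtain ⟨a, b, c⟩ := hp.tree
    have e : (p.setReg x v).reg 10 = p.reg 10 := by simp; omega
    exact ⟨by rw [e]; exact a, by rw [e]; exact b, by rw [e]; exact c⟩

include hm in
/-- `x := e`. -/
lemma Tr.asg (hx : 20 ≤ x ∧ x < 100) (h : e.UOk m.W s.reg) (hv : e.eval s.reg 0 = v)
    (hk : e.cost + 2 ≤ k) : Tr m.toMach (Rep m) (set x e) k s (s.setR x v) := by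
  subst hv
  refine Tr.mono (Tr.lift fun p hp => ?_) hk
  obtain ⟨h1, h2, h3⟩ := h.ok (K := m.K) (μ := p.mem) (by have := hm.W16; omega) hp.reg hp.regW
  exact ⟨_, Tr.rawSet' (hx := hx.2) (he := h2) (hv := h1) (hW := h3), hp.setReg hx.1 h3⟩

lemma Tr.draw (hx : 20 ≤ x ∧ x < 100) (hy : 20 ≤ y ∧ y < 100) (h0 : 0 < s.reg y) :
    Tr m.toMach (Rep m) (.draw x y) 1 s
      { s.setR x (m.ω (s.draws, s.reg y - 1) : ℕ) with draws := s.draws + 1 } := fun p hp => by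
  have e := hp.reg y hy.1 hy.2
  refine ⟨1, le_rfl, _, ?_, Exec.draw p x y (by omega)⟩
  have hlt : (m.ω (s.draws, s.reg y - 1) : ℕ) < m.W := by
    have h1 := (m.ω (s.draws, s.reg y - 1)).2
    have h2 := hp.regW y hy.1 hy.2
    have h3 : (s.draws, s.reg y - 1).2 = s.reg y - 1 := rfl
    omega
  have h := hp.setReg (x := x) hx.1 hlt
  rw [hp.draws, e]
  exact ⟨h.reg, h.regW, h.fW, rfl, h.out, ⟨h.tree.tree, h.tree.zero, h.tree.cap⟩⟩

lemma Tr.emit (hx : 20 ≤ x ∧ x < 100) (hy : 20 ≤ y ∧ y < 100) :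
    Tr m.toMach (Rep m) (.emit x y) 1 s { s with out := s.out ++ [(s.reg x, s.reg y)] } :=
  fun p hp => by
  refine ⟨1, le_rfl, _, ?_, Exec.emit p x y⟩
  rw [hp.reg x hx.1 hx.2, hp.reg y hy.1 hy.2, hp.out]
  exact ⟨hp.reg, hp.regW, hp.fW, hp.draws, rfl, ⟨hp.tree.tree, hp.tree.zero, hp.tree.cap⟩⟩

lemma Tr.scaleFloor {c : Fin 2} (hx : 20 ≤ x ∧ x < 100) (hy : 20 ≤ y ∧ y < 100)
    (hv : ⌊m.θ c * (s.reg y : ℝ)⌋₊ = v) (hW : v < m.W) :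
    Tr m.toMach (Rep m) (.scaleFloor c x y) 1 s (s.setR x v) := fun p hp => by
  have e := hp.reg y hy.1 hy.2
  subst hv
  refine ⟨1, le_rfl, _, hp.setReg hx.1 hW, ?_⟩
  rw [← e] at hW ⊢
  exact Exec.scaleFloor p c x y hW

lemma Tr.scaleCeil {c : Fin 2} (hx : 20 ≤ x ∧ x < 100) (hy : 20 ≤ y ∧ y < 100)
    (hv : ⌈m.θ c * (s.reg y : ℝ)⌉₊ = v) (hW : v < m.W) :
    Tr m.toMach (Rep m) (.scaleCeil c x y) 1 s (s.setR x v) := fun p hp => by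
  have e := hp.reg y hy.1 hy.2
  subst hv
  refine ⟨1, le_rfl, _, hp.setReg hx.1 hW, ?_⟩
  rw [← e] at hW ⊢
  exact Exec.scaleCeil p c x y hW

end Rules

/-! ### Reading and writing the virtual memory -/

/-- The cell `(t, x, i)` can be addressed. -/
def CellOk (m : VM) (t x i : ℕ) : Prop := t < 16 ∧ 16 * (max x i + 1) ^ 2 ≤ 2 ^ m.B t

/-- The pairing function `Nat.pair`. -/
def Expr.pair (a b : Expr) : Expr :=
  .bin .lt a b * (b * b + a) + (1 - .bin .lt a b) * (a * a + a + b)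

@[simp] lemma Expr.eval_pair (ρ μ : ℕ → ℕ) (a b : Expr) :
    (Expr.pair a b).eval ρ μ = Nat.pair (a.eval ρ μ) (b.eval ρ μ) := by
  simp only [Expr.pair, Expr.eval_add, Expr.eval_mul, Expr.eval_lt, Expr.eval_sub, Expr.eval_ofNat,
    Nat.pair]
  split_ifs <;> simp

/-- Compute the key of the cell `(t, e1, e2)` in register `0`. -/
def setKey (t : ℕ) (e1 e2 : Expr) : Prog :=
  set 7 e1 ;; set 8 e2 ;; set 0 (16 * Expr.pair (.reg 7) (.reg 8) + .const t)

/-- `x :=` the content of the virtual cell `(t, e1, e2)`. -/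
def rd (x t : ℕ) (e1 e2 : Expr) : Prog :=
  setKey t e1 e2 ;; search ;; set x (.ld (4 * .reg 2 + 1))

/-- Write `e3` into the virtual cell `(t, e1, e2)`. Depending on whether the new value is zero and
whether the key is present, this changes a value, or adds a leaf, or deletes a node. -/
def wr (t : ℕ) (e1 e2 e3 : Expr) : Prog :=
  set 4 e3 ;; setKey t e1 e2 ;; search ;;
  iff (.reg 4)
    (iff (.reg 2) (st (4 * .reg 2 + 1) (.reg 4))
      (set 10 (.reg 10 + 1) ;; st (4 * .reg 10) (.reg 0) ;; st (4 * .reg 10 + 1) (.reg 4) ;;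
        st (.reg 1) (.reg 10)))
    (iff (.reg 2) (descend ;; unlink ;; compact ;; clearLast) .skip)

section Access
variable {m : VM} (hm : m.Good) {s : VS} {e e1 e2 e3 : Expr} {x t v v1 v2 k : ℕ}

include hm in
lemma setKey_spec {p : Conf} (ht : CellOk m t v1 v2)
    (h1 : e1.Ok m.W m.K p.reg p.mem) (hv1 : e1.eval p.reg p.mem = v1)
    (h2 : ∀ r, e2.Ok m.W m.K (p.setReg 7 r).reg p.mem ∧ e2.eval (p.setReg 7 r).reg p.mem = v2)
    (hk1 : e1.cost ≤ 20) (hk2 : e2.cost ≤ 20) :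
    keyOf t v1 v2 < 2 ^ m.B t ∧
    Tr m.toMach Agree (setKey t e1 e2) 92 p
      (((p.setReg 7 v1).setReg 8 v2).setReg 0 (keyOf t v1 v2)) := by
  obtain ⟨ht16, hcell⟩ := ht
  have hW := hm.W16
  have hpow := hm.pow_le t
  have hb1 : v1 ≤ max v1 v2 := le_max_left _ _
  have hb2 : v2 ≤ max v1 v2 := le_max_right _ _
  set b := max v1 v2 with hb
  have hpair : Nat.pair v1 v2 < (b + 1) ^ 2 := Nat.pair_lt_max_add_one_sq v1 v2
  have hkey : keyOf t v1 v2 < 2 ^ m.B t := by unfold keyOf; omega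
  refine ⟨hkey, ?_⟩
  have hsq : (b + 1) ^ 2 = b * b + 2 * b + 1 := by ring
  have q1 : v1 * v1 ≤ b * b := Nat.mul_le_mul hb1 hb1
  have q2 : v2 * v2 ≤ b * b := Nat.mul_le_mul hb2 hb2
  have a1 := Tr.rawSet' (m := m.toMach) (x := 7) (s := p) (he := h1) (hv := hv1)
  have a2 := Tr.rawSet' (m := m.toMach) (x := 8) (s := p.setReg 7 v1) (he := (h2 v1).1)
    (hv := (h2 v1).2)
  have hpe : (Expr.pair (.reg 7) (.reg 8)).Ok m.W m.K ((p.setReg 7 v1).setReg 8 v2).reg p.mem := by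
    simp only [Expr.pair, Expr.ok_add, Expr.ok_mul, Expr.ok_bin, Expr.ok_reg, Expr.ok_sub,
      Expr.ok_ofNat, Expr.eval_add, Expr.eval_mul, Expr.eval_lt, Expr.eval_sub, Expr.eval_ofNat,
      Expr.eval_reg, Conf.setReg_reg, Op.eval]
    simp
    split_ifs <;> simp <;> refine ⟨?_, ?_⟩ <;> (try refine ⟨?_, ?_⟩) <;> omega
  have a3 := Tr.rawSet' (m := m.toMach) (x := 0) (s := (p.setReg 7 v1).setReg 8 v2)
    (e := 16 * Expr.pair (.reg 7) (.reg 8) + .const t) (v := keyOf t v1 v2)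
    (he := by
      simp only [Expr.ok_add, Expr.ok_mul, Expr.ok_const, Expr.ok_ofNat, Expr.eval_mul,
        Expr.eval_pair, Expr.eval_ofNat, Expr.eval_const, Conf.setReg_mem]
      refine ⟨⟨by omega, hpe, ?_⟩, by omega, ?_⟩ <;> simp <;> unfold keyOf at hkey <;> omega)
    (hv := by simp [keyOf])
  refine (a1.seq (a2.seq a3)).mono ?_
  simp only [Expr.pair, Expr.cost_add, Expr.cost_mul, Expr.cost_bin, Expr.cost_sub, Expr.cost_reg,
    Expr.cost_ofNat, Expr.cost_const]
  omega

include hm in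
lemma Tr.read (hx : 20 ≤ x ∧ x < 100) (hc : CellOk m t v1 v2)
    (h1 : e1.UOk m.W s.reg) (h2 : e2.UOk m.W s.reg)
    (hv1 : e1.eval s.reg 0 = v1) (hv2 : e2.eval s.reg 0 = v2) (hv : s.f (t, v1, v2) = v)
    (hk1 : e1.cost ≤ 20) (hk2 : e2.cost ≤ 20) :
    Tr m.toMach (Rep m) (rd x t e1 e2) (100 * m.B t) s (s.setR x v) := by
  refine Tr.lift fun p hp => ?_
  have hW := hm.W16
  have hcK := hm.capK
  have hcW := hm.capW
  obtain ⟨a1, a2, a3⟩ := h1.ok (K := m.K) (μ := p.mem) (by omega) hp.reg hp.regW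
  obtain ⟨hkey, tk⟩ := setKey_spec hm (p := p) (e1 := e1) (e2 := e2) hc a2 (a1.trans hv1)
    (fun r => by
      obtain ⟨b1, b2, b3⟩ := h2.ok (K := m.K) (ρ' := (p.setReg 7 r).reg) (μ := p.mem) (by omega)
        (fun r' h h' => by simp [hp.reg r' h h', show r' ≠ 7 by omega]) hp.regW
      exact ⟨b2, b1.trans hv2⟩) hk1 hk2
  set y := keyOf t v1 v2 with hy
  set p1 := ((p.setReg 7 v1).setReg 8 v2).setReg 0 y with hp1
  have hy16 : y % 16 = t := by have := hc.1; rw [hy]; unfold keyOf; omega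
  obtain ⟨ps, hS, hK⟩ := hp.tree.tree
  have hcap : ∀ q ∈ Finset.Icc 1 (p.reg 10), q ≤ m.cap := fun q hq =>
    (Finset.mem_Icc.1 hq).2.trans hp.tree.cap
  obtain ⟨d, loc, q, k', g1, g2, g3⟩ := search_spec hm (s := p1) (x := y) hS hK hcap
    (by simp [hp1]) (by rw [hy16]; exact hkey)
  rw [hy16] at g3
  have hval : p.mem (4 * q + 1) = v ∧ q ≤ m.cap := by
    rcases g2.res with ⟨rfl, hno⟩ | ⟨e1, e2, e3⟩
    · refine ⟨?_, by omega⟩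
      have h0 : p.mem (4 * 0 + 1) = 0 := hp.tree.zero 1 (by omega) (by simp)
      rw [h0, ← hv]
      by_contra hne
      obtain ⟨r, hr, e⟩ := hK.sup y (by
        simpa [hy, cellOf_keyOf hc.1] using fun h => hne h.symm)
      exact (hno r hr).1 e
    · refine ⟨?_, hcap q e1⟩
      have e4 : p.mem (4 * q) = y := e2
      have := hK.val q e1
      rw [e4] at this
      rw [this, ← hv]
      simp [hy, cellOf_keyOf hc.1]
  have hvW : v < m.W := hv ▸ hp.fW _
  have t3 := Tr.rawSet' (m := m.toMach) (x := x) (e := .ld (4 * .reg 2 + 1)) (v := v)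
    (s := ((p1.setReg 1 loc).setReg 2 q).setReg 3 k') (hx := hx.2) (he := by simp [hp1]; omega)
    (hv := by simpa [hp1] using hval.1) (hW := hvW)
  refine ⟨_, (tk.seq (g3.seq t3)).mono ?_, ?_⟩
  · have := hm.B_ge t
    simp; omega
  · refine Rep.setReg ?_ hx.1 hvW
    exact (((((hp.setLow (by omega) _).setLow (by omega) _).setLow (by omega) _).setLow
      (by omega) _).setLow (by omega) _).setLow (by omega) _

include hm in
/-- A write takes a number of steps that is linear in the length of all keys: a deletion descends to a
leaf below the key, which may be longer than the key. -/
lemma Tr.write {c : ℕ × ℕ × ℕ} (hc : CellOk m t v1 v2) (hct : c = (t, v1, v2))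
    (h1 : e1.UOk m.W s.reg) (h2 : e2.UOk m.W s.reg) (h3 : e3.UOk m.W s.reg)
    (hv1 : e1.eval s.reg 0 = v1) (hv2 : e2.eval s.reg 0 = v2) (hv : e3.eval s.reg 0 = v)
    {z : ℕ} (hz : Sz s.f z) (hzc : z + 1 ≤ m.cap)
    (hk1 : e1.cost ≤ 20) (hk2 : e2.cost ≤ 20) (hk3 : e3.cost ≤ 20) :
    Tr m.toMach (Rep m) (wr t e1 e2 e3) (400 * m.Bm) s (s.setF c v) := by
  subst hct
  refine Tr.lift fun p hp => ?_
  have hW := hm.W16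
  have hcK := hm.capK
  have hcW := hm.capW
  obtain ⟨c1, c2, c3⟩ := h3.ok (K := m.K) (μ := p.mem) (by omega) hp.reg hp.regW
  rw [hv] at c1 c3
  have t4 := Tr.rawSet' (m := m.toMach) (x := 4) (s := p) (he := c2) (hv := c1) (hW := c3)
  set p0 := p.setReg 4 v with hp0
  obtain ⟨a1, a2, a3⟩ := h1.ok (K := m.K) (ρ' := p0.reg) (μ := p.mem) (by omega)
    (fun r' h h' => by simp [hp0, hp.reg r' h h', show r' ≠ 4 by omega]) hp.regW
  obtain ⟨hkey, tk⟩ := setKey_spec hm (p := p0) (e1 := e1) (e2 := e2) hc a2 (a1.trans hv1)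
    (fun r => by
      obtain ⟨b1, b2, b3⟩ := h2.ok (K := m.K) (ρ' := (p0.setReg 7 r).reg) (μ := p0.mem) (by omega)
        (fun r' h h' => by simp [hp0, hp.reg r' h h', show r' ≠ 7 by omega, show r' ≠ 4 by omega])
        hp.regW
      exact ⟨b2, b1.trans hv2⟩) hk1 hk2
  set y := keyOf t v1 v2 with hy
  set p1 := ((p0.setReg 7 v1).setReg 8 v2).setReg 0 y with hp1
  have hy16 : y % 16 = t := by have := hc.1; rw [hy]; unfold keyOf; omega
  have hyW : y < m.W := hkey.trans_le (hm.pow_le t)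
  have hcy : cellOf y = (t, v1, v2) := cellOf_keyOf hc.1 _ _
  obtain ⟨ps, hS, hK⟩ := hp.tree.tree
  have hNcap := hp.tree.cap
  set N := p.reg 10 with hN
  have memR : ∀ q, q ∈ Finset.Icc 1 N ↔ 1 ≤ q ∧ q ≤ N := fun q => Finset.mem_Icc
  have hcap : ∀ q ∈ Finset.Icc 1 N, q ≤ m.cap := fun q hq =>
    (Finset.mem_Icc.1 hq).2.trans hp.tree.cap
  have hkey' : y < 2 ^ m.B (y % 16) := by rw [hy16]; exact hkey
  obtain ⟨d, loc, q, k', g1, g2, g3⟩ := search_spec hm (s := p1) (x := y) hS hK hcap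
    (by simp [hp1]) hkey'
  have hBle := hm.B_le (y % 16)
  have hBge := hm.B_ge (y % 16)
  set p2 := ((p1.setReg 1 loc).setReg 2 q).setReg 3 k' with hp2
  have r0 : p2.reg 0 = y := by simp [hp2, hp1]
  have r1 : p2.reg 1 = loc := by simp [hp2]
  have r2 : p2.reg 2 = q := by simp [hp2]
  have r4 : p2.reg 4 = v := by simp [hp2, hp1, hp0]
  have r10 : p2.reg 10 = N := by simp [hp2, hp1, hp0, hN]
  have em : p2.mem = p.mem := rfl
  have hup : (Function.update s.f (t, v1, v2) v) ∘ cellOf =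
      Function.update (s.f ∘ cellOf) y v := by
    funext z
    by_cases hzy : z = y
    · subst hzy; simp [hcy]
    · have : cellOf z ≠ (t, v1, v2) := fun e => hzy (cellOf_inj (e.trans hcy.symm))
      simp [Function.update_of_ne hzy, Function.update_of_ne this]
  -- it suffices to treat the tree
  have finish : ∀ p3, TreeRep m p3 (Function.update (s.f ∘ cellOf) y v) →
      (∀ r, 20 ≤ r → p3.reg r = p2.reg r) → p3.draws = p2.draws → p3.out = p2.out →
      Rep m p3 (s.setF (t, v1, v2) v) := by
    intro p3 h1 h2 h3 h4
    refine ⟨fun r ha hb => ?_, hp.regW, fun c => ?_, h3.trans hp.draws, h4.trans hp.out, ?_⟩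
    · rw [h2 r ha]
      have := hp.reg r ha hb
      simp [hp2, hp1, hp0, this, show r ≠ 0 by omega, show r ≠ 1 by omega, show r ≠ 2 by omega,
        show r ≠ 3 by omega, show r ≠ 4 by omega, show r ≠ 7 by omega, show r ≠ 8 by omega]
    · simp only [VS.setF_f]
      split_ifs
      exacts [c3, hp.fW c]
    · rw [← hup] at h1
      exact h1
  have slotle : ∀ π l, IsSlot (Finset.Icc 1 N) ps π l → l ≤ 4 * N + 3 ∧ 2 ≤ l % 4 ∧
      l / 4 ≤ N := by
    rintro π l (⟨_, rfl⟩ | ⟨q, hq, b, hb, _, rfl⟩)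
    · omega
    · have := (memR q).1 hq; omega
  have hloc := slotle _ _ g2.slot
  have hqcap : q ≤ m.cap := by
    rcases g2.res with ⟨rfl, hno⟩ | ⟨e1, e2, e3⟩
    exacts [by omega, hcap q e1]
  have V4 : Val m.toMach Agree (.reg 4) 2 p2 v :=
    Val.raw' (he := by simp [r4, c3]) (hv := by simp [r4])
  have V2 : Val m.toMach Agree (.reg 2) 2 p2 q :=
    Val.raw' (he := by simp [r2]; omega) (hv := by simp [r2])
  suffices H : ∃ p3, Tr m.toMach Agree (iff (.reg 4)
      (iff (.reg 2) (st (4 * .reg 2 + 1) (.reg 4))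
        (set 10 (.reg 10 + 1) ;; st (4 * .reg 10) (.reg 0) ;; st (4 * .reg 10 + 1) (.reg 4) ;;
          st (.reg 1) (.reg 10)))
      (iff (.reg 2) (descend ;; unlink ;; compact ;; clearLast) .skip)) (310 + 80 * m.Bm) p2 p3 ∧
      Rep m p3 (s.setF (t, v1, v2) v) by
    obtain ⟨p3, h1, h2⟩ := H
    exact ⟨p3, (t4.seq (tk.seq (g3.seq h1))).mono, h2⟩
  by_cases hv0 : v = 0
  · rw [hv0] at V4
    by_cases hq0 : q = 0
    · rw [hq0] at V2
      refine ⟨p2, (Tr.ite_false V4 (Tr.ite_false V2 Tr.skip)).mono, ?_⟩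
      refine finish p2 ?_ (fun _ _ => rfl) rfl rfl
      have h0 : (s.f ∘ cellOf) y = 0 := by
        rcases g2.res with ⟨_, hno⟩ | ⟨e1, e2, e3⟩
        · by_contra hne
          obtain ⟨r, hr, e⟩ := hK.sup y hne
          exact (hno r hr).1 e
        · have := (memR q).1 e1; omega
      have e : Function.update (s.f ∘ cellOf) y v = s.f ∘ cellOf := by
        rw [hv0, ← h0]; exact Function.update_eq_self _ _
      rw [e]
      exact ⟨⟨ps, by rw [r10]; exact hS, by rw [r10]; exact hK⟩, by rw [r10]; exact hp.tree.zero,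
        by rw [r10]; exact hNcap⟩
    · have hT : TreeRep m p2 (s.f ∘ cellOf) :=
        ⟨⟨ps, by rw [r10]; exact hS, by rw [r10]; exact hK⟩, by rw [r10]; exact hp.tree.zero,
        by rw [r10]; exact hNcap⟩
      obtain ⟨p3, x1, x2, x3, x4, x5⟩ := delete_spec hm hT r1 r2 (by rw [r10]; exact hS)
        (by rw [r10]; exact hK) (by rw [r10]; exact g2) hq0
      exact ⟨p3, (Tr.ite_false V4 (Tr.ite_true V2 hq0 x1)).mono,
        finish p3 (by rw [hv0]; exact x2) x3 x4 x5⟩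
  · by_cases hq0 : q = 0
    · obtain ⟨_, hno⟩ : q = 0 ∧ ∀ r ∈ Finset.Icc 1 N, p.mem (4 * r) ≠ y ∧ ps r ≠ path y d := by
        rcases g2.res with h | ⟨e1, _⟩
        · exact h
        · have := (memR q).1 e1; omega
      rw [hq0] at V2
      have hNz := hp.tree.card_le hz
      -- the number of nodes stays within the capacity
      have hN1 : N + 1 ≤ m.cap := by omega
      have b1 := Tr.rawSet' (m := m.toMach) (x := 10) (e := .reg 10 + 1) (v := N + 1) (s := p2)
        (he := by simp [r10]; omega) (hv := by simp [r10])
      have b2 := Tr.rawStore' (m := m.toMach) (e := 4 * .reg 10) (e' := .reg 0)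
        (s := p2.setReg 10 (N + 1)) (a := 4 * (N + 1)) (v := y) (he' := by simp [r0]; omega)
        (hv := by simp [r0])
      have b3 := Tr.rawStore' (m := m.toMach) (e := 4 * .reg 10 + 1) (e' := .reg 4)
        (s := (p2.setReg 10 (N + 1)).setMem (4 * (N + 1)) y) (a := 4 * (N + 1) + 1) (v := v)
        (he' := by simp [r4]; omega) (hv := by simp [r4])
      have b4 := Tr.rawStore' (m := m.toMach) (e := .reg 1) (e' := .reg 10)
        (s := ((p2.setReg 10 (N + 1)).setMem (4 * (N + 1)) y).setMem (4 * (N + 1) + 1) v) (a := loc)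
        (v := N + 1) (he := by simp [r1]; omega) (ha := by simp [r1])
      set p3 := (((p2.setReg 10 (N + 1)).setMem (4 * (N + 1)) y).setMem (4 * (N + 1) + 1) v).setMem
        loc (N + 1) with hp3
      have hmem : ∀ a, p3.mem a = if a = loc then N + 1 else if a = 4 * (N + 1) + 1 then v else
          if a = 4 * (N + 1) then y else p.mem a := by
        intro a; simp [hp3, em]
      have h10 : p3.reg 10 = N + 1 := by simp [hp3]
      have hins : Finset.Icc 1 (N + 1) = insert (N + 1) (Finset.Icc 1 N) := by
        ext a; simp only [Finset.mem_Icc, Finset.mem_insert]; omega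
      have hnot : N + 1 ∉ Finset.Icc 1 N := by simp
      refine ⟨p3, (Tr.ite_true V4 hv0 (Tr.ite_false V2 (b1.seq (b2.seq (b3.seq b4))))).mono
        (by simp; omega), finish p3 ⟨⟨Function.update ps (N + 1) (path y d), ?_, ?_⟩, ?_, ?_⟩ ?_
        rfl rfl⟩
      · rw [h10, hins]
        refine hS.add_leaf (by omega) hnot g2.slot (fun r hr => (hno r hr).2) ?_ ?_ ?_
          (fun a ha ha' => ?_)
        · rw [hmem, if_neg (by omega), if_neg (by omega), if_neg (by omega)]
          exact hp.tree.zero _ (by omega) (by rw [Finset.mem_Icc]; omega)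
        · rw [hmem, if_neg (by omega), if_neg (by omega), if_neg (by omega)]
          exact hp.tree.zero _ (by omega) (by rw [Finset.mem_Icc]; omega)
        · rw [hmem, if_pos rfl]
        · rw [Finset.mem_singleton] at ha
          rw [hmem, if_neg ha', if_neg (by omega), if_neg (by omega)]
      · rw [h10, hins]
        refine hK.add_leaf hnot hv0 (by omega) hkey' (fun r hr => (hno r hr).1) ?_ ?_
          (fun a ha ha' => ?_)
        · rw [hmem, if_neg (by omega), if_neg (by omega), if_pos rfl]
        · rw [hmem, if_neg (by omega), if_pos rfl]
        · rw [hmem, if_neg (by omega), if_neg (by omega), if_neg (by omega)]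
      · intro a ha ha'
        rw [h10, Finset.mem_Icc] at ha'
        have : a ≠ loc := by
          rintro rfl
          rcases g2.slot with ⟨_, e⟩ | ⟨r, hr, b, hb, _, e⟩
          · exact ha e
          · have := (memR r).1 hr; omega
        rw [hmem, if_neg this, if_neg (by omega), if_neg (by omega)]
        exact hp.tree.zero a ha (by rw [Finset.mem_Icc]; omega)
      · rw [h10]; exact hN1
      · intro r hr
        simp [hp3, show r ≠ 10 by omega]
    · obtain ⟨hqR, hqy, _⟩ : q ∈ Finset.Icc 1 N ∧ p.mem (4 * q) = y ∧ ps q = path y d := by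
        rcases g2.res with ⟨h, _⟩ | h
        exacts [absurd h hq0, h]
      have hqN := (memR q).1 hqR
      have b1 := Tr.rawStore' (m := m.toMach) (e := 4 * .reg 2 + 1) (e' := .reg 4) (s := p2)
        (a := 4 * q + 1) (v := v) (he := by simp [r2]; omega) (he' := by simp [r4]; omega)
        (ha := by simp [r2]) (hv := by simp [r4])
      refine ⟨p2.setMem (4 * q + 1) v, (Tr.ite_true V4 hv0 (Tr.ite_true V2 hq0 b1)).mono
        (by simp; omega), finish _ ⟨⟨ps, ?_, ?_⟩, ?_, ?_⟩ (fun _ _ => rfl) rfl rfl⟩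
      · rw [Conf.setMem_reg, r10]
        refine hS.congr fun a ha => ?_
        rw [Conf.setMem_mem, if_neg (by omega), em]
      · rw [Conf.setMem_reg, r10, ← hqy]
        refine hK.setVal hqR hv0 (fun a ha => ?_) (by simp)
        rw [Conf.setMem_mem, if_neg ha, em]
      · intro a ha ha'
        rw [Conf.setMem_reg, r10, Finset.mem_Icc] at ha'
        rw [Conf.setMem_mem, if_neg (by omega), em]
        exact hp.tree.zero a ha (by rw [Finset.mem_Icc]; omega)
      · rw [Conf.setMem_reg, r10]; exact hNcap

end Access


/-! ### Indexed sets

A set is stored as a list together with the positions of its elements, so that its members can be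
enumerated, added, removed and tested by a constant number of accesses. -/

/-- The position of `v` in the list, counted from `1`; it is `0` if `v` does not occur. -/
def posn (l : List ℕ) (v : ℕ) : ℕ := if v ∈ l then l.idxOf v + 1 else 0

/-- Remove `v` from the list and move the last element to its place. -/
def swapRem (l : List ℕ) (v : ℕ) : List ℕ :=
  (l.set (l.idxOf v) (l.getD (l.length - 1) 0)).take (l.length - 1)

lemma getD_append_one (l : List ℕ) (v i : ℕ) :
    (l ++ [v]).getD i 0 = if i = l.length then v else l.getD i 0 := by
  rcases lt_trichotomy i l.length with h | h | h
  · rw [if_neg (by omega), List.getD_append _ _ _ _ h]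
  · subst h; simp
  · rw [if_neg (by omega), List.getD_eq_default _ _ (by simp; omega),
      List.getD_eq_default _ _ (by omega)]

lemma posn_append_one {l : List ℕ} {v : ℕ} (hv : v ∉ l) (i : ℕ) :
    posn (l ++ [v]) i = if i = v then l.length + 1 else posn l i := by
  unfold posn
  by_cases h : i = v
  · subst h
    simp [List.idxOf_append, hv]
  · by_cases hi : i ∈ l <;> simp [h, hi, List.idxOf_append]

section swapRem
variable {l : List ℕ} {v : ℕ}

lemma length_swapRem : (swapRem l v).length = l.length - 1 := by
  simp [swapRem]

lemma getD_swapRem (hv : v ∈ l) (i : ℕ) : (swapRem l v).getD i 0 =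
    if i = l.length - 1 then 0 else if i = l.idxOf v then l.getD (l.length - 1) 0
    else l.getD i 0 := by
  have hlt := List.idxOf_lt_length_iff.2 hv
  by_cases h1 : i < l.length - 1
  · have hx : i < (swapRem l v).length := by rw [length_swapRem]; exact h1
    rw [List.getD_eq_getElem _ _ hx, if_neg (by omega)]
    simp only [swapRem, List.getElem_take, List.getElem_set]
    by_cases h2 : i = l.idxOf v
    · rw [if_pos h2.symm, if_pos h2]
    · rw [if_neg (fun e => h2 e.symm), if_neg h2]
      exact (List.getD_eq_getElem _ _ (by omega)).symm
  · rw [List.getD_eq_default _ _ (by rw [length_swapRem]; omega)]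
    by_cases h2 : i = l.length - 1
    · rw [if_pos h2]
    · rw [if_neg h2, if_neg (by omega), List.getD_eq_default _ _ (by omega)]

lemma posn_eq (hn : l.Nodup) {i : ℕ} (hi : i < l.length) : posn l (l.getD i 0) = i + 1 := by
  rw [List.getD_eq_getElem _ _ hi]
  unfold posn
  rw [if_pos (List.getElem_mem hi), hn.idxOf_getElem]

/-- The elements of `swapRem l v`, with their places. -/
lemma mem_swapRem_iff (hn : l.Nodup) (hv : v ∈ l) (z : ℕ) : z ∈ swapRem l v ↔ z ∈ l ∧ z ≠ v := by
  have hlt := List.idxOf_lt_length_iff.2 hv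
  have hvi : l.getD (l.idxOf v) 0 = v := by
    rw [List.getD_eq_getElem _ _ hlt, List.getElem_idxOf]
  have inj : ∀ i j, i < l.length → j < l.length → l.getD i 0 = l.getD j 0 → i = j := by
    intro i j hi hj e
    have := posn_eq hn hi
    rw [e, posn_eq hn hj] at this
    omega
  have getmem : ∀ i, i < l.length → l.getD i 0 ∈ l := fun i hi => by
    rw [List.getD_eq_getElem _ _ hi]; exact List.getElem_mem hi
  constructor
  · intro hz
    obtain ⟨i, hi, rfl⟩ := List.mem_iff_getElem.1 hz
    rw [← List.getD_eq_getElem _ 0 hi, getD_swapRem hv]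
    rw [length_swapRem] at hi
    rw [if_neg (by omega)]
    split_ifs with h
    · refine ⟨getmem _ (by omega), fun e => ?_⟩
      have := inj _ _ (by omega) hlt (e.trans hvi.symm)
      omega
    · exact ⟨getmem _ (by omega), fun e => h (inj _ _ (by omega) hlt (e.trans hvi.symm))⟩
  · rintro ⟨hz, hne⟩
    obtain ⟨i, hi, rfl⟩ := List.mem_iff_getElem.1 hz
    rw [← List.getD_eq_getElem _ 0 hi] at hne ⊢
    have hiv : i ≠ l.idxOf v := by rintro rfl; exact hne hvi
    by_cases h1 : i = l.length - 1
    · have : (swapRem l v).getD (l.idxOf v) 0 = l.getD i 0 := by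
        rw [getD_swapRem hv, if_neg (by omega), if_pos rfl, h1]
      rw [← this, List.getD_eq_getElem _ _ (by rw [length_swapRem]; omega)]
      exact List.getElem_mem _
    · have : (swapRem l v).getD i 0 = l.getD i 0 := by
        rw [getD_swapRem hv, if_neg h1, if_neg hiv]
      rw [← this, List.getD_eq_getElem _ _ (by rw [length_swapRem]; omega)]
      exact List.getElem_mem _

lemma nodup_swapRem (hn : l.Nodup) (hv : v ∈ l) : (swapRem l v).Nodup := by
  have hlt := List.idxOf_lt_length_iff.2 hv
  rw [List.nodup_iff_injective_getElem]
  rintro ⟨i, hi⟩ ⟨j, hj⟩ e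
  have e : (swapRem l v).getD i 0 = (swapRem l v).getD j 0 := by
    rw [List.getD_eq_getElem _ 0 hi, List.getD_eq_getElem _ 0 hj]; exact e
  rw [getD_swapRem hv, getD_swapRem hv] at e
  have hi' := hi
  have hj' := hj
  rw [length_swapRem] at hi' hj'
  have inj : ∀ i j, i < l.length → j < l.length → l.getD i 0 = l.getD j 0 → i = j := by
    intro i j hi hj e
    have := posn_eq hn hi
    rw [e, posn_eq hn hj] at this
    omega
  rw [if_neg (show ¬ i = l.length - 1 by omega), if_neg (show ¬ j = l.length - 1 by omega)] at e
  rw [Fin.mk.injEq]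
  split_ifs at e with h1 h2
  · omega
  · have := inj _ _ (by omega) (by omega) e; omega
  · have := inj _ _ (by omega) (by omega) e; omega
  · exact inj _ _ (by omega) (by omega) e

lemma posn_swapRem (hn : l.Nodup) (hv : v ∈ l) (z : ℕ) : posn (swapRem l v) z =
    if z = v then 0 else if z = l.getD (l.length - 1) 0 then l.idxOf v + 1 else posn l z := by
  have hlt := List.idxOf_lt_length_iff.2 hv
  have hvi : l.getD (l.idxOf v) 0 = v := by
    rw [List.getD_eq_getElem _ _ hlt, List.getElem_idxOf]
  have hn' := nodup_swapRem hn hv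
  by_cases hzv : z = v
  · rw [if_pos hzv]
    unfold posn
    rw [if_neg (by rw [mem_swapRem_iff hn hv]; tauto)]
  rw [if_neg hzv]
  by_cases hz : z ∈ l
  · obtain ⟨i, hi, rfl⟩ := List.mem_iff_getElem.1 hz
    rw [← List.getD_eq_getElem _ 0 hi] at hzv ⊢
    have hiv : i ≠ l.idxOf v := by rintro rfl; exact hzv hvi
    by_cases h1 : i = l.length - 1
    · have : (swapRem l v).getD (l.idxOf v) 0 = l.getD i 0 := by
        rw [getD_swapRem hv, if_neg (by omega), if_pos rfl, h1]
      rw [if_pos (by rw [h1]), ← this, posn_eq hn' (by rw [length_swapRem]; omega)]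
    · have : (swapRem l v).getD i 0 = l.getD i 0 := by
        rw [getD_swapRem hv, if_neg h1, if_neg hiv]
      rw [if_neg, ← this, posn_eq hn' (by rw [length_swapRem]; omega), this, posn_eq hn hi]
      intro e
      have h2 := posn_eq hn hi
      rw [e, posn_eq hn (by omega)] at h2
      omega
  · have h1 : posn l z = 0 := if_neg hz
    have h2 : posn (swapRem l v) z = 0 := if_neg (by rw [mem_swapRem_iff hn hv]; tauto)
    rw [h1, h2, if_neg]
    rintro rfl
    apply hz
    rw [List.getD_eq_getElem _ _ (by omega)]
    exact List.getElem_mem _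

end swapRem

/-! ### The deterministic part of the data -/

/-- The data of the implementation apart from the labels: `E 0 x` is the list of the neighbours of
`x`; `c x` counts the updates at `x`; the tracking instance of the edge `uv` is mature when
`c u + c v = T u v`; `al u v` is the value of `c u` at which the edge is looked at again, and
`E 1 (Nat.pair u a)` is the list of the `v` with `al u v = a`. The remaining fields are not stored:
`rr u v` is the number of affecting updates that were missing for maturity when the alarms were last
set, `calls` lists the invocations of the labelling strategy (with the adjacency lists), and `ne`
counts the alarms that went off. -/
structure Aux where
  E : ℕ → ℕ → List ℕ
  c : ℕ → ℕ
  T : ℕ → ℕ → ℕ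
  al : ℕ → ℕ → ℕ
  rr : ℕ → ℕ → ℕ
  calls : List (ℕ × ℕ × (ℕ → List ℕ))
  ne : ℕ

/-- Change a function of two variables at one place. -/
def upd {α : Type} (f : ℕ → ℕ → α) (u v : ℕ) (x : α) : ℕ → ℕ → α :=
  fun a b => if a = u ∧ b = v then x else f a b

/-- Add an element to a list. -/
def Aux.add (A : Aux) (b x v : ℕ) : Aux := { A with E := upd A.E b x (A.E b x ++ [v]) }

/-- Remove an element from a list. -/
def Aux.rem (A : Aux) (b x v : ℕ) : Aux := { A with E := upd A.E b x (swapRem (A.E b x) v) }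

/-- The cells that store a family of lists: sizes, elements, and positions. -/
def encSet (F : ℕ → List ℕ) (j x i : ℕ) : ℕ :=
  if j = 0 then (if i = 0 then (F x).length else 0)
  else if j = 1 then (F x).getD i 0 else posn (F x) i

/-- The virtual memory that stores the data and the labels. -/
def enc (A : Aux) (lab : ℕ → ℕ → ℕ) : ℕ × ℕ × ℕ → ℕ := fun (t, x, i) =>
  if t < 6 then encSet (A.E (t / 3)) (t % 3) x i
  else if t = 6 then (if i = 0 then A.c x else 0)
  else if t = 7 then A.T x i
  else if t = 8 then A.al x i
  else if t = 9 then lab x i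
  else 0

section enc
variable {A : Aux} {lab : ℕ → ℕ → ℕ}

lemma enc_set {b : ℕ} (hb : b < 2) {j : ℕ} (hj : j < 3) (x i : ℕ) :
    enc A lab (3 * b + j, x, i) = encSet (A.E b) j x i := by
  unfold enc
  simp only
  rw [if_pos (by omega), show (3 * b + j) / 3 = b by omega, show (3 * b + j) % 3 = j by omega]

lemma enc_c (x : ℕ) : enc A lab (6, x, 0) = A.c x := by simp [enc]
lemma enc_T (x i : ℕ) : enc A lab (7, x, i) = A.T x i := by simp [enc]
lemma enc_al (x i : ℕ) : enc A lab (8, x, i) = A.al x i := by simp [enc]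
lemma enc_lab (x i : ℕ) : enc A lab (9, x, i) = lab x i := by simp [enc]
lemma enc_size {b : ℕ} (hb : b < 2) (x : ℕ) : enc A lab (3 * b, x, 0) = (A.E b x).length := by
  simpa [encSet] using enc_set (A := A) (lab := lab) hb (j := 0) (by omega) x 0
lemma enc_elt {b : ℕ} (hb : b < 2) (x i : ℕ) :
    enc A lab (3 * b + 1, x, i) = (A.E b x).getD i 0 := by
  simpa [encSet] using enc_set (A := A) (lab := lab) hb (j := 1) (by omega) x i
lemma enc_pos {b : ℕ} (hb : b < 2) (x i : ℕ) :
    enc A lab (3 * b + 2, x, i) = posn (A.E b x) i := by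
  simpa [encSet] using enc_set (A := A) (lab := lab) hb (j := 2) (by omega) x i

lemma enc_update_T (u v w : ℕ) : Function.update (enc A lab) (7, u, v) w =
    enc { A with T := upd A.T u v w } lab := by
  funext ⟨t, x, i⟩
  simp only [Function.update_apply, Prod.mk.injEq, enc, upd]
  by_cases h : t = 7 <;> simp [h]

lemma enc_update_al (u v w : ℕ) : Function.update (enc A lab) (8, u, v) w =
    enc { A with al := upd A.al u v w } lab := by
  funext ⟨t, x, i⟩
  simp only [Function.update_apply, Prod.mk.injEq, enc, upd]
  by_cases h : t = 8 <;> simp [h]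

lemma enc_update_lab (u v w : ℕ) : Function.update (enc A lab) (9, u, v) w =
    enc A (upd lab u v w) := by
  funext ⟨t, x, i⟩
  simp only [Function.update_apply, Prod.mk.injEq, enc, upd]
  by_cases h : t = 9 <;> simp [h]

lemma enc_update_c (u w : ℕ) : Function.update (enc A lab) (6, u, 0) w =
    enc { A with c := Function.update A.c u w } lab := by
  funext ⟨t, x, i⟩
  simp only [Function.update_apply, Prod.mk.injEq, enc]
  by_cases h : t = 6
  · by_cases h1 : x = u <;> by_cases h2 : i = 0 <;> simp [h, h1, h2]
  · simp [h]

/-- Change one list, given the cells that store the new one. -/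
lemma enc_setList {b x : ℕ} (hb : b < 2) {l : List ℕ} {f : ℕ × ℕ × ℕ → ℕ}
    (h0 : ∀ j < 3, ∀ i, f (3 * b + j, x, i) = encSet (fun _ => l) j x i)
    (h1 : ∀ t y i, (∀ j < 3, (t, y) ≠ (3 * b + j, x)) → f (t, y, i) = enc A lab (t, y, i)) :
    f = enc { A with E := upd A.E b x l } lab := by
  funext ⟨t, y, i⟩
  by_cases ht : t < 6 ∧ t / 3 = b ∧ y = x
  · obtain ⟨h2, h3, rfl⟩ := ht
    obtain ⟨j, hj, rfl⟩ : ∃ j < 3, t = 3 * b + j := ⟨t % 3, Nat.mod_lt _ (by norm_num), by omega⟩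
    rw [h0 _ hj, enc_set hb hj]
    simp [encSet, upd]
  · rw [h1 t y i]
    · unfold enc
      simp only
      by_cases h6 : t < 6
      · have : ¬ (t / 3 = b ∧ y = x) := fun h => ht ⟨h6, h.1, h.2⟩
        simp only [if_pos h6, encSet, upd, if_neg this]
      · simp only [if_neg h6]
    · rintro j hj e
      simp only [Prod.mk.injEq] at e
      exact ht ⟨by omega, by omega, e.2⟩

lemma enc_add {b x v : ℕ} (hb : b < 2) (hv : v ∉ A.E b x) :
    Function.update (Function.update (Function.update (enc A lab) (3 * b + 1, x, (A.E b x).length) v)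
      (3 * b + 2, x, v) ((A.E b x).length + 1)) (3 * b, x, 0) ((A.E b x).length + 1) =
    enc (A.add b x v) lab := by
  refine enc_setList hb (fun j hj i => ?_) (fun t y i h => ?_)
  · obtain rfl | rfl | rfl : j = 0 ∨ j = 1 ∨ j = 2 := by omega
    · by_cases hi : i = 0
      · simp [encSet, hi]
      · simp [encSet, hi]
        simpa [encSet, hi] using enc_set (A := A) (lab := lab) hb (j := 0) (by omega) x i
    · simp [Function.update_apply, encSet]
      rw [enc_elt hb, ← List.getD_eq_getElem?_getD, getD_append_one]
    · simp [Function.update_apply, encSet]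
      rw [enc_pos hb, posn_append_one hv]
  · have h0 := h 0 (by omega)
    have h1 := h 1 (by omega)
    have h2 := h 2 (by omega)
    simp only [add_zero, ne_eq, Prod.mk.injEq, not_and] at h0 h1 h2
    simp only [Function.update_apply, Prod.mk.injEq]
    rw [if_neg (fun e => h0 e.1 e.2.1), if_neg (fun e => h2 e.1 e.2.1),
      if_neg (fun e => h1 e.1 e.2.1)]

lemma enc_rem {b x v k i0 y : ℕ} (hb : b < 2) (hn : (A.E b x).Nodup) (hv : v ∈ A.E b x)
    (hk : (A.E b x).length - 1 = k) (hi : (A.E b x).idxOf v = i0) (hy : (A.E b x).getD k 0 = y) :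
    Function.update (Function.update (Function.update (Function.update (Function.update (enc A lab)
      (3 * b + 1, x, i0) y) (3 * b + 2, x, y) (i0 + 1)) (3 * b + 1, x, k) 0)
      (3 * b + 2, x, v) 0) (3 * b, x, 0) k =
    enc (A.rem b x v) lab := by
  subst hk hi hy
  refine enc_setList hb (fun j hj i => ?_) (fun t y i h => ?_)
  · obtain rfl | rfl | rfl : j = 0 ∨ j = 1 ∨ j = 2 := by omega
    · by_cases hi : i = 0
      · simp [encSet, hi, length_swapRem]
      · simp [encSet, hi]
        simpa [encSet, hi] using enc_set (A := A) (lab := lab) hb (j := 0) (by omega) x i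
    · simp [Function.update_apply, encSet]
      rw [enc_elt hb, ← List.getD_eq_getElem?_getD, ← List.getD_eq_getElem?_getD, getD_swapRem hv]
    · simp [Function.update_apply, encSet]
      rw [enc_pos hb, posn_swapRem hn hv, List.getD_eq_getElem?_getD]
  · have h0 := h 0 (by omega)
    have h1 := h 1 (by omega)
    have h2 := h 2 (by omega)
    simp only [add_zero, ne_eq, Prod.mk.injEq, not_and] at h0 h1 h2
    simp only [Function.update_apply, Prod.mk.injEq]
    rw [if_neg (fun e => h0 e.1 e.2.1), if_neg (fun e => h2 e.1 e.2.1),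
      if_neg (fun e => h1 e.1 e.2.1), if_neg (fun e => h2 e.1 e.2.1),
      if_neg (fun e => h1 e.1 e.2.1)]

end enc

/-! ### Programs for indexed sets -/

/-- Add `ev` to the list number `ex` of the family `b`. -/
def setAdd (b : ℕ) (ex ev : Expr) : Prog :=
  set 20 ex ;; set 21 ev ;; rd 22 (3 * b) (.reg 20) 0 ;;
  wr (3 * b + 1) (.reg 20) (.reg 22) (.reg 21) ;; wr (3 * b + 2) (.reg 20) (.reg 21) (.reg 22 + 1) ;;
  wr (3 * b) (.reg 20) 0 (.reg 22 + 1)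

/-- Remove `ev` from the list number `ex` of the family `b`. -/
def setRem (b : ℕ) (ex ev : Expr) : Prog :=
  set 20 ex ;; set 21 ev ;; rd 22 (3 * b) (.reg 20) 0 ;; set 22 (.reg 22 - 1) ;;
  rd 23 (3 * b + 2) (.reg 20) (.reg 21) ;; set 23 (.reg 23 - 1) ;;
  rd 24 (3 * b + 1) (.reg 20) (.reg 22) ;; wr (3 * b + 1) (.reg 20) (.reg 23) (.reg 24) ;;
  wr (3 * b + 2) (.reg 20) (.reg 24) (.reg 23 + 1) ;; wr (3 * b + 1) (.reg 20) (.reg 22) 0 ;;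
  wr (3 * b + 2) (.reg 20) (.reg 21) 0 ;; wr (3 * b) (.reg 20) 0 (.reg 22)

section SetOps
variable {m : VM} (hm : m.Good) {s : VS} {ex ev : Expr} {b x v n z : ℕ} {A : Aux}
  {lab : ℕ → ℕ → ℕ}

/-- The cells of the list number `x` of the family `b` can be addressed. -/
def RowOk (m : VM) (n b x : ℕ) : Prop := b < 2 ∧ ∀ j < 3, ∀ i ≤ n, CellOk m (3 * b + j) x i

include hm in
lemma CellOk.lt {t x i : ℕ} (h : CellOk m t x i) : 16 * (max x i + 1) ^ 2 ≤ m.W :=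
  h.2.trans (hm.pow_le t)

include hm in
lemma CellOk.lt_W {t x i y : ℕ} (h : CellOk m t x i) (hy : y ≤ max x i + 2) : y < m.W := by
  have := h.lt hm
  set q := max x i
  have : (q + 1) ^ 2 = q * q + 2 * q + 1 := by ring
  have := hm.W16
  omega

include hm in
lemma setAdd_spec (hrow : RowOk m n b x) (hx : ex.UOk m.W s.reg) (hxv : ex.eval s.reg 0 = x)
    (hv : ∀ r, ev.UOk m.W (s.setR 20 r).reg ∧ ev.eval (s.setR 20 r).reg 0 = v)
    (hcx : ex.cost ≤ 60) (hcv : ev.cost ≤ 60)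
    (hf : s.f = enc A lab) (hnot : v ∉ A.E b x) (hlen : (A.E b x).length < n) (hvn : v ≤ n)
    (hz : Sz s.f z) (hzc : z + 4 ≤ m.cap) :
    ∃ ρ, Tr m.toMach (Rep m) (setAdd b ex ev) (1400 * m.Bm) s
      ⟨ρ, enc (A.add b x v) lab, s.draws, s.out⟩ ∧ ∀ r, 30 ≤ r → ρ r = s.reg r := by
  obtain ⟨hb, hcell⟩ := hrow
  have hW := hm.W16
  set k := (A.E b x).length with hk
  have c0 := hcell 0 (by omega) 0 (by omega)
  have c1 := hcell 1 (by omega) k (by omega)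
  have c2 := hcell 2 (by omega) v hvn
  have hk1 : k + 1 < m.W := c1.lt_W hm (by omega)
  have hB0 := hm.B_le (3 * b)
  have hB7 := hm.B_ge (3 * b)
  have t1 := Tr.asg hm (x := 20) (k := 62) (by omega) hx hxv (by omega)
  have t2 := Tr.asg hm (x := 21) (k := 62) (by omega) (hv x).1 (hv x).2 (by omega)
  have t3 := Tr.read hm (s := (s.setR 20 x).setR 21 v) (x := 22) (t := 3 * b) (e1 := .reg 20)
    (e2 := 0) (v1 := x) (v2 := 0) (v := k) (by omega) c0 (by simp) (by simp; omega) (by simp)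
    (by simp) (by simp [hf, enc_size hb, hk]) (by simp) (by simp)
  set s3 := ((s.setR 20 x).setR 21 v).setR 22 k with hs3
  have hf3 : s3.f = enc A lab := hf
  have t4 := Tr.write hm (s := s3) (t := 3 * b + 1) (e1 := .reg 20) (e2 := .reg 22) (e3 := .reg 21)
    (v1 := x) (v2 := k) (v := v) (z := z) c1 rfl (by simp) (by simp) (by simp) (by simp [hs3])
    (by simp [hs3]) (by simp [hs3]) hz (by omega) (by simp) (by simp) (by simp)
  have hz1 := hz.update (3 * b + 1, x, k) v
  have t5 := Tr.write hm (s := s3.setF (3 * b + 1, x, k) v) (t := 3 * b + 2) (e1 := .reg 20)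
    (e2 := .reg 21) (e3 := .reg 22 + 1)
    (v1 := x) (v2 := v) (v := k + 1) (z := z + 1) c2 rfl (by simp) (by simp)
    (by simp [hs3]; omega) (by simp [hs3]) (by simp [hs3]) (by simp [hs3]) hz1 (by omega) (by simp)
    (by simp) (by simp)
  have hz2 := hz1.update (3 * b + 2, x, v) (k + 1)
  have t6 := Tr.write hm (s := (s3.setF (3 * b + 1, x, k) v).setF (3 * b + 2, x, v) (k + 1))
    (t := 3 * b) (e1 := .reg 20) (e2 := 0) (e3 := .reg 22 + 1)
    (v1 := x) (v2 := 0) (v := k + 1) (z := z + 1 + 1) c0 rfl (by simp) (by simp; omega)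
    (by simp [hs3]; omega) (by simp [hs3]) (by simp [hs3]) (by simp [hs3]) hz2 (by omega) (by simp)
    (by simp) (by simp)
  refine ⟨s3.reg, ?_, fun r hr => ?_⟩
  · have := t1.seq (t2.seq (t3.seq (t4.seq (t5.seq t6))))
    refine Tr.mono ?_ (show 62 + (62 + (100 * m.B (3 * b) + (400 * m.Bm + (400 * m.Bm +
      400 * m.Bm)))) ≤ _ by omega)
    rw [← enc_add hb hnot, ← hf3]
    exact this
  · simp [hs3, show r ≠ 20 by omega, show r ≠ 21 by omega, show r ≠ 22 by omega]

include hm in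
lemma setRem_spec (hrow : RowOk m n b x) (hx : ex.UOk m.W s.reg) (hxv : ex.eval s.reg 0 = x)
    (hv : ∀ r, ev.UOk m.W (s.setR 20 r).reg ∧ ev.eval (s.setR 20 r).reg 0 = v)
    (hcx : ex.cost ≤ 60) (hcv : ev.cost ≤ 60)
    (hf : s.f = enc A lab) (hnd : (A.E b x).Nodup) (hin : v ∈ A.E b x)
    (hlen : (A.E b x).length ≤ n) (hvn : ∀ y ∈ A.E b x, y ≤ n)
    (hz : Sz s.f z) (hzc : z + 6 ≤ m.cap) :
    ∃ ρ, Tr m.toMach (Rep m) (setRem b ex ev) (2400 * m.Bm) s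
      ⟨ρ, enc (A.rem b x v) lab, s.draws, s.out⟩ ∧ ∀ r, 30 ≤ r → ρ r = s.reg r := by
  obtain ⟨hb, hcell⟩ := hrow
  have hW := hm.W16
  have hlt := List.idxOf_lt_length_iff.2 hin
  set k := (A.E b x).length - 1 with hk
  set i0 := (A.E b x).idxOf v with hi0
  set y := (A.E b x).getD k 0 with hy
  have hyn : y ≤ n := by
    rw [hy, List.getD_eq_getElem _ _ (by omega)]
    exact hvn _ (List.getElem_mem _)
  have c0 := hcell 0 (by omega) 0 (by omega)
  have ck := hcell 1 (by omega) k (by omega)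
  have ci := hcell 1 (by omega) i0 (by omega)
  have cv := hcell 2 (by omega) v (hvn v hin)
  have cy := hcell 2 (by omega) y hyn
  have hk1 : i0 + 1 < m.W := ci.lt_W hm (by omega)
  have hB0 := hm.B_le (3 * b)
  have hB1 := hm.B_le (3 * b + 1)
  have hB2 := hm.B_le (3 * b + 2)
  have hB7 := hm.B_ge (3 * b)
  have t1 := Tr.asg hm (x := 20) (k := 62) (by omega) hx hxv (by omega)
  have t2 := Tr.asg hm (x := 21) (k := 62) (by omega) (hv x).1 (hv x).2 (by omega)
  have t3 := Tr.read hm (s := (s.setR 20 x).setR 21 v) (x := 22) (t := 3 * b) (e1 := .reg 20)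
    (e2 := 0) (v1 := x) (v2 := 0) (v := (A.E b x).length) (by omega) c0 (by simp) (by simp; omega)
    (by simp) (by simp) (by simp [hf, enc_size hb]) (by simp) (by simp)
  have t4 := Tr.asg hm (s := ((s.setR 20 x).setR 21 v).setR 22 (A.E b x).length) (x := 22) (k := 6)
    (e := .reg 22 - 1) (v := k) (by omega) (by simp; omega) (by simp [hk]) (by simp)
  set s4 := (((s.setR 20 x).setR 21 v).setR 22 (A.E b x).length).setR 22 k with hs4
  have t5 := Tr.read hm (s := s4) (x := 23) (t := 3 * b + 2) (e1 := .reg 20)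
    (e2 := .reg 21) (v1 := x) (v2 := v) (v := i0 + 1) (by omega) cv (by simp) (by simp)
    (by simp [hs4]) (by simp [hs4]) (by simp [hs4, hf, enc_pos hb, posn, hin, hi0]) (by simp) (by simp)
  have t6 := Tr.asg hm (s := s4.setR 23 (i0 + 1)) (x := 23) (k := 6)
    (e := .reg 23 - 1) (v := i0) (by omega) (by simp; omega) (by simp) (by simp)
  have t7 := Tr.read hm (s := (s4.setR 23 (i0 + 1)).setR 23 i0) (x := 24) (t := 3 * b + 1)
    (e1 := .reg 20) (e2 := .reg 22) (v1 := x) (v2 := k) (v := y) (by omega) ck (by simp) (by simp)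
    (by simp [hs4]) (by simp [hs4]) (by simp only [hs4, hf, VS.setR_f, enc_elt hb, hy]) (by simp)
    (by simp)
  set s7 := ((s4.setR 23 (i0 + 1)).setR 23 i0).setR 24 y with hs7
  have hf7 : s7.f = enc A lab := hf
  have w1 := Tr.write hm (s := s7) (t := 3 * b + 1) (e1 := .reg 20) (e2 := .reg 23) (e3 := .reg 24)
    (v1 := x) (v2 := i0) (v := y) (z := z) ci rfl (by simp) (by simp) (by simp) (by simp [hs7, hs4])
    (by simp [hs7]) (by simp [hs7]) hz (by omega) (by simp) (by simp) (by simp)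
  have hz1 := hz.update (3 * b + 1, x, i0) y
  set s8 := s7.setF (3 * b + 1, x, i0) y with hs8
  have r8 : s8.reg = s7.reg := rfl
  have w2 := Tr.write hm (s := s8) (t := 3 * b + 2) (e1 := .reg 20) (e2 := .reg 24)
    (e3 := .reg 23 + 1)
    (v1 := x) (v2 := y) (v := i0 + 1) (z := z + 1) cy rfl (by simp) (by simp)
    (by simp [r8, hs7]; omega) (by simp [r8, hs7, hs4])
    (by simp [r8, hs7]) (by simp [r8, hs7]) hz1 (by omega) (by simp) (by simp) (by simp)
  have hz2 := hz1.update (3 * b + 2, x, y) (i0 + 1)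
  set s9 := s8.setF (3 * b + 2, x, y) (i0 + 1) with hs9
  have r9 : s9.reg = s7.reg := rfl
  have w3 := Tr.write hm (s := s9) (t := 3 * b + 1) (e1 := .reg 20) (e2 := .reg 22) (e3 := 0)
    (v1 := x) (v2 := k) (v := 0) (z := z + 1 + 1) ck rfl (by simp) (by simp) (by simp; omega)
    (by simp [r9, hs7, hs4])
    (by simp [r9, hs7, hs4]) (by simp) hz2 (by omega) (by simp) (by simp) (by simp)
  have hz3 := hz2.update (3 * b + 1, x, k) 0
  set s10 := s9.setF (3 * b + 1, x, k) 0 with hs10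
  have r10 : s10.reg = s7.reg := rfl
  have w4 := Tr.write hm (s := s10) (t := 3 * b + 2) (e1 := .reg 20) (e2 := .reg 21) (e3 := 0)
    (v1 := x) (v2 := v) (v := 0) (z := z + 1 + 1 + 1) cv rfl (by simp) (by simp) (by simp; omega)
    (by simp [r10, hs7, hs4])
    (by simp [r10, hs7, hs4]) (by simp) hz3 (by omega) (by simp) (by simp) (by simp)
  have hz4 := hz3.update (3 * b + 2, x, v) 0
  set s11 := s10.setF (3 * b + 2, x, v) 0 with hs11
  have r11 : s11.reg = s7.reg := rfl
  have w5 := Tr.write hm (s := s11) (t := 3 * b) (e1 := .reg 20) (e2 := 0) (e3 := .reg 22)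
    (v1 := x) (v2 := 0) (v := k) (z := z + 1 + 1 + 1 + 1) c0 rfl (by simp) (by simp; omega)
    (by simp) (by simp [r11, hs7, hs4])
    (by simp [r11, hs7, hs4]) (by simp [r11, hs7, hs4]) hz4 (by omega) (by simp) (by simp) (by simp)
  refine ⟨s7.reg, ?_, fun r hr => ?_⟩
  · have := t1.seq (t2.seq (t3.seq (t4.seq (t5.seq (t6.seq (t7.seq (w1.seq (w2.seq (w3.seq
      (w4.seq w5))))))))))
    refine Tr.mono ?_ (show 62 + (62 + (100 * m.B (3 * b) + (6 + (100 * m.B (3 * b + 2) + (6 +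
      (100 * m.B (3 * b + 1) + (400 * m.Bm + (400 * m.Bm + (400 * m.Bm + (400 * m.Bm +
      400 * m.Bm)))))))))) ≤ _ by omega)
    rw [← enc_rem (k := k) (i0 := i0) (y := y) hb hnd hin rfl rfl rfl, ← hf7]
    exact this
  · simp [hs7, hs4, show r ≠ 20 by omega, show r ≠ 21 by omega, show r ≠ 22 by omega,
      show r ≠ 23 by omega, show r ≠ 24 by omega]

end SetOps


/-! ### The procedures and their models

The tracking instances are distributed: for each edge `av` both endpoints hold an alarm, which is a
value of the counter of the endpoint. If `r` updates are missing for maturity, one of the two counters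
must grow by at least `r / 2` before that, so the alarms are set `⌈r / 2⌉` updates ahead. When one of
them goes off, the edge is relabelled if it is mature, and the alarms are set again. Thus an instance
with threshold `τ` causes `O(log τ)` alarms, and an update looks only at the alarms that go off.

In the programs, the registers `60` and `61` hold the edge under consideration, `62` the vertex whose
alarms are processed, and `90`, `91`, `92` the counters for the sample size. -/

/-- The constants of the problem: the factors `θ`, and the numbers that determine the sample size. -/
structure Par where
  θ : Fin 2 → ℝ
  K0 : ℕ
  D : ℕ

/-- The number of samples of the `i`-th invocation. The bit length of `i` replaces `log i`, which the
machine cannot compute. -/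
def Par.L (P : Par) (i : ℕ) : ℕ := P.K0 * (Nat.size i + P.D)

/-- The threshold of a tracking instance, in terms of the maximal degree. -/
noncomputable def Par.thr (P : Par) (d : ℕ) : ℕ := ⌊P.θ 1 * (d : ℝ)⌋₊ + 1

/-- Change a symmetric function. -/
def upd2 (f : ℕ → ℕ → ℕ) (u v x : ℕ) : ℕ → ℕ → ℕ := upd (upd f u v x) v u x

/-- Set the alarms of the edge `av`: they are half of the missing number of updates away. -/
def Aux.place (A : Aux) (a v : ℕ) : Aux :=
  let r := A.T a v - A.c a - A.c v
  let p := A.c a + (r + 1) / 2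
  let q := A.c v + (r + 1) / 2
  Aux.add (Aux.add { A with al := upd (upd A.al a v p) v a q, rr := upd2 A.rr a v r }
    1 (Nat.pair a p) v) 1 (Nat.pair v q) a

/-- Remove the alarms of the edge `av`. -/
def Aux.unplace (A : Aux) (a v : ℕ) : Aux :=
  Aux.rem (Aux.rem A 1 (Nat.pair a (A.al a v)) v) 1 (Nat.pair v (A.al v a)) a

/-- The tracking instance that is started when `av` is labelled. -/
noncomputable def Aux.label (P : Par) (A : Aux) (a v : ℕ) : Aux :=
  { A with
    T := upd2 A.T a v (P.thr (max (A.E 0 a).length (A.E 0 v).length) + A.c a + A.c v)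
    calls := A.calls ++ [(a, v, A.E 0)] }

open scoped Classical in
/-- Process an alarm of the edge `av`. -/
noncomputable def Aux.eval (P : Par) (A : Aux) (a v : ℕ) : Aux :=
  let A1 := A.unplace a v
  let A2 := if A.T a v = A.c a + A.c v then A1.label P a v else A1
  Aux.place { A2 with ne := A2.ne + 1 } a v

/-- The first vertex in the list of alarms of `a` that go off now. -/
def Aux.head (A : Aux) (a : ℕ) : ℕ := (A.E 1 (Nat.pair a (A.c a))).getD 0 0

/-- The number of alarms of `a` that go off now. -/
def Aux.due (A : Aux) (a : ℕ) : ℕ := (A.E 1 (Nat.pair a (A.c a))).length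

/-- Process `k` alarms of `a`. -/
noncomputable def Aux.scanN (P : Par) (a : ℕ) : ℕ → Aux → Aux
  | 0, A => A
  | k + 1, A => Aux.scanN P a k (A.eval P a (A.head a))

/-- The state of the implementation, apart from registers: the data, the labels, the number of
random draws, and the output. -/
structure Dat where
  A : Aux
  lab : ℕ → ℕ → ℕ
  draws : ℕ
  out : List (ℕ × ℕ)

/-- The vertex that is picked for the random number `x < |N[a]| + |N[v]|`, given the lists of
neighbours. -/
def pick (a v : ℕ) (Ea Ev : List ℕ) (x : ℕ) : ℕ :=
  if x < Ea.length then Ea.getD x 0 else if x = Ea.length then a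
  else if x < Ea.length + 1 + Ev.length then Ev.getD (x - Ea.length - 1) 0 else v

/-- Whether `y` lies in both closed neighbourhoods. -/
def hit (a v : ℕ) (Ea Ev : List ℕ) (y : ℕ) : ℕ :=
  if (y = a ∨ y ∈ Ea) ∧ (y = v ∨ y ∈ Ev) then 1 else 0

/-- The number of hits among the first `k` samples, if `p` draws have been made before. -/
def hits (ω : Tape) (p : ℕ) (a v : ℕ) (Ea Ev : List ℕ) (k : ℕ) : ℕ :=
  ∑ j ∈ Finset.range k,
    hit a v Ea Ev (pick a v Ea Ev (ω (p + j, Ea.length + Ev.length + 1) : ℕ))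

/-- The new label of the edge `av`: with `h` hits among `L` samples, the estimate is
`h / (2 * L - h)`. -/
noncomputable def Dat.bit (P : Par) (ω : Tape) (d : Dat) (a v : ℕ) : ℕ :=
  let L := P.L (d.A.calls.length + 1)
  let h := hits ω d.draws a v (d.A.E 0 a) (d.A.E 0 v) L
  if h < ⌈P.θ 0 * ((2 * L - h : ℕ) : ℝ)⌉₊ then 0 else 1

/-- Label the edge `av`. -/
noncomputable def Dat.label (P : Par) (ω : Tape) (d : Dat) (a v : ℕ) : Dat where
  A := d.A.label P a v
  lab := upd2 d.lab a v (d.bit P ω a v)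
  draws := d.draws + P.L (d.A.calls.length + 1)
  out := if d.bit P ω a v = d.lab a v then d.out else d.out ++ [(a, v)]

open scoped Classical in
/-- Process an alarm of the edge `av`. -/
noncomputable def Dat.eval (P : Par) (ω : Tape) (d : Dat) (a v : ℕ) : Dat :=
  let d1 := { d with A := d.A.unplace a v }
  let d2 := if d.A.T a v = d.A.c a + d.A.c v then d1.label P ω a v else d1
  { d2 with A := Aux.place { d2.A with ne := d2.A.ne + 1 } a v }

/-- Process `k` alarms of `a`. -/
noncomputable def Dat.scanN (P : Par) (ω : Tape) (a : ℕ) : ℕ → Dat → Dat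
  | 0, d => d
  | k + 1, d => Dat.scanN P ω a k (d.eval P ω a (d.A.head a))

/-- Process all alarms of `a` that go off now. -/
noncomputable def Dat.scan (P : Par) (ω : Tape) (d : Dat) (a : ℕ) : Dat :=
  d.scanN P ω a (d.A.due a)

/-- Insert the edge `uw` into the lists. -/
def Aux.link (A : Aux) (u w : ℕ) : Aux := (A.add 0 u w).add 0 w u

/-- Remove the edge `uw` from the graph and from the data. -/
def Aux.cut (A : Aux) (u w : ℕ) : Aux :=
  let A1 := A.unplace u w
  let A2 := { A1 with T := upd2 A1.T u w 0, al := upd2 A1.al u w 0 }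
  (A2.rem 0 u w).rem 0 w u

/-- Count an update at `u`. -/
def Aux.tick (A : Aux) (u : ℕ) : Aux := { A with c := Function.update A.c u (A.c u + 1) }

/-- The part of an update before the alarms are processed. -/
noncomputable def Aux.arrive (P : Par) (A : Aux) (ins : Bool) (u w : ℕ) : Aux :=
  if ins then ((((A.link u w).tick u).tick w).label P u w).place u w
  else ((A.cut u w).tick u).tick w

/-- An update. -/
noncomputable def Aux.update (P : Par) (A : Aux) (ins : Bool) (u w : ℕ) : Aux :=
  let A1 := A.arrive P ins u w
  let A2 := A1.scanN P u (A1.due u)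
  A2.scanN P w (A2.due w)

/-- Remove the edge `uw`, and report it if it was similar. -/
def Dat.cut (d : Dat) (u w : ℕ) : Dat where
  A := d.A.cut u w
  lab := upd2 d.lab u w 0
  draws := d.draws
  out := if d.lab u w = 0 then d.out else d.out ++ [(u, w)]

/-- The part of an update before the alarms are processed. -/
noncomputable def Dat.arrive (P : Par) (ω : Tape) (d : Dat) (ins : Bool) (u w : ℕ) : Dat :=
  if ins then
    let d1 := { d with A := ((d.A.link u w).tick u).tick w }
    let d2 := d1.label P ω u w
    { d2 with A := d2.A.place u w }
  else
    let d1 := d.cut u w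
    { d1 with A := (d1.A.tick u).tick w }

/-- An update. -/
noncomputable def Dat.update (P : Par) (ω : Tape) (d : Dat) (ins : Bool) (u w : ℕ) : Dat :=
  ((Dat.arrive P ω { d with out := [] } ins u w).scan P ω u).scan P ω w

section Programs

/-- Set the alarms of the edge. -/
def placeP : Prog :=
  rd 40 7 (.reg 60) (.reg 61) ;; rd 41 6 (.reg 60) 0 ;; rd 42 6 (.reg 61) 0 ;;
  set 43 ((.reg 40 - .reg 41 - .reg 42 + 1) / 2) ;; set 44 (.reg 41 + .reg 43) ;;
  set 45 (.reg 42 + .reg 43) ;; wr 8 (.reg 60) (.reg 61) (.reg 44) ;;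
  wr 8 (.reg 61) (.reg 60) (.reg 45) ;; setAdd 1 (.pair (.reg 60) (.reg 44)) (.reg 61) ;;
  setAdd 1 (.pair (.reg 61) (.reg 45)) (.reg 60)

/-- Remove the alarms of the edge. -/
def unplaceP : Prog :=
  rd 40 8 (.reg 60) (.reg 61) ;; rd 41 8 (.reg 61) (.reg 60) ;;
  setRem 1 (.pair (.reg 60) (.reg 40)) (.reg 61) ;; setRem 1 (.pair (.reg 61) (.reg 41)) (.reg 60)

/-- Draw one sample and count it if it is a hit. -/
def sampleP : Prog :=
  .draw 46 45 ;;
  iff (.bin .lt (.reg 46) (.reg 40)) (rd 47 1 (.reg 60) (.reg 46))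
    (iff (.bin .eq (.reg 46) (.reg 40)) (set 47 (.reg 60))
      (iff (.bin .lt (.reg 46) (.reg 40 + 1 + .reg 41))
        (rd 47 1 (.reg 61) (.reg 46 - .reg 40 - 1)) (set 47 (.reg 61)))) ;;
  rd 48 2 (.reg 60) (.reg 47) ;; rd 49 2 (.reg 61) (.reg 47) ;;
  set 44 (.reg 44 + .bin .lt 0 (.bin .eq (.reg 47) (.reg 60) + .reg 48) *
    .bin .lt 0 (.bin .eq (.reg 47) (.reg 61) + .reg 49)) ;;
  set 43 (.reg 43 - 1)

/-- Register `90` counts the invocations; `91` is its bit length, and `92` the largest number of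
this bit length. -/
def countP : Prog :=
  set 90 (.reg 90 + 1) ;;
  iff (.bin .lt (.reg 92) (.reg 90)) (set 92 (2 * .reg 92 + 1) ;; set 91 (.reg 91 + 1)) .skip

/-- Sample and decide the label. -/
def decideP (P : Par) : Prog :=
  rd 40 0 (.reg 60) 0 ;; rd 41 0 (.reg 61) 0 ;;
  set 42 (.const P.K0 * (.reg 91 + .const P.D)) ;; set 43 (.reg 42) ;; set 44 0 ;;
  set 45 (.reg 40 + .reg 41 + 2) ;; whl (.reg 43) sampleP ;;
  set 46 (2 * .reg 42 - .reg 44) ;; .scaleCeil 0 47 46 ;; set 48 (1 - .bin .lt (.reg 44) (.reg 47))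

/-- Store the label and start the tracking instance. -/
def trackP : Prog :=
  rd 49 9 (.reg 60) (.reg 61) ;; iff (.bin .eq (.reg 48) (.reg 49)) .skip (.emit 60 61) ;;
  wr 9 (.reg 60) (.reg 61) (.reg 48) ;; wr 9 (.reg 61) (.reg 60) (.reg 48) ;;
  set 46 (.reg 40 + (.reg 41 - .reg 40)) ;; .scaleFloor 1 47 46 ;;
  rd 50 6 (.reg 60) 0 ;; rd 51 6 (.reg 61) 0 ;; set 47 (.reg 47 + 1 + .reg 50 + .reg 51) ;;
  wr 7 (.reg 60) (.reg 61) (.reg 47) ;; wr 7 (.reg 61) (.reg 60) (.reg 47)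

/-- Label the edge. -/
def labelP (P : Par) : Prog := countP ;; decideP P ;; trackP

/-- Process an alarm of the edge. -/
def evalP (P : Par) : Prog :=
  rd 40 7 (.reg 60) (.reg 61) ;; rd 41 6 (.reg 60) 0 ;; rd 42 6 (.reg 61) 0 ;;
  set 55 (.bin .eq (.reg 40) (.reg 41 + .reg 42)) ;; unplaceP ;;
  iff (.reg 55) (labelP P) .skip ;; placeP

/-- Process all alarms of a vertex that go off now. -/
def scanP (P : Par) : Prog :=
  rd 63 6 (.reg 62) 0 ;; set 63 (.pair (.reg 62) (.reg 63)) ;; rd 64 3 (.reg 63) 0 ;;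
  whl (.reg 64) (rd 61 4 (.reg 63) 0 ;; set 60 (.reg 62) ;; evalP P ;; rd 64 3 (.reg 63) 0)

/-- Remove the edge. -/
def cutP : Prog :=
  unplaceP ;; rd 40 9 (.reg 60) (.reg 61) ;; iff (.reg 40) (.emit 60 61) .skip ;;
  wr 9 (.reg 60) (.reg 61) 0 ;; wr 9 (.reg 61) (.reg 60) 0 ;;
  wr 7 (.reg 60) (.reg 61) 0 ;; wr 7 (.reg 61) (.reg 60) 0 ;;
  wr 8 (.reg 60) (.reg 61) 0 ;; wr 8 (.reg 61) (.reg 60) 0 ;;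
  setRem 0 (.reg 60) (.reg 61) ;; setRem 0 (.reg 61) (.reg 60)

/-- Count an update at the vertex in register `r`. -/
def tickP (r : ℕ) : Prog := rd 40 6 (.reg r) 0 ;; wr 6 (.reg r) 0 (.reg 40 + 1)

/-- The part of an update before the alarms are processed; register `70` tells the kind of update. -/
def arriveP (P : Par) : Prog :=
  iff (.reg 70)
    (setAdd 0 (.reg 60) (.reg 61) ;; setAdd 0 (.reg 61) (.reg 60) ;; tickP 60 ;; tickP 61 ;;
      labelP P ;; placeP)
    (cutP ;; tickP 60 ;; tickP 61)

/-- The program for the updates. -/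
def updateP (P : Par) : Prog :=
  set 70 (.reg 0) ;; set 60 (.reg 1) ;; set 61 (.reg 2) ;; set 71 (.reg 1) ;; set 72 (.reg 2) ;;
  arriveP P ;; set 62 (.reg 71) ;; scanP P ;; set 62 (.reg 72) ;; scanP P

/-- The program for looking up a label. -/
def lookupP : Prog :=
  set 60 (.reg 1) ;; set 61 (.reg 2) ;; rd 40 9 (.reg 60) (.reg 61) ;; set 0 (.reg 40)

end Programs

/-! ### Invariants -/

/-- The invariants of the data after `t` updates on `n` vertices; `Q u v` says that the alarms of the
edge `uv` are set. By `al_sum` and `c_al`, an edge whose alarms lie strictly ahead of the counters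
is not mature; by `rr`, when an alarm goes off then the number of missing updates is at most half of
what it was when the alarms were set. -/
structure Inv (n t : ℕ) (Q : ℕ → ℕ → Prop) (A : Aux) : Prop where
  lt : ∀ {u v}, v ∈ A.E 0 u → u < n ∧ v < n ∧ u ≠ v
  sym : ∀ {u v}, v ∈ A.E 0 u → u ∈ A.E 0 v
  nd : ∀ b x, (A.E b x).Nodup
  Qadj : ∀ {u v}, Q u v → v ∈ A.E 0 u
  Qsym : ∀ {u v}, Q u v → Q v u
  bkt : ∀ u a v, v ∈ A.E 1 (Nat.pair u a) ↔ Q u v ∧ A.al u v = a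
  c_le : ∀ x, A.c x ≤ t
  c_zero : ∀ x, n ≤ x → A.c x = 0
  Tsym : ∀ u v, A.T u v = A.T v u
  T_le : ∀ u v, A.T u v ≤ 2 * t + n
  al_le : ∀ u v, A.al u v ≤ 3 * t + n + 1
  al_sum : ∀ {u v}, Q u v → A.al u v + A.al v u ≤ A.T u v + 1
  c_al : ∀ {u v}, Q u v → A.c u ≤ A.al u v
  rr : ∀ {u v}, Q u v → A.T u v + (A.rr u v + 1) / 2 ≤ A.al u v + A.c v + A.rr u v
  rr_pos : ∀ {u v}, Q u v → 1 ≤ A.rr u v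
  rr_sym : ∀ u v, A.rr u v = A.rr v u
  off : ∀ {u v}, v ∉ A.E 0 u → A.T u v = 0 ∧ A.al u v = 0

/-- Only alarms at the vertices in `S` go off now, for edges to vertices outside of `S`. -/
def Calm (Q : ℕ → ℕ → Prop) (S : Set ℕ) (A : Aux) : Prop :=
  ∀ u v, Q u v → A.al u v = A.c u → u ∈ S ∧ v ∉ S

/-- All edges except `av`. -/
def except (Q : ℕ → ℕ → Prop) (a v : ℕ) : ℕ → ℕ → Prop :=
  fun x y => Q x y ∧ ¬ (x = a ∧ y = v) ∧ ¬ (x = v ∧ y = a)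

/-- All edges of `Q` and `av`. -/
def also (Q : ℕ → ℕ → Prop) (a v : ℕ) : ℕ → ℕ → Prop :=
  fun x y => Q x y ∨ (x = a ∧ y = v) ∨ (x = v ∧ y = a)

@[simp] lemma upd_apply {α : Type} (f : ℕ → ℕ → α) (u v : ℕ) (x : α) (a b : ℕ) :
    upd f u v x a b = if a = u ∧ b = v then x else f a b := rfl

@[simp] lemma upd2_apply (f : ℕ → ℕ → ℕ) (u v x a b : ℕ) :
    upd2 f u v x a b = if (a = v ∧ b = u) ∨ (a = u ∧ b = v) then x else f a b := by
  simp only [upd2, upd_apply]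
  split_ifs <;> tauto

lemma length_le_of_lt {l : List ℕ} {n : ℕ} (hn : l.Nodup) (h : ∀ v ∈ l, v < n) : l.length ≤ n := by
  have h1 := List.toFinset_card_of_nodup hn
  have h2 : l.toFinset ⊆ Finset.range n := fun v hv => by
    simpa using h v (by simpa using hv)
  have := Finset.card_le_card h2
  simp at this
  omega

namespace Inv
variable {n t : ℕ} {Q : ℕ → ℕ → Prop} {A : Aux} (h : Inv n t Q A)
include h

lemma deg_lt {a : ℕ} (ha : a < n) : (A.E 0 a).length < n := by
  have h1 : (a :: A.E 0 a).Nodup := List.nodup_cons.2 ⟨fun h' => (h.lt h').2.2 rfl, h.nd 0 a⟩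
  have := length_le_of_lt (n := n) h1 (fun v hv => by
    rcases List.mem_cons.1 hv with rfl | hv
    exacts [ha, (h.lt hv).2.1])
  simp at this
  omega

lemma mem_bkt {k v : ℕ} (hv : v ∈ A.E 1 k) : v < n := by
  rw [← Nat.pair_unpair k, h.bkt] at hv
  exact (h.lt (h.Qadj hv.1)).2.1

lemma bkt_le (k : ℕ) : (A.E 1 k).length ≤ n := length_le_of_lt (h.nd 1 k) fun _ => h.mem_bkt

lemma unplace {a v : ℕ} (hav : Q a v) : Inv n t (except Q a v) (A.unplace a v) ∧
    v ∈ A.E 1 (Nat.pair a (A.al a v)) ∧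
    a ∈ (A.rem 1 (Nat.pair a (A.al a v)) v).E 1 (Nat.pair v (A.al v a)) := by
  have hne : a ≠ v := (h.lt (h.Qadj hav)).2.2
  have m1 : v ∈ A.E 1 (Nat.pair a (A.al a v)) := (h.bkt _ _ _).2 ⟨hav, rfl⟩
  have m2 : a ∈ A.E 1 (Nat.pair v (A.al v a)) := (h.bkt _ _ _).2 ⟨h.Qsym hav, rfl⟩
  have E0 : ∀ x, (A.unplace a v).E 0 x = A.E 0 x := fun x => by simp [Aux.unplace, Aux.rem]
  have hp : Nat.pair v (A.al v a) ≠ Nat.pair a (A.al a v) := fun e =>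
    hne (Nat.pair_eq_pair.1 e).1.symm
  have m3 : a ∈ (A.rem 1 (Nat.pair a (A.al a v)) v).E 1 (Nat.pair v (A.al v a)) := by
    simpa [Aux.rem, hp] using m2
  have E1 : ∀ k, (A.unplace a v).E 1 k = if k = Nat.pair v (A.al v a) then
      swapRem (A.E 1 k) a else if k = Nat.pair a (A.al a v) then swapRem (A.E 1 k) v
      else A.E 1 k := fun k => by
    simp only [Aux.unplace, Aux.rem, upd_apply, true_and, hp, if_false]
    split_ifs with h1 h2 <;> simp_all
  refine ⟨⟨?_, ?_, fun b x => ?_, ?_, ?_, fun u c y => ?_, h.c_le, h.c_zero, h.Tsym, h.T_le, h.al_le,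
    fun q => h.al_sum q.1, fun q => h.c_al q.1, fun q => h.rr q.1, fun q => h.rr_pos q.1, h.rr_sym,
    ?_⟩, m1, m3⟩
  · simp only [E0]; exact h.lt
  · simp only [E0]; exact h.sym
  · simp only [Aux.unplace, Aux.rem, upd_apply]
    have := h.nd 1
    split_ifs
    · exact absurd ‹_› (by tauto)
    · exact nodup_swapRem (h.nd _ _) m2
    · exact nodup_swapRem (h.nd _ _) m1
    · exact h.nd _ _
  · simp only [E0]; exact fun q => h.Qadj q.1
  · exact fun q => ⟨h.Qsym q.1, fun e => q.2.2 ⟨e.2, e.1⟩, fun e => q.2.1 ⟨e.2, e.1⟩⟩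
  · show y ∈ (A.unplace a v).E 1 _ ↔ _ ∧ A.al u y = c
    rw [E1]
    unfold except
    split_ifs with h1 h2
    · rw [h1, mem_swapRem_iff (h.nd _ _) m2, ← h1, h.bkt]
      obtain ⟨rfl, rfl⟩ := Nat.pair_eq_pair.1 h1
      have : u ≠ a := hne.symm
      tauto
    · rw [h2, mem_swapRem_iff (h.nd _ _) m1, ← h2, h.bkt]
      obtain ⟨rfl, rfl⟩ := Nat.pair_eq_pair.1 h2
      tauto
    · rw [h.bkt]
      constructor
      · rintro ⟨q, rfl⟩
        refine ⟨⟨q, ?_, ?_⟩, rfl⟩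
        · rintro ⟨rfl, rfl⟩; exact h2 rfl
        · rintro ⟨rfl, rfl⟩; exact h1 rfl
      · tauto
  · simp only [E0]; exact h.off

lemma place {a v : ℕ} (hadj : v ∈ A.E 0 a) (hav : ¬ Q a v) (hT : A.c a + A.c v < A.T a v)
    {al' rr' : ℕ → ℕ → ℕ} :
    Inv n t (also Q a v) (A.place a v) ∧
    (∀ p, v ∉ A.E 1 (Nat.pair a p)) ∧
    (∀ p q, a ∉ (Aux.add { A with al := al', rr := rr' } 1 (Nat.pair a p) v).E 1 (Nat.pair v q)) ∧
    ∀ x y, (A.place a v).al x y = (A.place a v).c x → also Q a v x y →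
      Q x y ∧ A.al x y = A.c x := by
  obtain ⟨han, hvn, hne⟩ := h.lt hadj
  set r := A.T a v - A.c a - A.c v with hr
  set p := A.c a + (r + 1) / 2 with hp
  set q := A.c v + (r + 1) / 2 with hq
  have n1 : ∀ p, v ∉ A.E 1 (Nat.pair a p) := fun p e => hav ((h.bkt _ _ _).1 e).1
  have n2 : ∀ p, a ∉ A.E 1 (Nat.pair v p) := fun p e => hav (h.Qsym ((h.bkt _ _ _).1 e).1)
  have hpp : ∀ p q, Nat.pair v q ≠ Nat.pair a p := fun p q e => hne (Nat.pair_eq_pair.1 e).1.symm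
  have n3 : ∀ p q, a ∉ (Aux.add { A with al := al', rr := rr' } 1 (Nat.pair a p) v).E 1
      (Nat.pair v q) := fun p q => by
    simpa [Aux.add, hpp] using n2 q
  have Tle := h.T_le a v
  have ca := h.c_le a
  have cv := h.c_le v
  have Ts := h.Tsym a v
  have E0 : ∀ x, (A.place a v).E 0 x = A.E 0 x := fun x => by simp [Aux.place, Aux.add]
  have eal : ∀ x y, (A.place a v).al x y = if x = v ∧ y = a then q else if x = a ∧ y = v then p
    else A.al x y := fun x y => by simp [Aux.place, Aux.add, ← hr, ← hp, ← hq]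
  have err : ∀ x y, (A.place a v).rr x y = if (x = v ∧ y = a) ∨ (x = a ∧ y = v) then r
    else A.rr x y := fun x y => by simp [Aux.place, Aux.add, ← hr]
  have E1 : ∀ k, (A.place a v).E 1 k = if k = Nat.pair v q then A.E 1 k ++ [a] else
      if k = Nat.pair a p then A.E 1 k ++ [v] else A.E 1 k := fun k => by
    have e : (A.place a v).E = upd (upd A.E 1 (Nat.pair a p) (A.E 1 (Nat.pair a p) ++ [v])) 1
      (Nat.pair v q) ((upd A.E 1 (Nat.pair a p) (A.E 1 (Nat.pair a p) ++ [v])) 1 (Nat.pair v q)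
        ++ [a]) := rfl
    simp only [e, upd_apply, true_and, if_neg (hpp p q)]
    split_ifs with h1 h2 <;> simp_all
  have eE : ∀ b, b ≠ 1 → ∀ x, (A.place a v).E b x = A.E b x := fun b hb x => by
    simp [Aux.place, Aux.add, hb]
  have ec : (A.place a v).c = A.c := rfl
  have eT : (A.place a v).T = A.T := rfl
  refine ⟨⟨?_, ?_, fun b x => ?_, ?_, ?_, fun u c y => ?_, h.c_le, h.c_zero, h.Tsym, h.T_le,
    fun x y => ?_, ?_, ?_, ?_, ?_, fun x y => ?_, ?_⟩, n1, n3, ?_⟩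
  · simp only [E0]; exact h.lt
  · simp only [E0]; exact h.sym
  · by_cases hb : b = 1
    · subst hb
      rw [E1]
      have := h.nd 1 x
      split_ifs with h1 h2
      · rw [h1] at this ⊢
        exact List.nodup_append.2 ⟨this, by simp, by rintro y hy z hz rfl; simp at hz; subst hz; exact n2 _ hy⟩
      · rw [h2] at this ⊢
        exact List.nodup_append.2 ⟨this, by simp, by rintro y hy z hz rfl; simp at hz; subst hz; exact n1 _ hy⟩
      · exact this
    · rw [eE b hb]; exact h.nd b x
  · simp only [E0]
    rintro x y (e | ⟨rfl, rfl⟩ | ⟨rfl, rfl⟩)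
    exacts [h.Qadj e, hadj, h.sym hadj]
  · rintro x y (e | e | e)
    exacts [.inl (h.Qsym e), .inr (.inr ⟨e.2, e.1⟩), .inr (.inl ⟨e.2, e.1⟩)]
  · rw [E1, eal]
    unfold also
    by_cases h1 : u = v
    · subst h1
      have : ¬ u = a := hne.symm
      by_cases h2 : y = a
      · subst h2
        simp only [Nat.pair_eq_pair, true_and, this, false_and, if_false, and_self, if_true,
          or_true]
        split_ifs with h3
        · simp [h3]
        · simp only [n2, false_iff]; exact fun e => h3 e.symm
      · simp only [Nat.pair_eq_pair, true_and, this, false_and, if_false, h2, and_false, or_false]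
        split_ifs with h3
        · simp [h.bkt, h2]
        · exact h.bkt _ _ _
    · by_cases h0 : u = a
      · subst h0
        by_cases h2 : y = v
        · subst h2
          simp only [Nat.pair_eq_pair, true_and, h1, false_and, if_false, and_self, if_true,
            or_true, true_or]
          split_ifs with h3
          · simp [h3]
          · simp only [n1, false_iff]; exact fun e => h3 e.symm
        · simp only [Nat.pair_eq_pair, true_and, h1, false_and, if_false, h2, and_false, or_false]
          split_ifs with h3
          · simp [h.bkt, h2]
          · exact h.bkt _ _ _
      · simp only [Nat.pair_eq_pair, h1, h0, false_and, if_false, or_false]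
        exact h.bkt _ _ _
  · rw [eal]
    have := h.al_le x y
    split_ifs <;> omega
  · intro x y e
    rw [eal, eal, eT]
    rcases e with e | ⟨rfl, rfl⟩ | ⟨rfl, rfl⟩
    · have h1 : ¬ (x = v ∧ y = a) := by rintro ⟨rfl, rfl⟩; exact hav (h.Qsym e)
      have h2 : ¬ (x = a ∧ y = v) := by rintro ⟨rfl, rfl⟩; exact hav e
      rw [if_neg h1, if_neg h2, if_neg (by tauto), if_neg (by tauto)]
      exact h.al_sum e
    · simp [hne.symm, hne]; omega
    · simp [hne.symm, hne]; omega
  · intro x y e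
    rw [eal, ec]
    split_ifs with h1 h2
    · rw [h1.1]; omega
    · rw [h2.1]; omega
    · rcases e with e | e | e
      exacts [h.c_al e, absurd e h2, absurd e h1]
  · intro x y e
    rw [eal, ec, eT, err]
    by_cases h1 : x = v ∧ y = a
    · rw [if_pos (.inl h1), if_pos h1, h1.1, h1.2]; omega
    · by_cases h2 : x = a ∧ y = v
      · rw [if_pos (.inr h2), if_neg h1, if_pos h2, h2.1, h2.2]; omega
      · rw [if_neg (by tauto), if_neg h1, if_neg h2]
        rcases e with e | e | e
        exacts [h.rr e, absurd e h2, absurd e h1]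
  · intro x y e
    rw [err]
    split_ifs with h1
    · omega
    · rcases e with e | e | e
      exacts [h.rr_pos e, by tauto, by tauto]
  · rw [err, err, h.rr_sym x y]
    congr 1
    simp only [eq_iff_iff]; tauto
  · intro x y e
    rw [E0] at e
    rw [eal, eT, if_neg, if_neg]
    · exact h.off e
    · rintro ⟨rfl, rfl⟩; exact e hadj
    · rintro ⟨rfl, rfl⟩; exact e (h.sym hadj)
  · intro x y e1 e2
    rw [eal, ec] at e1
    split_ifs at e1 with h1 h2
    · rw [h1.1] at e1; omega
    · rw [h2.1] at e1; omega
    · rcases e2 with e | e | e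
      exacts [⟨e, e1⟩, absurd e h2, absurd e h1]

lemma label {P : Par} {a v : ℕ} (hadj : v ∈ A.E 0 a) (hav : ¬ Q a v)
    (hP : P.thr (max (A.E 0 a).length (A.E 0 v).length) ≤ n) : Inv n t Q (A.label P a v) := by
  have ca := h.c_le a
  have cv := h.c_le v
  set X := P.thr (max (A.E 0 a).length (A.E 0 v).length) + A.c a + A.c v with hX
  have eT : ∀ x y, (A.label P a v).T x y = if (x = v ∧ y = a) ∨ (x = a ∧ y = v) then X
    else A.T x y := fun x y => by simp [Aux.label, ← hX]
  have nQ : ∀ {x y}, Q x y → ¬ ((x = v ∧ y = a) ∨ (x = a ∧ y = v)) := by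
    rintro x y q (⟨rfl, rfl⟩ | ⟨rfl, rfl⟩)
    exacts [hav (h.Qsym q), hav q]
  refine ⟨h.lt, h.sym, h.nd, h.Qadj, h.Qsym, h.bkt, h.c_le, h.c_zero, fun x y => ?_, fun x y => ?_,
    h.al_le, fun q => ?_, h.c_al, fun q => ?_, h.rr_pos, h.rr_sym, @fun x y e => ?_⟩
  · rw [eT, eT, h.Tsym x y]
    congr 1
    simp only [eq_iff_iff]; tauto
  · rw [eT]
    have := h.T_le x y
    split_ifs <;> omega
  · rw [eT, if_neg (nQ q)]; exact h.al_sum q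
  · rw [eT, if_neg (nQ q)]; exact h.rr q
  · rw [eT, if_neg]
    · exact h.off e
    · rintro (⟨rfl, rfl⟩ | ⟨rfl, rfl⟩)
      exacts [e (h.sym hadj), e hadj]

end Inv


/-- The edges. -/
def Aux.adj (A : Aux) (u v : ℕ) : Prop := v ∈ A.E 0 u

lemma except_not (Q : ℕ → ℕ → Prop) (a v : ℕ) : ¬ except Q a v a v := fun q => q.2.1 ⟨rfl, rfl⟩

lemma also_except {Q : ℕ → ℕ → Prop} {a v : ℕ} (h : Q a v) (h' : Q v a) :
    also (except Q a v) a v = Q := by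
  funext x y
  apply propext
  unfold also except
  constructor
  · rintro (q | ⟨rfl, rfl⟩ | ⟨rfl, rfl⟩)
    exacts [q.1, h, h']
  · intro q; tauto

@[simp] lemma Aux.unplace_E0 (A : Aux) (a v x : ℕ) : (A.unplace a v).E 0 x = A.E 0 x := by
  simp [Aux.unplace, Aux.rem]
@[simp] lemma Aux.unplace_c (A : Aux) (a v : ℕ) : (A.unplace a v).c = A.c := rfl
@[simp] lemma Aux.unplace_T (A : Aux) (a v : ℕ) : (A.unplace a v).T = A.T := rfl
@[simp] lemma Aux.unplace_al (A : Aux) (a v : ℕ) : (A.unplace a v).al = A.al := rfl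
@[simp] lemma Aux.unplace_rr (A : Aux) (a v : ℕ) : (A.unplace a v).rr = A.rr := rfl
@[simp] lemma Aux.unplace_calls (A : Aux) (a v : ℕ) : (A.unplace a v).calls = A.calls := rfl
@[simp] lemma Aux.unplace_ne (A : Aux) (a v : ℕ) : (A.unplace a v).ne = A.ne := rfl
@[simp] lemma Aux.place_E0 (A : Aux) (a v x : ℕ) : (A.place a v).E 0 x = A.E 0 x := by
  simp [Aux.place, Aux.add]
@[simp] lemma Aux.place_c (A : Aux) (a v : ℕ) : (A.place a v).c = A.c := rfl
@[simp] lemma Aux.place_T (A : Aux) (a v : ℕ) : (A.place a v).T = A.T := rfl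
@[simp] lemma Aux.place_calls (A : Aux) (a v : ℕ) : (A.place a v).calls = A.calls := rfl
@[simp] lemma Aux.place_ne (A : Aux) (a v : ℕ) : (A.place a v).ne = A.ne := rfl
lemma Aux.place_rr (A : Aux) (a v : ℕ) :
    (A.place a v).rr = upd2 A.rr a v (A.T a v - A.c a - A.c v) := rfl
lemma Aux.place_al (A : Aux) (a v x y : ℕ) : (A.place a v).al x y =
    if x = v ∧ y = a then A.c v + (A.T a v - A.c a - A.c v + 1) / 2 else
    if x = a ∧ y = v then A.c a + (A.T a v - A.c a - A.c v + 1) / 2 else A.al x y := rfl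
@[simp] lemma Aux.label_E (P : Par) (A : Aux) (a v : ℕ) : (A.label P a v).E = A.E := rfl
@[simp] lemma Aux.label_c (P : Par) (A : Aux) (a v : ℕ) : (A.label P a v).c = A.c := rfl
@[simp] lemma Aux.label_al (P : Par) (A : Aux) (a v : ℕ) : (A.label P a v).al = A.al := rfl
@[simp] lemma Aux.label_rr (P : Par) (A : Aux) (a v : ℕ) : (A.label P a v).rr = A.rr := rfl
@[simp] lemma Aux.label_ne (P : Par) (A : Aux) (a v : ℕ) : (A.label P a v).ne = A.ne := rfl
lemma Aux.label_T (P : Par) (A : Aux) (a v : ℕ) : (A.label P a v).T a v =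
    P.thr (max (A.E 0 a).length (A.E 0 v).length) + A.c a + A.c v := by
  simp [Aux.label]
lemma Par.thr_pos (P : Par) (d : ℕ) : 1 ≤ P.thr d := by unfold Par.thr; omega

@[simp] lemma Dat.label_A (P : Par) (ω : Tape) (d : Dat) (a v : ℕ) :
    (d.label P ω a v).A = d.A.label P a v := rfl

lemma Dat.eval_A (P : Par) (ω : Tape) (d : Dat) (a v : ℕ) :
    (d.eval P ω a v).A = d.A.eval P a v := by
  unfold Dat.eval Aux.eval
  by_cases h : d.A.T a v = d.A.c a + d.A.c v <;> simp [h]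

lemma Dat.scanN_A (P : Par) (ω : Tape) (a k : ℕ) (d : Dat) :
    (d.scanN P ω a k).A = d.A.scanN P a k := by
  induction k generalizing d with
  | zero => rfl
  | succ k ih => simp only [Dat.scanN, Aux.scanN, ih, Dat.eval_A]

lemma Dat.arrive_A (P : Par) (ω : Tape) (d : Dat) (ins : Bool) (u w : ℕ) :
    (d.arrive P ω ins u w).A = d.A.arrive P ins u w := by
  cases ins <;> rfl

lemma Dat.update_A (P : Par) (ω : Tape) (d : Dat) (ins : Bool) (u w : ℕ) :
    (d.update P ω ins u w).A = d.A.update P ins u w := by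
  simp only [Dat.update, Dat.scan, Dat.scanN_A, Dat.arrive_A, Aux.update]

/-! ### The potential -/

/-- The potential. With each alarm, the bit length of the number of missing updates decreases; both
directions of an edge contribute it, whence the factor `2` for the alarms. -/
def Aux.pot (n : ℕ) (A : Aux) : ℕ :=
  2 * A.ne + ∑ p ∈ Finset.range n ×ˢ Finset.range n, Nat.size (A.rr p.1 p.2)

lemma sum_upd {n a v : ℕ} (ha : a < n) (hv : v < n) (f : ℕ → ℕ → ℕ) (r : ℕ) :
    (∑ p ∈ Finset.range n ×ˢ Finset.range n, Nat.size (upd f a v r p.1 p.2)) + Nat.size (f a v) =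
    (∑ p ∈ Finset.range n ×ˢ Finset.range n, Nat.size (f p.1 p.2)) + Nat.size r := by
  have hm : (a, v) ∈ Finset.range n ×ˢ Finset.range n := by simp [ha, hv]
  rw [← Finset.add_sum_erase _ _ hm, ← Finset.add_sum_erase _ (fun p => Nat.size (f p.1 p.2)) hm]
  have : ∑ p ∈ (Finset.range n ×ˢ Finset.range n).erase (a, v), Nat.size (upd f a v r p.1 p.2) =
      ∑ p ∈ (Finset.range n ×ˢ Finset.range n).erase (a, v), Nat.size (f p.1 p.2) := by
    refine Finset.sum_congr rfl fun p hp => ?_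
    rw [upd_apply, if_neg]
    rintro ⟨h1, h2⟩
    exact (Finset.mem_erase.1 hp).1 (Prod.ext h1 h2)
  rw [this]
  simp
  omega

lemma sum_upd2 {n a v : ℕ} (ha : a < n) (hv : v < n) (hne : a ≠ v) {f : ℕ → ℕ → ℕ}
    (hf : f v a = f a v) (r : ℕ) :
    (∑ p ∈ Finset.range n ×ˢ Finset.range n, Nat.size (upd2 f a v r p.1 p.2)) +
      2 * Nat.size (f a v) =
    (∑ p ∈ Finset.range n ×ˢ Finset.range n, Nat.size (f p.1 p.2)) + 2 * Nat.size r := by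
  have h1 := sum_upd ha hv f r
  have h2 := sum_upd hv ha (upd f a v r) r
  have h3 : upd f a v r v a = f a v := by simp [hne.symm, hf]
  rw [h3] at h2
  unfold upd2
  omega

/-- Halving decreases the bit length. -/
lemma size_half {x y : ℕ} (hy : 1 ≤ y) (h : x + (y + 1) / 2 ≤ y) : Nat.size x + 1 ≤ Nat.size y := by
  rw [Nat.succ_le_iff, Nat.lt_size]
  rcases Nat.eq_zero_or_pos x with rfl | hx
  · simpa using hy
  · have h1 : 2 ^ (Nat.size x - 1) ≤ x := Nat.lt_size.1 (by have := Nat.size_pos.2 hx; omega)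
    have h2 : 0 < Nat.size x := Nat.size_pos.2 hx
    obtain ⟨s, hs⟩ : ∃ s, Nat.size x = s + 1 := ⟨Nat.size x - 1, by omega⟩
    rw [hs] at h1 ⊢
    rw [pow_succ]
    simp at h1
    omega

lemma Aux.pot_place {n t : ℕ} {Q : ℕ → ℕ → Prop} {A : Aux} (h : Inv n t Q A) {a v : ℕ}
    (ha : a < n) (hv : v < n) (hne : a ≠ v) :
    (A.place a v).pot n + 2 * Nat.size (A.rr a v) =
      A.pot n + 2 * Nat.size (A.T a v - A.c a - A.c v) := by
  have := sum_upd2 ha hv hne (h.rr_sym v a) (A.T a v - A.c a - A.c v)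
  simp only [Aux.pot, Aux.place_rr, Aux.place_ne]
  omega

lemma Aux.head_mem {A : Aux} {a k : ℕ} (hk : A.due a = k + 1) :
    A.head a ∈ A.E 1 (Nat.pair a (A.c a)) := by
  unfold Aux.head Aux.due at *
  rw [List.getD_eq_getElem _ _ (by omega)]
  exact List.getElem_mem _

lemma Aux.pot_link (A : Aux) (u w k : ℕ) : (A.link u w).pot k = A.pot k := by
  simp [Aux.pot, Aux.link, Aux.add]

namespace Inv
variable {n t : ℕ} {Q : ℕ → ℕ → Prop} {A : Aux} (h : Inv n t Q A) {S : Set ℕ} {P : Par}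
  (hP : ∀ d < n, P.thr d ≤ n)
include h

lemma ne_inc (k : ℕ) : Inv n t Q { A with ne := k } := { h with }

lemma deg_max_lt {a v : ℕ} (ha : a < n) (hv : v < n) :
    max (A.E 0 a).length (A.E 0 v).length < n := max_lt (h.deg_lt ha) (h.deg_lt hv)

/-- The missing number of updates is never negative. -/
lemma c_add_le (hC : Calm Q S A) {a v : ℕ} (ha : a ∈ S) (q : Q a v) (hal : A.al a v = A.c a) :
    A.c a + A.c v ≤ A.T a v := by
  have h1 := h.al_sum q
  have h2 := h.c_al (h.Qsym q)
  have h3 : A.al v a ≠ A.c v := fun e => (hC v a (h.Qsym q) e).2 ha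
  omega

include hP in
/-- The data just before the alarms of an edge are set again. -/
lemma eval_mid (hC : Calm Q S A) {a v : ℕ} (ha : a ∈ S) (q : Q a v) (hal : A.al a v = A.c a)
    {A' : Aux} (hA' : A' = if A.T a v = A.c a + A.c v then (A.unplace a v).label P a v
      else A.unplace a v) :
    Inv n t (except Q a v) A' ∧ v ∈ A'.E 0 a ∧ A'.c a + A'.c v < A'.T a v ∧
      A'.al = A.al ∧ A'.c = A.c ∧ A'.rr = A.rr ∧ A'.ne = A.ne ∧ A'.E 0 = A.E 0 := by
  obtain ⟨h1, -, -⟩ := h.unplace q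
  have hadj := h.Qadj q
  obtain ⟨han, hvn, hne⟩ := h.lt hadj
  have hT := h.c_add_le hC ha q hal
  have e0 : (A.unplace a v).E 0 = A.E 0 := by funext x; simp
  subst hA'
  split_ifs with hm
  · refine ⟨h1.label (by simpa using hadj) (except_not Q a v) (hP _ ?_), by simpa using hadj, ?_,
      rfl, rfl, rfl, rfl, by simp [e0]⟩
    · simpa using h.deg_max_lt han hvn
    · rw [Aux.label_T]
      have := P.thr_pos (max ((A.unplace a v).E 0 a).length ((A.unplace a v).E 0 v).length)
      simp only [Aux.label_c]
      omega
  · exact ⟨h1, by simpa using hadj, by simp; omega, rfl, rfl, rfl, rfl, e0⟩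

include hP in
/-- The processing of an alarm. Either the edge is not mature, and the bit length of the number of missing
updates decreases, or there is a new invocation, which pays for at most `size n` alarms at each of
the two endpoints. -/
lemma eval (hC : Calm Q S A) {a v : ℕ} (ha : a ∈ S) (hv : v ∈ A.E 1 (Nat.pair a (A.c a))) :
    Inv n t Q (A.eval P a v) ∧ Calm Q S (A.eval P a v) ∧
    (A.eval P a v).due a + 1 = A.due a ∧ (A.eval P a v).c = A.c ∧ (A.eval P a v).E 0 = A.E 0 ∧
    (A.eval P a v).ne = A.ne + 1 ∧
    (A.eval P a v).pot n + (2 + 2 * Nat.size n) * A.calls.length ≤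
      A.pot n + (2 + 2 * Nat.size n) * (A.eval P a v).calls.length := by
  obtain ⟨q, hal⟩ := (h.bkt _ _ _).1 hv
  have hadj := h.Qadj q
  obtain ⟨han, hvn, hne⟩ := h.lt hadj
  have hT := h.c_add_le hC ha q hal
  set A' := if A.T a v = A.c a + A.c v then (A.unplace a v).label P a v else A.unplace a v with hA'
  obtain ⟨h1, h2, h3, e1, e2, e3, e4, e5⟩ := h.eval_mid hP hC ha q hal hA'
  have hev : A.eval P a v = Aux.place { A' with ne := A'.ne + 1 } a v := rfl
  have h1' := h1.ne_inc (A'.ne + 1)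
  obtain ⟨g1, -, -, g4⟩ := h1'.place (al' := A.al) (rr' := A.rr) h2 (except_not Q a v) h3
  rw [also_except q (h.Qsym q)] at g1 g4
  rw [← hev] at g1 g4
  have ec : (A.eval P a v).c = A.c := by rw [hev]; simpa using e2
  have eal : ∀ y, y ≠ v → (A.eval P a v).al a y = A.al a y := fun y hy => by
    rw [hev, Aux.place_al, if_neg (fun e => hne e.1), if_neg (fun e => hy e.2)]
    exact congrFun (congrFun e1 a) y
  refine ⟨g1, ?_, ?_, ec, ?_, by rw [hev]; simp [e4], ?_⟩
  · intro x y hq e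
    obtain ⟨k1, k2⟩ := g4 x y e hq
    exact hC x y hq (by simpa [e1, e2] using k2)
  · unfold Aux.due
    rw [ec]
    have hmem : ∀ y, y ∈ (A.eval P a v).E 1 (Nat.pair a (A.c a)) ↔
        y ∈ (A.E 1 (Nat.pair a (A.c a))).erase v := fun y => by
      rw [List.Nodup.mem_erase_iff (h.nd _ _), g1.bkt, h.bkt]
      constructor
      · rintro ⟨k1, k2⟩
        have hyv : y ≠ v := by
          rintro rfl
          obtain ⟨k3, k4⟩ := g4 a y (by rw [ec]; exact k2) k1
          exact k3.2.1 ⟨rfl, rfl⟩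
        exact ⟨hyv, k1, by rw [← eal y hyv]; exact k2⟩
      · rintro ⟨hyv, k1, k2⟩
        exact ⟨k1, by rw [eal y hyv]; exact k2⟩
    have := ((List.perm_ext_iff_of_nodup (g1.nd _ _) ((h.nd 1 _).erase v)).2 hmem).length_eq
    rw [this, List.length_erase_of_mem hv]
    have := List.length_pos_of_mem hv
    omega
  · rw [hev]; funext x; simp [e5]
  · have hp := Aux.pot_place h1' han hvn hne
    rw [← hev] at hp
    have hp' : Aux.pot n { A' with ne := A'.ne + 1 } = A.pot n + 2 := by
      simp only [Aux.pot, e3, e4]; ring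
    rw [hp'] at hp
    have hcalls : (A.eval P a v).calls = A'.calls := rfl
    rw [hcalls]
    simp only [e2, e3] at hp
    by_cases hm : A.T a v = A.c a + A.c v
    -- after an invocation, at most `n` updates are missing
    · have e6 : A'.calls.length = A.calls.length + 1 := by
        rw [hA', if_pos hm]; simp [Aux.label]
      have e7 : A'.T a v - A.c a - A.c v ≤ n := by
        rw [hA', if_pos hm, Aux.label_T]
        have := hP _ (h.deg_max_lt han hvn)
        simp only [Aux.unplace_E0, Aux.unplace_c]
        omega
      have := Nat.size_le_size e7
      rw [e6]
      ring_nf at hp ⊢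
      omega
    · have e6 : A'.calls = A.calls := by rw [hA', if_neg hm]; rfl
      have e7 : A'.T = A.T := by rw [hA', if_neg hm]; rfl
      rw [e6]
      rw [e7] at hp
      have := h.rr q
      have := size_half (h.rr_pos q) (x := A.T a v - A.c a - A.c v) (by omega)
      omega

include hP in
lemma scanN (hC : Calm Q S A) {a k : ℕ} (ha : a ∈ S) (hk : A.due a = k) :
    Inv n t Q (A.scanN P a k) ∧ Calm Q (S \ {a}) (A.scanN P a k) ∧ (A.scanN P a k).c = A.c ∧
    (A.scanN P a k).E 0 = A.E 0 ∧ (A.scanN P a k).ne = A.ne + k ∧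
    (A.scanN P a k).pot n + (2 + 2 * Nat.size n) * A.calls.length ≤
      A.pot n + (2 + 2 * Nat.size n) * (A.scanN P a k).calls.length := by
  induction k generalizing A with
  | zero =>
    refine ⟨h, fun u v q e => ?_, rfl, rfl, rfl, le_rfl⟩
    obtain ⟨h1, h2⟩ := hC u v q e
    refine ⟨⟨h1, ?_⟩, fun h3 => h2 h3.1⟩
    rintro rfl
    have : v ∈ A.E 1 (Nat.pair u (A.c u)) := (h.bkt _ _ _).2 ⟨q, e⟩
    have := List.length_pos_of_mem this
    unfold Aux.due at hk
    omega
  | succ k ih =>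
    obtain ⟨g1, g2, g3, g4, g5, g6, g7⟩ := h.eval hP hC ha (Aux.head_mem hk)
    obtain ⟨k1, k2, k3, k4, k5, k6⟩ := ih g1 g2 (by omega)
    simp only [Aux.scanN]
    exact ⟨k1, k2, k3.trans g4, k4.trans g5, by rw [k5, g6]; omega, by omega⟩

lemma tick {u w : ℕ} (hC : Calm Q ∅ A) (hu : u < n) (hw : w < n) (huw : u ≠ w) (hQ : ¬ Q u w) :
    Inv n (t + 1) Q ((A.tick u).tick w) ∧ Calm Q {u, w} ((A.tick u).tick w) := by
  have hlt : ∀ {x y}, Q x y → A.c x < A.al x y := fun {x y} q =>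
    lt_of_le_of_ne (h.c_al q) fun e => (hC x y q e.symm).1
  have ec : ∀ x, ((A.tick u).tick w).c x = if x = w ∨ x = u then A.c x + 1 else A.c x := by
    intro x
    simp only [Aux.tick, Function.update_apply]
    split_ifs <;> simp_all
  refine ⟨⟨h.lt, h.sym, h.nd, h.Qadj, h.Qsym, h.bkt, fun x => ?_, fun x hx => ?_, h.Tsym,
    fun x y => ?_, fun x y => ?_, h.al_sum, @fun x y q => ?_, @fun x y q => ?_, h.rr_pos, h.rr_sym,
    h.off⟩, fun x y q e => ?_⟩
  · rw [ec]; have := h.c_le x; split_ifs <;> omega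
  · rw [ec, if_neg (by omega)]; exact h.c_zero x hx
  · have := h.T_le x y
    show A.T x y ≤ _
    omega
  · have := h.al_le x y
    show A.al x y ≤ _
    omega
  · rw [ec]
    have := hlt q
    show _ ≤ A.al x y
    split_ifs <;> omega
  · rw [ec]
    have := h.rr q
    show A.T x y + (A.rr x y + 1) / 2 ≤ A.al x y + _ + A.rr x y
    split_ifs <;> omega
  · rw [ec] at e
    change A.al x y = _ at e
    have := hlt q
    have hx : x = w ∨ x = u := by
      by_contra hx
      rw [if_neg hx] at e
      omega
    have hxy := (h.lt (h.Qadj q)).2.2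
    simp only [Set.mem_insert_iff, Set.mem_singleton_iff]
    refine ⟨hx.symm, ?_⟩
    rintro (rfl | rfl)
    · rcases hx with rfl | rfl
      exacts [hQ (h.Qsym q), hxy rfl]
    · rcases hx with rfl | rfl
      exacts [hxy rfl, hQ q]

lemma link {u w : ℕ} (hu : u < n) (hw : w < n) (huw : u ≠ w) (hadj : ¬ A.adj u w) :
    Inv n t Q (A.link u w) ∧ (∀ x y, (A.link u w).adj x y ↔ also A.adj u w x y) ∧
    w ∉ A.E 0 u ∧ u ∉ (A.add 0 u w).E 0 w := by
  have n1 : w ∉ A.E 0 u := hadj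
  have n2 : u ∉ A.E 0 w := fun e => hadj (h.sym e)
  have n3 : u ∉ (A.add 0 u w).E 0 w := by simpa [Aux.add, huw.symm] using n2
  have E0 : ∀ x, (A.link u w).E 0 x = if x = w then A.E 0 x ++ [u] else
      if x = u then A.E 0 x ++ [w] else A.E 0 x := fun x => by
    have e : (A.link u w).E = upd (upd A.E 0 u (A.E 0 u ++ [w])) 0
      w ((upd A.E 0 u (A.E 0 u ++ [w])) 0 w ++ [u]) := rfl
    simp only [e, upd_apply, true_and, if_neg huw.symm]
    split_ifs with h1 h2 <;> simp_all
  have E1 : ∀ b, b ≠ 0 → ∀ x, (A.link u w).E b x = A.E b x := fun b hb x => by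
    simp [Aux.link, Aux.add, hb]
  have hmem : ∀ x y, (A.link u w).adj x y ↔ also A.adj u w x y := fun x y => by
    show y ∈ (A.link u w).E 0 x ↔ _
    rw [E0]
    unfold also Aux.adj
    by_cases h1 : x = w
    · subst h1; simp [huw.symm]
    · by_cases h2 : x = u
      · subst h2; simp [huw]
      · simp [h1, h2]
  have hmem' : ∀ {x y}, y ∈ (A.link u w).E 0 x ↔ also A.adj u w x y := hmem _ _
  refine ⟨⟨?_, ?_, fun b x => ?_, ?_, h.Qsym, fun x k y => ?_, h.c_le, h.c_zero, h.Tsym, h.T_le,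
    h.al_le, h.al_sum, h.c_al, h.rr, h.rr_pos, h.rr_sym, ?_⟩, hmem, n1, n3⟩
  · intro x y e
    rcases hmem'.1 e with e | ⟨rfl, rfl⟩ | ⟨rfl, rfl⟩
    exacts [h.lt e, ⟨hu, hw, huw⟩, ⟨hw, hu, huw.symm⟩]
  · intro x y e
    rw [hmem'] at e ⊢
    rcases e with e | e | e
    exacts [.inl (h.sym e), .inr (.inr ⟨e.2, e.1⟩), .inr (.inl ⟨e.2, e.1⟩)]
  · by_cases hb : b = 0
    · subst hb
      rw [E0]
      have := h.nd 0 x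
      split_ifs with h1 h2
      · rw [h1] at this ⊢
        exact List.nodup_append.2 ⟨this, by simp, by rintro y hy z hz rfl; simp at hz; subst hz; exact n2 hy⟩
      · rw [h2] at this ⊢
        exact List.nodup_append.2 ⟨this, by simp, by rintro y hy z hz rfl; simp at hz; subst hz; exact n1 hy⟩
      · exact this
    · rw [E1 b hb]; exact h.nd b x
  · exact fun q => hmem'.2 (.inl (h.Qadj q))
  · rw [E1 1 one_ne_zero]; exact h.bkt x k y
  · intro x y e
    rw [hmem'] at e
    exact h.off fun e' => e (.inl e')

lemma cut {u w : ℕ} (hQ : Q u w) :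
    Inv n t (except Q u w) (A.cut u w) ∧
    (∀ x y, (A.cut u w).adj x y ↔ except A.adj u w x y) ∧
    w ∈ A.E 0 u ∧ u ∈ (A.rem 0 u w).E 0 w := by
  obtain ⟨h1, -, -⟩ := h.unplace hQ
  have m1 := h.Qadj hQ
  have m2 := h.sym m1
  have hne := (h.lt m1).2.2
  have m3 : u ∈ (A.rem 0 u w).E 0 w := by simpa [Aux.rem, hne.symm] using m2
  have E0 : ∀ x, (A.cut u w).E 0 x = if x = w then swapRem (A.E 0 x) u else
      if x = u then swapRem (A.E 0 x) w else A.E 0 x := fun x => by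
    have e : (A.cut u w).E = upd (upd (A.unplace u w).E 0 u (swapRem ((A.unplace u w).E 0 u) w)) 0 w
      (swapRem ((upd (A.unplace u w).E 0 u (swapRem ((A.unplace u w).E 0 u) w)) 0 w) u) := rfl
    simp only [e, upd_apply, true_and, if_neg hne.symm, Aux.unplace_E0]
    split_ifs with h1 h2 <;> simp_all
  have E1 : ∀ b, b ≠ 0 → ∀ x, (A.cut u w).E b x = (A.unplace u w).E b x := fun b hb x => by
    simp [Aux.cut, Aux.rem, hb]
  have hmem : ∀ x y, (A.cut u w).adj x y ↔ except A.adj u w x y := fun x y => by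
    show y ∈ (A.cut u w).E 0 x ↔ _
    rw [E0]
    unfold except Aux.adj
    by_cases h1 : x = w
    · subst h1; simp [hne.symm, mem_swapRem_iff (h.nd _ _) m2]
    · by_cases h2 : x = u
      · subst h2; simp [hne, mem_swapRem_iff (h.nd _ _) m1]
      · simp [h1, h2]
  have hmem' : ∀ {x y}, y ∈ (A.cut u w).E 0 x ↔ except A.adj u w x y := hmem _ _
  have eT : ∀ x y, (A.cut u w).T x y = if (x = w ∧ y = u) ∨ (x = u ∧ y = w) then 0
    else A.T x y := fun x y => by simp [Aux.cut, Aux.rem]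
  have eal : ∀ x y, (A.cut u w).al x y = if (x = w ∧ y = u) ∨ (x = u ∧ y = w) then 0
    else A.al x y := fun x y => by simp [Aux.cut, Aux.rem]
  have nQ : ∀ {x y}, except Q u w x y → ¬ ((x = w ∧ y = u) ∨ (x = u ∧ y = w)) := by
    rintro x y ⟨_, q1, q2⟩; tauto
  refine ⟨⟨?_, ?_, fun b x => ?_, ?_, h1.Qsym, fun x k y => ?_, h.c_le, h.c_zero, fun x y => ?_,
    fun x y => ?_, fun x y => ?_, fun q => ?_, fun q => ?_, fun q => ?_, h1.rr_pos, h.rr_sym, ?_⟩,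
    hmem, m1, m3⟩
  · intro x y e
    exact h.lt (hmem'.1 e).1
  · intro x y e
    rw [hmem'] at e ⊢
    exact ⟨h.sym e.1, fun k => e.2.2 ⟨k.2, k.1⟩, fun k => e.2.1 ⟨k.2, k.1⟩⟩
  · by_cases hb : b = 0
    · subst hb
      rw [E0]
      have := h.nd 0 x
      split_ifs with h1 h2
      · rw [h1]; exact nodup_swapRem (h.nd _ _) m2
      · rw [h2]; exact nodup_swapRem (h.nd _ _) m1
      · exact this
    · rw [E1 b hb]; exact h1.nd b x
  · exact fun q => hmem'.2 ⟨h.Qadj q.1, q.2⟩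
  · rw [E1 1 one_ne_zero, h1.bkt, eal]
    constructor
    · rintro ⟨q, e⟩
      exact ⟨q, by rw [if_neg (nQ q)]; exact e⟩
    · rintro ⟨q, e⟩
      rw [if_neg (nQ q)] at e
      exact ⟨q, e⟩
  · rw [eT, eT, h.Tsym x y]
    congr 1
    simp only [eq_iff_iff]; tauto
  · rw [eT]; have := h.T_le x y; split_ifs <;> omega
  · rw [eal]; have := h.al_le x y; split_ifs <;> omega
  · rw [eT, eal, eal, if_neg (nQ q), if_neg (nQ q), if_neg (nQ (h1.Qsym q))]; exact h.al_sum q.1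
  · rw [eal, if_neg (nQ q)]; exact h.c_al q.1
  · rw [eT, eal, if_neg (nQ q), if_neg (nQ q)]; exact h.rr q.1
  · intro x y e
    rw [hmem'] at e
    rw [eT, eal]
    split_ifs with k
    · exact ⟨rfl, rfl⟩
    · refine h.off fun e' => e ⟨e', ?_⟩
      tauto

/-- The data after the insertion of an edge that has not been labelled yet. -/
lemma linked (hC : Calm Q ∅ A) {u w : ℕ} (hQ : Q = A.adj) (hu : u < n) (hw : w < n) (huw : u ≠ w)
    (hadj : ¬ A.adj u w) {A1 : Aux} (hA1 : A1 = ((A.link u w).tick u).tick w) :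
    Inv n (t + 1) Q A1 ∧ Calm Q {u, w} A1 ∧ w ∈ A1.E 0 u ∧ ¬ Q u w ∧
      (∀ x y, A1.adj x y ↔ also A.adj u w x y) := by
  subst hA1
  obtain ⟨h1, h2, -, -⟩ := h.link hu hw huw hadj
  have hQ' : ¬ Q u w := by rw [hQ]; exact hadj
  obtain ⟨h3, h4⟩ := h1.tick (u := u) (w := w) (fun x y q e => hC x y q e) hu hw huw hQ'
  exact ⟨h3, h4, (h2 u w).2 (.inr (.inl ⟨rfl, rfl⟩)), hQ', h2⟩

include hP in
lemma arrive (hC : Calm Q ∅ A) {u w : ℕ} {ins : Bool} (hQ : Q = A.adj) (hu : u < n) (hw : w < n)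
    (huw : u ≠ w) (hins : ins = true ↔ ¬ A.adj u w) :
    Inv n (t + 1) (A.arrive P ins u w).adj (A.arrive P ins u w) ∧
    Calm (A.arrive P ins u w).adj {u, w} (A.arrive P ins u w) ∧
    (A.arrive P ins u w).ne = A.ne ∧
    (A.arrive P ins u w).pot n + (2 + 2 * Nat.size n) * A.calls.length ≤
      A.pot n + (2 + 2 * Nat.size n) * (A.arrive P ins u w).calls.length := by
  cases hi : ins with
  | true =>
    set A1 := ((A.link u w).tick u).tick w with hA1
    obtain ⟨h1, h2, h3, h4, h5⟩ := h.linked hC hQ hu hw huw (hins.1 hi) hA1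
    have hthr := hP _ (h1.deg_max_lt hu hw)
    have h6 := h1.label (P := P) h3 h4 hthr
    have hT := Aux.label_T P A1 u w
    have hpos := P.thr_pos (max (A1.E 0 u).length (A1.E 0 w).length)
    obtain ⟨h7, -, -, h8⟩ := h6.place (al' := A.al) (rr' := A.rr) h3 h4
      (by rw [hT]; simp only [Aux.label_c]; omega)
    have hA' : A.arrive P true u w = (A1.label P u w).place u w := rfl
    have hadj : also Q u w = (A.arrive P true u w).adj := by
      funext x y
      apply propext
      rw [hA', hQ, ← h5]
      simp [Aux.adj]
    rw [← hA', hadj] at h7 h8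
    refine ⟨h7, fun x y q e => ?_, rfl, ?_⟩
    · obtain ⟨k1, k2⟩ := h8 x y e q
      exact h2 x y k1 k2
    · have hp := Aux.pot_place h6 hu hw huw
      rw [← hA', hT] at hp
      have e1 : (A1.label P u w).pot n = A.pot n := A.pot_link u w n
      have e2 : (A.arrive P true u w).calls.length = A.calls.length + 1 := by
        rw [hA']
        have : A1.calls = A.calls := rfl
        simp [Aux.label, this]
      have e3 : P.thr (max (A1.E 0 u).length (A1.E 0 w).length) + A1.c u + A1.c w -
        (A1.label P u w).c u - (A1.label P u w).c w ≤ n := by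
        simp only [Aux.label_c]; omega
      have := Nat.size_le_size e3
      rw [e2]
      rw [e1] at hp
      ring_nf at hp this ⊢
      omega
  | false =>
    have hq : Q u w := by
      rw [hQ]
      by_contra hq
      have := hins.2 hq
      rw [hi] at this
      cases this
    obtain ⟨h1, h2, h3, h4⟩ := h.cut hq
    have hC' : Calm (except Q u w) ∅ (A.cut u w) := fun x y q e => by
      have e1 : (A.cut u w).al x y = A.al x y := by
        have : ¬ ((x = w ∧ y = u) ∨ (x = u ∧ y = w)) := by
          rcases q with ⟨_, q1, q2⟩; tauto
        have e2 : (A.cut u w).al x y = upd2 A.al u w 0 x y := by simp [Aux.cut, Aux.rem]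
        rw [e2, upd2_apply, if_neg this]
      exact hC x y q.1 (by rw [← e1]; exact e)
    obtain ⟨h5, h6⟩ := h1.tick hC' hu hw huw (except_not Q u w)
    have hA' : A.arrive P false u w = ((A.cut u w).tick u).tick w := rfl
    have hadj : except Q u w = (A.arrive P false u w).adj := by
      funext x y
      apply propext
      rw [hQ, ← h2]
      rfl
    rw [← hA', hadj] at h5 h6
    exact ⟨h5, h6, rfl, le_of_eq rfl⟩

include hP in
/-- The invariants are preserved by an update. -/
lemma update (hC : Calm Q ∅ A) {u w : ℕ} {ins : Bool} (hQ : Q = A.adj) (hu : u < n) (hw : w < n)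
    (huw : u ≠ w) (hins : ins = true ↔ ¬ A.adj u w) :
    Inv n (t + 1) (A.update P ins u w).adj (A.update P ins u w) ∧
    Calm (A.update P ins u w).adj ∅ (A.update P ins u w) ∧
    (A.update P ins u w).pot n + (2 + 2 * Nat.size n) * A.calls.length ≤
      A.pot n + (2 + 2 * Nat.size n) * (A.update P ins u w).calls.length := by
  obtain ⟨h1, h2, h3, h4⟩ := h.arrive hP hC hQ hu hw huw hins
  obtain ⟨g1, g2, g3, g4, g5, g6⟩ := h1.scanN hP h2 (a := u) (by simp) rfl
  have e : ({u, w} : Set ℕ) \ {u} = {w} := by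
    ext x
    simp
    rintro rfl
    exact huw.symm
  rw [e] at g2
  obtain ⟨k1, k2, k3, k4, k5, k6⟩ := g1.scanN hP g2 (a := w) (by simp) rfl
  rw [Set.sdiff_self] at k2
  have hadj : (A.arrive P ins u w).adj = (A.update P ins u w).adj := by
    funext x y
    unfold Aux.adj Aux.update
    simp only [k4, g4]
  rw [hadj] at k1 k2
  exact ⟨k1, k2, by unfold Aux.update; simp only; omega⟩

end Inv


/-! ### Correctness and cost of the procedures -/

/-- The machine is large enough for `n` vertices, for alarms up to `X`, and for `I` invocations of
the labelling strategy. All cells but those of the alarm lists have keys of at most `B1` bits. -/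
structure Fit (m : VM) (P : Par) (n X I B1 : ℕ) : Prop where
  good : m.Good
  θ : m.θ = P.θ
  θ0 : 0 ≤ P.θ 0 ∧ P.θ 0 ≤ 1
  K0 : 1 ≤ P.K0
  D : 1 ≤ P.D
  cell : ∀ {t x i}, t < 16 → ¬ (3 ≤ t ∧ t < 6) → x ≤ n → i ≤ n → CellOk m t x i
  bcell : ∀ {t x a i}, 3 ≤ t → t < 6 → x ≤ n → a ≤ X → i ≤ n → CellOk m t (Nat.pair x a) i
  key : ∀ {x a}, x ≤ n → a ≤ X → 4 * (max x a + 1) ^ 2 < m.W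
  bits : ∀ {t}, ¬ (3 ≤ t ∧ t < 6) → m.B t ≤ B1
  bits_le : B1 ≤ m.Bm
  word : 4 * X + 4 * n + 10 < m.W
  word_L : ∀ i ≤ I, 2 * P.L i < m.W
  word_I : 4 * I + 4 < m.W

/-- The virtual state for given registers. -/
def Dat.vs (d : Dat) (ρ : ℕ → ℕ) : VS := ⟨ρ, enc d.A d.lab, d.draws, d.out⟩

/-- The registers from `k` on are the same. -/
def Keep (k : ℕ) (ρ ρ' : ℕ → ℕ) : Prop := ∀ r, k ≤ r → ρ' r = ρ r

lemma Keep.refl (k : ℕ) (ρ : ℕ → ℕ) : Keep k ρ ρ := fun _ _ => rfl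
lemma Keep.trans {k : ℕ} {ρ ρ' ρ'' : ℕ → ℕ} (h : Keep k ρ ρ') (h' : Keep k ρ' ρ'') :
    Keep k ρ ρ'' := fun r hr => (h' r hr).trans (h r hr)
lemma Keep.mono {k l : ℕ} {ρ ρ' : ℕ → ℕ} (h : Keep k ρ ρ')
    (hkl : k ≤ l := by omega) : Keep l ρ ρ' :=
  fun r hr => h r (hkl.trans hr)
lemma Keep.update {k x : ℕ} {ρ ρ' : ℕ → ℕ} {v : ℕ} (h : Keep k ρ ρ')
    (hx : x < k := by omega) : Keep k ρ (Function.update ρ' x v) := fun r hr => by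
  rw [Function.update_of_ne (by omega), h r hr]

/-- The number of nonzero cells. -/
def Dat.Sz (d : Dat) (z : ℕ) : Prop := DynELM.Sz (enc d.A d.lab) z

lemma Sz.add {A : Aux} {lab : ℕ → ℕ → ℕ} {z b x v : ℕ} (h : Sz (enc A lab) z) (hb : b < 2)
    (hv : v ∉ A.E b x) : Sz (enc (A.add b x v) lab) (z + 3) := by
  rw [← enc_add hb hv]
  exact ((h.update _ _).update _ _).update _ _

lemma Sz.rem {A : Aux} {lab : ℕ → ℕ → ℕ} {z b x v : ℕ} (h : Sz (enc A lab) z) (hb : b < 2)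
    (hn : (A.E b x).Nodup) (hv : v ∈ A.E b x) : Sz (enc (A.rem b x v) lab) (z + 5) := by
  rw [← enc_rem hb hn hv rfl rfl rfl]
  exact ((((h.update _ _).update _ _).update _ _).update _ _).update _ _

namespace Fit
variable {m : VM} {P : Par} {n X I B1 : ℕ} (hF : Fit m P n X I B1) {d : Dat} {ρ : ℕ → ℕ} {z : ℕ}
  {e e1 e2 e3 : Expr} {r r1 r2 r3 t x i v k : ℕ} {a b u w : ℕ}
include hF

lemma asg (h : e.UOk m.W ρ) (hv : e.eval ρ 0 = v) (hr : 20 ≤ r ∧ r < 100 := by omega)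
    (hk : e.cost + 2 ≤ k := by simp) :
    Tr m.toMach (Rep m) (set r e) k (d.vs ρ) (d.vs (Function.update ρ r v)) :=
  Tr.asg hF.good hr h hv hk

lemma read (hx : ρ r1 = x) (hi : e2.eval ρ 0 = i) (hv : enc d.A d.lab (t, x, i) = v)
    (hr : 20 ≤ r ∧ r < 100 := by omega) (ht : t < 16 := by omega)
    (ht' : ¬ (3 ≤ t ∧ t < 6) := by omega) (h1 : 20 ≤ r1 ∧ r1 < 100 := by omega)
    (hxn : x ≤ n := by omega) (h2 : e2.UOk m.W ρ := by simp <;> omega) (hin : i ≤ n := by omega)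
    (hk : e2.cost ≤ 20 := by simp) :
    Tr m.toMach (Rep m) (rd r t (.reg r1) e2) (100 * B1) (d.vs ρ)
      (d.vs (Function.update ρ r v)) := by
  have := Tr.read hF.good (s := d.vs ρ) (x := r) (t := t) (e1 := .reg r1) (e2 := e2) hr
    (hF.cell ht ht' hxn hin) h1 h2 hx hi hv (by simp) hk
  exact this.mono (Nat.mul_le_mul_left _ (hF.bits ht'))

lemma readB (hx : ρ r1 = Nat.pair u a) (hv : enc d.A d.lab (t, Nat.pair u a, 0) = v)
    (hr : 20 ≤ r ∧ r < 100 := by omega) (ht : 3 ≤ t := by omega) (ht' : t < 6 := by omega)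
    (h1 : 20 ≤ r1 ∧ r1 < 100 := by omega) (hun : u ≤ n := by omega) (ha : a ≤ X := by omega) :
    Tr m.toMach (Rep m) (rd r t (.reg r1) 0) (100 * m.Bm) (d.vs ρ)
      (d.vs (Function.update ρ r v)) := by
  have hW := hF.good.W16
  have := Tr.read hF.good (s := d.vs ρ) (x := r) (t := t) (e1 := .reg r1) (e2 := 0) hr
    (hF.bcell ht ht' hun ha (Nat.zero_le n)) h1 (by simp; omega) hx rfl hv (by simp) (by simp)
  exact this.mono (Nat.mul_le_mul_left _ (hF.good.B_le t))

lemma write {d' : Dat} (hx : ρ r1 = x) (hi : e2.eval ρ 0 = i) (hv : e3.eval ρ 0 = v)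
    (hz : d.Sz z) (hd : Function.update (enc d.A d.lab) (t, x, i) v = enc d'.A d'.lab)
    (ht : t < 16 := by omega) (ht' : ¬ (3 ≤ t ∧ t < 6) := by omega)
    (h1 : 20 ≤ r1 ∧ r1 < 100 := by omega) (hxn : x ≤ n := by omega)
    (h2 : e2.UOk m.W ρ := by simp <;> omega) (hin : i ≤ n := by omega)
    (hk2 : e2.cost ≤ 20 := by simp) (h3 : e3.UOk m.W ρ := by simp <;> omega)
    (hk3 : e3.cost ≤ 20 := by simp) (hzc : z + 1 ≤ m.cap := by omega)
    (hdr : d'.draws = d.draws := by rfl) (hout : d'.out = d.out := by rfl) :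
    Tr m.toMach (Rep m) (wr t (.reg r1) e2 e3) (400 * m.Bm) (d.vs ρ) (d'.vs ρ) ∧ d'.Sz (z + 1) := by
  have := Tr.write hF.good (s := d.vs ρ) (t := t) (e1 := .reg r1) (e2 := e2) (e3 := e3)
    (hF.cell ht ht' hxn hin) rfl h1 h2 h3 hx hi hv hz hzc (by simp) hk2 hk3
  refine ⟨?_, ?_⟩
  · have e : (d.vs ρ).setF (t, x, i) v = d'.vs ρ := by
      unfold Dat.vs VS.setF
      simp only [hd, hdr, hout]
    rwa [e] at this
  · unfold Dat.Sz
    rw [← hd]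
    exact Sz.update hz _ _

lemma row0 (hx : x ≤ n) : RowOk m n 0 x :=
  ⟨by omega, fun j hj i hi => hF.cell (by omega) (by omega) hx hi⟩

lemma row1 (hu : u ≤ n) (ha : a ≤ X) : RowOk m n 1 (Nat.pair u a) :=
  ⟨by omega, fun j hj i hi => hF.bcell (by omega) (by omega) hu ha hi⟩

lemma uok_pair (h1 : 20 ≤ r1 ∧ r1 < 100) (h2 : 20 ≤ r2 ∧ r2 < 100) (hu : ρ r1 ≤ n) (ha : ρ r2 ≤ X) :
    (Expr.pair (.reg r1) (.reg r2)).UOk m.W ρ := by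
  have hk := hF.key hu ha
  have q1 : ρ r1 ≤ max (ρ r1) (ρ r2) := le_max_left _ _
  have q2 : ρ r2 ≤ max (ρ r1) (ρ r2) := le_max_right _ _
  set b := max (ρ r1) (ρ r2) with hb
  have hsq : (b + 1) ^ 2 = b * b + 2 * b + 1 := by ring
  have q3 : ρ r1 * ρ r1 ≤ b * b := Nat.mul_le_mul q1 q1
  have q4 : ρ r2 * ρ r2 ≤ b * b := Nat.mul_le_mul q2 q2
  have hW := hF.good.W16
  by_cases hlt : ρ r1 < ρ r2
  · have eL : (Expr.bin .lt (.reg r1) (.reg r2)).eval ρ 0 = 1 := if_pos hlt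
    simp only [Expr.pair, Expr.uok_add, Expr.uok_mul, Expr.uok_lt, Expr.uok_reg, Expr.uok_sub,
      Expr.uok_ofNat, Expr.eval_add, Expr.eval_mul, eL, Expr.eval_sub, Expr.eval_ofNat,
      Expr.eval_reg, one_mul, Nat.sub_self, zero_mul]
    refine ⟨⟨⟨h1, h2⟩, ⟨⟨h2, h2, ?_⟩, h1, ?_⟩, ?_⟩,
      ⟨⟨?_, h1, h2⟩, ⟨⟨⟨h1, h1, ?_⟩, h1, ?_⟩, h2, ?_⟩, ?_⟩, ?_⟩ <;> omega
  · have eL : (Expr.bin .lt (.reg r1) (.reg r2)).eval ρ 0 = 0 := if_neg hlt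
    simp only [Expr.pair, Expr.uok_add, Expr.uok_mul, Expr.uok_lt, Expr.uok_reg, Expr.uok_sub,
      Expr.uok_ofNat, Expr.eval_add, Expr.eval_mul, eL, Expr.eval_sub, Expr.eval_ofNat,
      Expr.eval_reg, one_mul, Nat.sub_zero, zero_mul]
    refine ⟨⟨⟨h1, h2⟩, ⟨⟨h2, h2, ?_⟩, h1, ?_⟩, ?_⟩,
      ⟨⟨?_, h1, h2⟩, ⟨⟨⟨h1, h1, ?_⟩, h1, ?_⟩, h2, ?_⟩, ?_⟩, ?_⟩ <;> omega

lemma setAdd0 (hu : ρ r1 = u) (hw : ρ r2 = w) (hnot : w ∉ d.A.E 0 u)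
    (hlen : (d.A.E 0 u).length < n) (hz : d.Sz z) (h1 : 30 ≤ r1 ∧ r1 < 100 := by omega)
    (h2 : 30 ≤ r2 ∧ r2 < 100 := by omega)
    (hun : u ≤ n := by omega) (hwn : w ≤ n := by omega) (hzc : z + 4 ≤ m.cap := by omega) :
    ∃ ρ', Tr m.toMach (Rep m) (setAdd 0 (.reg r1) (.reg r2)) (1400 * m.Bm) (d.vs ρ)
      (Dat.vs { d with A := d.A.add 0 u w } ρ') ∧ Keep 30 ρ ρ' ∧
      Dat.Sz { d with A := d.A.add 0 u w } (z + 3) := by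
  obtain ⟨ρ', h3, h4⟩ := setAdd_spec hF.good (s := d.vs ρ) (ex := .reg r1) (ev := .reg r2)
    (hF.row0 hun) (by simp; omega) hu
    (fun r => ⟨by simp; omega, by simp [show r2 ≠ 20 by omega]; exact hw⟩) (by simp) (by simp) rfl
    hnot hlen hwn hz hzc
  exact ⟨ρ', h3, h4, Sz.add hz (by omega) hnot⟩

lemma setRem0 (hu : ρ r1 = u) (hw : ρ r2 = w) (hnd : (d.A.E 0 u).Nodup) (hin : w ∈ d.A.E 0 u)
    (hlen : (d.A.E 0 u).length ≤ n) (hwn : ∀ y ∈ d.A.E 0 u, y ≤ n) (hz : d.Sz z)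
    (h1 : 30 ≤ r1 ∧ r1 < 100 := by omega) (h2 : 30 ≤ r2 ∧ r2 < 100 := by omega)
    (hun : u ≤ n := by omega) (hzc : z + 6 ≤ m.cap := by omega) :
    ∃ ρ', Tr m.toMach (Rep m) (setRem 0 (.reg r1) (.reg r2)) (2400 * m.Bm) (d.vs ρ)
      (Dat.vs { d with A := d.A.rem 0 u w } ρ') ∧ Keep 30 ρ ρ' ∧
      Dat.Sz { d with A := d.A.rem 0 u w } (z + 5) := by
  obtain ⟨ρ', h3, h4⟩ := setRem_spec hF.good (s := d.vs ρ) (ex := .reg r1) (ev := .reg r2)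
    (hF.row0 hun) (by simp; omega) hu
    (fun r => ⟨by simp; omega, by simp [show r2 ≠ 20 by omega]; exact hw⟩) (by simp) (by simp) rfl
    hnd hin hlen hwn hz hzc
  exact ⟨ρ', h3, h4, Sz.rem hz (by omega) hnd hin⟩

lemma setAdd1 (hu : ρ r1 = u) (ha : ρ r2 = a) (hw : ρ r3 = w) (hnot : w ∉ d.A.E 1 (Nat.pair u a))
    (hlen : (d.A.E 1 (Nat.pair u a)).length < n) (hz : d.Sz z) (h1 : 30 ≤ r1 ∧ r1 < 100 := by omega)
    (h2 : 30 ≤ r2 ∧ r2 < 100 := by omega) (h3 : 30 ≤ r3 ∧ r3 < 100 := by omega)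
    (hun : u ≤ n := by omega) (haX : a ≤ X := by omega) (hwn : w ≤ n := by omega)
    (hzc : z + 4 ≤ m.cap := by omega) :
    ∃ ρ', Tr m.toMach (Rep m) (setAdd 1 (.pair (.reg r1) (.reg r2)) (.reg r3)) (1400 * m.Bm)
      (d.vs ρ) (Dat.vs { d with A := d.A.add 1 (Nat.pair u a) w } ρ') ∧ Keep 30 ρ ρ' ∧
      Dat.Sz { d with A := d.A.add 1 (Nat.pair u a) w } (z + 3) := by
  obtain ⟨ρ', h3, h4⟩ := setAdd_spec hF.good (s := d.vs ρ) (ex := .pair (.reg r1) (.reg r2))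
    (ev := .reg r3) (hF.row1 hun haX)
    (hF.uok_pair (by omega) (by omega) (by rw [← hu] at hun; exact hun) (by rw [← ha] at haX; exact haX))
    (by rw [Expr.eval_pair]; show Nat.pair (ρ r1) (ρ r2) = _; rw [hu, ha])
    (fun r => ⟨by simp; omega, by simp [show r3 ≠ 20 by omega]; exact hw⟩) (by simp [Expr.pair])
    (by simp) rfl hnot hlen hwn hz hzc
  exact ⟨ρ', h3, h4, Sz.add hz (by omega) hnot⟩

lemma setRem1 (hu : ρ r1 = u) (ha : ρ r2 = a) (hw : ρ r3 = w)
    (hnd : (d.A.E 1 (Nat.pair u a)).Nodup) (hin : w ∈ d.A.E 1 (Nat.pair u a))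
    (hlen : (d.A.E 1 (Nat.pair u a)).length ≤ n) (hwn : ∀ y ∈ d.A.E 1 (Nat.pair u a), y ≤ n)
    (hz : d.Sz z) (h1 : 30 ≤ r1 ∧ r1 < 100 := by omega)
    (h2 : 30 ≤ r2 ∧ r2 < 100 := by omega) (h3 : 30 ≤ r3 ∧ r3 < 100 := by omega)
    (hun : u ≤ n := by omega) (haX : a ≤ X := by omega) (hzc : z + 6 ≤ m.cap := by omega) :
    ∃ ρ', Tr m.toMach (Rep m) (setRem 1 (.pair (.reg r1) (.reg r2)) (.reg r3)) (2400 * m.Bm)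
      (d.vs ρ) (Dat.vs { d with A := d.A.rem 1 (Nat.pair u a) w } ρ') ∧ Keep 30 ρ ρ' ∧
      Dat.Sz { d with A := d.A.rem 1 (Nat.pair u a) w } (z + 5) := by
  obtain ⟨ρ', h3, h4⟩ := setRem_spec hF.good (s := d.vs ρ) (ex := .pair (.reg r1) (.reg r2))
    (ev := .reg r3) (hF.row1 hun haX)
    (hF.uok_pair (by omega) (by omega) (by rw [← hu] at hun; exact hun) (by rw [← ha] at haX; exact haX))
    (by rw [Expr.eval_pair]; show Nat.pair (ρ r1) (ρ r2) = _; rw [hu, ha])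
    (fun r => ⟨by simp; omega, by simp [show r3 ≠ 20 by omega]; exact hw⟩) (by simp [Expr.pair])
    (by simp) rfl hnd hin hlen hwn hz hzc
  exact ⟨ρ', h3, h4, Sz.rem hz (by omega) hnd hin⟩

variable {t0 : ℕ} {Q : ℕ → ℕ → Prop} {S : Set ℕ}

lemma unplace (h : Inv n t0 Q d.A) (hX : 3 * t0 + n + 1 ≤ X) (hu : ρ 60 = a) (hw : ρ 61 = v)
    (q : Q a v) (hz : d.Sz z) (hzc : z + 11 ≤ m.cap) :
    ∃ ρ', Tr m.toMach (Rep m) unplaceP (200 * B1 + 4800 * m.Bm) (d.vs ρ)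
      (Dat.vs { d with A := d.A.unplace a v } ρ') ∧ Keep 50 ρ ρ' ∧
      Dat.Sz { d with A := d.A.unplace a v } (z + 10) := by
  obtain ⟨han, hvn, hne⟩ := h.lt (h.Qadj q)
  obtain ⟨-, m1, m2⟩ := h.unplace q
  have a1 := h.al_le a v
  have a2 := h.al_le v a
  have t1 := hF.read (d := d) (ρ := ρ) (r := 40) (t := 8) (r1 := 60) (e2 := .reg 61) (x := a)
    (i := v) hu (by simpa using hw) (enc_al _ _)
  set ρ1 := Function.update ρ 40 (d.A.al a v) with hρ1
  have t2 := hF.read (d := d) (ρ := ρ1) (r := 41) (t := 8) (r1 := 61) (e2 := .reg 60) (x := v)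
    (i := a) (by simp [hρ1, hw]) (by simp [hρ1, hu]) (enc_al _ _)
  set ρ2 := Function.update ρ1 41 (d.A.al v a) with hρ2
  obtain ⟨ρ3, t3, k3, z3⟩ := hF.setRem1 (d := d) (ρ := ρ2) (r1 := 60) (r2 := 40) (r3 := 61) (u := a)
    (a := d.A.al a v) (w := v) (by simp [hρ2, hρ1, hu]) (by simp [hρ2, hρ1])
    (by simp [hρ2, hρ1, hw]) (h.nd _ _) m1 (h.bkt_le _) (fun y hy => (h.mem_bkt hy).le) hz
  have hpp : Nat.pair v (d.A.al v a) ≠ Nat.pair a (d.A.al a v) := fun e =>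
    hne (Nat.pair_eq_pair.1 e).1.symm
  have hE : (d.A.rem 1 (Nat.pair a (d.A.al a v)) v).E 1 (Nat.pair v (d.A.al v a)) =
      d.A.E 1 (Nat.pair v (d.A.al v a)) := by simp [Aux.rem, hpp]
  obtain ⟨ρ4, t4, k4, z4⟩ := hF.setRem1 (d := { d with A := d.A.rem 1 (Nat.pair a (d.A.al a v)) v })
    (ρ := ρ3) (r1 := 61) (r2 := 41) (r3 := 60) (u := v) (a := d.A.al v a) (w := a)
    (by rw [k3 _ (by omega)]; simp [hρ2, hρ1, hw]) (by rw [k3 _ (by omega)]; simp [hρ2, hρ1])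
    (by rw [k3 _ (by omega)]; simp [hρ2, hρ1, hu]) (by simp only [hE]; exact h.nd _ _) m2
    (by simp only [hE]; exact h.bkt_le _) (by simp only [hE]; exact fun y hy => (h.mem_bkt hy).le)
    z3
  refine ⟨ρ4, (t1.seq (t2.seq (t3.seq t4))).mono, ?_, z4⟩
  exact (Keep.refl _ _).update.update.trans
    ((k3.trans k4).mono)

lemma place (h : Inv n t0 Q d.A) (hX : 3 * t0 + n + 1 ≤ X) (hu : ρ 60 = a) (hw : ρ 61 = v)
    (hadj : v ∈ d.A.E 0 a) (q : ¬ Q a v) (hT : d.A.c a + d.A.c v < d.A.T a v)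
    (hz : d.Sz z) (hzc : z + 11 ≤ m.cap) :
    ∃ ρ', Tr m.toMach (Rep m) placeP (300 * B1 + 3700 * m.Bm) (d.vs ρ)
      (Dat.vs { d with A := d.A.place a v } ρ') ∧ Keep 50 ρ ρ' ∧
      Dat.Sz { d with A := d.A.place a v } (z + 8) := by
  obtain ⟨han, hvn, hne⟩ := h.lt hadj
  have hTle := h.T_le a v
  have hca := h.c_le a
  have hcv := h.c_le v
  have hW := hF.word
  have hB := (hF.good.B_ge 0).trans (hF.good.B_le 0)
  set T := d.A.T a v with hTe
  set ca := d.A.c a with hcae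
  set cv := d.A.c v with hcve
  set hh := (T - ca - cv + 1) / 2 with hhe
  set al' := upd (upd d.A.al a v (ca + hh)) v a (cv + hh) with hal'
  set rr' := upd2 d.A.rr a v (T - ca - cv) with hrr'
  obtain ⟨-, n1, n2, -⟩ := h.place hadj q hT (al' := al') (rr' := rr')
  have t1 := hF.read (d := d) (ρ := ρ) (r := 40) (t := 7) (r1 := 60) (e2 := .reg 61) (x := a)
    (i := v) hu (by simpa using hw) (enc_T _ _)
  set ρ1 := Function.update ρ 40 T with hρ1
  have t2 := hF.read (d := d) (ρ := ρ1) (r := 41) (t := 6) (r1 := 60) (e2 := 0) (x := a) (i := 0)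
    (by simp [hρ1, hu]) (by simp) (enc_c _)
  set ρ2 := Function.update ρ1 41 ca with hρ2
  have t3 := hF.read (d := d) (ρ := ρ2) (r := 42) (t := 6) (r1 := 61) (e2 := 0) (x := v) (i := 0)
    (by simp [hρ2, hρ1, hw]) (by simp) (enc_c _)
  set ρ3 := Function.update ρ2 42 cv with hρ3
  have t4 := hF.asg (d := d) (ρ := ρ3) (r := 43) (e := (.reg 40 - .reg 41 - .reg 42 + 1) / 2)
    (v := hh) (k := 20) (by simp [hρ3, hρ2, hρ1]; omega) (by simp [hρ3, hρ2, hρ1, hhe])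
  set ρ4 := Function.update ρ3 43 hh with hρ4
  have t5 := hF.asg (d := d) (ρ := ρ4) (r := 44) (e := .reg 41 + .reg 43) (v := ca + hh) (k := 20)
    (by simp [hρ4, hρ3, hρ2, hρ1]; omega) (by simp [hρ4, hρ3, hρ2, hρ1])
  set ρ5 := Function.update ρ4 44 (ca + hh) with hρ5
  have t6 := hF.asg (d := d) (ρ := ρ5) (r := 45) (e := .reg 42 + .reg 43) (v := cv + hh) (k := 20)
    (by simp [hρ5, hρ4, hρ3, hρ2, hρ1]; omega) (by simp [hρ5, hρ4, hρ3, hρ2, hρ1])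
  set ρ6 := Function.update ρ5 45 (cv + hh) with hρ6
  have K6 : Keep 50 ρ ρ6 := (Keep.refl _ _).update.update.update.update.update.update
  have u6 : ρ6 60 = a := (K6 60 (by omega)).trans hu
  have v6 : ρ6 61 = v := (K6 61 (by omega)).trans hw
  have p6 : ρ6 44 = ca + hh := by simp [hρ6, hρ5]
  have q6 : ρ6 45 = cv + hh := by simp [hρ6]
  obtain ⟨t7, z7⟩ := hF.write (d := d)
    (d' := { d with A := { d.A with al := upd d.A.al a v (ca + hh) } }) (ρ := ρ6) (t := 8)
    (r1 := 60) (e2 := .reg 61) (e3 := .reg 44) (x := a) (i := v) (v := ca + hh) u6 v6 p6 hz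
    (enc_update_al _ _ _)
  obtain ⟨t8, z8⟩ := hF.write (d := { d with A := { d.A with al := upd d.A.al a v (ca + hh) } })
    (d' := { d with A := { d.A with al := al' } }) (ρ := ρ6) (t := 8) (r1 := 61) (e2 := .reg 60)
    (e3 := .reg 45) (x := v) (i := a) (v := cv + hh) v6 u6 q6 z7 (enc_update_al _ _ _)
  set A1 : Aux := { d.A with al := al', rr := rr' } with hA1
  have z8' : Dat.Sz { d with A := A1 } (z + 1 + 1) := z8
  -- a vertex in a list of alarms of `x` is different from `x`
  have hlt : ∀ x y k, y ∉ d.A.E 1 (Nat.pair x k) → y < n → (d.A.E 1 (Nat.pair x k)).length < n := by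
    intro x y k hy hyn
    have := length_le_of_lt (n := n) (List.nodup_cons.2 ⟨hy, h.nd 1 (Nat.pair x k)⟩) (fun z hz => by
      rcases List.mem_cons.1 hz with rfl | hz
      exacts [hyn, h.mem_bkt hz])
    simp at this
    omega
  obtain ⟨ρ9, t9, k9, z9⟩ := hF.setAdd1 (d := { d with A := A1 }) (ρ := ρ6) (r1 := 60) (r2 := 44)
    (r3 := 61) (u := a) (a := ca + hh) (w := v) u6 p6 v6 (n1 _) (hlt _ _ _ (n1 _) hvn) z8'
  have hpp : Nat.pair v (cv + hh) ≠ Nat.pair a (ca + hh) := fun e =>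
    hne (Nat.pair_eq_pair.1 e).1.symm
  have n3 := n2 (ca + hh) (cv + hh)
  have hE : (A1.add 1 (Nat.pair a (ca + hh)) v).E 1 (Nat.pair v (cv + hh)) =
      d.A.E 1 (Nat.pair v (cv + hh)) := by simp [Aux.add, hpp, hA1]
  obtain ⟨ρ10, t10, k10, z10⟩ := hF.setAdd1 (d := { d with A := A1.add 1 (Nat.pair a (ca + hh)) v })
    (ρ := ρ9) (r1 := 61) (r2 := 45) (r3 := 60) (u := v) (a := cv + hh) (w := a)
    (by rw [k9 _ (by omega), v6]) (by rw [k9 _ (by omega), q6]) (by rw [k9 _ (by omega), u6]) n3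
    (by simp only [hE]; exact hlt _ _ _ (by rw [← hE]; exact n3) han) z9
  refine ⟨ρ10, ?_, K6.trans ((k9.trans k10).mono), z10⟩
  exact (t1.seq (t2.seq (t3.seq (t4.seq (t5.seq (t6.seq (t7.seq (t8.seq (t9.seq t10))))))))).mono

end Fit


/-- The registers `90`, `91`, `92` count the invocations of the labelling strategy. -/
structure Counts (ρ : ℕ → ℕ) (I : ℕ) : Prop where
  count : ρ 90 = I
  size : ρ 91 = Nat.size I
  pow : ρ 92 + 1 = 2 ^ Nat.size I

lemma Counts.congr {ρ ρ' : ℕ → ℕ} {I : ℕ} (h : Counts ρ I) (h90 : ρ' 90 = ρ 90)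
    (h91 : ρ' 91 = ρ 91) (h92 : ρ' 92 = ρ 92) : Counts ρ' I :=
  ⟨h90.trans h.count, h91.trans h.size, by rw [h92]; exact h.pow⟩

/-- The registers from `k` on, except for the counters, are the same. -/
def Same (k : ℕ) (ρ ρ' : ℕ → ℕ) : Prop := ∀ r, k ≤ r → r < 90 → ρ' r = ρ r

lemma Same.refl (k : ℕ) (ρ : ℕ → ℕ) : Same k ρ ρ := fun _ _ _ => rfl
lemma Same.trans {k : ℕ} {ρ ρ' ρ'' : ℕ → ℕ} (h : Same k ρ ρ') (h' : Same k ρ' ρ'') : Same k ρ ρ'' :=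
  fun r h1 h2 => (h' r h1 h2).trans (h r h1 h2)
lemma Same.mono {k l : ℕ} {ρ ρ' : ℕ → ℕ} (h : Same k ρ ρ')
    (hkl : k ≤ l := by omega) : Same l ρ ρ' :=
  fun r h1 h2 => h r (hkl.trans h1) h2
lemma Keep.same {ρ ρ' : ℕ → ℕ} {k l : ℕ} (h : Keep k ρ ρ') (hk : k ≤ l := by omega) : Same l ρ ρ' :=
  fun r h1 _ => h r (hk.trans h1)
lemma Keep.counts {ρ ρ' : ℕ → ℕ} {k I : ℕ} (h : Keep k ρ ρ') (hc : Counts ρ I)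
    (hk : k ≤ 90 := by omega) :
    Counts ρ' I := hc.congr (h _ (by omega)) (h _ (by omega)) (h _ (by omega))

lemma size_succ (i : ℕ) :
    Nat.size (i + 1) = if i + 1 < 2 ^ Nat.size i then Nat.size i else Nat.size i + 1 := by
  split_ifs with h
  · exact le_antisymm (Nat.size_le.2 h) (Nat.size_le_size (by omega))
  · refine le_antisymm (Nat.size_le.2 ?_) ?_
    · have := Nat.lt_size_self i
      rw [pow_succ]; omega
    · rw [Nat.succ_le_iff, Nat.lt_size]; omega

lemma pow_size_le {i : ℕ} : 2 ^ Nat.size i ≤ 2 * i + 1 := by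
  rcases Nat.eq_zero_or_pos i with rfl | h
  · simp
  · have h0 := Nat.size_pos.2 h
    obtain ⟨s, hs⟩ : ∃ s, Nat.size i = s + 1 := ⟨Nat.size i - 1, by omega⟩
    have : 2 ^ s ≤ i := Nat.lt_size.1 (by omega)
    rw [hs, pow_succ]; omega

lemma hit_le (a v : ℕ) (Ea Ev : List ℕ) (y : ℕ) : hit a v Ea Ev y ≤ 1 := by
  unfold hit; split_ifs <;> omega

lemma hits_le (ω : Tape) (p a v : ℕ) (Ea Ev : List ℕ) (k : ℕ) : hits ω p a v Ea Ev k ≤ k := by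
  unfold hits
  refine (Finset.sum_le_sum fun j _ => hit_le _ _ _ _ _).trans ?_
  simp

lemma hits_succ (ω : Tape) (p a v : ℕ) (Ea Ev : List ℕ) (k : ℕ) :
    hits ω p a v Ea Ev (k + 1) =
      hit a v Ea Ev (pick a v Ea Ev (ω (p, Ea.length + Ev.length + 1) : ℕ)) +
        hits ω (p + 1) a v Ea Ev k := by
  unfold hits
  rw [Finset.sum_range_succ', add_comm]
  refine congrArg₂ _ rfl (Finset.sum_congr rfl fun j _ => ?_)
  rw [show p + (j + 1) = p + 1 + j by ring]

/-- The registers during the sampling: `k` samples are still to be drawn, and there have been `h`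
hits. -/
structure Smp (ρ0 ρ : ℕ → ℕ) (a v da dv k h : ℕ) : Prop where
  r40 : ρ 40 = da
  r41 : ρ 41 = dv
  r43 : ρ 43 = k
  r44 : ρ 44 = h
  r45 : ρ 45 = da + dv + 2
  r60 : ρ0 60 = a
  r61 : ρ0 61 = v
  r42 : ρ 42 = ρ0 42
  keep : Keep 60 ρ0 ρ

lemma Smp.of {ρ0 ρ ρ' : ℕ → ℕ} {a v da dv k h : ℕ} (hs : Smp ρ0 ρ a v da dv k h)
    (h1 : ∀ r, 40 ≤ r → r < 46 → ρ' r = ρ r) (h2 : Keep 60 ρ ρ') : Smp ρ0 ρ' a v da dv k h :=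
  ⟨(h1 _ (by omega) (by omega)).trans hs.r40, (h1 _ (by omega) (by omega)).trans hs.r41,
    (h1 _ (by omega) (by omega)).trans hs.r43, (h1 _ (by omega) (by omega)).trans hs.r44,
    (h1 _ (by omega) (by omega)).trans hs.r45, hs.r60, hs.r61,
    (h1 _ (by omega) (by omega)).trans hs.r42, hs.keep.trans h2⟩

lemma posn_pos {l : List ℕ} {y : ℕ} : 0 < posn l y ↔ y ∈ l := by
  unfold posn; split_ifs with h <;> simp [h]

namespace Fit
variable {m : VM} {P : Par} {n X I B1 : ℕ} (hF : Fit m P n X I B1) {d : Dat} {ρ : ℕ → ℕ} {z : ℕ}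
  {a v i : ℕ}
include hF

lemma count (hc : Counts ρ i) (hi : i + 1 ≤ I) :
    ∃ ρ', Tr m.toMach (Rep m) countP 60 (d.vs ρ) (d.vs ρ') ∧ Same 60 ρ ρ' ∧ Counts ρ' (i + 1) := by
  have hW := hF.word_I
  have hps := pow_size_le (i := i)
  have h92 := hc.pow
  have t1 := hF.asg (d := d) (ρ := ρ) (r := 90) (e := .reg 90 + 1) (v := i + 1) (k := 10)
    (by simp [hc.count]; omega) (by simp [hc.count])
  set ρ1 := Function.update ρ 90 (i + 1) with hρ1
  have hval : Val m.toMach (Rep m) (.bin .lt (.reg 92) (.reg 90)) 10 (d.vs ρ1)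
      (if ρ 92 < i + 1 then 1 else 0) :=
    Val.user hF.good (by simp [Dat.vs, hρ1])
  have hs := size_succ i
  by_cases h : ρ 92 < i + 1
  · rw [if_pos h] at hval
    rw [if_neg (by omega)] at hs
    have t2 := hF.asg (d := d) (ρ := ρ1) (r := 92) (e := 2 * .reg 92 + 1) (v := 2 * ρ 92 + 1)
      (k := 10) (by simp [hρ1]; omega) (by simp [hρ1])
    set ρ2 := Function.update ρ1 92 (2 * ρ 92 + 1) with hρ2
    have hsz : Nat.size i < 2 ^ Nat.size i := Nat.lt_two_pow_self
    have t3 := hF.asg (d := d) (ρ := ρ2) (r := 91) (e := .reg 91 + 1) (v := Nat.size i + 1)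
      (k := 10) (by simp [hρ2, hρ1, hc.size]; omega) (by simp [hρ2, hρ1, hc.size])
    refine ⟨_, (t1.seq (Tr.ite_true (ke := 10) hval one_ne_zero (t2.seq t3))).mono, ?_, ?_⟩
    · intro r h1 h2
      simp [hρ2, hρ1, show r ≠ 90 by omega, show r ≠ 91 by omega, show r ≠ 92 by omega]
    · refine ⟨by simp [hρ2, hρ1], by simp [hs], ?_⟩
      rw [hs, pow_succ, ← h92]
      simp [hρ2]; omega
  · rw [if_neg h] at hval
    rw [if_pos (by omega)] at hs
    refine ⟨ρ1, (t1.seq (Tr.ite_false (ke := 10) hval Tr.skip)).mono, ?_, ?_⟩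
    · intro r h1 h2
      simp [hρ1, show r ≠ 90 by omega]
    · exact ⟨by simp [hρ1], by simp [hρ1, hs, hc.size], by simp [hρ1, hs, hc.pow]⟩

lemma sample {t0 : ℕ} {Q : ℕ → ℕ → Prop} (h : Inv n t0 Q d.A) (han : a < n) (hvn : v < n)
    {ρ0 : ℕ → ℕ} {k c : ℕ} (hs : Smp ρ0 ρ a v (d.A.E 0 a).length (d.A.E 0 v).length (k + 1) c)
    (hc : c + 1 < m.W) :
    ∃ ρ', Tr m.toMach (Rep m) sampleP (300 * B1 + 200) (d.vs ρ)
      (Dat.vs { d with draws := d.draws + 1 } ρ') ∧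
      Smp ρ0 ρ' a v (d.A.E 0 a).length (d.A.E 0 v).length k (c + hit a v (d.A.E 0 a) (d.A.E 0 v)
        (pick a v (d.A.E 0 a) (d.A.E 0 v)
          (m.ω (d.draws, (d.A.E 0 a).length + (d.A.E 0 v).length + 1) : ℕ))) := by
  have hda := h.deg_lt han
  have hdv := h.deg_lt hvn
  have hW := hF.word
  set Ea := d.A.E 0 a with hEa
  set Ev := d.A.E 0 v with hEv
  set x : ℕ := (m.ω (d.draws, Ea.length + Ev.length + 1) : ℕ) with hx
  have hxlt : x < Ea.length + Ev.length + 2 := (m.ω (d.draws, Ea.length + Ev.length + 1)).2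
  have t1 := Tr.draw (m := m) (s := d.vs ρ) (x := 46) (y := 45) (by omega) (by omega)
    (by show 0 < ρ 45; rw [hs.r45]; omega)
  have e1 : ({ (d.vs ρ).setR 46 (m.ω ((d.vs ρ).draws, (d.vs ρ).reg 45 - 1) : ℕ) with
      draws := (d.vs ρ).draws + 1 } : VS) =
      Dat.vs { d with draws := d.draws + 1 } (Function.update ρ 46 x) := by
    have : (d.vs ρ).reg 45 - 1 = Ea.length + Ev.length + 1 := by
      show ρ 45 - 1 = _; rw [hs.r45]; omega
    rw [this]
    rfl
  rw [e1] at t1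
  set d1 : Dat := { d with draws := d.draws + 1 } with hd1
  set ρ1 := Function.update ρ 46 x with hρ1
  have K1 : Smp ρ0 ρ1 a v Ea.length Ev.length (k + 1) c :=
    hs.of (fun r h1 h2 => by simp [hρ1, show r ≠ 46 by omega])
      (Keep.refl _ _).update
  have x46 : ρ1 46 = x := by simp [hρ1]
  have u1 : ρ1 60 = a := (K1.keep 60 le_rfl).trans K1.r60
  have v1 : ρ1 61 = v := (K1.keep 61 (by omega)).trans K1.r61
  set y := pick a v Ea Ev x with hy
  have hyn : y < n := by
    rw [hy]; unfold pick
    split_ifs with h1 h2 h3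
    · rw [List.getD_eq_getElem _ _ h1]
      exact (h.lt (List.getElem_mem h1)).2.1
    · exact han
    · have h4 : x - Ea.length - 1 < Ev.length := by omega
      rw [List.getD_eq_getElem _ _ h4]
      exact (h.lt (List.getElem_mem h4)).2.1
    · exact hvn
  have V1 : Val m.toMach (Rep m) (.bin .lt (.reg 46) (.reg 40)) 10 (d1.vs ρ1)
      (if x < Ea.length then 1 else 0) :=
    Val.user hF.good (by simp [Dat.vs, x46, K1.r40])
  have V2 : Val m.toMach (Rep m) (.bin .eq (.reg 46) (.reg 40)) 10 (d1.vs ρ1)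
      (if x = Ea.length then 1 else 0) :=
    Val.user hF.good (by simp [Dat.vs, x46, K1.r40])
  have V3 : Val m.toMach (Rep m) (.bin .lt (.reg 46) (.reg 40 + 1 + .reg 41)) 10 (d1.vs ρ1)
      (if x < Ea.length + 1 + Ev.length then 1 else 0) :=
    Val.user hF.good (h := by simp [Dat.vs, K1.r40, K1.r41]; omega)
    (by simp [Dat.vs, x46, K1.r40, K1.r41])
  have t2 : Tr m.toMach (Rep m) (iff (.bin .lt (.reg 46) (.reg 40)) (rd 47 1 (.reg 60) (.reg 46))
    (iff (.bin .eq (.reg 46) (.reg 40)) (set 47 (.reg 60))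
      (iff (.bin .lt (.reg 46) (.reg 40 + 1 + .reg 41))
        (rd 47 1 (.reg 61) (.reg 46 - .reg 40 - 1)) (set 47 (.reg 61))))) (100 * B1 + 60)
      (d1.vs ρ1) (d1.vs (Function.update ρ1 47 y)) := by
    by_cases h1 : x < Ea.length
    · have ey : y = Ea.getD x 0 := by rw [hy]; unfold pick; rw [if_pos h1]
      rw [if_pos h1] at V1
      exact (Tr.ite_true V1 one_ne_zero (hF.read u1 (by simpa using x46)
        (by rw [ey]; exact enc_elt (b := 0) (by omega) a x))).mono
    · rw [if_neg h1] at V1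
      by_cases h2 : x = Ea.length
      · have ey : y = a := by rw [hy]; unfold pick; rw [if_neg h1, if_pos h2]
        rw [if_pos h2] at V2
        exact (Tr.ite_false V1 (Tr.ite_true V2 one_ne_zero (hF.asg (k := 4) (by simp)
          (by rw [ey]; exact u1)))).mono
      · rw [if_neg h2] at V2
        by_cases h3 : x < Ea.length + 1 + Ev.length
        · have ey : y = Ev.getD (x - Ea.length - 1) 0 := by
            rw [hy]; unfold pick; rw [if_neg h1, if_neg h2, if_pos h3]
          rw [if_pos h3] at V3
          exact (Tr.ite_false V1 (Tr.ite_false V2 (Tr.ite_true V3 one_ne_zero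
            (hF.read (i := x - Ea.length - 1) v1 (by simp [x46, K1.r40])
            (by rw [ey]; exact enc_elt (b := 0) (by omega) v _))))).mono
        · have ey : y = v := by rw [hy]; unfold pick; rw [if_neg h1, if_neg h2, if_neg h3]
          rw [if_neg h3] at V3
          exact (Tr.ite_false V1 (Tr.ite_false V2 (Tr.ite_false V3 (hF.asg (k := 4) (by simp)
            (by rw [ey]; exact v1))))).mono
  set ρ2 := Function.update ρ1 47 y with hρ2
  have K2 : Smp ρ0 ρ2 a v Ea.length Ev.length (k + 1) c :=
    K1.of (fun r h1 h2 => by simp [hρ2, show r ≠ 47 by omega])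
      (Keep.refl _ _).update
  have t3 := hF.read (d := d1) (ρ := ρ2) (r := 48) (t := 2) (r1 := 60) (e2 := .reg 47) (x := a)
    (i := y) (by simp [hρ2, u1]) (by simp [hρ2]) (enc_pos (b := 0) (by omega) a y)
  set ρ3 := Function.update ρ2 48 (posn (d1.A.E 0 a) y) with hρ3
  have t4 := hF.read (d := d1) (ρ := ρ3) (r := 49) (t := 2) (r1 := 61) (e2 := .reg 47) (x := v)
    (i := y) (by simp [hρ3, hρ2, v1]) (by simp [hρ3, hρ2]) (enc_pos (b := 0) (by omega) v y)
  set ρ4 := Function.update ρ3 49 (posn (d1.A.E 0 v) y) with hρ4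
  have K4 : Smp ρ0 ρ4 a v Ea.length Ev.length (k + 1) c :=
    K2.of (fun r h1 h2 => by simp [hρ4, hρ3, show r ≠ 48 by omega, show r ≠ 49 by omega])
      (Keep.refl _ _).update.update
  have hpa : posn (d1.A.E 0 a) y ≤ n := by
    show posn Ea y ≤ n
    unfold posn; split_ifs with hh
    · have := List.idxOf_lt_length_iff.2 hh; omega
    · omega
  have hpv : posn (d1.A.E 0 v) y ≤ n := by
    show posn Ev y ≤ n
    unfold posn; split_ifs with hh
    · have := List.idxOf_lt_length_iff.2 hh; omega
    · omega
  have u4 : ρ4 60 = a := (K4.keep 60 le_rfl).trans K4.r60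
  have v4 : ρ4 61 = v := (K4.keep 61 (by omega)).trans K4.r61
  have r47 : ρ4 47 = y := by simp [hρ4, hρ3, hρ2]
  have r48 : ρ4 48 = posn Ea y := by simp [hρ4, hρ3, hd1, hEa]
  have r49 : ρ4 49 = posn Ev y := by simp [hρ4, hd1, hEv]
  have hmul : (if 0 < (if y = a then 1 else 0) + posn Ea y then 1 else 0) *
      (if 0 < (if y = v then 1 else 0) + posn Ev y then 1 else 0) = hit a v Ea Ev y := by
    unfold hit
    have e1 : 0 < (if y = a then 1 else 0) + posn Ea y ↔ y = a ∨ y ∈ Ea := by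
      rw [← posn_pos]; split_ifs with hh <;> simp [hh]
    have e2 : 0 < (if y = v then 1 else 0) + posn Ev y ↔ y = v ∨ y ∈ Ev := by
      rw [← posn_pos]; split_ifs with hh <;> simp [hh]
    simp only [e1, e2]
    split_ifs <;> simp_all
  have hh1 := hit_le a v Ea Ev y
  have t5 := hF.asg (d := d1) (ρ := ρ4) (r := 44)
    (e := .reg 44 + .bin .lt 0 (.bin .eq (.reg 47) (.reg 60) + .reg 48) *
      .bin .lt 0 (.bin .eq (.reg 47) (.reg 61) + .reg 49))
    (v := c + hit a v Ea Ev y) (k := 40)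
    (by
      simp only [Expr.uok_add, Expr.uok_reg, Expr.uok_mul, Expr.uok_lt, Expr.uok_ofNat, Expr.uok_eq,
        Expr.eval_eq, Expr.eval_reg, Expr.eval_lt, Expr.eval_mul, Expr.eval_add, Expr.eval_ofNat,
        r47, u4, v4, r48, r49, hmul, K4.r44]
      change posn Ea y ≤ n at hpa
      change posn Ev y ≤ n at hpv
      refine ⟨by omega, ⟨⟨by omega, ⟨by omega, by omega, ?_⟩⟩, ⟨by omega, by omega, ?_⟩, by omega⟩,
        by omega⟩ <;> split_ifs <;> omega)
    (by simp only [Expr.eval_eq, Expr.eval_reg, Expr.eval_lt, Expr.eval_mul, Expr.eval_add,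
        Expr.eval_ofNat, r47, u4, v4, r48, r49, hmul, K4.r44])
  set ρ5 := Function.update ρ4 44 (c + hit a v Ea Ev y) with hρ5
  have t6 := hF.asg (d := d1) (ρ := ρ5) (r := 43) (e := .reg 43 - 1) (v := k) (k := 10)
    (by simp; omega) (by simp [hρ5, K4.r43])
  refine ⟨_, (t1.seq (t2.seq (t3.seq (t4.seq (t5.seq t6))))).mono, ?_⟩
  refine ⟨by simp [hρ5, K4.r40], by simp [hρ5, K4.r41], by simp, by simp [hρ5], by simp [hρ5, K4.r45],
    K4.r60, K4.r61, by simp [hρ5, K4.r42], ?_⟩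
  exact K4.keep.update.update

/-- All samples of an invocation are drawn. -/
lemma sample_loop {t0 : ℕ} {Q : ℕ → ℕ → Prop} (h : Inv n t0 Q d.A) (han : a < n) (hvn : v < n)
    {ρ0 : ℕ → ℕ} {k c : ℕ} (hs : Smp ρ0 ρ a v (d.A.E 0 a).length (d.A.E 0 v).length k c)
    (hc : c + k < m.W) :
    ∃ ρ', Tr m.toMach (Rep m) (whl (.reg 43) sampleP) (k * (300 * B1 + 210) + 10) (d.vs ρ)
      (Dat.vs { d with draws := d.draws + k } ρ') ∧
      Smp ρ0 ρ' a v (d.A.E 0 a).length (d.A.E 0 v).length 0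
        (c + hits m.ω d.draws a v (d.A.E 0 a) (d.A.E 0 v) k) := by
  induction k generalizing d ρ c with
  | zero =>
    refine ⟨ρ, (Tr.while_done (ke := 2) (Val.user hF.good (by simp [Dat.vs, hs.r43]))).mono, ?_⟩
    simpa [hits] using hs
  | succ k ih =>
    obtain ⟨ρ1, t1, s1⟩ := hF.sample h han hvn hs (by omega)
    have hh := hit_le a v (d.A.E 0 a) (d.A.E 0 v) (pick a v (d.A.E 0 a) (d.A.E 0 v)
          (m.ω (d.draws, (d.A.E 0 a).length + (d.A.E 0 v).length + 1) : ℕ))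
    obtain ⟨ρ2, t2, s2⟩ := ih (d := { d with draws := d.draws + 1 }) h s1 (by omega)
    refine ⟨ρ2, ?_, ?_⟩
    · have := Tr.while_more (ke := 2) (v := k + 1) (e := .reg 43) (Val.user hF.good
        (by simp [Dat.vs, hs.r43])) (by omega) t1 t2
      have e : d.draws + 1 + k = d.draws + (k + 1) := by ring
      simp only [e] at this
      exact this.mono (by ring_nf; omega)
    · rw [hits_succ, ← add_assoc]
      exact s2

/-- The new label is computed in register `48`. -/
lemma decide {t0 : ℕ} {Q : ℕ → ℕ → Prop} (h : Inv n t0 Q d.A) (han : a < n) (hvn : v < n)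
    (hu : ρ 60 = a) (hw : ρ 61 = v) (hc : Counts ρ (d.A.calls.length + 1))
    (hi : d.A.calls.length + 1 ≤ I) :
    ∃ ρ', Tr m.toMach (Rep m) (decideP P)
      (P.L (d.A.calls.length + 1) * (300 * B1 + 210) + 200 * B1 + 100) (d.vs ρ)
      (Dat.vs { d with draws := d.draws + P.L (d.A.calls.length + 1) } ρ') ∧ Keep 60 ρ ρ' ∧
      ρ' 40 = (d.A.E 0 a).length ∧ ρ' 41 = (d.A.E 0 v).length ∧ ρ' 48 = d.bit P m.ω a v := by
  have hda := h.deg_lt han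
  have hdv := h.deg_lt hvn
  have hW := hF.word
  set Ea := d.A.E 0 a with hEa
  set Ev := d.A.E 0 v with hEv
  set i := d.A.calls.length + 1 with hie
  have hL := hF.word_L i hi
  have hLe : P.K0 * (Nat.size i + P.D) = P.L i := rfl
  have hK := hF.K0
  have hD := hF.D
  have b1 : P.K0 ≤ P.L i := Nat.le_mul_of_pos_right _ (by omega)
  have b2 : Nat.size i + P.D ≤ P.L i := Nat.le_mul_of_pos_left _ (by omega)
  set L := P.L i with hLd
  have t1 := hF.read (d := d) (ρ := ρ) (r := 40) (t := 0) (r1 := 60) (e2 := 0) (x := a) (i := 0) hu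
    (by simp) (enc_size (b := 0) (by omega) a)
  rw [← hEa] at t1
  set ρ1 := Function.update ρ 40 Ea.length with hρ1
  have t2 := hF.read (d := d) (ρ := ρ1) (r := 41) (t := 0) (r1 := 61) (e2 := 0) (x := v) (i := 0)
    (by simp [hρ1, hw]) (by simp) (enc_size (b := 0) (by omega) v)
  rw [← hEv] at t2
  set ρ2 := Function.update ρ1 41 Ev.length with hρ2
  have t3 := hF.asg (d := d) (ρ := ρ2) (r := 42) (e := .const P.K0 * (.reg 91 + .const P.D))
    (v := L) (k := 20) (by simp [hρ2, hρ1, hc.size, hLe]; omega) (by simp [hρ2, hρ1, hc.size, hLe])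
  set ρ3 := Function.update ρ2 42 L with hρ3
  have t4 := hF.asg (d := d) (ρ := ρ3) (r := 43) (e := .reg 42) (v := L) (k := 5) (by simp)
    (by simp [hρ3])
  set ρ4 := Function.update ρ3 43 L with hρ4
  have t5 := hF.asg (d := d) (ρ := ρ4) (r := 44) (e := 0) (v := 0) (k := 5) (by simp; omega)
    (by simp)
  set ρ5 := Function.update ρ4 44 0 with hρ5
  have t6 := hF.asg (d := d) (ρ := ρ5) (r := 45) (e := .reg 40 + .reg 41 + 2)
    (v := Ea.length + Ev.length + 2) (k := 10) (by simp [hρ5, hρ4, hρ3, hρ2, hρ1]; omega)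
    (by simp [hρ5, hρ4, hρ3, hρ2, hρ1])
  set ρ6 := Function.update ρ5 45 (Ea.length + Ev.length + 2) with hρ6
  have K6 : Keep 60 ρ ρ6 := (Keep.refl _ _).update.update.update.update.update.update
  have S6 : Smp ρ6 ρ6 a v Ea.length Ev.length L 0 :=
    ⟨by simp [hρ6, hρ5, hρ4, hρ3, hρ2, hρ1], by simp [hρ6, hρ5, hρ4, hρ3, hρ2], by simp [hρ6, hρ5, hρ4],
      by simp [hρ6, hρ5], by simp [hρ6], (K6 60 le_rfl).trans hu, (K6 61 (by omega)).trans hw, rfl,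
      Keep.refl _ _⟩
  have r42 : ρ6 42 = L := by simp [hρ6, hρ5, hρ4, hρ3]
  obtain ⟨ρ7, t7, S7⟩ := hF.sample_loop h han hvn S6 (by omega)
  rw [zero_add, ← hEa, ← hEv] at S7
  set hh := hits m.ω d.draws a v Ea Ev L with hhe
  have hhL : hh ≤ L := hits_le _ _ _ _ _ _ _
  set d1 : Dat := { d with draws := d.draws + L } with hd1
  have t8 := hF.asg (d := d1) (ρ := ρ7) (r := 46) (e := 2 * .reg 42 - .reg 44) (v := 2 * L - hh)
    (k := 10) (by simp [S7.r42, r42]; omega) (by simp [S7.r42, r42, S7.r44])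
  set ρ8 := Function.update ρ7 46 (2 * L - hh) with hρ8
  have hceil : ⌈P.θ 0 * ((2 * L - hh : ℕ) : ℝ)⌉₊ ≤ 2 * L - hh := by
    refine Nat.ceil_le.2 ?_
    exact mul_le_of_le_one_left (Nat.cast_nonneg _) hF.θ0.2
  set cl := ⌈P.θ 0 * ((2 * L - hh : ℕ) : ℝ)⌉₊ with hcl
  have t9 := Tr.scaleCeil (m := m) (s := d1.vs ρ8) (c := 0) (x := 47) (y := 46) (v := cl) (by omega)
    (by omega) (by rw [hF.θ]; simp [Dat.vs, hρ8, hcl]) (by omega)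
  change Tr _ _ _ _ _ (d1.vs (Function.update ρ8 47 cl)) at t9
  set ρ9 := Function.update ρ8 47 cl with hρ9
  have hbit : d.bit P m.ω a v = if hh < cl then 0 else 1 := rfl
  have t10 := hF.asg (d := d1) (ρ := ρ9) (r := 48) (e := 1 - .bin .lt (.reg 44) (.reg 47))
    (v := d.bit P m.ω a v) (k := 10) (by simp; omega)
    (by rw [hbit]; simp [hρ9, hρ8, S7.r44]; split_ifs <;> rfl)
  refine ⟨_, (t1.seq (t2.seq (t3.seq (t4.seq (t5.seq (t6.seq (t7.seq (t8.seq (t9.seq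
    t10))))))))).mono, ?_, by simp [hρ9, hρ8, S7.r40], by simp [hρ9, hρ8, S7.r41],
    by simp⟩
  exact (K6.trans S7.keep).update.update.update

lemma track {t0 : ℕ} {Q : ℕ → ℕ → Prop} (h : Inv n t0 Q d.A) (hX : 3 * t0 + n + 1 ≤ X) (han : a < n)
    (hvn : v < n) (hP : ∀ x < n, P.thr x ≤ n) {bit : ℕ}
    (hu : ρ 60 = a) (hw : ρ 61 = v) (h40 : ρ 40 = (d.A.E 0 a).length)
    (h41 : ρ 41 = (d.A.E 0 v).length) (h48 : ρ 48 = bit) (hz : d.Sz z) (hzc : z + 5 ≤ m.cap)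
    {d' : Dat} (hd' : d' = ⟨d.A.label P a v, upd2 d.lab a v bit, d.draws,
      if bit = d.lab a v then d.out else d.out ++ [(a, v)]⟩) :
    ∃ ρ', Tr m.toMach (Rep m) trackP (300 * B1 + 1600 * m.Bm + 100) (d.vs ρ) (d'.vs ρ') ∧
      Keep 60 ρ ρ' ∧ d'.Sz (z + 4) := by
  have hda := h.deg_lt han
  have hdv := h.deg_lt hvn
  have hW := hF.word
  have hca := h.c_le a
  have hcv := h.c_le v
  have t1 := hF.read (d := d) (ρ := ρ) (r := 49) (t := 9) (r1 := 60) (e2 := .reg 61) (x := a)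
    (i := v) hu (by simpa using hw) (enc_lab _ _)
  set ρ1 := Function.update ρ 49 (d.lab a v) with hρ1
  have u1 : ρ1 60 = a := by simp [hρ1, hu]
  have v1 : ρ1 61 = v := by simp [hρ1, hw]
  have b1 : ρ1 48 = bit := by simp [hρ1, h48]
  set o := if bit = d.lab a v then d.out else d.out ++ [(a, v)] with ho
  have V1 : Val m.toMach (Rep m) (.bin .eq (.reg 48) (.reg 49)) 10 (d.vs ρ1)
      (if bit = d.lab a v then 1 else 0) :=
    Val.user hF.good (by simp [Dat.vs, hρ1, h48])
  have t2 : Tr m.toMach (Rep m) (iff (.bin .eq (.reg 48) (.reg 49)) .skip (.emit 60 61)) 20 (d.vs ρ1)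
      (Dat.vs { d with out := o } ρ1) := by
    by_cases hb : bit = d.lab a v
    · rw [if_pos hb] at V1 ho
      rw [ho]
      exact (Tr.ite_true V1 one_ne_zero Tr.skip).mono
    · rw [if_neg hb] at V1 ho
      rw [ho]
      have := Tr.emit (m := m) (s := d.vs ρ1) (x := 60) (y := 61) (by omega) (by omega)
      have e : ({ d.vs ρ1 with out := (d.vs ρ1).out ++ [((d.vs ρ1).reg 60, (d.vs ρ1).reg 61)] } : VS) =
          Dat.vs { d with out := d.out ++ [(a, v)] } ρ1 := by
        simp only [Dat.vs, u1, v1]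
      rw [e] at this
      exact (Tr.ite_false V1 this).mono
  set d1 : Dat := { d with out := o } with hd1
  obtain ⟨t3, z3⟩ := hF.write (d := d1) (d' := { d1 with lab := upd d.lab a v bit }) (ρ := ρ1)
    (t := 9) (r1 := 60) (e2 := .reg 61) (e3 := .reg 48) (x := a) (i := v) (v := bit) (z := z) u1 v1
    b1 hz (enc_update_lab _ _ _)
  obtain ⟨t4, z4⟩ := hF.write (d := { d1 with lab := upd d.lab a v bit })
    (d' := { d1 with lab := upd2 d.lab a v bit }) (ρ := ρ1) (t := 9) (r1 := 61) (e2 := .reg 60)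
    (e3 := .reg 48) (x := v) (i := a) (v := bit) v1 u1 b1 z3 (enc_update_lab _ _ _)
  set d2 : Dat := { d1 with lab := upd2 d.lab a v bit } with hd2
  set da := (d.A.E 0 a).length with hda'
  set dv := (d.A.E 0 v).length with hdv'
  have hmax : da + (dv - da) = max da dv := by omega
  have hmaxn : max da dv < n := by omega
  have t5 := hF.asg (d := d2) (ρ := ρ1) (r := 46) (e := .reg 40 + (.reg 41 - .reg 40))
    (v := max da dv) (k := 10) (by simp [hρ1, h40, h41]; omega) (by simp [hρ1, h40, h41, hmax])
  set ρ2 := Function.update ρ1 46 (max da dv) with hρ2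
  have hthr := hP _ hmaxn
  have hthr' : P.thr (max da dv) = ⌊P.θ 1 * ((max da dv : ℕ) : ℝ)⌋₊ + 1 := rfl
  set fl := ⌊P.θ 1 * ((max da dv : ℕ) : ℝ)⌋₊ with hfl
  have t6 := Tr.scaleFloor (m := m) (s := d2.vs ρ2) (c := 1) (x := 47) (y := 46) (v := fl) (by omega)
    (by omega) (by rw [hF.θ]; simp only [Dat.vs, hρ2, Function.update_self, hfl]) (by omega)
  change Tr _ _ _ _ _ (d2.vs (Function.update ρ2 47 fl)) at t6
  set ρ3 := Function.update ρ2 47 fl with hρ3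
  have t7 := hF.read (d := d2) (ρ := ρ3) (r := 50) (t := 6) (r1 := 60) (e2 := 0) (x := a) (i := 0)
    (by simp [hρ3, hρ2, u1]) (by simp) (enc_c _)
  set ρ4 := Function.update ρ3 50 (d2.A.c a) with hρ4
  have t8 := hF.read (d := d2) (ρ := ρ4) (r := 51) (t := 6) (r1 := 61) (e2 := 0) (x := v) (i := 0)
    (by simp [hρ4, hρ3, hρ2, v1]) (by simp) (enc_c _)
  set ρ5 := Function.update ρ4 51 (d2.A.c v) with hρ5
  have ecA : d2.A = d.A := rfl
  have t9 := hF.asg (d := d2) (ρ := ρ5) (r := 47) (e := .reg 47 + 1 + .reg 50 + .reg 51)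
    (v := P.thr (max da dv) + d.A.c a + d.A.c v) (k := 20) (by simp [hρ5, hρ4, hρ3, ecA]; omega)
    (by simp [hρ5, hρ4, hρ3, ecA, hthr'])
  set Y := P.thr (max da dv) + d.A.c a + d.A.c v with hY
  set ρ6 := Function.update ρ5 47 Y with hρ6
  have K6 : Keep 60 ρ ρ6 := (Keep.refl _ _).update.update.update.update.update.update
  have u6 : ρ6 60 = a := (K6 60 (by omega)).trans hu
  have v6 : ρ6 61 = v := (K6 61 (by omega)).trans hw
  obtain ⟨t10, z10⟩ := hF.write (d := d2) (d' := { d2 with A := { d.A with T := upd d.A.T a v Y } })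
    (ρ := ρ6) (t := 7) (r1 := 60) (e2 := .reg 61) (e3 := .reg 47) (x := a) (i := v) (v := Y) u6 v6
    (by simp [hρ6]) z4 (enc_update_T _ _ _)
  obtain ⟨t11, z11⟩ := hF.write (d := { d2 with A := { d.A with T := upd d.A.T a v Y } }) (d' := d')
    (ρ := ρ6) (t := 7) (r1 := 61) (e2 := .reg 60) (e3 := .reg 47) (x := v) (i := a) (v := Y)
    (hdr := by rw [hd']) (hout := by rw [hd']) v6 u6 (by simp [hρ6]) z10
    (by rw [hd', enc_update_T]; rfl)
  refine ⟨ρ6, ?_, K6, z11⟩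
  exact (t1.seq (t2.seq (t3.seq (t4.seq (t5.seq (t6.seq (t7.seq (t8.seq (t9.seq (t10.seq
    t11)))))))))).mono

lemma label {t0 : ℕ} {Q : ℕ → ℕ → Prop} (h : Inv n t0 Q d.A) (hX : 3 * t0 + n + 1 ≤ X) (han : a < n)
    (hvn : v < n) (hP : ∀ x < n, P.thr x ≤ n)
    (hu : ρ 60 = a) (hw : ρ 61 = v) (hc : Counts ρ d.A.calls.length)
    (hi : d.A.calls.length + 1 ≤ I) (hz : d.Sz z) (hzc : z + 5 ≤ m.cap) :
    ∃ ρ', Tr m.toMach (Rep m) (labelP P)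
      (P.L (d.A.calls.length + 1) * (300 * B1 + 210) + 500 * B1 + 1600 * m.Bm + 260) (d.vs ρ)
      ((d.label P m.ω a v).vs ρ') ∧ Same 60 ρ ρ' ∧ Counts ρ' (d.label P m.ω a v).A.calls.length ∧
      (d.label P m.ω a v).Sz (z + 4) := by
  obtain ⟨ρ1, t1, s1, c1⟩ := hF.count (d := d) hc hi
  obtain ⟨ρ2, t2, k2, e40, e41, e48⟩ := hF.decide h han hvn ((s1 60 le_rfl (by omega)).trans hu)
    ((s1 61 (by omega) (by omega)).trans hw) c1 hi
  have k2' := k2.same (l := 60) le_rfl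
  have s2 := s1.trans k2'
  obtain ⟨ρ3, t3, k3, z3⟩ := hF.track (d := { d with draws := d.draws + P.L (d.A.calls.length + 1) })
    (ρ := ρ2) h hX han hvn hP ((s2 60 le_rfl (by omega)).trans hu)
    ((s2 61 (by omega) (by omega)).trans hw) e40 e41 e48 hz hzc (d' := d.label P m.ω a v) rfl
  refine ⟨ρ3, (t1.seq (t2.seq t3)).mono, s2.trans (k3.same le_rfl), ?_, z3⟩
  have := k3.counts (k2.counts c1)
  simpa [Aux.label] using this

end Fit


/-! ### The size of the data -/

/-- The number of ordered pairs of adjacent vertices. -/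
def Aux.arcs (n : ℕ) (A : Aux) : ℕ :=
  ((Finset.range n ×ˢ Finset.range n).filter fun p => p.2 ∈ A.E 0 p.1).card

/-- Only edges carry labels. -/
def Dat.LabOff (d : Dat) : Prop := ∀ u v, v ∉ d.A.E 0 u → d.lab u v = 0

/-- The virtual memory has `O(n + m)` nonzero cells: each cell belongs to a vertex, or to an edge with a
direction. -/
lemma Inv.sz {n t : ℕ} {Q : ℕ → ℕ → Prop} {d : Dat} (h : Inv n t Q d.A) (hl : d.LabOff) :
    d.Sz (2 * n + 8 * d.A.arcs n) := by
  classical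
  set F := (Finset.range n ×ˢ Finset.range n).filter fun p => p.2 ∈ d.A.E 0 p.1 with hF
  have memF : ∀ {u v}, v ∈ d.A.E 0 u → (u, v) ∈ F := fun {u v} e => by
    have := h.lt e
    simp [hF, e, this.1, this.2.1]
  set key : ℕ × ℕ → ℕ := fun p => Nat.pair p.1 (d.A.al p.1 p.2) with hkey
  let S : Finset (ℕ × ℕ × ℕ) :=
    (Finset.range n).image (fun x => (0, x, 0)) ∪ (Finset.range n).image (fun x => (6, x, 0)) ∪
    F.image (fun p => (1, p.1, (d.A.E 0 p.1).idxOf p.2)) ∪ F.image (fun p => (2, p.1, p.2)) ∪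
    F.image (fun p => (3, key p, 0)) ∪ F.image (fun p => (4, key p, (d.A.E 1 (key p)).idxOf p.2)) ∪
    F.image (fun p => (5, key p, p.2)) ∪ F.image (fun p => (7, p.1, p.2)) ∪
    F.image (fun p => (8, p.1, p.2)) ∪ F.image (fun p => (9, p.1, p.2))
  have hedge : ∀ {k v}, v ∈ d.A.E 1 k → ∃ u, (u, v) ∈ F ∧ key (u, v) = k := fun {k v} e => by
    rw [← Nat.pair_unpair k, h.bkt] at e
    refine ⟨_, memF (h.Qadj e.1), ?_⟩
    rw [hkey]
    simp only [e.2, Nat.pair_unpair]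
  refine ⟨S, fun c hc => ?_, ?_⟩
  · obtain ⟨t, x, i⟩ := c
    simp only [enc] at hc
    simp only [S, Finset.mem_union, Finset.mem_image, Finset.mem_range, Prod.mk.injEq, or_assoc]
    by_cases ht : t < 6
    · rw [if_pos ht] at hc
      unfold encSet at hc
      by_cases h0 : t % 3 = 0
      · rw [if_pos h0] at hc
        have hi : i = 0 := by by_contra hi; rw [if_neg hi] at hc; exact hc rfl
        rw [if_pos hi] at hc
        obtain ⟨v, hv⟩ := List.exists_mem_of_length_pos (Nat.pos_of_ne_zero hc)
        obtain rfl | rfl : t = 0 ∨ t = 3 := by omega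
        · exact .inl ⟨x, (h.lt hv).1, rfl, rfl, hi.symm⟩
        · obtain ⟨u, h1, h2⟩ := hedge hv
          exact .inr (.inr (.inr (.inr (.inl ⟨(u, v), h1, rfl, h2, hi.symm⟩))))
      · rw [if_neg h0] at hc
        by_cases h1 : t % 3 = 1
        · rw [if_pos h1] at hc
          have hi : i < (d.A.E (t / 3) x).length := by
            by_contra hi
            exact hc (List.getD_eq_default _ _ (by omega))
          have hm := List.getElem_mem hi
          obtain rfl | rfl : t = 1 ∨ t = 4 := by omega
          · exact .inr (.inr (.inl ⟨(x, _), memF hm, rfl, rfl, (h.nd _ _).idxOf_getElem _ hi⟩))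
          · obtain ⟨u, h2, h3⟩ := hedge hm
            refine .inr (.inr (.inr (.inr (.inr (.inl ⟨(u, _), h2, rfl, h3, ?_⟩)))))
            rw [h3]
            exact (h.nd _ _).idxOf_getElem _ hi
        · rw [if_neg h1] at hc
          have hm : i ∈ d.A.E (t / 3) x := by
            by_contra hi
            exact hc (if_neg hi)
          obtain rfl | rfl : t = 2 ∨ t = 5 := by omega
          · exact .inr (.inr (.inr (.inl ⟨(x, i), memF hm, rfl, rfl, rfl⟩)))
          · obtain ⟨u, h2, h3⟩ := hedge hm
            exact .inr (.inr (.inr (.inr (.inr (.inr (.inl ⟨(u, i), h2, rfl, h3, rfl⟩))))))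
    · rw [if_neg ht] at hc
      by_cases h6 : t = 6
      · rw [if_pos h6] at hc
        have hi : i = 0 := by by_contra hi; rw [if_neg hi] at hc; exact hc rfl
        rw [if_pos hi] at hc
        refine .inr (.inl ⟨x, ?_, h6.symm, rfl, hi.symm⟩)
        by_contra hx
        exact hc (h.c_zero x (by omega))
      · rw [if_neg h6] at hc
        have hm : i ∈ d.A.E 0 x := by
          by_contra hm
          have h1 := h.off hm
          have h2 := hl _ _ hm
          rw [h1.1, h1.2, h2] at hc
          simp at hc
        obtain h7 | h7 | h7 | h7 : t = 7 ∨ t = 8 ∨ t = 9 ∨ (t ≠ 7 ∧ t ≠ 8 ∧ t ≠ 9) := by omega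
        · exact .inr (.inr (.inr (.inr (.inr (.inr (.inr (.inl ⟨(x, i), memF hm, h7.symm, rfl, rfl⟩)))))))
        · exact .inr (.inr (.inr (.inr (.inr (.inr (.inr (.inr (.inl ⟨(x, i), memF hm, h7.symm, rfl, rfl⟩))))))))
        · exact .inr (.inr (.inr (.inr (.inr (.inr (.inr (.inr (.inr ⟨(x, i), memF hm, h7.symm, rfl, rfl⟩))))))))
        · rw [if_neg h7.1, if_neg h7.2.1, if_neg h7.2.2] at hc
          exact absurd rfl hc
  · have hA : d.A.arcs n = F.card := rfl
    have c1 : ∀ (f : ℕ → ℕ × ℕ × ℕ), ((Finset.range n).image f).card ≤ n := fun f =>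
      Finset.card_image_le.trans (by simp)
    have c2 : ∀ (f : ℕ × ℕ → ℕ × ℕ × ℕ), (F.image f).card ≤ F.card := fun f => Finset.card_image_le
    have cu : ∀ {a b : Finset (ℕ × ℕ × ℕ)} {p q : ℕ}, a.card ≤ p → b.card ≤ q →
        (a ∪ b).card ≤ p + q := fun ha hb => (Finset.card_union_le _ _).trans (add_le_add ha hb)
    have := cu (cu (cu (cu (cu (cu (cu (cu (cu (c1 fun x => (0, x, 0)) (c1 fun x => (6, x, 0)))
      (c2 (fun p => (1, p.1, (d.A.E 0 p.1).idxOf p.2)))) (c2 (fun p => (2, p.1, p.2))))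
      (c2 (fun p => (3, key p, 0)))) (c2 (fun p => (4, key p, (d.A.E 1 (key p)).idxOf p.2))))
      (c2 (fun p => (5, key p, p.2)))) (c2 (fun p => (7, p.1, p.2)))) (c2 (fun p => (8, p.1, p.2))))
      (c2 (fun p => (9, p.1, p.2)))
    rw [hA]
    refine this.trans (by omega)

lemma Dat.LabOff.label {d : Dat} (h : d.LabOff) {a v : ℕ} (h1 : v ∈ d.A.E 0 a) (h2 : a ∈ d.A.E 0 v)
    (P : Par) (ω : Tape) : (d.label P ω a v).LabOff := by
  intro x y e
  have e' : y ∉ d.A.E 0 x := e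
  show upd2 d.lab a v _ x y = 0
  rw [upd2_apply, if_neg]
  · exact h x y e'
  · rintro (⟨rfl, rfl⟩ | ⟨rfl, rfl⟩)
    exacts [e' h2, e' h1]

lemma Dat.LabOff.congr {d d' : Dat} (h : d.LabOff) (hE : d'.A.E 0 = d.A.E 0) (hl : d'.lab = d.lab) :
    d'.LabOff := by
  intro x y e
  rw [hE] at e
  rw [hl]
  exact h x y e

lemma Dat.LabOff.eval {d : Dat} (h : d.LabOff) {a v : ℕ} (h1 : v ∈ d.A.E 0 a) (h2 : a ∈ d.A.E 0 v)
    (P : Par) (ω : Tape) : (d.eval P ω a v).LabOff := by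
  have hu : (Dat.mk (d.A.unplace a v) d.lab d.draws d.out).LabOff :=
    h.congr (funext fun x => Aux.unplace_E0 _ _ _ _) rfl
  have hl := hu.label (a := a) (v := v) (by simpa using h1) (by simpa using h2) P ω
  unfold Dat.eval
  by_cases hm : d.A.T a v = d.A.c a + d.A.c v
  · refine hl.congr (funext fun x => ?_) ?_ <;> simp [hm]
  · refine hu.congr (funext fun x => ?_) ?_ <;> simp [hm]

lemma Aux.calls_eval (P : Par) (A : Aux) (a v : ℕ) : A.calls <+: (A.eval P a v).calls := by
  unfold Aux.eval
  split_ifs <;> simp [Aux.label]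

lemma Aux.calls_scanN (P : Par) (A : Aux) (a k : ℕ) : A.calls <+: (A.scanN P a k).calls := by
  induction k generalizing A with
  | zero => exact List.prefix_refl _
  | succ k ih => exact (A.calls_eval P a _).trans (ih _)

lemma Aux.calls_arrive (P : Par) (A : Aux) (ins : Bool) (u w : ℕ) :
    A.calls <+: (A.arrive P ins u w).calls := by
  unfold Aux.arrive
  split_ifs
  · simp [Aux.label, Aux.tick, Aux.link, Aux.add]
  · exact List.prefix_refl _

namespace Fit
variable {m : VM} {P : Par} {n X I B1 : ℕ} (hF : Fit m P n X I B1) {d : Dat} {ρ : ℕ → ℕ} {z : ℕ}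
  {a v i Λ : ℕ} {t0 : ℕ} {Q : ℕ → ℕ → Prop} {S : Set ℕ} (hP : ∀ x < n, P.thr x ≤ n)
  (hΛ : ∀ i ≤ I, P.L i * (300 * B1 + 210) + 500 * B1 + 1600 * m.Bm + 260 ≤ Λ)
include hF hP hΛ

lemma eval (h : Inv n t0 Q d.A) (hC : Calm Q S d.A) (hX : 3 * t0 + n + 1 ≤ X) (ha : a ∈ S)
    (hv : v ∈ d.A.E 1 (Nat.pair a (d.A.c a))) (hu : ρ 60 = a) (hw : ρ 61 = v)
    (hc : Counts ρ d.A.calls.length) (hi : (d.A.eval P a v).calls.length ≤ I) (hz : d.Sz z)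
    (hzc : z + 30 ≤ m.cap) :
    ∃ ρ', Tr m.toMach (Rep m) (evalP P)
      (10000 * m.Bm + ((d.A.eval P a v).calls.length - d.A.calls.length) * Λ) (d.vs ρ)
      ((d.eval P m.ω a v).vs ρ') ∧ Same 60 ρ ρ' ∧ Counts ρ' (d.A.eval P a v).calls.length := by
  obtain ⟨q, hal⟩ := (h.bkt _ _ _).1 hv
  have hadj := h.Qadj q
  obtain ⟨han, hvn, hne⟩ := h.lt hadj
  have hW := hF.word
  have hBl := hF.bits_le
  have hB7 := (hF.good.B_ge 0).trans (hF.good.B_le 0)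
  have hT := h.T_le a v
  have hca := h.c_le a
  have hcv := h.c_le v
  have t1 := hF.read (d := d) (ρ := ρ) (r := 40) (t := 7) (r1 := 60) (e2 := .reg 61) (x := a)
    (i := v) hu (by simpa using hw) (enc_T _ _)
  set ρ1 := Function.update ρ 40 (d.A.T a v) with hρ1
  have t2 := hF.read (d := d) (ρ := ρ1) (r := 41) (t := 6) (r1 := 60) (e2 := 0) (x := a) (i := 0)
    (by simp [hρ1, hu]) (by simp) (enc_c _)
  set ρ2 := Function.update ρ1 41 (d.A.c a) with hρ2
  have t3 := hF.read (d := d) (ρ := ρ2) (r := 42) (t := 6) (r1 := 61) (e2 := 0) (x := v) (i := 0)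
    (by simp [hρ2, hρ1, hw]) (by simp) (enc_c _)
  set ρ3 := Function.update ρ2 42 (d.A.c v) with hρ3
  set mt := if d.A.T a v = d.A.c a + d.A.c v then 1 else 0 with hmt
  have t4 := hF.asg (d := d) (ρ := ρ3) (r := 55) (e := .bin .eq (.reg 40) (.reg 41 + .reg 42))
    (v := mt) (k := 20) (by simp [hρ3, hρ2, hρ1]; omega) (by simp [hρ3, hρ2, hρ1, hmt])
  set ρ4 := Function.update ρ3 55 mt with hρ4
  have K4 : Keep 60 ρ ρ4 := (Keep.refl _ _).update.update.update.update
  have u4 : ρ4 60 = a := (K4 60 (by omega)).trans hu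
  have v4 : ρ4 61 = v := (K4 61 (by omega)).trans hw
  obtain ⟨ρ5, t5, k5, z5⟩ := hF.unplace (d := d) h hX u4 v4 q hz (by omega)
  have m5 : ρ5 55 = mt := by rw [k5 _ (by omega)]; simp [hρ4]
  have K5 : Keep 60 ρ ρ5 := K4.trans k5.mono
  set d1 : Dat := { d with A := d.A.unplace a v } with hd1
  obtain ⟨hu1, -, -⟩ := h.unplace q
  set A2 := if d.A.T a v = d.A.c a + d.A.c v then (d.A.unplace a v).label P a v else d.A.unplace a v
    with hA2
  obtain ⟨g1, g2, g3, e1, e2, e3, e4, e5⟩ := h.eval_mid hP hC ha q hal hA2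
  set d2 : Dat := if d.A.T a v = d.A.c a + d.A.c v then d1.label P m.ω a v else d1 with hd2
  have hd2A : d2.A = A2 := by
    rw [hd2, hA2]; split_ifs <;> rfl
  have hev : d.eval P m.ω a v =
      { d2 with A := Aux.place { d2.A with ne := d2.A.ne + 1 } a v } := rfl
  have hcalls : (d.A.eval P a v).calls = A2.calls := rfl
  rw [hcalls] at hi ⊢
  have V : Val m.toMach (Rep m) (.reg 55) 2 (d1.vs ρ5) mt :=
    Val.user hF.good (by simp [Dat.vs, m5])
  have t6 : ∃ ρ6, Tr m.toMach (Rep m) (iff (.reg 55) (labelP P) .skip)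
      (10 + (A2.calls.length - d.A.calls.length) * Λ) (d1.vs ρ5) (d2.vs ρ6) ∧ Same 60 ρ5 ρ6 ∧
      Counts ρ6 A2.calls.length ∧ d2.Sz (z + 14) := by
    by_cases hm : d.A.T a v = d.A.c a + d.A.c v
    · have hmt1 : mt = 1 := if_pos hm
      have e6 : A2.calls.length = d.A.calls.length + 1 := by
        rw [hA2, if_pos hm]; simp [Aux.label]
      obtain ⟨ρ6, t6, s6, c6, z6⟩ := hF.label (d := d1) (ρ := ρ5) hu1 hX han hvn hP
        ((K5 60 (by omega)).trans hu) ((K5 61 (by omega)).trans hw) (K5.counts hc)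
        (by simp only [hd1, Aux.unplace_calls]; omega) z5 (by omega)
      have hd2' : d2 = d1.label P m.ω a v := if_pos hm
      rw [hmt1] at V
      rw [hd2']
      refine ⟨ρ6, (Tr.ite_true V one_ne_zero t6).mono ?_, s6, ?_, z6⟩
      · have := hΛ (d1.A.calls.length + 1) (by simp only [hd1, Aux.unplace_calls]; omega)
        rw [e6, Nat.add_sub_cancel_left, one_mul]
        exact (Nat.add_le_add_right (Nat.add_le_add_left this 2) 1).trans (by omega)
      · have : (d1.label P m.ω a v).A.calls = A2.calls := by rw [← hd2A, hd2']
        rw [← this]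
        exact c6
    · have hmt0 : mt = 0 := if_neg hm
      have e6 : A2.calls = d.A.calls := by rw [hA2, if_neg hm]; rfl
      have hd2' : d2 = d1 := if_neg hm
      rw [hmt0] at V
      rw [hd2']
      exact ⟨ρ5, (Tr.ite_false V Tr.skip).mono, Same.refl _ _,
        by rw [e6]; exact K5.counts hc, z5.mono (by omega)⟩
  obtain ⟨ρ6, t6, s6, c6, z6⟩ := t6
  have g1' := g1.ne_inc (A2.ne + 1)
  obtain ⟨ρ7, t7, k7, -⟩ := hF.place (d := { d2 with A := { d2.A with ne := d2.A.ne + 1 } }) (ρ := ρ6)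
    (by simp only [hd2A]; exact g1') hX
    ((s6 60 le_rfl (by omega)).trans ((K5 60 (by omega)).trans hu))
    ((s6 61 (by omega) (by omega)).trans ((K5 61 (by omega)).trans hw))
    (by simp only [hd2A]; exact g2) (except_not Q a v) (by simp only [hd2A]; exact g3) z6 (by omega)
  rw [hev]
  refine ⟨ρ7, (t1.seq (t2.seq (t3.seq (t4.seq (t5.seq (t6.seq t7)))))).mono,
    (K5.same le_rfl).trans (s6.trans k7.same), k7.counts c6⟩

lemma scan_loop (h : Inv n t0 Q d.A) (hC : Calm Q S d.A) (hX : 3 * t0 + n + 1 ≤ X) (ha : a ∈ S)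
    (hl : d.LabOff) {k : ℕ} (hk : d.A.due a = k) (han : a < n) (hu : ρ 62 = a)
    (h63 : ρ 63 = Nat.pair a (d.A.c a)) (h64 : ρ 64 = k)
    (hc : Counts ρ d.A.calls.length) (hi : (d.A.scanN P a k).calls.length ≤ I)
    (hzc : 2 * n + 8 * d.A.arcs n + 30 ≤ m.cap) :
    ∃ ρ', Tr m.toMach (Rep m)
      (whl (.reg 64) (rd 61 4 (.reg 63) 0 ;; set 60 (.reg 62) ;; evalP P ;; rd 64 3 (.reg 63) 0))
      (k * (10500 * m.Bm) + ((d.A.scanN P a k).calls.length - d.A.calls.length) * Λ + 10) (d.vs ρ)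
      ((d.scanN P m.ω a k).vs ρ') ∧ Same 70 ρ ρ' ∧ Counts ρ' (d.A.scanN P a k).calls.length ∧
      (d.scanN P m.ω a k).LabOff := by
  induction k generalizing d ρ with
  | zero =>
    exact ⟨ρ, (Tr.while_done (ke := 2) (Val.user hF.good (by simp [Dat.vs, h64]))).mono, Same.refl _ _, hc, hl⟩
  | succ k ih =>
    have hB7 := (hF.good.B_ge 0).trans (hF.good.B_le 0)
    have hca := h.c_le a
    have hmem := Aux.head_mem hk
    obtain ⟨q, -⟩ := (h.bkt _ _ _).1 hmem
    have hadj := h.Qadj q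
    obtain ⟨g1, g2, g3, g4, g5, g6, -⟩ := h.eval hP hC ha hmem
    set b := d.A.head a with hb
    have t1 := hF.readB (d := d) (ρ := ρ) (r := 61) (t := 4) (r1 := 63) (u := a) (a := d.A.c a)
      (v := b) h63 (enc_elt (b := 1) (by omega) _ _)
    set ρ1 := Function.update ρ 61 b with hρ1
    have t2 := hF.asg (d := d) (ρ := ρ1) (r := 60) (e := .reg 62) (v := a) (k := 5) (by simp)
      (by simp [hρ1, hu])
    set ρ2 := Function.update ρ1 60 a with hρ2
    have K2 : Keep 62 ρ ρ2 := (Keep.refl _ _).update.update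
    have hmono := ((d.A.eval P a b).calls_scanN P a k).length_le
    have hmono' := (d.A.calls_eval P a b).length_le
    change (Aux.scanN P a k (d.A.eval P a b)).calls.length ≤ I at hi
    obtain ⟨ρ3, t3, s3, c3⟩ := hF.eval hP hΛ (d := d) (ρ := ρ2) h hC hX ha hmem (by simp [hρ2])
      (by simp [hρ2, hρ1]) (K2.counts hc) (by omega) (h.sz hl) (by omega)
    have eA := Dat.eval_A P m.ω d a b
    have s3' : Same 62 ρ ρ3 := (K2.same le_rfl).trans s3.mono
    have r63 : ρ3 63 = Nat.pair a (d.A.c a) := (s3' _ (by omega) (by omega)).trans h63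
    have hk' : (d.A.eval P a b).due a = k := by omega
    have t4 := hF.readB (d := d.eval P m.ω a b) (ρ := ρ3) (r := 64) (t := 3) (r1 := 63) (u := a)
      (a := d.A.c a) (v := k) r63
      (by
        refine (enc_size (A := (d.eval P m.ω a b).A) (lab := (d.eval P m.ω a b).lab) (b := 1)
          (by omega) (Nat.pair a (d.A.c a))).trans ?_
        rw [← hk']; unfold Aux.due; rw [eA, g4])
    set ρ4 := Function.update ρ3 64 k with hρ4
    have harcs : (d.eval P m.ω a b).A.arcs n = d.A.arcs n := by
      unfold Aux.arcs
      rw [eA, g5]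
    obtain ⟨ρ5, t5, s5, c5, l5⟩ := ih (d := d.eval P m.ω a b) (ρ := ρ4) (by rw [eA]; exact g1)
      (by rw [eA]; exact g2) (hl.eval hadj (h.sym hadj) P m.ω) (by rw [eA]; exact hk')
      (by simp [hρ4]; rw [s3' _ (by omega) (by omega), hu])
      (by simp [hρ4]; rw [r63, eA, g4]) (by simp [hρ4])
      (by rw [eA]; exact c3.congr (by simp [hρ4]) (by simp [hρ4]) (by simp [hρ4]))
      (by rw [eA]; exact hi) (by rw [harcs]; exact hzc)
    rw [eA] at t5 c5
    refine ⟨ρ5, ?_, ?_, c5, l5⟩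
    · have := Tr.while_more (ke := 2) (v := k + 1) (e := .reg 64) (Val.user hF.good
        (by simp [Dat.vs, h64])) (by omega) (t1.seq (t2.seq (t3.seq t4))) t5
      refine this.mono ?_
      change _ ≤ (k + 1) * (10500 * m.Bm) +
        ((Aux.scanN P a k (d.A.eval P a b)).calls.length - d.A.calls.length) * Λ + 10
      have e : (Aux.scanN P a k (d.A.eval P a b)).calls.length - d.A.calls.length =
        ((Aux.scanN P a k (d.A.eval P a b)).calls.length - (d.A.eval P a b).calls.length) +
        ((d.A.eval P a b).calls.length - d.A.calls.length) := by omega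
      rw [e]
      ring_nf
      omega
    · exact (s3'.mono).trans (Same.trans (fun r h1 _ => by
        simp [hρ4, show r ≠ 64 by omega]) s5)

lemma scan (h : Inv n t0 Q d.A) (hC : Calm Q S d.A) (hX : 3 * t0 + n + 1 ≤ X) (ha : a ∈ S)
    (hl : d.LabOff) (han : a < n) (hu : ρ 62 = a)
    (hc : Counts ρ d.A.calls.length) (hi : (d.A.scanN P a (d.A.due a)).calls.length ≤ I)
    (hzc : 2 * n + 8 * d.A.arcs n + 30 ≤ m.cap) :
    ∃ ρ', Tr m.toMach (Rep m) (scanP P) (d.A.due a * (10500 * m.Bm) +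
        ((d.A.scanN P a (d.A.due a)).calls.length - d.A.calls.length) * Λ + 250 * m.Bm) (d.vs ρ)
      ((d.scan P m.ω a).vs ρ') ∧ Same 70 ρ ρ' ∧
      Counts ρ' (d.A.scanN P a (d.A.due a)).calls.length ∧ (d.scan P m.ω a).LabOff := by
  have hB7 := (hF.good.B_ge 0).trans (hF.good.B_le 0)
  have hBl := hF.bits_le
  have hca := h.c_le a
  have hW := hF.word
  have t1 := hF.read (d := d) (ρ := ρ) (r := 63) (t := 6) (r1 := 62) (e2 := 0) (x := a) (i := 0) hu
    (by simp) (enc_c _)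
  set ρ1 := Function.update ρ 63 (d.A.c a) with hρ1
  have t2 := hF.asg (d := d) (ρ := ρ1) (r := 63) (e := .pair (.reg 62) (.reg 63))
    (v := Nat.pair a (d.A.c a)) (k := 70) (hk := by simp [Expr.pair])
    (hF.uok_pair (by omega) (by omega) (by simp [hρ1]; omega) (by simp [hρ1]; omega))
    (by simp [hρ1, hu])
  set ρ2 := Function.update ρ1 63 (Nat.pair a (d.A.c a)) with hρ2
  have t3 := hF.readB (d := d) (ρ := ρ2) (r := 64) (t := 3) (r1 := 63) (u := a) (a := d.A.c a)
    (v := d.A.due a) (by simp [hρ2]) (enc_size (b := 1) (by omega) _)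
  set ρ3 := Function.update ρ2 64 (d.A.due a) with hρ3
  obtain ⟨ρ4, t4, s4, c4, l4⟩ := hF.scan_loop hP hΛ (d := d) (ρ := ρ3) h hC hX ha hl rfl han
    (by simp [hρ3, hρ2, hρ1, hu]) (by simp [hρ3, hρ2]) (by simp [hρ3])
    (hc.congr (by simp [hρ3, hρ2, hρ1]) (by simp [hρ3, hρ2, hρ1]) (by simp [hρ3, hρ2, hρ1])) hi hzc
  refine ⟨ρ4, (t1.seq (t2.seq (t3.seq t4))).mono, Same.trans (fun r h1 _ => ?_) s4, c4, l4⟩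
  simp [hρ3, hρ2, hρ1, show r ≠ 63 by omega, show r ≠ 64 by omega]

end Fit


lemma Dat.LabOff.cut {n t : ℕ} {Q : ℕ → ℕ → Prop} {d : Dat} (hl : d.LabOff) (h : Inv n t Q d.A)
    {u w : ℕ} (hQ : Q u w) : (d.cut u w).LabOff := by
  obtain ⟨-, h2, -, -⟩ := h.cut hQ
  intro x y e
  have e' : ¬ (d.A.cut u w).adj x y := e
  rw [h2] at e'
  show upd2 d.lab u w 0 x y = 0
  rw [upd2_apply]
  split_ifs with hxy
  · rfl
  · refine hl x y fun e3 => e' ⟨e3, ?_⟩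
    tauto

lemma Dat.arrive_LabOff {n t : ℕ} {Q : ℕ → ℕ → Prop} {d : Dat} (hl : d.LabOff) (h : Inv n t Q d.A)
    {u w : ℕ} {ins : Bool} (hQ : Q = d.A.adj) (hu : u < n) (hw : w < n) (huw : u ≠ w)
    (hins : ins = true ↔ ¬ d.A.adj u w) (P : Par) (ω : Tape) : (d.arrive P ω ins u w).LabOff := by
  cases hi : ins with
  | true =>
    obtain ⟨-, h2, -, -⟩ := h.link hu hw huw (hins.1 hi)
    set d1 : Dat := { d with A := ((d.A.link u w).tick u).tick w } with hd1
    have l1 : d1.LabOff := by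
      intro x y e
      have e' : ¬ (d.A.link u w).adj x y := e
      rw [h2] at e'
      exact hl x y fun e3 => e' (.inl e3)
    have l2 := l1.label (a := u) (v := w) ((h2 u w).2 (.inr (.inl ⟨rfl, rfl⟩)))
      ((h2 w u).2 (.inr (.inr ⟨rfl, rfl⟩))) P ω
    exact l2.congr (funext fun x => by simp [Dat.arrive, ← hd1]) (by simp [Dat.arrive, ← hd1])
  | false =>
    have hq : Q u w := by
      rw [hQ]
      by_contra hq
      have := hins.2 hq
      rw [hi] at this
      cases this
    exact (hl.cut h hq).congr rfl rfl

namespace Fit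
variable {m : VM} {P : Par} {n X I B1 : ℕ} (hF : Fit m P n X I B1) {d : Dat} {ρ : ℕ → ℕ} {z : ℕ}
  {u w r i Λ : ℕ} {t0 : ℕ} {Q : ℕ → ℕ → Prop}
include hF

lemma tick (hr : 50 ≤ r ∧ r < 100) (hu : ρ r = u) (hun : u < n) (hc : d.A.c u ≤ X) (hz : d.Sz z)
    (hzc : z + 1 ≤ m.cap) :
    ∃ ρ', Tr m.toMach (Rep m) (tickP r) (500 * m.Bm) (d.vs ρ)
      (Dat.vs { d with A := d.A.tick u } ρ') ∧ Keep 50 ρ ρ' ∧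
      Dat.Sz { d with A := d.A.tick u } (z + 1) := by
  have hBl := hF.bits_le
  have hW := hF.word
  have t1 := hF.read (d := d) (ρ := ρ) (r := 40) (t := 6) (r1 := r) (e2 := 0) (x := u) (i := 0) hu
    (by simp) (enc_c _)
  set ρ1 := Function.update ρ 40 (d.A.c u) with hρ1
  obtain ⟨t2, z2⟩ := hF.write (d := d) (d' := { d with A := d.A.tick u }) (ρ := ρ1) (t := 6)
    (r1 := r) (e2 := 0) (e3 := .reg 40 + 1) (x := u) (i := 0) (v := d.A.c u + 1)
    (h3 := by simp [hρ1]; omega) (hzc := hzc) (by simp [hρ1, show r ≠ 40 by omega, hu]) (by simp)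
    (by simp [hρ1]) hz (enc_update_c _ _)
  exact ⟨ρ1, (t1.seq t2).mono, (Keep.refl _ _).update, z2⟩

lemma cut (h : Inv n t0 Q d.A) (hX : 3 * t0 + n + 1 ≤ X) (hu : ρ 60 = u) (hw : ρ 61 = w)
    (q : Q u w) (hz : d.Sz z) (hzc : z + 27 ≤ m.cap) :
    ∃ ρ', Tr m.toMach (Rep m) cutP (13000 * m.Bm) (d.vs ρ)
      ((d.cut u w).vs ρ') ∧ Keep 50 ρ ρ' ∧ (d.cut u w).Sz (z + 26) := by
  obtain ⟨hun, hwn, hne⟩ := h.lt (h.Qadj q)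
  have hBl := hF.bits_le
  have hB7 := (hF.good.B_ge 0).trans (hF.good.B_le 0)
  have hW := hF.word
  obtain ⟨-, -, m1, m2⟩ := h.cut q
  obtain ⟨hI1, -, -⟩ := h.unplace q
  obtain ⟨ρ1, t1, k1, z1⟩ := hF.unplace h hX hu hw q hz (by omega)
  set d1 : Dat := { d with A := d.A.unplace u w } with hd1
  have u1 : ρ1 60 = u := (k1 60 (by omega)).trans hu
  have w1 : ρ1 61 = w := (k1 61 (by omega)).trans hw
  have t2 := hF.read (d := d1) (ρ := ρ1) (r := 40) (t := 9) (r1 := 60) (e2 := .reg 61) (x := u)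
    (i := w) (v := d.lab u w) u1 (by simpa using w1) (enc_lab _ _)
  set ρ2 := Function.update ρ1 40 (d.lab u w) with hρ2
  have k2 : Keep 50 ρ1 ρ2 := (Keep.refl _ _).update
  have u2 : ρ2 60 = u := (k2 60 (by omega)).trans u1
  have w2 : ρ2 61 = w := (k2 61 (by omega)).trans w1
  set o := if d.lab u w = 0 then d.out else d.out ++ [(u, w)] with ho
  have V : Val m.toMach (Rep m) (.reg 40) 2 (d1.vs ρ2) (d.lab u w) :=
    Val.user hF.good (by simp [Dat.vs, hρ2])
  have t3 : Tr m.toMach (Rep m) (iff (.reg 40) (.emit 60 61) .skip) 10 (d1.vs ρ2)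
      (Dat.vs { d1 with out := o } ρ2) := by
    by_cases hb : d.lab u w = 0
    · rw [hb] at V
      rw [ho, if_pos hb]
      exact (Tr.ite_false V Tr.skip).mono
    · rw [ho, if_neg hb]
      have := Tr.emit (m := m) (s := d1.vs ρ2) (x := 60) (y := 61) (by omega) (by omega)
      have e : ({ d1.vs ρ2 with out := (d1.vs ρ2).out ++ [((d1.vs ρ2).reg 60, (d1.vs ρ2).reg 61)] } : VS) =
          Dat.vs { d1 with out := d.out ++ [(u, w)] } ρ2 := by
        simp only [Dat.vs, u2, w2, hd1]
      rw [e] at this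
      exact (Tr.ite_true V hb this).mono
  set d3 : Dat := { d1 with out := o } with hd3
  obtain ⟨t4, z4⟩ := hF.write (d := d3) (d' := { d3 with lab := upd d.lab u w 0 }) (t := 9)
    (r1 := 60) (e2 := .reg 61) (e3 := 0) u2 (by simpa) rfl z1 (enc_update_lab _ _ _)
  obtain ⟨t5, z5⟩ := hF.write (d := { d3 with lab := upd d.lab u w 0 })
    (d' := { d3 with lab := upd2 d.lab u w 0 }) (t := 9) (r1 := 61) (e2 := .reg 60) (e3 := 0) w2
    (by simpa) rfl z4 (enc_update_lab _ _ _)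
  set d5 : Dat := { d3 with lab := upd2 d.lab u w 0 } with hd5
  set A1 := d.A.unplace u w with hA1
  have eA5 : d5.A = A1 := rfl
  obtain ⟨t6, z6⟩ := hF.write (d := d5) (d' := { d5 with A := { A1 with T := upd A1.T u w 0 } })
    (t := 7) (r1 := 60) (e2 := .reg 61) (e3 := 0) u2 (by simpa) rfl z5 (enc_update_T _ _ _)
  obtain ⟨t7, z7⟩ := hF.write (d := { d5 with A := { A1 with T := upd A1.T u w 0 } })
    (d' := { d5 with A := { A1 with T := upd2 A1.T u w 0 } }) (t := 7) (r1 := 61) (e2 := .reg 60)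
    (e3 := 0) w2 (by simpa) rfl z6 (enc_update_T _ _ _)
  obtain ⟨t8, z8⟩ := hF.write (d := { d5 with A := { A1 with T := upd2 A1.T u w 0 } })
    (d' := { d5 with A := { A1 with T := upd2 A1.T u w 0, al := upd A1.al u w 0 } }) (t := 8)
    (r1 := 60) (e2 := .reg 61) (e3 := 0) u2 (by simpa) rfl z7 (enc_update_al _ _ _)
  set A2 : Aux := { A1 with T := upd2 A1.T u w 0, al := upd2 A1.al u w 0 } with hA2
  obtain ⟨t9, z9⟩ := hF.write
    (d := { d5 with A := { A1 with T := upd2 A1.T u w 0, al := upd A1.al u w 0 } })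
    (d' := { d5 with A := A2 }) (t := 8) (r1 := 61) (e2 := .reg 60) (e3 := 0) w2 (by simpa) rfl z8
    (enc_update_al _ _ _)
  have hE : ∀ x, A2.E 0 x = d.A.E 0 x := fun x => by simp [hA2, hA1]
  obtain ⟨ρ3, t10, k3, z10⟩ := hF.setRem0 (d := { d5 with A := A2 }) (ρ := ρ2) (r1 := 60) (r2 := 61)
    (u := u) (w := w) u2 w2 (by simp only [hE]; exact h.nd _ _) (by simp only [hE]; exact m1)
    (by simp only [hE]; exact (h.deg_lt hun).le)
    (by simp only [hE]; exact fun y hy => (h.lt hy).2.1.le) z9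
  have hE' : (A2.rem 0 u w).E 0 w = d.A.E 0 w := by simp [Aux.rem, hne.symm, hE]
  obtain ⟨ρ4, t11, k4, z11⟩ := hF.setRem0 (d := { d5 with A := A2.rem 0 u w }) (ρ := ρ3) (r1 := 61)
    (r2 := 60) (u := w) (w := u) (by rw [k3 _ (by omega), w2]) (by rw [k3 _ (by omega), u2])
    (by simp only [hE']; exact h.nd _ _) (by simp only [hE']; exact h.sym m1)
    (by simp only [hE']; exact (h.deg_lt hwn).le)
    (by simp only [hE']; exact fun y hy => (h.lt hy).2.1.le) z10
  refine ⟨ρ4, ?_, (k1.trans k2).trans (k3.trans k4).mono, z11⟩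
  exact (t1.seq (t2.seq (t3.seq (t4.seq (t5.seq (t6.seq (t7.seq (t8.seq (t9.seq (t10.seq
    t11)))))))))).mono

variable (hP : ∀ x < n, P.thr x ≤ n)
  (hΛ : ∀ i ≤ I, P.L i * (300 * B1 + 210) + 500 * B1 + 1600 * m.Bm + 260 ≤ Λ)
include hP hΛ

lemma arrive {ins : Bool} (h : Inv n t0 Q d.A) (hC : Calm Q ∅ d.A) (hX : 3 * t0 + n + 4 ≤ X)
    (hQ : Q = d.A.adj) (hun : u < n) (hwn : w < n) (huw : u ≠ w)
    (hins : ins = true ↔ ¬ d.A.adj u w) (hu : ρ 60 = u) (hw : ρ 61 = w)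
    (h70 : ρ 70 = if ins then 1 else 0) (hc : Counts ρ d.A.calls.length)
    (hi : (d.A.arrive P ins u w).calls.length ≤ I) (hz : d.Sz z) (hzc : z + 40 ≤ m.cap) :
    ∃ ρ', Tr m.toMach (Rep m) (arriveP P)
      (15000 * m.Bm + ((d.A.arrive P ins u w).calls.length - d.A.calls.length) * Λ) (d.vs ρ)
      ((d.arrive P m.ω ins u w).vs ρ') ∧ Same 60 ρ ρ' ∧
      Counts ρ' (d.A.arrive P ins u w).calls.length := by
  have hBl := hF.bits_le
  have hB7 := (hF.good.B_ge 0).trans (hF.good.B_le 0)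
  have hcu := h.c_le u
  have hcw := h.c_le w
  have V : Val m.toMach (Rep m) (.reg 70) 2 (d.vs ρ) (if ins then 1 else 0) :=
    Val.user hF.good (by simp [Dat.vs, h70])
  cases hb : ins with
  | true =>
    rw [hb, if_pos rfl] at V
    have hadj := hins.1 hb
    obtain ⟨-, -, n1, n2⟩ := h.link hun hwn huw hadj
    obtain ⟨g1, g2, g3, g4, -⟩ := h.linked hC hQ hun hwn huw hadj rfl
    obtain ⟨ρ1, t1, k1, z1⟩ := hF.setAdd0 (d := d) (ρ := ρ) (r1 := 60) (r2 := 61) (u := u) (w := w)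
      hu hw n1 (h.deg_lt hun) hz
    have hE' : (d.A.add 0 u w).E 0 w = d.A.E 0 w := by simp [Aux.add, huw.symm]
    obtain ⟨ρ2, t2, k2, z2⟩ := hF.setAdd0 (d := { d with A := d.A.add 0 u w }) (ρ := ρ1) (r1 := 61)
      (r2 := 60) (u := w) (w := u) (by rw [k1 _ (by omega), hw]) (by rw [k1 _ (by omega), hu]) n2
      (by simp only [hE']; exact h.deg_lt hwn) z1
    have K2 := (k1.trans k2).mono (show 30 ≤ 50 by omega)
    obtain ⟨ρ3, t3, k3, z3⟩ := hF.tick (d := { d with A := d.A.link u w }) (ρ := ρ2) (r := 60) (u := u)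
      (by omega) ((K2 60 (by omega)).trans hu) hun (show d.A.c u ≤ X by omega) z2 (by omega)
    have K3 := K2.trans k3
    have hcw' : ((d.A.link u w).tick u).c w = d.A.c w := by
      simp [Aux.tick, Function.update_of_ne huw.symm, Aux.link, Aux.add]
    obtain ⟨ρ4, t4, k4, z4⟩ := hF.tick (d := { d with A := (d.A.link u w).tick u }) (ρ := ρ3) (r := 61)
      (u := w) (by omega) ((K3 61 (by omega)).trans hw) hwn (by simp only [hcw']; omega) z3 (by omega)
    have K4 := K3.trans k4
    set d1 : Dat := { d with A := ((d.A.link u w).tick u).tick w } with hd1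
    have e1 : (d.A.arrive P true u w).calls.length = d.A.calls.length + 1 := by
      simp [Aux.arrive, Aux.label, Aux.tick, Aux.link, Aux.add]
    rw [hb, e1] at hi
    obtain ⟨ρ5, t5, s5, c5, z5⟩ := hF.label (d := d1) (ρ := ρ4) g1 (by omega) hun hwn hP
      ((K4 60 (by omega)).trans hu) ((K4 61 (by omega)).trans hw) (K4.counts hc) hi z4
      (by omega)
    have hT := Aux.label_T P d1.A u w
    have hpos := P.thr_pos (max (d1.A.E 0 u).length (d1.A.E 0 w).length)
    have hthr := hP _ (g1.deg_max_lt hun hwn)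
    obtain ⟨ρ6, t6, k6, z6⟩ := hF.place (d := d1.label P m.ω u w) (ρ := ρ5) (g1.label g3 g4 hthr)
      (by omega) ((s5 60 le_rfl (by omega)).trans ((K4 60 (by omega)).trans hu))
      ((s5 61 (by omega) (by omega)).trans ((K4 61 (by omega)).trans hw)) g3 g4
      (by
        show (d1.A.label P u w).c u + (d1.A.label P u w).c w < (d1.A.label P u w).T u w
        rw [hT]; simp only [Aux.label_c]; omega) z5 (by omega)
    refine ⟨ρ6, ?_, K4.same.trans (s5.trans k6.same),
      k6.counts c5⟩
    have hΛ1 := hΛ _ hi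
    have hΛ2 : P.L (d1.A.calls.length + 1) * (300 * B1 + 210) + 500 * B1 + 1600 * m.Bm + 260 ≤ Λ := hΛ1
    refine (Tr.ite_true V one_ne_zero (t1.seq (t2.seq (t3.seq (t4.seq ((t5.mono hΛ2).seq
      t6)))))).mono ?_
    rw [e1, Nat.add_sub_cancel_left, one_mul]
    omega
  | false =>
    rw [hb, if_neg (by simp)] at V
    have q : Q u w := by
      rw [hQ]
      by_contra hq
      have := hins.2 hq
      rw [hb] at this
      cases this
    obtain ⟨ρ1, t1, k1, z1⟩ := hF.cut h (by omega) hu hw q hz (by omega)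
    obtain ⟨ρ3, t3, k3, z3⟩ := hF.tick (d := d.cut u w) (ρ := ρ1) (r := 60) (u := u)
      (by omega) ((k1 60 (by omega)).trans hu) hun (show d.A.c u ≤ X by omega) z1 (by omega)
    have K3 := k1.trans k3
    have hcw' : ((d.A.cut u w).tick u).c w = d.A.c w := by
      simp [Aux.tick, Function.update_of_ne huw.symm, Aux.cut, Aux.rem]
    obtain ⟨ρ4, t4, k4, z4⟩ := hF.tick (d := { d.cut u w with A := (d.cut u w).A.tick u }) (ρ := ρ3)
      (r := 61) (u := w) (by omega) ((K3 61 (by omega)).trans hw) hwn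
      (show ((d.A.cut u w).tick u).c w ≤ X by rw [hcw']; omega) z3 (by omega)
    have K4 := K3.trans k4
    exact ⟨ρ4, (Tr.ite_false V (t1.seq (t3.seq t4))).mono, K4.same,
      K4.counts hc⟩

end Fit

/-- The input of a program. -/
lemma Rep.input {m : VM} {p : Conf} {d : Dat} {ρ : ℕ → ℕ} (hp : Rep m p (d.vs ρ)) (x y z : ℕ) :
    Rep m (p.input x y z) (Dat.vs { d with out := [] } ρ) := by
  have h := ((hp.setLow (x := 0) (by omega) x).setLow (x := 1) (by omega) y).setLow (x := 2)
    (by omega) z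
  exact ⟨h.reg, h.regW, h.fW, h.draws, rfl, ⟨h.tree.tree, h.tree.zero, h.tree.cap⟩⟩


/-! ### The programs -/

/-- Copy an input register. -/
lemma Tr.copy {m : VM} {x r v : ℕ} {d : Dat} {ρ V : ℕ → ℕ} (hv : v < m.W)
    (hV : V r = v) (hx : 20 ≤ x ∧ x < 100 := by omega) (hr : r < 3 := by omega) :
    Tr m.toMach (fun p s => Rep m p s ∧ ∀ r < 3, p.reg r = V r) (set x (.reg r)) 4 (d.vs ρ)
      (d.vs (Function.update ρ x v)) := fun p ⟨hp, h1⟩ => by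
  have e := h1 r hr
  have t := Tr.rawSet' (m := m.toMach) (x := x) (s := p) (e := .reg r) (v := v) (hx := hx.2)
    (he := by simp [e, hV]; omega) (hv := by simp [e, hV]) (hW := hv)
  obtain ⟨k, hk, p', h2, h3⟩ := t p (Agree.refl p)
  refine ⟨k, hk, p', ⟨(hp.setReg hx.1 hv).of_agree h2, fun r' hr' => ?_⟩, h3⟩
  rw [h2.reg r' (by omega), Conf.setReg_reg, if_neg (by omega)]
  exact h1 r' hr'

/-- After the input, the copies of the input registers. -/
lemma Tr.forget {m : VM} {V : ℕ → ℕ} {c : Prog} {k : ℕ} {s s' : VS}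
    (h : Tr m.toMach (fun p s => Rep m p s ∧ ∀ r < 3, p.reg r = V r) c k s s') {p : Conf}
    (hp : Rep m p s) (hV : ∀ r < 3, p.reg r = V r) :
    ∃ k' ≤ k, ∃ p', Rep m p' s' ∧ m.toMach.Ex c p k' p' := by
  obtain ⟨k', h1, p', h2, h3⟩ := h p ⟨hp, hV⟩
  exact ⟨k', h1, p', h2.1, h3⟩

/-- A configuration does not depend on the amount of memory at hand. -/
lemma Rep.rebase {m m' : VM} {p : Conf} {s : VS} (h : Rep m p s) (hB : m'.B = m.B)
    (hBm : m'.Bm = m.Bm) (hW : m'.W = m.W) (hc : p.reg 10 ≤ m'.cap) : Rep m' p s :=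
  ⟨h.reg, by rw [hW]; exact h.regW, by rw [hW]; exact h.fW, h.draws, h.out,
    ⟨by rw [hB, hBm]; exact h.tree.tree, h.tree.zero, hc⟩⟩

lemma Rep.mem_eq_zero {m : VM} (hm : m.Good) {p : Conf} {s : VS} (h : Rep m p s) {a : ℕ}
    (ha : m.K ≤ a) : p.mem a = 0 := by
  have h1 := hm.capK
  have h2 := h.tree.cap
  exact h.tree.zero a (by omega) (by simp; omega)

/-- The data before the first update. -/
def Dat.init : Dat := ⟨⟨fun _ _ => [], 0, 0, 0, 0, [], 0⟩, 0, 0, []⟩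

lemma Rep.blank {m : VM} (hm : m.Good) : Rep m Conf.blank (Dat.init.vs 0) := by
  have hW := hm.W16
  have e : enc Dat.init.A Dat.init.lab = 0 := by
    funext ⟨t, x, i⟩
    simp [enc, Dat.init, encSet, posn]
  have e2 : (Dat.init.vs 0).f ∘ cellOf = 0 := by unfold Dat.vs; simp only [e]; rfl
  refine ⟨fun _ _ _ => rfl, fun _ _ _ => by simp [Dat.vs]; omega,
    fun c => by unfold Dat.vs; simp only [e]; simp; omega, rfl, rfl, ?_⟩
  rw [e2]
  refine ⟨⟨fun _ => [], ?_, ?_⟩, fun _ _ _ => rfl, Nat.zero_le _⟩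
  · constructor <;> simp [Conf.blank, IsSlot, NodeAt]
  · constructor <;> simp [Conf.blank]

lemma Counts.zero : Counts 0 0 := ⟨rfl, by simp, by simp⟩

/-- The data between two updates. -/
structure Rest (n t : ℕ) (d : Dat) : Prop where
  inv : Inv n t d.A.adj d.A
  calm : Calm d.A.adj ∅ d.A
  lab : d.LabOff

lemma Rest.init (n : ℕ) : Rest n 0 Dat.init := by
  refine ⟨?_, fun u v h => by simp [Dat.init, Aux.adj] at h, fun _ _ _ => rfl⟩
  constructor <;> simp [Dat.init, Aux.adj]

/-- `p` stores the data `d`. -/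
def Stores (m : VM) (p : Conf) (d : Dat) : Prop :=
  ∃ ρ, Rep m p (d.vs ρ) ∧ Counts ρ d.A.calls.length

namespace Fit
variable {m : VM} {P : Par} {n X I B1 : ℕ} (hF : Fit m P n X I B1) {d : Dat} {u w t : ℕ} {p : Conf}
include hF

/-- An update, with its amortized cost: the alarms that it processes and the invocations that it makes are
accounted for by the growth of `ne` and of `calls`. -/
lemma update {Λ : ℕ} (hP : ∀ x < n, P.thr x ≤ n)
    (hΛ : ∀ i ≤ I, P.L i * (300 * B1 + 210) + 500 * B1 + 1600 * m.Bm + 260 ≤ Λ)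
    {ins : Bool} (h : Rest n t d) (hX : 3 * t + n + 4 ≤ X) (hun : u < n) (hwn : w < n) (huw : u ≠ w)
    (hins : ins = true ↔ ¬ d.A.adj u w) (hi : (d.A.update P ins u w).calls.length ≤ I)
    (hc0 : 2 * n + 8 * d.A.arcs n + 40 ≤ m.cap)
    (hc1 : 2 * n + 8 * (d.A.update P ins u w).arcs n + 40 ≤ m.cap) (hp : Stores m p d) :
    Rest n (t + 1) (d.update P m.ω ins u w) ∧
    ∃ k p', m.toMach.Ex (updateP P) (p.input (if ins then 1 else 0) u w) k p' ∧
      Stores m p' (d.update P m.ω ins u w) ∧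
      k + d.A.ne * (10500 * m.Bm) + d.A.calls.length * Λ ≤ 16000 * m.Bm +
        (d.A.update P ins u w).ne * (10500 * m.Bm) + (d.A.update P ins u w).calls.length * Λ := by
  have hB7 := (hF.good.B_ge 0).trans (hF.good.B_le 0)
  have hW := hF.word
  obtain ⟨ρ, hp, hc⟩ := hp
  have hp0 := hp.input (if ins then 1 else 0) u w
  set d0 : Dat := { d with out := [] } with hd0
  set V : ℕ → ℕ := (p.input (if ins then 1 else 0) u w).reg with hV
  have V0 : V 0 = if ins then 1 else 0 := by simp [hV, Conf.input, Conf.setReg]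
  have V1 : V 1 = u := by simp [hV, Conf.input, Conf.setReg]
  have V2 : V 2 = w := by simp [hV, Conf.input, Conf.setReg]
  have q1 : (if ins then 1 else 0) < m.W := by split_ifs <;> omega
  have t1 := Tr.copy (m := m) (x := 70) (r := 0) (d := d0) (ρ := ρ) q1 V0
  set ρ1 := Function.update ρ 70 (if ins then 1 else 0) with hρ1
  have t2 := Tr.copy (m := m) (x := 60) (r := 1) (d := d0) (ρ := ρ1) (show u < m.W by omega) V1
  set ρ2 := Function.update ρ1 60 u with hρ2
  have t3 := Tr.copy (m := m) (x := 61) (r := 2) (d := d0) (ρ := ρ2) (show w < m.W by omega) V2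
  set ρ3 := Function.update ρ2 61 w with hρ3
  have t4 := Tr.copy (m := m) (x := 71) (r := 1) (d := d0) (ρ := ρ3) (show u < m.W by omega) V1
  set ρ4 := Function.update ρ3 71 u with hρ4
  have t5 := Tr.copy (m := m) (x := 72) (r := 2) (d := d0) (ρ := ρ4) (show w < m.W by omega) V2
  set ρ5 := Function.update ρ4 72 w with hρ5
  set A1 := d.A.arrive P ins u w with hA1
  set A2 := A1.scanN P u (A1.due u) with hA2
  set A3 := A2.scanN P w (A2.due w) with hA3
  have eA3 : d.A.update P ins u w = A3 := rfl
  rw [eA3] at hi hc1 ⊢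
  obtain ⟨g1, g2, g3, -⟩ := h.inv.arrive hP h.calm rfl hun hwn huw hins
  obtain ⟨i1, i2, i3, i4, i5, -⟩ := g1.scanN hP g2 (a := u) (by simp) rfl
  have e : ({u, w} : Set ℕ) \ {u} = {w} := by
    ext x
    simp
    rintro rfl
    exact huw.symm
  rw [e] at i2
  obtain ⟨j1, j2, j3, j4, j5, -⟩ := i1.scanN hP i2 (a := w) (by simp) rfl
  rw [← hA1] at g1 g2 g3
  rw [← hA1, ← hA2] at i1 i2 i3 i4 i5 j1 j2 j3 j4 j5
  rw [← hA3] at j1 j2 j3 j4 j5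
  have ea2 : A2.arcs n = A3.arcs n := by unfold Aux.arcs; rw [j4]
  have ea1 : A1.arcs n = A3.arcs n := by rw [← ea2]; unfold Aux.arcs; rw [i4]
  have c12 : A1.calls.length ≤ A2.calls.length := (A1.calls_scanN P u _).length_le
  have c23 : A2.calls.length ≤ A3.calls.length := (A2.calls_scanN P w _).length_le
  have c01 : d.A.calls.length ≤ A1.calls.length := (d.A.calls_arrive P ins u w).length_le
  have l0 : d0.LabOff := h.lab.congr rfl rfl
  obtain ⟨ρ6, t6, s6, c6⟩ := hF.arrive hP hΛ (d := d0) (ρ := ρ5) h.inv h.calm hX rfl hun hwn huw hins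
    (by simp [hρ5, hρ4, hρ3, hρ2]) (by simp [hρ5, hρ4, hρ3])
    (by simp [hρ5, hρ4, hρ3, hρ2, hρ1]) (hc.congr (by simp [hρ5, hρ4, hρ3, hρ2, hρ1])
      (by simp [hρ5, hρ4, hρ3, hρ2, hρ1]) (by simp [hρ5, hρ4, hρ3, hρ2, hρ1]))
    ((c12.trans c23).trans hi) (h.inv.sz l0) hc0
  have l1 := Dat.arrive_LabOff l0 h.inv rfl hun hwn huw hins P m.ω
  set d1 := d0.arrive P m.ω ins u w with hd1
  have e1 : d1.A = A1 := Dat.arrive_A _ _ _ _ _ _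
  have r71 : ρ6 71 = u := by rw [s6 _ (by omega) (by omega)]; simp [hρ5, hρ4]
  have r72 : ρ6 72 = w := by rw [s6 _ (by omega) (by omega)]; simp [hρ5]
  have t7 := hF.asg (d := d1) (ρ := ρ6) (r := 62) (e := .reg 71) (v := u) (k := 5) (by simp)
    (by simp [r71])
  set ρ7 := Function.update ρ6 62 u with hρ7
  obtain ⟨ρ8, t8, s8, c8, l8⟩ := hF.scan hP hΛ (d := d1) (ρ := ρ7) (Q := A1.adj) (a := u)
    (by rw [e1]; exact g1) (by rw [e1]; exact g2) (by omega) (by simp) l1 hun (by simp [hρ7])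
    (by rw [e1]; exact c6.congr (by simp [hρ7]) (by simp [hρ7]) (by simp [hρ7]))
    (by rw [e1]; exact c23.trans hi) (by rw [e1, ea1]; omega)
  set d2 := d1.scan P m.ω u with hd2
  have e2 : d2.A = A2 := by rw [hd2, Dat.scan, Dat.scanN_A, e1]
  have t9 := hF.asg (d := d2) (ρ := ρ8) (r := 62) (e := .reg 72) (v := w) (k := 5) (by simp)
    (by simp [s8 72 (by omega) (by omega), hρ7, r72])
  set ρ9 := Function.update ρ8 62 w with hρ9
  rw [e1] at t8 c8
  obtain ⟨ρ10, t10, s10, c10, l10⟩ := hF.scan hP hΛ (d := d2) (ρ := ρ9) (Q := A1.adj) (a := w)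
    (by rw [e2]; exact i1) (by rw [e2]; exact i2) (by omega) (by simp) l8 hwn (by simp [hρ9])
    (by rw [e2]; exact c8.congr (by simp [hρ9]) (by simp [hρ9]) (by simp [hρ9]))
    (by rw [e2]; exact hi) (by rw [e2, ea2]; omega)
  have ed : d2.scan P m.ω w = d.update P m.ω ins u w := rfl
  have e3 : (d.update P m.ω ins u w).A = A3 := (Dat.update_A _ _ _ _ _ _).trans eA3
  rw [e2] at t10 c10
  rw [ed] at t10 l10
  have hadj : A1.adj = A3.adj := by
    funext x y
    unfold Aux.adj
    rw [j4, i4]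
  rw [Set.sdiff_self, hadj] at j2
  rw [hadj] at j1
  refine ⟨⟨by rw [e3]; exact j1, by rw [e3]; exact j2, l10⟩, ?_⟩
  obtain ⟨ka, hka, pa, ra, xa⟩ := Tr.forget (t1.seq (t2.seq (t3.seq (t4.seq t5)))) hp0 fun _ _ => rfl
  obtain ⟨kb, hkb, pb, rb, xb⟩ := (t6.seq (t7.seq (t8.seq (t9.seq t10)))) pa ra
  have hs : ∀ {c1 c2 c3 c4 c5 c6 p q r k k'}, m.toMach.Ex (c1 ;; c2 ;; c3 ;; c4 ;; c5) p k q →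
      m.toMach.Ex c6 q k' r → m.toMach.Ex (c1 ;; c2 ;; c3 ;; c4 ;; c5 ;; c6) p (k + k') r := by
    intro c1 c2 c3 c4 c5 c6 p q r k k' h h'
    cases h with | seq _ _ _ _ _ k1 _ x1 h =>
    cases h with | seq _ _ _ _ _ k2 _ x2 h =>
    cases h with | seq _ _ _ _ _ k3 _ x3 h =>
    cases h with | seq _ _ _ _ _ k4 k5 x4 x5 =>
    have := Exec.seq _ _ _ _ _ _ _ x1 (Exec.seq _ _ _ _ _ _ _ x2 (Exec.seq _ _ _ _ _ _ _ x3
      (Exec.seq _ _ _ _ _ _ _ x4 (Exec.seq _ _ _ _ _ _ _ x5 h'))))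
    simpa only [add_assoc] using this
  refine ⟨ka + kb, pb, hs xa xb, ⟨ρ10, rb, by rw [e3]; exact c10⟩, ?_⟩
  have hk := Nat.add_le_add hka hkb
  have hn3 : A3.ne = d.A.ne + A1.due u + A2.due w := by omega
  rw [hn3]
  have f1 := Nat.sub_add_cancel c01
  have f2 := Nat.sub_add_cancel c12
  have f3 := Nat.sub_add_cancel c23
  have e4 : A3.calls.length * Λ = (A3.calls.length - A2.calls.length) * Λ +
      (A2.calls.length - A1.calls.length) * Λ + (A1.calls.length - d.A.calls.length) * Λ +
      d.A.calls.length * Λ := by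
    rw [← add_mul, ← add_mul, ← add_mul]
    congr 1
    omega
  rw [e4, add_mul, add_mul]
  have e5 : d0.A = d.A := rfl
  rw [e5, ← hA1, ← hA2, ← hA3] at hk
  omega

lemma lookup (hun : u < n) (hwn : w < n) (hp : Stores m p d) :
    ∃ k p', m.toMach.Ex lookupP (p.input 0 u w) k p' ∧ p'.reg 0 = d.lab u w ∧ k ≤ 120 * B1 := by
  obtain ⟨ρ, hp, hc⟩ := hp
  have hB7 := (hF.good.B_ge 0).trans (hF.bits (t := 0) (by omega))
  have hW := hF.word
  have hp0 := hp.input 0 u w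
  set d0 : Dat := { d with out := [] } with hd0
  set V : ℕ → ℕ := (p.input 0 u w).reg with hV
  have t1 := Tr.copy (m := m) (x := 60) (r := 1) (d := d0) (ρ := ρ) (show u < m.W by omega)
    (show V 1 = u by simp [hV, Conf.input, Conf.setReg])
  set ρ1 := Function.update ρ 60 u with hρ1
  have t2 := Tr.copy (m := m) (x := 61) (r := 2) (d := d0) (ρ := ρ1) (show w < m.W by omega)
    (show V 2 = w by simp [hV, Conf.input, Conf.setReg])
  set ρ2 := Function.update ρ1 61 w with hρ2
  have t3 := hF.read (d := d0) (ρ := ρ2) (r := 40) (t := 9) (r1 := 60) (e2 := .reg 61) (x := u)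
    (i := w) (v := d.lab u w) (by simp [hρ2, hρ1]) (by simp [hρ2]) (enc_lab _ _)
  obtain ⟨ka, hka, pa, ra, xa⟩ := Tr.forget (t1.seq t2) hp0 fun _ _ => rfl
  obtain ⟨kb, hkb, pb, rb, xb⟩ := t3 pa ra
  have r40 : pb.reg 40 = d.lab u w := (rb.reg 40 (by omega) (by omega)).trans (by simp [Dat.vs])
  have hlab : d.lab u w < m.W := by
    have := rb.regW 40 (by omega) (by omega)
    simpa [Dat.vs] using this
  have t4 := Tr.rawSet' (m := m.toMach) (x := 0) (s := pb) (e := .reg 40) (v := d.lab u w)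
    (he := by simp [r40]; omega) (hv := by simp [r40]) (hW := hlab)
  obtain ⟨kc, hkc, pc, rc, xc⟩ := t4 pb (Agree.refl pb)
  have hs : m.toMach.Ex lookupP (p.input 0 u w) (ka + (kb + kc)) pc := by
    cases xa with | seq _ _ _ _ _ k1 _ x1 h =>
    have := Exec.seq _ _ _ _ _ _ _ x1 (Exec.seq _ _ _ _ _ _ _ h (Exec.seq _ _ _ _ _ _ _ xb xc))
    simp only [add_assoc] at this ⊢
    exact this
  refine ⟨_, pc, hs, ?_, ?_⟩
  · rw [rc.reg 0 (by omega)]; simp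
  · simp at hkc; omega

end Fit


/-! ### The implementation follows the algorithm -/

/-- An invocation of the labelling strategy as it is recorded by the implementation and by the
algorithm. -/
structure CallRel {n : ℕ} (c : ℕ × ℕ × (ℕ → List ℕ)) (s : SimpleGraph (Fin n) × Fin n × Fin n) :
    Prop where
  fst : c.1 = s.2.1
  snd : c.2.1 = s.2.2
  adj : ∀ u v : Fin n, s.1.Adj u v ↔ (v : ℕ) ∈ c.2.2 u
  nd : ∀ u, (c.2.2 u).Nodup
  lt : ∀ u, ∀ v ∈ c.2.2 u, v < n

lemma CallRel.unique {n : ℕ} {c : ℕ × ℕ × (ℕ → List ℕ)} {s s' : SimpleGraph (Fin n) × Fin n × Fin n}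
    (h : CallRel c s) (h' : CallRel c s') : s = s' := by
  refine Prod.ext ?_ (Prod.ext ?_ ?_)
  · ext u v; rw [h.adj, h'.adj]
  · exact Fin.ext (h.fst.symm.trans h'.fst)
  · exact Fin.ext (h.snd.symm.trans h'.snd)

/-- The number of draws before the invocation number `i + 1`. -/
def Par.off (P : Par) (i : ℕ) : ℕ := ∑ k ∈ Finset.range i, P.L (k + 1)

/-- The samples `smp` of the invocations in the list `cl` are those that the machine takes from the
tape `ω`. -/
def FromTape {n : ℕ} (P : Par) (ω : Tape) (cl : List (ℕ × ℕ × (ℕ → List ℕ)))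
    (smp : ℕ → ℕ → Fin n ⊕ Fin n) : Prop :=
  ∀ i c, cl[i]? = some c → ∀ j < P.L (i + 1), ∀ y : Fin n,
    (y : ℕ) = pick c.1 c.2.1 (c.2.2 c.1) (c.2.2 c.2.1)
      (ω (P.off i + j, (c.2.2 c.1).length + (c.2.2 c.2.1).length + 1) : ℕ) →
    Sum.elim id id (smp (i + 1) j) = y

lemma pick_lt {n a v : ℕ} {Ea Ev : List ℕ} (ha : a < n) (hv : v < n) (hEa : ∀ y ∈ Ea, y < n)
    (hEv : ∀ y ∈ Ev, y < n) (x : ℕ) : pick a v Ea Ev x < n := by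
  unfold pick
  split_ifs with h1 h2 h3
  · rw [List.getD_eq_getElem _ _ h1]; exact hEa _ (List.getElem_mem _)
  · exact ha
  · rw [List.getD_eq_getElem _ _ (by omega)]; exact hEv _ (List.getElem_mem _)
  · exact hv

/-- The data `d` represent the state `s`; the relation `Q` tells for which edges there are tracking
instances. The count of an instance is not stored: it is the growth of the two counters of the
endpoints, so that `time` compares the missing numbers of updates. -/
structure Sim {n : ℕ} (P : Par) (Q : ℕ → ℕ → Prop) (d : Dat) (s : State (Fin n)) : Prop where
  graph : ∀ u v : Fin n, s.graph.Adj u v ↔ (v : ℕ) ∈ d.A.E 0 u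
  time : ∀ u v : Fin n, Q u v → d.A.T u v + s.cnt s(u, v) = d.A.c u + d.A.c v + s.thr s(u, v)
  lab : ∀ u v : Fin n, d.lab u v = (s.label s(u, v)).toNat
  calls : List.Forall₂ CallRel d.A.calls s.calls
  draws : d.draws = P.off d.A.calls.length
  flips : {e | ∃ p ∈ d.out, e = s(p.1, p.2)} = Sym2.map (fun v : Fin n => (v : ℕ)) '' s.flips

lemma mem_closedNbr {V : Type} [Fintype V] {G : SimpleGraph V} {a x : V} :
    x ∈ closedNbr G a ↔ x = a ∨ G.Adj a x := by simp [closedNbr]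

lemma estimate_iff {V : Type} [Fintype V] {G : SimpleGraph V} {ε : ℝ} {L : ℕ} (hL : 0 < L) {a v : V}
    {f : ℕ → V ⊕ V} {g : ℕ → ℕ} {h : ℕ} (hh : h = ∑ j ∈ Finset.range L, g j) (hle : h ≤ L)
    (h1 : ∀ j < L, (Sum.elim id id (f j) ∈ closedNbr G a ∧ Sum.elim id id (f j) ∈ closedNbr G v) →
      g j = 1)
    (h0 : ∀ j < L, ¬ (Sum.elim id id (f j) ∈ closedNbr G a ∧ Sum.elim id id (f j) ∈ closedNbr G v) →
      g j = 0) :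
    ε ≤ estimate G a v L f ↔ ¬ h < ⌈ε * ((2 * L - h : ℕ) : ℝ)⌉₊ := by
  classical
  have hL' : (0 : ℝ) < L := by exact_mod_cast hL
  have hle' : (h : ℝ) ≤ L := by exact_mod_cast hle
  have e : estimate G a v L f = h / (2 * L - h) := by
    unfold estimate
    have hc : ∀ {r : ℝ}, r = h → r / L / (2 - r / L) = h / (2 * L - h) := by
      rintro _ rfl
      have : (2 : ℝ) * L - h ≠ 0 := by linarith
      field_simp
    refine hc ?_
    rw [hh]
    push_cast
    refine Finset.sum_congr rfl fun j hj => ?_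
    split_ifs with hy
    · rw [h1 j (Finset.mem_range.1 hj) (Finset.mem_inter.1 hy), Nat.cast_one]
    · rw [h0 j (Finset.mem_range.1 hj) (fun e => hy (Finset.mem_inter.2 e)), Nat.cast_zero]
  rw [e, le_div_iff₀ (by linarith), not_lt, Nat.ceil_le, Nat.cast_sub (by omega)]
  push_cast
  rfl

section
variable {n : ℕ} {G : SimpleGraph (Fin n)}

lemma deg_eq {l : List ℕ} {u : Fin n} (hl : l.Nodup) (hlt : ∀ v ∈ l, v < n)
    (h : ∀ v : Fin n, G.Adj u v ↔ (v : ℕ) ∈ l) : deg G u = l.length := by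
  unfold deg
  rw [← Set.ncard_image_of_injective _ Fin.val_injective, ← List.toFinset_card_of_nodup hl,
    ← Set.ncard_coe_finset]
  congr 1
  ext x
  simp only [Set.mem_image, SimpleGraph.mem_neighborSet, h, List.coe_toFinset, Set.mem_ofPred_eq]
  exact ⟨by rintro ⟨v, hv, rfl⟩; exact hv, fun hx => ⟨⟨x, hlt x hx⟩, hx, rfl⟩⟩

end

section
variable {n t : ℕ} {P : Par} {Q : ℕ → ℕ → Prop} {d d' : Dat} {s : State (Fin n)} {ω : Tape}
  {cl : List (ℕ × ℕ × (ℕ → List ℕ))} {smp : ℕ → ℕ → Fin n ⊕ Fin n} {ε ρ : ℝ}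

lemma Sim.congr (h : Sim P Q d s) (hE : d'.A.E 0 = d.A.E 0) (hc : d'.A.c = d.A.c)
    (hT : d'.A.T = d.A.T) (hcl : d'.A.calls = d.A.calls) (hl : d'.lab = d.lab)
    (hd : d'.draws = d.draws) (ho : d'.out = d.out) : Sim P Q d' s :=
  ⟨by rw [hE]; exact h.graph, by rw [hc, hT]; exact h.time, by rw [hl]; exact h.lab,
    by rw [hcl]; exact h.calls, by rw [hd, hcl]; exact h.draws, by rw [ho]; exact h.flips⟩

lemma pair_eq_iff {a b u w : Fin n} : s(a, b) = s(u, w) ↔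
    ((a : ℕ) = w ∧ (b : ℕ) = u) ∨ ((a : ℕ) = u ∧ (b : ℕ) = w) := by
  rw [Sym2.eq_iff, Fin.ext_iff, Fin.ext_iff, Fin.ext_iff, Fin.ext_iff, or_comm]

/-- The algorithm and the implementation label an edge. -/
lemma Sim.label (h : Sim P Q d s) (hI : Inv n t Q d.A) (hL : ∀ i, 0 < P.L i) (h0 : P.θ 0 = ε)
    (h1 : P.θ 1 = ρ * ε / 2) (hs : FromTape P ω cl smp) {a v : Fin n}
    (hcl : (d.A.label P a v).calls <+: cl) :
    Sim P (also Q a v) (d.label P ω a v) (relabel ε ρ P.L smp s (a, v)) := by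
  classical
  have hlt : ∀ u, ∀ y ∈ d.A.E 0 u, y < n := fun u y hy => (hI.lt hy).2.1
  have hdeg : ∀ u : Fin n, deg s.graph u = (d.A.E 0 u).length := fun u =>
    deg_eq (hI.nd _ _) (hlt u) (h.graph u)
  have hlen : s.calls.length = d.A.calls.length := h.calls.length_eq.symm
  have hcl' : cl[d.A.calls.length]? = some ((a : ℕ), (v : ℕ), d.A.E 0) := by
    obtain ⟨l, rfl⟩ := hcl
    simp [Aux.label]
  have hpick : ∀ j < P.L (d.A.calls.length + 1),
      ((Sum.elim id id (smp (d.A.calls.length + 1) j) : Fin n) : ℕ) =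
        pick a v (d.A.E 0 a) (d.A.E 0 v)
          (ω (P.off d.A.calls.length + j, (d.A.E 0 a).length + (d.A.E 0 v).length + 1) : ℕ) := fun j hj =>
    congrArg Fin.val (hs _ _ hcl' j hj ⟨_, pick_lt a.2 v.2 (hlt a) (hlt v) _⟩ rfl)
  set L := P.L (d.A.calls.length + 1) with hLd
  have hbit : decide (ε ≤ estimate s.graph a v L (smp (d.A.calls.length + 1))) =
      decide (d.bit P ω a v = 1) := by
    have hq : ∀ y : Fin n, (((y : ℕ) = a ∨ (y : ℕ) ∈ d.A.E 0 a) ∧ ((y : ℕ) = v ∨ (y : ℕ) ∈ d.A.E 0 v)) ↔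
        y ∈ closedNbr s.graph a ∧ y ∈ closedNbr s.graph v := fun y => by
      rw [mem_closedNbr, mem_closedNbr, h.graph, h.graph, Fin.ext_iff, Fin.ext_iff]
    rw [decide_eq_decide, estimate_iff (hL _) (h := hits ω d.draws a v (d.A.E 0 a) (d.A.E 0 v) L) rfl
      (hits_le _ _ _ _ _ _ _)]
    · unfold Dat.bit
      simp only [← hLd, h0]
      split_ifs <;> simp_all
    · intro j hj hy
      rw [h.draws, ← hpick j hj]
      exact if_pos ((hq _).2 hy)
    · intro j hj hy
      rw [h.draws, ← hpick j hj]
      exact if_neg fun e => hy ((hq _).1 e)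
  have hb1 : d.bit P ω a v = (decide (d.bit P ω a v = 1)).toNat := by
    unfold Dat.bit; simp only; split_ifs <;> simp
  have hthr : P.thr (max (d.A.E 0 a).length (d.A.E 0 v).length) =
      ⌊ρ * ε / 2 * (degMax s.graph a v : ℝ)⌋₊ + 1 := by
    unfold Par.thr degMax; rw [h1, hdeg, hdeg]
  unfold relabel
  simp only [hlen, ← hLd, hbit]
  refine ⟨h.graph, fun x y q => ?_, fun x y => ?_, ?_, ?_, ?_⟩
  · simp only [Dat.label, Aux.label, upd2_apply, Function.update_apply, pair_eq_iff]
    split_ifs with hxy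
    · rw [hthr]
      rcases hxy with e | e <;> rw [e.1, e.2] <;> ring
    · refine h.time x y ?_
      unfold also at q
      tauto
  · simp only [Dat.label, upd2_apply, Function.update_apply, pair_eq_iff]
    split_ifs
    · exact hb1
    · exact h.lab x y
  · simp only [Dat.label, Aux.label]
    exact List.rel_append h.calls (.cons ⟨rfl, rfl, h.graph, fun u => hI.nd 0 u, hlt⟩ .nil)
  · simp only [Dat.label, Aux.label, List.length_append, List.length_singleton, h.draws]
    unfold Par.off
    rw [Finset.sum_range_succ]
  · have hl := h.lab a v
    have hiff : (decide (d.bit P ω a v = 1) = s.label s(a, v)) ↔ d.bit P ω a v = d.lab a v := by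
      rw [hl]
      constructor
      · intro e; rw [hb1, e]
      · intro e; rw [e]; cases s.label s(a, v) <;> simp
    simp only [Dat.label, hiff]
    split_ifs
    · exact h.flips
    · rw [Set.image_insert_eq, ← h.flips]
      ext e
      simp [or_comm, or_and_right, exists_or]

/-- The mature edges at `a` have alarms at `a` that go off now. -/
lemma Inv.not_mature {A : Aux} {S : Set ℕ} (h : Inv n t Q A) (hC : Calm Q S A) {a v : ℕ} (ha : a ∈ S)
    (hd : A.due a = 0) (q : Q a v) : A.T a v ≠ A.c a + A.c v := fun e => by
  have h1 := h.al_sum q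
  have h2 := h.c_al q
  have h3 := h.c_al (h.Qsym q)
  have h4 : A.al v a ≠ A.c v := fun e => (hC v a (h.Qsym q) e).2 ha
  have h5 : A.al a v ≠ A.c a := fun e => by
    have := List.length_pos_of_mem ((h.bkt _ _ _).2 ⟨q, e⟩)
    unfold Aux.due at hd
    omega
  omega

/-- The mature edges are relabelled by the processing of the alarms. -/
lemma Sim.scanN {S : Set ℕ} (h : Sim P Q d s) (hI : Inv n t Q d.A) (hC : Calm Q S d.A)
    (hP : ∀ x < n, P.thr x ≤ n)
    (hL : ∀ i, 0 < P.L i) (h0 : P.θ 0 = ε) (h1 : P.θ 1 = ρ * ε / 2) (hs : FromTape P ω cl smp)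
    {a : Fin n} (ha : (a : ℕ) ∈ S) {k : ℕ} (hk : d.A.due a = k)
    (hcl : (d.A.scanN P a k).calls <+: cl) :
    ∃ vs : List (Fin n), vs.Nodup ∧
      (∀ v : Fin n, v ∈ vs ↔ Q a v ∧ d.A.T a v = d.A.c a + d.A.c v) ∧
      Sim P Q (d.scanN P ω a k) ((vs.map fun v => (a, v)).foldl (relabel ε ρ P.L smp) s) := by
  induction k generalizing d s with
  | zero =>
    exact ⟨[], List.nodup_nil, fun v => by simpa using fun q => hI.not_mature hC ha hk q, h⟩
  | succ k ih =>
    have hmem := Aux.head_mem hk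
    obtain ⟨q, hal⟩ := (hI.bkt _ _ _).1 hmem
    obtain ⟨g1, g2, g3, g4, g5, -⟩ := hI.eval hP hC ha hmem
    obtain ⟨hu1, -, -⟩ := hI.unplace q
    obtain ⟨b, hb⟩ : ∃ b : Fin n, (b : ℕ) = d.A.head a := ⟨⟨_, hI.mem_bkt hmem⟩, rfl⟩
    rw [← hb] at q hal g1 g2 g3 g4 g5 hu1
    have eA := Dat.eval_A P ω d a b
    have hcl1 : (d.A.scanN P a (k + 1)).calls = ((d.A.eval P a b).scanN P a k).calls := by
      rw [hb]; rfl
    rw [hcl1] at hcl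
    obtain ⟨-, -, k1, -⟩ := hI.eval_mid hP hC ha q hal rfl
    have hTab : (d.A.eval P a b).T a b ≠ d.A.c a + d.A.c b := by
      rw [← g4]; exact (show (d.A.eval P a b).c a + (d.A.eval P a b).c b < _ from k1).ne'
    have hTne : ∀ y : ℕ, y ≠ b → (d.A.eval P a b).T a y = d.A.T a y := fun y hy => by
      unfold Aux.eval
      have hne := (hI.lt (hI.Qadj q)).2.2
      split_ifs <;> simp [Aux.label, hy, hne]
    have key : ∀ vs : List (Fin n), (∀ v : Fin n, v ∈ vs ↔ Q a v ∧
        (d.eval P ω a b).A.T a v = (d.eval P ω a b).A.c a + (d.eval P ω a b).A.c v) →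
        b ∉ vs ∧ ∀ v : Fin n, v ≠ b → (v ∈ vs ↔ Q a v ∧ d.A.T a v = d.A.c a + d.A.c v) := by
      intro vs hvs
      rw [eA, g4] at hvs
      refine ⟨fun hb' => hTab ((hvs b).1 hb').2, fun v hv => ?_⟩
      rw [hvs, hTne v fun e => hv (Fin.ext e)]
    have hu : Sim P (except Q a b) { d with A := d.A.unplace a b } s := by
      have := h.congr (d' := { d with A := d.A.unplace a b }) (by funext x; simp) rfl rfl rfl rfl rfl rfl
      exact ⟨this.graph, fun x y q => this.time x y q.1, this.lab, this.calls, this.draws, this.flips⟩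
    by_cases hm : d.A.T a b = d.A.c a + d.A.c b
    · have hsim : Sim P Q (d.eval P ω a b) (relabel ε ρ P.L smp s (a, b)) := by
        have hpre : ((d.A.unplace a b).label P a b).calls <+: cl := by
          have e : (d.A.eval P a b).calls = ((d.A.unplace a b).label P a b).calls := by
            simp [Aux.eval, hm]
          rw [← e]
          exact (Aux.calls_scanN P _ _ _).trans hcl
        have := hu.label hu1 hL h0 h1 hs hpre
        rw [also_except q (hI.Qsym q)] at this
        refine this.congr (funext fun x => ?_) ?_ ?_ ?_ ?_ ?_ ?_ <;> simp [Dat.eval, hm]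
      obtain ⟨vs, i1, i2, i3⟩ := ih hsim (by rw [eA]; exact g1) (by rw [eA]; exact g2)
        (by rw [eA]; omega) (by rw [eA]; exact hcl)
      obtain ⟨j1, j2⟩ := key vs i2
      refine ⟨b :: vs, List.nodup_cons.2 ⟨j1, i1⟩, fun v => ?_, ?_⟩
      · by_cases hv : v = b
        · subst hv; simp [q, hm]
        · rw [List.mem_cons, ← j2 v hv]; simp [hv]
      · show Sim P Q (Dat.scanN P ω a k (d.eval P ω a (d.A.head a))) _
        rw [← hb]; exact i3
    · have hsim : Sim P Q (d.eval P ω a b) s := by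
        refine h.congr (funext fun x => ?_) ?_ ?_ ?_ ?_ ?_ ?_ <;> simp [Dat.eval, hm]
      obtain ⟨vs, i1, i2, i3⟩ := ih hsim (by rw [eA]; exact g1) (by rw [eA]; exact g2)
        (by rw [eA]; omega) (by rw [eA]; exact hcl)
      obtain ⟨j1, j2⟩ := key vs i2
      refine ⟨vs, i1, fun v => ?_, by
        show Sim P Q (Dat.scanN P ω a k (d.eval P ω a (d.A.head a))) _
        rw [← hb]; exact i3⟩
      by_cases hv : v = b
      · subst hv; simp [j1, hm]
      · exact j2 v hv

end


section
variable {n t : ℕ} {P : Par} {Q : ℕ → ℕ → Prop} {d : Dat} {s : State (Fin n)} {ω : Tape}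
  {cl : List (ℕ × ℕ × (ℕ → List ℕ))} {smp : ℕ → ℕ → Fin n ⊕ Fin n} {ε ρ : ℝ}

lemma tick_add (A : Aux) {u w : Fin n} (huw : u ≠ w) {x y : Fin n} (hxy : x ≠ y)
    (he : s(x, y) ≠ s(u, w)) : ((A.tick u).tick w).c x + ((A.tick u).tick w).c y =
      A.c x + A.c y + if u ∈ s(x, y) ∨ w ∈ s(x, y) then 1 else 0 := by
  have ec : ∀ z : Fin n, ((A.tick u).tick w).c z = if z = w ∨ z = u then A.c z + 1 else A.c z := by
    intro z
    simp only [Aux.tick, Function.update_apply, ← Fin.ext_iff]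
    split_ifs <;> simp_all
  rw [ec, ec]
  simp only [Sym2.mem_iff]
  rw [ne_eq, Sym2.eq_iff] at he
  split_ifs <;> omega

/-- The data and the state after the change of the graph. -/
lemma Sim.arrive (h : Sim P Q d s) {x : Update (Fin n)} (huw : x.u ≠ x.w)
    {d' : Dat} {A' : Aux} {Q' : ℕ → ℕ → Prop} (hA : d'.A = (A'.tick x.u).tick x.w)
    (hc : A'.c = d.A.c) (hcl : A'.calls = d.A.calls) (hd : d'.draws = d.draws)
    (hQ : ∀ a b : Fin n, Q' a b → Q a b ∧ a ≠ b ∧ s(a, b) ≠ s(x.u, x.w) ∧ A'.T a b = d.A.T a b)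
    (hG : ∀ a b : Fin n, (x.apply s.graph).Adj a b ↔ (b : ℕ) ∈ A'.E 0 a)
    (hl : ∀ a b : Fin n, d'.lab a b = ((DynELM.arrive s x).label s(a, b)).toNat)
    (ho : d'.out = if x.ins = false ∧ s.label s(x.u, x.w) = true then [((x.u : ℕ), (x.w : ℕ))] else []) :
    Sim P Q' d' (DynELM.arrive s x) := by
  refine ⟨?_, fun a b q => ?_, hl, ?_, ?_, ?_⟩
  · rw [hA]; exact hG
  · obtain ⟨q1, q2, q3, q4⟩ := hQ a b q
    have := h.time a b q1
    have ht := tick_add A' huw q2 q3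
    rw [hA, ht, hc, show ((A'.tick x.u).tick x.w).T a b = d.A.T a b from q4]
    simp only [DynELM.arrive, q3, ne_eq, not_false_eq_true, and_true]
    split_ifs <;> omega
  · rw [hA]; exact (show A'.calls = _ from hcl) ▸ h.calls
  · rw [hd, hA, h.draws, ← hcl]; rfl
  · rw [ho]
    simp only [DynELM.arrive]
    split_ifs <;> simp

/-- The insertion of an edge. -/
lemma Sim.insert (h : Sim P d.A.adj d s) (hr : Rest n t d) (hL : ∀ i, 0 < P.L i) (h0 : P.θ 0 = ε)
    (h1 : P.θ 1 = ρ * ε / 2) (hs : FromTape P ω cl smp) {x : Update (Fin n)} (huw : x.u ≠ x.w)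
    (hi : x.ins = true) (hnadj : ¬ d.A.adj x.u x.w)
    (hcl : (d.A.arrive P true x.u x.w).calls <+: cl) :
    Sim P (d.A.arrive P true x.u x.w).adj (Dat.arrive P ω { d with out := [] } true x.u x.w)
      (relabel ε ρ P.L smp (DynELM.arrive s x) (x.u, x.w)) := by
  have huw' : (x.u : ℕ) ≠ x.w := fun e => huw (Fin.ext e)
  have hun := x.u.2
  have hwn := x.w.2
  obtain ⟨k1, k2, k3, k4, k5⟩ := hr.inv.linked hr.calm rfl hun hwn huw' hnadj rfl
  set B := ((d.A.link x.u x.w).tick x.u).tick x.w with hB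
  have hs0 : Sim P d.A.adj { d with out := [], A := B } (DynELM.arrive s x) := by
    refine h.arrive huw rfl rfl rfl rfl (fun a b q => ⟨q, ?_, fun e => ?_, rfl⟩) (fun a b => ?_)
      (fun a b => ?_) ?_
    · rintro rfl; exact (hr.inv.lt q).2.2 rfl
    · rcases pair_eq_iff.1 e with e | e
      · rw [e.1, e.2] at q; exact hnadj (hr.inv.sym q)
      · rw [e.1, e.2] at q; exact hnadj q
    · have := k5 a b
      rw [show B.adj a b ↔ (b : ℕ) ∈ (d.A.link x.u x.w).E 0 a from Iff.rfl] at this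
      rw [this]
      simp only [Update.apply, hi, if_true, SimpleGraph.sup_adj, SimpleGraph.fromEdgeSet_adj,
        Set.mem_singleton_iff, h.graph, pair_eq_iff, also]
      have : ((a : ℕ) = x.u ∧ (b : ℕ) = x.w) ∨ ((a : ℕ) = x.w ∧ (b : ℕ) = x.u) → a ≠ b := by
        rintro (e | e) rfl <;> omega
      unfold Aux.adj
      tauto
    · simp only [DynELM.arrive, hi, if_true]; exact h.lab a b
    · simp [hi]
  have := hs0.label k1 hL h0 h1 hs (a := x.u) (v := x.w) hcl
  have hadj : also d.A.adj x.u x.w = (d.A.arrive P true x.u x.w).adj := by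
    funext a b
    rw [← propext (k5 a b)]
    simp [Aux.adj, Aux.arrive, ← hB]
  rw [hadj] at this
  exact this.congr (funext fun y => Aux.place_E0 _ _ _ _) rfl rfl rfl rfl rfl rfl

/-- The deletion of an edge. -/
lemma Sim.delete (h : Sim P d.A.adj d s) (hr : Rest n t d) {x : Update (Fin n)} (huw : x.u ≠ x.w)
    (hi : x.ins = false) (hadj : d.A.adj x.u x.w) :
    Sim P (d.A.arrive P false x.u x.w).adj (Dat.arrive P ω { d with out := [] } false x.u x.w)
      (DynELM.arrive s x) := by
  obtain ⟨-, k2, -⟩ := hr.inv.cut hadj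
  have hlab := h.lab x.u x.w
  refine h.arrive (A' := d.A.cut x.u x.w) huw rfl rfl rfl rfl
    (fun a b q => ?_) (fun a b => ?_) (fun a b => ?_) ?_
  · have q' : except d.A.adj x.u x.w a b := (k2 a b).1 q
    have hne : ¬ s(a, b) = s(x.u, x.w) := by rw [pair_eq_iff]; rcases q' with ⟨_, q1, q2⟩; tauto
    refine ⟨q'.1, ?_, hne, ?_⟩
    · rintro rfl; exact (hr.inv.lt q'.1).2.2 rfl
    · rw [pair_eq_iff] at hne
      simp only [Aux.cut, Aux.rem, Aux.unplace_T, upd2_apply]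
      rw [if_neg (by tauto)]
  · rw [show (b : ℕ) ∈ (d.A.cut x.u x.w).E 0 a ↔ except d.A.adj x.u x.w a b from k2 a b]
    simp only [Update.apply, hi, Bool.false_eq_true, if_false, SimpleGraph.deleteEdges_adj,
      Set.mem_singleton_iff, h.graph, pair_eq_iff, except]
    unfold Aux.adj
    tauto
  · simp only [DynELM.arrive, hi, Dat.arrive, Bool.false_eq_true, if_false, Dat.cut, upd2_apply,
      Function.update_apply, pair_eq_iff]
    split_ifs
    · rfl
    · exact h.lab a b
  · simp only [Dat.arrive, Bool.false_eq_true, if_false, Dat.cut, hlab, hi, true_and]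
    cases s.label s(x.u, x.w) <;> simp

lemma Sim.mature (h : Sim P Q d s) (hQ : Q = d.A.adj) (a v : Fin n) :
    Mature s a v ↔ Q a v ∧ d.A.T a v = d.A.c a + d.A.c v := by
  have hq : s.graph.Adj a v ↔ Q a v := by rw [h.graph, hQ]; rfl
  unfold Mature
  rw [hq, and_congr_right_iff]
  intro q
  have := h.time a v q
  omega

/-- The implementation follows the algorithm during an update. -/
lemma Sim.update (h : Sim P d.A.adj d s) (hr : Rest n t d) (hP : ∀ x < n, P.thr x ≤ n)
    (hL : ∀ i, 0 < P.L i) (h0 : P.θ 0 = ε) (h1 : P.θ 1 = ρ * ε / 2) (hs : FromTape P ω cl smp)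
    {x : Update (Fin n)} (hx : x.Valid s.graph)
    (hcl : (d.A.update P x.ins x.u x.w).calls <+: cl) :
    ∃ s', Step ε ρ P.L smp x s s' ∧
      Sim P (d.A.update P x.ins x.u x.w).adj (d.update P ω x.ins x.u x.w) s' := by
  obtain ⟨huw, hins⟩ := hx
  rw [h.graph] at hins
  have huw' : (x.u : ℕ) ≠ x.w := fun e => huw (Fin.ext e)
  have hun := x.u.2
  have hwn := x.w.2
  set A1 := d.A.arrive P x.ins x.u x.w with hA1
  set A2 := A1.scanN P x.u (A1.due x.u) with hA2
  set A3 := A2.scanN P x.w (A2.due x.w) with hA3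
  have eA3 : d.A.update P x.ins x.u x.w = A3 := rfl
  rw [eA3] at hcl ⊢
  obtain ⟨g1, g2, -⟩ := hr.inv.arrive hP hr.calm rfl hun hwn huw' hins
  obtain ⟨i1, i2, i3, i4, -⟩ := g1.scanN hP g2 (a := x.u) (by simp) rfl
  have e : ({(x.u : ℕ), (x.w : ℕ)} : Set ℕ) \ {(x.u : ℕ)} = {(x.w : ℕ)} := by
    ext y
    simp
    rintro rfl
    exact huw'.symm
  rw [e] at i2
  obtain ⟨-, -, -, j4, -⟩ := i1.scanN hP i2 (a := x.w) (by simp) rfl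
  rw [← hA1] at g1 g2
  rw [← hA1, ← hA2] at i1 i2 i3 i4 j4
  rw [← hA3] at j4
  have c23 : A2.calls <+: cl := (A2.calls_scanN P x.w _).trans hcl
  have c12 : A1.calls <+: cl := (A1.calls_scanN P x.u _).trans c23
  set d1 := Dat.arrive P ω { d with out := [] } x.ins x.u x.w with hd1
  have e1 : d1.A = A1 := Dat.arrive_A _ _ _ _ _ _
  have h1' : Sim P A1.adj d1
      (if x.ins then relabel ε ρ P.L smp (DynELM.arrive s x) (x.u, x.w) else DynELM.arrive s x) := by
    cases hi : x.ins with
    | true =>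
      rw [hi] at hA1 hd1
      rw [hA1] at c12
      rw [if_pos rfl, hd1, hA1]
      exact h.insert hr hL h0 h1 hs huw hi (hins.1 hi) c12
    | false =>
      rw [hi] at hA1 hd1
      rw [if_neg (by simp), hd1, hA1]
      exact h.delete hr huw hi (by_contra fun q => by simpa [hi] using hins.2 q)
  set s1 := if x.ins then relabel ε ρ P.L smp (DynELM.arrive s x) (x.u, x.w) else DynELM.arrive s x
    with hs1
  obtain ⟨vs, v1, v2, v3⟩ := h1'.scanN (S := {(x.u : ℕ), (x.w : ℕ)}) (by rw [e1]; exact g1)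
    (by rw [e1]; exact g2) hP hL h0 h1 hs (a := x.u) (by simp) rfl
    (by rw [e1]; exact c23)
  set s2 := (vs.map fun v => (x.u, v)).foldl (relabel ε ρ P.L smp) s1 with hs2
  have e2 : (d1.scan P ω x.u).A = A2 := by rw [Dat.scan, Dat.scanN_A, e1]
  obtain ⟨ws, w1, w2, w3⟩ := Sim.scanN (d := d1.scan P ω x.u) v3 (S := {(x.w : ℕ)})
    (by rw [e2]; exact i1) (by rw [e2]; exact i2) hP hL h0 h1 hs (a := x.w) (by simp) rfl
    (by rw [e2]; exact hcl)
  have hadj2 : A1.adj = A2.adj := by unfold Aux.adj; rw [i4]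
  have hadj3 : A1.adj = A3.adj := by unfold Aux.adj; rw [j4, i4]
  refine ⟨_, ⟨s1, s2, hs1, ⟨vs, v1, fun v => ?_, hs2⟩, ⟨ws, w1, fun v => ?_, rfl⟩⟩, ?_⟩
  · rw [v2, h1'.mature (by rw [e1])]
  · rw [w2, Sim.mature (d := d1.scan P ω x.u) v3 (by rw [e2, hadj2])]
  · rw [← hadj3]; exact w3

end


/-! ### The similarity changes slowly -/

lemma card_insert_near {V : Type} [DecidableEq V] (A B : Finset V) (z : V) :
    (A ∩ B).card ≤ (insert z A ∩ B).card ∧ (A ∪ B).card ≤ (insert z A ∪ B).card ∧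
      (insert z A ∩ B).card + (insert z A ∪ B).card ≤ (A ∩ B).card + (A ∪ B).card + 1 := by
  refine ⟨Finset.card_le_card (Finset.inter_subset_inter_right (Finset.subset_insert _ _)),
    Finset.card_le_card (Finset.union_subset_union_left (Finset.subset_insert _ _)), ?_⟩
  have h1 := Finset.card_union_add_card_inter A B
  have h2 := Finset.card_union_add_card_inter (insert z A) B
  have h3 := Finset.card_insert_le z A
  omega

section
variable {V : Type} [Fintype V] {G G' : SimpleGraph V} {a b u w : V}

open scoped Classical in
/-- The size of `N[u] ∩ N[v]`. -/
noncomputable def common (G : SimpleGraph V) (u v : V) : ℕ := (closedNbr G u ∩ closedNbr G v).card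

open scoped Classical in
/-- The size of `N[u] ∪ N[v]`. -/
noncomputable def total (G : SimpleGraph V) (u v : V) : ℕ := (closedNbr G u ∪ closedNbr G v).card

/-- The Jaccard similarity of the closed neighbourhoods of any two vertices. -/
noncomputable def jac (G : SimpleGraph V) (u v : V) : ℝ := common G u v / total G u v

lemma sim_eq (h : G.Adj u w) : sim G u w = jac G u w := if_pos h

lemma jac_comm : jac G u w = jac G w u := by
  classical
  unfold jac common total; rw [Finset.inter_comm, Finset.union_comm]

/-- The sizes of the intersection and of the union of `N[u]` and `N[v]` differ by at most `k` in
total. -/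
def Close (G G' : SimpleGraph V) (u v : V) (k : ℕ) : Prop :=
  (common G u v - common G' u v) + (common G' u v - common G u v) +
    ((total G u v - total G' u v) + (total G' u v - total G u v)) ≤ k

/-- An update changes the two sizes by at most `1` in total, and only if it affects the edge: it adds or
removes one vertex in one of the two neighbourhoods. -/
lemma close_apply {x : Update V} (hx : x.u ≠ x.w) (hab : a ≠ b) (he : s(a, b) ≠ s(x.u, x.w))
    [Decidable (x.u ∈ s(a, b) ∨ x.w ∈ s(a, b))] :
    Close G (x.apply G) a b (if x.u ∈ s(a, b) ∨ x.w ∈ s(a, b) then 1 else 0) := by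
  classical
  have adj : ∀ c y, (x.apply G).Adj c y ↔ if s(c, y) = s(x.u, x.w) then x.ins = true else G.Adj c y := by
    intro c y
    unfold Update.apply
    have : s(c, y) = s(x.u, x.w) → c ≠ y := by
      rintro h rfl
      rcases Sym2.eq_iff.1 h with ⟨h1, h2⟩ | ⟨h1, h2⟩ <;> exact hx (by rw [← h1, ← h2])
    by_cases h : s(c, y) = s(x.u, x.w)
    · rw [if_pos h]
      cases x.ins <;> simp only [Bool.false_eq_true, if_false, if_true, SimpleGraph.deleteEdges_adj,
        SimpleGraph.sup_adj, SimpleGraph.fromEdgeSet_adj, Set.mem_singleton_iff] <;> tauto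
    · rw [if_neg h]
      cases x.ins <;> simp only [Bool.false_eq_true, if_false, if_true, SimpleGraph.deleteEdges_adj,
        SimpleGraph.sup_adj, SimpleGraph.fromEdgeSet_adj, Set.mem_singleton_iff] <;> tauto
  have h0 : ∀ c, c ≠ x.u → c ≠ x.w → closedNbr (x.apply G) c = closedNbr G c := fun c h1 h2 => by
    ext y
    rw [mem_closedNbr, mem_closedNbr, adj, if_neg]
    rw [Sym2.eq_iff]; tauto
  -- the neighbourhood of an endpoint before and after the update: a set `A`, with or without `z`
  have h1 : ∀ c z, s(c, z) = s(x.u, x.w) → ∃ A, (closedNbr G c = A ∨ closedNbr G c = insert z A) ∧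
      (closedNbr (x.apply G) c = A ∨ closedNbr (x.apply G) c = insert z A) := by
    intro c z hcz
    refine ⟨(closedNbr G c).erase z, ?_, ?_⟩
    · by_cases hz : z ∈ closedNbr G c
      · exact .inr (Finset.insert_erase hz).symm
      · exact .inl (Finset.erase_eq_of_notMem hz).symm
    · have hzc : z ≠ c := by rintro rfl; rcases Sym2.eq_iff.1 hcz with ⟨rfl, h⟩ | ⟨rfl, h⟩ <;> simp_all
      have : ∀ y, y ≠ z → (y ∈ closedNbr (x.apply G) c ↔ y ∈ closedNbr G c) := fun y hy => by
        rw [mem_closedNbr, mem_closedNbr, adj, if_neg]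
        rw [← hcz, Sym2.congr_right]; exact hy
      by_cases hz : z ∈ closedNbr (x.apply G) c
      · refine .inr (Finset.ext fun y => ?_)
        by_cases hy : y = z
        · subst hy; simp [hz]
        · simp [hy, this y hy]
      · refine .inl (Finset.ext fun y => ?_)
        by_cases hy : y = z
        · subst hy; simp [hz]
        · simp [hy, this y hy]
  have h2 : ∀ {A A' B : Finset V} {z}, (A' = A ∨ A' = insert z A) → ∀ {A''}, (A'' = A ∨ A'' = insert z A) →
      ((A' ∩ B).card - (A'' ∩ B).card) + ((A'' ∩ B).card - (A' ∩ B).card) +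
      (((A' ∪ B).card - (A'' ∪ B).card) + ((A'' ∪ B).card - (A' ∪ B).card)) ≤ 1 := by
    intro A A' B z h h'  h''
    have := card_insert_near A B z
    rcases h with rfl | rfl <;> rcases h'' with rfl | rfl <;> omega
  have hab' : ∀ {c}, c = x.u ∨ c = x.w → ∃ z, s(c, z) = s(x.u, x.w) := by
    rintro c (rfl | rfl)
    exacts [⟨_, rfl⟩, ⟨_, Sym2.eq_swap⟩]
  unfold Close common total
  by_cases ha : a = x.u ∨ a = x.w
  · have hb : b ≠ x.u ∧ b ≠ x.w := by
      rw [ne_eq, Sym2.eq_iff] at he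
      constructor <;> rintro rfl <;> rcases ha with rfl | rfl <;> simp_all
    obtain ⟨z, hz⟩ := hab' ha
    obtain ⟨A, k1, k2⟩ := h1 a z hz
    rw [h0 b hb.1 hb.2, if_pos (by simp only [Sym2.mem_iff]; tauto)]
    convert h2 k1 k2
  · rw [h0 a (by tauto) (by tauto)]
    by_cases hb : b = x.u ∨ b = x.w
    · obtain ⟨z, hz⟩ := hab' hb
      obtain ⟨A, k1, k2⟩ := h1 b z hz
      rw [if_pos (by simp only [Sym2.mem_iff]; tauto), Finset.inter_comm, Finset.union_comm,
        Finset.inter_comm (closedNbr G a), Finset.union_comm (closedNbr G a)]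
      convert h2 k1 k2
    · rw [h0 b (by tauto) (by tauto)]
      simp

lemma card_closedNbr (G : SimpleGraph V) (u : V) : (closedNbr G u).card = deg G u + 1 := by
  unfold closedNbr deg
  rw [← Set.ncard_eq_toFinset_card, Set.ncard_insert_of_notMem (by simp)]

lemma degMax_lt_total (G : SimpleGraph V) (u w : V) : degMax G u w < total G u w := by
  classical
  unfold degMax
  have h1 : (closedNbr G u).card ≤ total G u w := Finset.card_le_card Finset.subset_union_left
  have h2 : (closedNbr G w).card ≤ total G u w := Finset.card_le_card Finset.subset_union_right
  rw [card_closedNbr] at h1 h2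
  omega

lemma total_le (G : SimpleGraph V) (u w : V) : total G u w ≤ 2 * degMax G u w + 2 := by
  classical
  have h1 : total G u w ≤ _ := Finset.card_union_le _ _
  rw [card_closedNbr, card_closedNbr] at h1
  unfold degMax
  omega

lemma common_le_total (G : SimpleGraph V) (u w : V) : common G u w ≤ total G u w := by
  classical
  exact Finset.card_le_card Finset.inter_subset_union

/-- While a tracking instance is not mature, the similarity changes by at most `Δ`. -/
lemma Close.jac_sub_le {Δ : ℝ} {k : ℕ} (hΔ : 0 ≤ Δ) (h : Close G G' a b k)
    (hk : (k : ℝ) ≤ Δ * degMax G a b) :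
    |jac G' a b - jac G a b| ≤ Δ := by
  have h0 := degMax_lt_total G a b
  have h0' : 0 < total G' a b := (Nat.zero_le _).trans_lt (degMax_lt_total G' a b)
  have h1 := common_le_total G' a b
  unfold Close at h
  unfold jac
  set i := common G a b
  set j := common G' a b
  set p := total G a b
  set q := total G' a b
  have p0 : (0 : ℝ) < p := by exact_mod_cast (Nat.zero_le _).trans_lt h0
  have q0 : (0 : ℝ) < q := by exact_mod_cast h0'
  have hp : (degMax G a b : ℝ) ≤ p := by exact_mod_cast h0.le
  have hk0 : (0 : ℝ) ≤ k := Nat.cast_nonneg k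
  have hj : (j : ℝ) ≤ q := by exact_mod_cast h1
  have hd : |(j : ℝ) - i| + |(q : ℝ) - p| ≤ k := by
    have e : ∀ m l : ℕ, |(m : ℝ) - l| = ((l - m) + (m - l) : ℕ) := fun m l => by
      rcases le_total l m with h | h
      · rw [Nat.sub_eq_zero_of_le h, abs_of_nonneg (by simpa using h), zero_add, Nat.cast_sub h]
      · rw [Nat.sub_eq_zero_of_le h, abs_of_nonpos (by simpa using h), add_zero, Nat.cast_sub h]
        ring
    rw [e, e]
    exact_mod_cast h
  -- both quotients have values in `[0, 1]`, so the difference is at most `k / p`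
  have e : (j : ℝ) / q - i / p = (((j : ℝ) - i) * q - (q - p) * j) / (q * p) := by
    field_simp; ring
  rw [e, abs_div, abs_of_pos (mul_pos q0 p0), div_le_iff₀ (mul_pos q0 p0)]
  have h2 : |((j : ℝ) - i) * q - (q - p) * j| ≤ k * q := by
    refine (abs_sub _ _).trans ?_
    rw [abs_mul, abs_mul, abs_of_pos q0, abs_of_nonneg (Nat.cast_nonneg j : (0 : ℝ) ≤ j)]
    nlinarith [mul_le_mul_of_nonneg_left hj (abs_nonneg ((q : ℝ) - p))]
  have := hk.trans (mul_le_mul_of_nonneg_left hp hΔ)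
  nlinarith

end


/-! ### Validity of the labels and the number of invocations -/

section
variable {V : Type} [Fintype V] {ε ρ : ℝ} {L : ℕ → ℕ} {smp : ℕ → ℕ → V ⊕ V} {s s' : State V}
  {Z : Set V} {e : Sym2 V} {a v : V}

lemma getElem?_of_prefix {α : Type} {l l' : List α} (h : l <+: l') {i : ℕ} {c : α}
    (hc : l[i]? = some c) : l'[i]? = some c := by
  obtain ⟨r, rfl⟩ := h
  rwa [List.getElem?_append_left (List.getElem?_eq_some_iff.1 hc).1]

/-- The edge `e` has a tracking instance, and the similarity has changed little since it was
labelled. -/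
def Tracked (ε ρ : ℝ) (L : ℕ → ℕ) (smp : ℕ → ℕ → V ⊕ V) (s : State V) (e : Sym2 V) : Prop :=
  ∃ i c, s.calls[i]? = some c ∧ s(c.2.1, c.2.2) = e ∧
    (s.label e = true ↔ ε ≤ estimate c.1 c.2.1 c.2.2 (L (i + 1)) (smp (i + 1))) ∧
    s.thr e = ⌊ρ * ε / 2 * (degMax c.1 c.2.1 c.2.2 : ℝ)⌋₊ + 1 ∧
    Close c.1 s.graph c.2.1 c.2.2 (s.cnt e)

/-- All edges are tracked, and only edges at the vertices in `Z` are mature. -/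
structure Live (ε ρ : ℝ) (L : ℕ → ℕ) (smp : ℕ → ℕ → V ⊕ V) (Z : Set V) (s : State V) : Prop where
  tr : ∀ e ∈ s.graph.edgeSet, Tracked ε ρ L smp s e
  le : ∀ e ∈ s.graph.edgeSet, s.cnt e ≤ s.thr e
  mat : ∀ e ∈ s.graph.edgeSet, s.cnt e = s.thr e → ∃ z ∈ Z, z ∈ e

open scoped Classical in
/-- The progress of all tracking instances, each measured relative to its threshold. A relabelling
consumes `1`, and an update adds only a constant. -/
noncomputable def progress (s : State V) : ℝ :=
  ∑ e : Sym2 V, if e ∈ s.graph.edgeSet then (s.cnt e : ℝ) / s.thr e else 0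

lemma progress_nonneg (s : State V) : 0 ≤ progress s :=
  Finset.sum_nonneg fun e _ => by split_ifs <;> positivity

lemma Live.lt (h : Live ε ρ L smp ∅ s) (he : e ∈ s.graph.edgeSet) : s.cnt e < s.thr e :=
  lt_of_le_of_ne (h.le e he) fun hc => by obtain ⟨z, hz, -⟩ := h.mat e he hc; exact hz

lemma tracked_relabel : Tracked ε ρ L smp (relabel ε ρ L smp s (a, v)) s(a, v) :=
  ⟨s.calls.length, (s.graph, a, v), by simp [relabel], rfl, by simp [relabel], by simp [relabel],
    by simp [relabel, Close]⟩

lemma Tracked.relabel (h : Tracked ε ρ L smp s e) (he : e ≠ s(a, v)) :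
    Tracked ε ρ L smp (relabel ε ρ L smp s (a, v)) e := by
  obtain ⟨i, c, h1, h2, h3⟩ := h
  refine ⟨i, c, getElem?_of_prefix ?_ h1, h2, ?_⟩
  · simp [DynELM.relabel]
  · simpa [DynELM.relabel, he] using h3

lemma relabel_eq (h : (relabel ε ρ L smp s (a, v)).cnt e = (relabel ε ρ L smp s (a, v)).thr e) :
    e ≠ s(a, v) ∧ s.cnt e = s.thr e := by
  have he : e ≠ s(a, v) := by rintro rfl; simp [relabel] at h
  exact ⟨he, by simpa [relabel, he] using h⟩

lemma Live.relabel (h : Live ε ρ L smp Z s) (hadj : s.graph.Adj a v) (hm : s.cnt s(a, v) = s.thr s(a, v)) :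
    Live ε ρ L smp Z (relabel ε ρ L smp s (a, v)) ∧
      progress (DynELM.relabel ε ρ L smp s (a, v)) + 1 = progress s := by
  classical
  refine ⟨⟨fun e he => ?_, fun e he => ?_, fun e he hc => ?_⟩, ?_⟩
  · by_cases hav : e = s(a, v)
    · subst hav; exact tracked_relabel
    · exact (h.tr e he).relabel hav
  · by_cases hav : e = s(a, v)
    · subst hav; simp [DynELM.relabel]
    · simpa [DynELM.relabel, hav] using h.le e he
  · exact h.mat e he (relabel_eq hc).2
  · obtain ⟨i, c, -, -, -, h4, -⟩ := h.tr s(a, v) hadj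
    unfold progress
    rw [← Finset.add_sum_erase _ _ (Finset.mem_univ s(a, v)), ← Finset.add_sum_erase (a := s(a, v)) (s := Finset.univ)
      (fun e => if e ∈ s.graph.edgeSet then (s.cnt e : ℝ) / s.thr e else 0) (Finset.mem_univ s(a, v))]
    have e1 : ∑ e ∈ Finset.univ.erase s(a, v), (if e ∈ (DynELM.relabel ε ρ L smp s (a, v)).graph.edgeSet then
        ((DynELM.relabel ε ρ L smp s (a, v)).cnt e : ℝ) / (DynELM.relabel ε ρ L smp s (a, v)).thr e else 0) =
        ∑ e ∈ Finset.univ.erase s(a, v), if e ∈ s.graph.edgeSet then (s.cnt e : ℝ) / s.thr e else 0 :=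
      Finset.sum_congr rfl fun e he => by simp [DynELM.relabel, Finset.ne_of_mem_erase he]
    rw [e1, if_pos (show s(a, v) ∈ s.graph.edgeSet from hadj), hm, h4]
    have : ((⌊ρ * ε / 2 * (degMax c.1 c.2.1 c.2.2 : ℝ)⌋₊ + 1 : ℕ) : ℝ) ≠ 0 := by positivity
    rw [div_self this]
    simp [DynELM.relabel]
    ring

lemma Live.foldl (h : Live ε ρ L smp Z s) {vs : List V} (hn : vs.Nodup) (hv : ∀ v ∈ vs, Mature s a v)
    (hs' : s' = (vs.map fun v => (a, v)).foldl (DynELM.relabel ε ρ L smp) s) :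
    Live ε ρ L smp Z s' ∧ progress s' + s'.calls.length = progress s + s.calls.length ∧
      s'.graph = s.graph ∧ s.calls <+: s'.calls ∧
      ∀ e, s'.cnt e = s'.thr e → s.cnt e = s.thr e ∧ ∀ v ∈ vs, e ≠ s(a, v) := by
  induction vs generalizing s with
  | nil => subst hs'; simp [h]
  | cons v vs ih =>
    obtain ⟨h1, h2⟩ := h.relabel (hv v (by simp)).1 (hv v (by simp)).2
    obtain ⟨hn1, hn2⟩ := List.nodup_cons.1 hn
    obtain ⟨i1, i2, i3, i4, i5⟩ := ih h1 hn2 (fun y hy => by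
      obtain ⟨k1, k2⟩ := hv y (by simp [hy])
      have hne : s(a, y) ≠ s(a, v) := fun e => hn1 (by rw [← Sym2.congr_right.1 e]; exact hy)
      exact ⟨k1, by simpa [DynELM.relabel, hne] using k2⟩) hs'
    refine ⟨i1, ?_, i3, ?_, fun e he => ?_⟩
    · rw [i2, ← h2]
      simp [DynELM.relabel]; ring
    · exact List.IsPrefix.trans (by simp [DynELM.relabel]) i4
    · obtain ⟨j1, j2⟩ := i5 e he
      obtain ⟨k1, k2⟩ := relabel_eq j1
      exact ⟨k2, by simpa [k1] using j2⟩

/-- The relabelling at `a` leaves no mature edge at `a`. -/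
lemma Live.relabelAt (h : Live ε ρ L smp Z s) (hs' : RelabelAt ε ρ L smp a s s') :
    Live ε ρ L smp (Z \ {a}) s' ∧ progress s' + s'.calls.length = progress s + s.calls.length ∧
      s'.graph = s.graph ∧ s.calls <+: s'.calls := by
  obtain ⟨vs, h1, h2, h3⟩ := hs'
  obtain ⟨i1, i2, i3, i4, i5⟩ := h.foldl h1 (fun v hv => (h2 v).1 hv) h3
  refine ⟨⟨i1.tr, i1.le, fun e he hc => ?_⟩, i2, i3, i4⟩
  obtain ⟨k1, k2⟩ := i5 e hc
  rw [i3] at he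
  obtain ⟨z, hz, hze⟩ := h.mat e he k1
  refine ⟨z, ⟨hz, ?_⟩, hze⟩
  rintro rfl
  obtain ⟨y, rfl⟩ := Sym2.mem_iff_exists.1 hze
  exact k2 y ((h2 y).2 ⟨he, k1⟩) rfl

variable (hε : 0 < ε) (hρ : 0 < ρ)
include hε hρ

/-- A tracking instance needs a number of updates that is proportional to the degrees. -/
lemma Live.deg_le (h : Live ε ρ L smp ∅ s) (he : e ∈ s.graph.edgeSet) (ha : a ∈ e) :
    (deg s.graph a : ℝ) ≤ (4 / (ρ * ε) + 1) * s.thr e := by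
  have hlt := h.lt he
  obtain ⟨i, c, -, h2, -, h4, h5⟩ := h.tr e he
  have h6 := degMax_lt_total s.graph c.2.1 c.2.2
  have h7 := total_le c.1 c.2.1 c.2.2
  have h8 : deg s.graph a ≤ degMax s.graph c.2.1 c.2.2 := by
    rw [← h2, Sym2.mem_iff] at ha
    rcases ha with rfl | rfl
    exacts [le_max_left _ _, le_max_right _ _]
  unfold Close at h5
  have h9 : deg s.graph a ≤ 2 * degMax c.1 c.2.1 c.2.2 + s.thr e := by omega
  have h10 : (deg s.graph a : ℝ) ≤ 2 * degMax c.1 c.2.1 c.2.2 + s.thr e := by exact_mod_cast h9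
  have h11 : ρ * ε / 2 * (degMax c.1 c.2.1 c.2.2 : ℝ) < s.thr e := by
    rw [h4]; push_cast; exact Nat.lt_floor_add_one _
  have hp : 0 < ρ * ε := mul_pos hρ hε
  have h12 : (degMax c.1 c.2.1 c.2.2 : ℝ) ≤ 2 / (ρ * ε) * s.thr e := by
    rw [div_mul_eq_mul_div, le_div_iff₀ hp]; nlinarith
  calc (deg s.graph a : ℝ) ≤ 2 * (2 / (ρ * ε) * s.thr e) + s.thr e := by linarith
    _ = _ := by ring

open scoped Classical in
/-- The progress that an update at `a` adds is bounded: each of the `deg a` instances contributes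
`O(1 / deg a)`. -/
lemma Live.sum_le (h : Live ε ρ L smp ∅ s) (a : V) :
    ∑ e : Sym2 V, (if e ∈ s.graph.edgeSet ∧ a ∈ e then 1 / (s.thr e : ℝ) else 0) ≤
      4 / (ρ * ε) + 1 := by
  have hk : 0 ≤ 4 / (ρ * ε) + 1 := by positivity
  rw [← Finset.sum_filter]
  set F := Finset.univ.filter fun e => e ∈ s.graph.edgeSet ∧ a ∈ e with hF
  have hc : F.card ≤ deg s.graph a := by
    unfold deg
    rw [← Set.ncard_coe_finset]
    refine (Set.ncard_le_ncard (t := (fun y => s(a, y)) '' s.graph.neighborSet a) (fun e he => ?_)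
      (Set.toFinite _)).trans (Set.ncard_image_le (Set.toFinite _))
    obtain ⟨h1, h2⟩ := (Finset.mem_filter.1 he).2
    obtain ⟨y, rfl⟩ := Sym2.mem_iff_exists.1 h2
    exact ⟨y, h1, rfl⟩
  rcases F.eq_empty_or_nonempty with h0 | h0
  · rw [h0]; simpa using hk
  have hd : (0 : ℝ) < deg s.graph a := by
    exact_mod_cast (Finset.card_pos.2 h0).trans_le hc
  have h1 : ∀ e ∈ F, 1 / (s.thr e : ℝ) ≤ (4 / (ρ * ε) + 1) / deg s.graph a := fun e he => by
    obtain ⟨h1, h2⟩ := (Finset.mem_filter.1 he).2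
    have ht : (0 : ℝ) < s.thr e := by exact_mod_cast (Nat.zero_le _).trans_lt (h.lt h1)
    rw [div_le_div_iff₀ ht hd, one_mul]
    exact h.deg_le hε hρ h1 h2
  refine (Finset.sum_le_card_nsmul _ _ _ h1).trans ?_
  rw [nsmul_eq_mul, mul_div_assoc', div_le_iff₀ hd, mul_comm]
  exact mul_le_mul_of_nonneg_left (by exact_mod_cast hc) hk

lemma Live.arrive (h : Live ε ρ L smp ∅ s) {x : Update V} (hx : x.Valid s.graph)
    (hs' : s' = if x.ins then DynELM.relabel ε ρ L smp (arrive s x) (x.u, x.w) else arrive s x) :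
    Live ε ρ L smp {x.u, x.w} s' ∧ progress s' ≤ progress s + 2 * (4 / (ρ * ε) + 1) ∧
      s'.graph = x.apply s.graph ∧ s.calls <+: s'.calls ∧ s'.calls.length ≤ s.calls.length + 1 := by
  classical
  set t : Sym2 V → ℕ := fun e => if x.u ∈ e ∨ x.w ∈ e then 1 else 0 with ht
  have hg : s'.graph = x.apply s.graph := by rw [hs']; split_ifs <;> rfl
  have hold : ∀ e, e ≠ s(x.u, x.w) → e ∈ s'.graph.edgeSet → e ∈ s.graph.edgeSet ∧
      s'.cnt e = s.cnt e + t e ∧ s'.thr e = s.thr e ∧ s'.label e = s.label e := by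
    intro e hne he
    have hcnt : (DynELM.arrive s x).cnt e = s.cnt e + t e := by
      simp only [DynELM.arrive, ht]; split_ifs <;> simp_all
    refine ⟨?_, ?_⟩
    · rw [hg] at he
      unfold Update.apply at he
      split_ifs at he
      · simpa [hne] using he
      · rw [SimpleGraph.edgeSet_deleteEdges] at he; exact he.1
    · rw [hs']
      split_ifs with hi
      · refine ⟨?_, ?_, ?_⟩ <;> simp [DynELM.relabel, hne, hcnt]
        · simp [DynELM.arrive]
        · simp [DynELM.arrive, hi]
      · exact ⟨hcnt, rfl, by simp [DynELM.arrive, hi, hne]⟩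
  have hnew : ∀ e ∈ s'.graph.edgeSet, e = s(x.u, x.w) → Tracked ε ρ L smp s' e ∧ s'.cnt e = 0 := by
    rintro e he rfl
    cases hi : x.ins with
    | true =>
      rw [hs', if_pos hi]
      exact ⟨tracked_relabel, by simp [DynELM.relabel]⟩
    | false =>
      rw [hg] at he
      unfold Update.apply at he
      rw [hi, if_neg (by simp), SimpleGraph.edgeSet_deleteEdges] at he
      exact absurd rfl he.2
  have hcalls : s.calls <+: s'.calls ∧ s'.calls.length ≤ s.calls.length + 1 := by
    rw [hs']; split_ifs <;> simp [DynELM.relabel, DynELM.arrive]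
  refine ⟨⟨fun e he => ?_, fun e he => ?_, fun e he hc => ?_⟩, ?_, hg, hcalls⟩
  · by_cases hne : e = s(x.u, x.w)
    · exact (hnew e he hne).1
    · obtain ⟨h1, h2, h3, h4⟩ := hold e hne he
      obtain ⟨i, c, k1, k2, k3, k4, k5⟩ := h.tr e h1
      refine ⟨i, c, getElem?_of_prefix hcalls.1 k1, k2, by rw [h4]; exact k3,
        by rw [h3]; exact k4, ?_⟩
      have hab : c.2.1 ≠ c.2.2 := by
        rw [← k2] at h1
        exact s.graph.ne_of_adj h1
      have := close_apply (G := s.graph) hx.1 hab (by rw [k2]; exact hne)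
      rw [hg, h2]
      simp only [ht]
      rw [← k2] at k5 ⊢
      unfold Close at *
      omega
  · by_cases hne : e = s(x.u, x.w)
    · rw [(hnew e he hne).2]; exact Nat.zero_le _
    · obtain ⟨h1, h2, h3, h4⟩ := hold e hne he
      have := h.lt h1
      rw [h2, h3]
      simp only [ht]; split_ifs <;> omega
  · by_cases hne : e = s(x.u, x.w)
    · exact ⟨x.u, by simp, by simp [hne]⟩
    · obtain ⟨h1, h2, h3, h4⟩ := hold e hne he
      have := h.lt h1
      rw [h2, h3] at hc
      by_contra hz
      have : t e = 0 := if_neg fun h' => hz (by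
        rcases h' with h' | h'
        exacts [⟨_, by simp, h'⟩, ⟨_, by simp, h'⟩])
      omega
  · have h1 := h.sum_le hε hρ x.u
    have h2 := h.sum_le hε hρ x.w
    have h3 : progress s' ≤ progress s +
        (∑ e : Sym2 V, (if e ∈ s.graph.edgeSet ∧ x.u ∈ e then 1 / (s.thr e : ℝ) else 0) +
        ∑ e : Sym2 V, (if e ∈ s.graph.edgeSet ∧ x.w ∈ e then 1 / (s.thr e : ℝ) else 0)) := by
      unfold progress
      rw [← Finset.sum_add_distrib, ← Finset.sum_add_distrib]
      refine Finset.sum_le_sum fun e _ => ?_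
      have hnn : ∀ (p : Prop) [Decidable p], (0 : ℝ) ≤ if p then 1 / (s.thr e : ℝ) else 0 := fun p _ => by
        split_ifs <;> positivity
      by_cases he : e ∈ s'.graph.edgeSet
      · by_cases hne : e = s(x.u, x.w)
        · rw [(hnew e he hne).2]
          have : (0 : ℝ) ≤ if e ∈ s.graph.edgeSet then (s.cnt e : ℝ) / s.thr e else 0 := by
            split_ifs <;> positivity
          simp only [Nat.cast_zero, zero_div, ite_self]
          exact add_nonneg this (add_nonneg (hnn _) (hnn _))
        · obtain ⟨k1, k2, k3, -⟩ := hold e hne he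
          rw [if_pos he, if_pos k1, k2, k3]
          push_cast
          rw [add_div]
          have : (0 : ℝ) ≤ 1 / s.thr e := by positivity
          simp only [ht, k1, true_and]
          split_ifs <;> simp_all
      · rw [if_neg he]
        exact add_nonneg (by split_ifs <;> positivity) (add_nonneg (hnn _) (hnn _))
    linarith

/-- The invariants of the algorithm. -/
lemma Live.step (h : Live ε ρ L smp ∅ s) {x : Update V} (hx : x.Valid s.graph)
    (hs : Step ε ρ L smp x s s') : Live ε ρ L smp ∅ s' ∧ s'.graph = x.apply s.graph ∧
      s.calls <+: s'.calls ∧ progress s' + s'.calls.length ≤ progress s + s.calls.length +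
        (2 * (4 / (ρ * ε) + 1) + 1) := by
  obtain ⟨s1, s2, h1, h2, h3⟩ := hs
  obtain ⟨i1, i2, i3, i4, i5⟩ := h.arrive hε hρ hx h1
  obtain ⟨j1, j2, j3, j4⟩ := i1.relabelAt h2
  obtain ⟨k1, k2, k3, k4⟩ := j1.relabelAt h3
  have : (({x.u, x.w} : Set V) \ {x.u}) \ {x.w} = ∅ := by ext; simp
  rw [this] at k1
  refine ⟨k1, by rw [k3, j3, i3], (i4.trans j4).trans k4, ?_⟩
  have : (s1.calls.length : ℝ) ≤ s.calls.length + 1 := by exact_mod_cast i5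
  linarith

/-- If all estimates are good then the labels are valid. -/
lemma Live.valid (h : Live ε ρ L smp ∅ s)
    (hg : ∀ i c, s.calls[i]? = some c →
      |estimate c.1 c.2.1 c.2.2 (L (i + 1)) (smp (i + 1)) - jac c.1 c.2.1 c.2.2| ≤ ρ * ε / 2) :
    ValidLabelling s.graph ε ρ s.label := by
  intro u w huw
  obtain ⟨i, c, h1, h2, h3, h4, h5⟩ := h.tr s(u, w) huw
  have hlt := h.lt (e := s(u, w)) huw
  have hp : 0 < ρ * ε := mul_pos hρ hε
  have hj : jac s.graph u w = jac s.graph c.2.1 c.2.2 := by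
    rcases Sym2.eq_iff.1 h2 with ⟨rfl, rfl⟩ | ⟨rfl, rfl⟩
    exacts [rfl, jac_comm]
  have hk : (s.cnt s(u, w) : ℝ) ≤ ρ * ε / 2 * degMax c.1 c.2.1 c.2.2 := by
    have h6 : s.cnt s(u, w) ≤ ⌊ρ * ε / 2 * (degMax c.1 c.2.1 c.2.2 : ℝ)⌋₊ := by omega
    exact (Nat.cast_le.2 h6).trans (Nat.floor_le (by positivity))
  have h6 := abs_le.1 (h5.jac_sub_le (by positivity) hk)
  have h7 := abs_le.1 (hg i c h1)
  rw [sim_eq huw, hj]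
  refine ⟨fun h8 => h3.2 (by linarith), fun h8 => ?_⟩
  rw [← Bool.not_eq_true, h3]
  intro h9
  linarith

end


/-! ### The estimates are good with high probability -/

lemma abs_div_two_sub_le {x y : ℝ} (hx : x ≤ 1) (hy : y ≤ 1) :
    |x / (2 - x) - y / (2 - y)| ≤ 2 * |x - y| := by
  have h1 : 0 < 2 - x := by linarith
  have h2 : 0 < 2 - y := by linarith
  have e : x / (2 - x) - y / (2 - y) = 2 * (x - y) / ((2 - x) * (2 - y)) := by field_simp; ring
  rw [e, abs_div, abs_mul, abs_of_pos (mul_pos h1 h2), abs_two]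
  exact div_le_self (by positivity) (by nlinarith)

/-- Hoeffding's inequality for the similarity estimate: `x ↦ x / (2 - x)` is `2`-Lipschitz on `[0, 1]`,
so it suffices that the fraction of hits is within `Δ / 2` of its mean. -/
lemma estimate_fail {Ω V : Type} [MeasurableSpace Ω] {μ : Measure Ω} [IsProbabilityMeasure μ]
    [Fintype V] [MeasurableSpace V] [MeasurableSingletonClass (V ⊕ V)] {G : SimpleGraph V} {a b : V}
    {X : ℕ → Ω → V ⊕ V} (hind : iIndepFun X μ) (hm : ∀ j, Measurable (X j)) {L : ℕ} (hL : 0 < L)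
    (hlaw : ∀ j < L, μ.map (X j) =
      uniformOn (((closedNbr G a).disjSum (closedNbr G b) : Finset (V ⊕ V)) : Set (V ⊕ V)))
    {Δ : ℝ} (hΔ : 0 ≤ Δ) :
    μ.real {ω | Δ < |estimate G a b L (fun j => X j ω) - jac G a b|} ≤
      2 * Real.exp (-(L * Δ ^ 2 / 2)) := by
  classical
  set S := (closedNbr G a).disjSum (closedNbr G b) with hS
  set T : Finset (V ⊕ V) := Finset.univ.filter fun y => Sum.elim id id y ∈ closedNbr G a ∩ closedNbr G b
    with hT
  set h : V ⊕ V → ℝ := (T : Set (V ⊕ V)).indicator 1 with hh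
  have hL' : (0 : ℝ) < L := by exact_mod_cast hL
  have hU : (0 : ℝ) < total G a b := by
    exact_mod_cast (Nat.zero_le _).trans_lt (degMax_lt_total G a b)
  -- the probability of a hit
  set p : ℝ := 2 * common G a b / (common G a b + total G a b) with hp
  have hpI : (0 : ℝ) < common G a b + total G a b := by positivity
  have hle : (common G a b : ℝ) ≤ total G a b := by exact_mod_cast common_le_total G a b
  have hp1 : p ≤ 1 := by rw [hp, div_le_one hpI]; linarith
  have hjac : p / (2 - p) = jac G a b := by
    have : 2 - p = 2 * total G a b / (common G a b + total G a b) := by rw [hp]; field_simp; ring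
    rw [this, hp]
    unfold jac
    field_simp
  have hST : (S ∩ T).card = 2 * common G a b := by
    have : S ∩ T = (closedNbr G a ∩ closedNbr G b).disjSum (closedNbr G a ∩ closedNbr G b) := by
      ext y
      rcases y with y | y <;> simp [hS, hT]
    rw [this, Finset.card_disjSum]
    unfold common
    ring_nf
  have hSc : S.card = common G a b + total G a b := by
    rw [hS, Finset.card_disjSum, ← Finset.card_union_add_card_inter, add_comm]
    unfold common total
    congr!
  have mh : Measurable h := (measurable_one.indicator T.measurableSet)
  have hmean : ∀ j < L, ∫ ω, h (X j ω) ∂μ = p := fun j hj => by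
    rw [← integral_map (hm j).aemeasurable mh.aestronglyMeasurable, hlaw j hj, hh,
      integral_indicator_one T.measurableSet, Measure.real, uniformOn_apply_finset, hST, hSc, hp]
    simp [ENNReal.toReal_add]
  have hsub : ∀ j < L, HasSubgaussianMGF (fun ω => h (X j ω) - p) ((‖(1 : ℝ) - 0‖₊ / 2) ^ 2) μ := by
    intro j hj
    rw [← hmean j hj]
    refine hasSubgaussianMGF_of_mem_Icc (mh.comp (hm j)).aemeasurable (.of_forall fun ω => ?_)
    simp only [hh, Set.indicator_apply]
    split_ifs <;> simp
  have i1 : iIndepFun (fun j ω => h (X j ω) - p) μ :=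
    hind.comp (fun _ y => h y - p) fun _ => mh.sub_const p
  have i2 : iIndepFun (fun j => -fun ω => h (X j ω) - p) μ :=
    hind.comp (fun _ y => -(h y - p)) fun _ => (mh.sub_const p).neg
  have b1 := HasSubgaussianMGF.measure_sum_range_ge_le_of_iIndepFun i1 hsub (ε := L * (Δ / 2))
    (by positivity)
  have b2 := HasSubgaussianMGF.measure_sum_range_ge_le_of_iIndepFun i2 (fun j hj => (hsub j hj).neg)
    (ε := L * (Δ / 2)) (by positivity)
  have hexp : -(L * (Δ / 2)) ^ 2 / (2 * L * (((‖(1 : ℝ) - 0‖₊ / 2) ^ 2 : NNReal) : ℝ)) =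
      -(L * Δ ^ 2 / 2) := by
    simp
    field_simp
  rw [hexp] at b1 b2
  refine (measureReal_mono ?_).trans ((measureReal_union_le _ _).trans ((add_le_add b1 b2).trans
    (by linarith)))
  intro ω hω
  set s : ℝ := ∑ j ∈ Finset.range L, h (X j ω) with hs
  have he : estimate G a b L (fun j => X j ω) = s / L / (2 - s / L) := by
    unfold estimate
    have : s = ∑ j ∈ Finset.range L, if Sum.elim id id (X j ω) ∈ closedNbr G a ∩ closedNbr G b
        then (1 : ℝ) else 0 :=
      Finset.sum_congr rfl fun j _ => by simp [hh, hT, Set.indicator_apply]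
    rw [this]
  have hs1 : s / L ≤ 1 := by
    rw [div_le_one hL', hs]
    refine (Finset.sum_le_sum (g := fun _ => 1) fun j _ => ?_).trans (by simp)
    simp only [hh, Set.indicator_apply]
    split_ifs <;> simp
  have h3 : Δ < 2 * |s / L - p| := by
    refine lt_of_lt_of_le hω ?_
    rw [he, ← hjac]
    exact abs_div_two_sub_le hs1 hp1
  have e1 : ∑ j ∈ Finset.range L, (h (X j ω) - p) = L * (s / L - p) := by
    rw [Finset.sum_sub_distrib, ← hs]; simp; field_simp
  have e2 : ∑ j ∈ Finset.range L, (-fun ω => h (X j ω) - p) ω = -(L * (s / L - p)) := by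
    rw [← e1, ← Finset.sum_neg_distrib]; rfl
  simp only [Set.mem_union, Set.mem_ofPred_eq, e1, e2]
  rcases le_abs.1 (show Δ / 2 ≤ |s / L - p| by linarith) with h4 | h4
  · exact .inl (mul_le_mul_of_nonneg_left h4 hL'.le)
  · exact .inr (by rw [← mul_neg]; exact mul_le_mul_of_nonneg_left h4 hL'.le)

lemma sum_inv_le (δ : ℝ) (hδ : 0 ≤ δ) (k : ℕ) :
    ∑ i ∈ Finset.range k, δ / ((i + 1 : ℕ) * ((i + 1 : ℕ) + 1)) ≤ δ := by
  have : ∑ i ∈ Finset.range k, δ / ((i + 1 : ℕ) * ((i + 1 : ℕ) + 1)) = δ - δ / (k + 1) := by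
    induction k with
    | zero => simp
    | succ k ih =>
      rw [Finset.sum_range_succ, ih]
      push_cast
      field_simp
      ring
  rw [this]
  have : 0 ≤ δ / (k + 1) := by positivity
  linarith

/-- With probability at least `1 - δ`, all estimates are good, by a union bound with the failure
probabilities `δ / (i * (i + 1))`, whose sum telescopes. -/
lemma sampling_fail {Ω V : Type} [MeasurableSpace Ω] {μ : Measure Ω} [IsProbabilityMeasure μ]
    [Fintype V] [MeasurableSpace V] [MeasurableSingletonClass (V ⊕ V)] {L : ℕ → ℕ}
    {calls : List (SimpleGraph V × V × V)} {smp : Ω → ℕ → ℕ → V ⊕ V} (h : IsSampling μ L calls smp)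
    (hm : ∀ i j, Measurable fun ω => smp ω i j) {Δ δ : ℝ} (hΔ : 0 < Δ) (hδ : 0 < δ)
    (hL0 : ∀ i, 0 < L i)
    (hL : ∀ i : ℕ, 1 ≤ i → 2 / Δ ^ 2 * Real.log (2 / (δ / (i * (i + 1)))) ≤ L i) :
    μ {ω | ¬ ∀ i c, calls[i]? = some c →
      |estimate c.1 c.2.1 c.2.2 (L (i + 1)) (smp ω (i + 1)) - jac c.1 c.2.1 c.2.2| ≤ Δ} ≤
      ENNReal.ofReal δ := by
  set F : Fin calls.length → Set Ω := fun i => {ω | Δ < |estimate calls[i].1 calls[i].2.1 calls[i].2.2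
    (L (i + 1)) (smp ω (i + 1)) - jac calls[i].1 calls[i].2.1 calls[i].2.2|} with hF
  have hF1 : ∀ i, μ.real (F i) ≤ δ / ((i + 1 : ℕ) * ((i + 1 : ℕ) + 1)) := fun i => by
    have hind : iIndepFun (fun j ω => smp ω (i + 1) j) μ :=
      h.1.precomp (g := fun j => ((i : ℕ) + 1, j)) fun _ _ e => by simpa using e
    refine (estimate_fail hind (fun j => hm _ j) (hL0 _) (fun j hj => h.2 i i.2 j hj) hΔ.le).trans ?_
    have h1 := hL (i + 1) (by omega)
    set D := δ / ((i + 1 : ℕ) * ((i + 1 : ℕ) + 1 : ℝ)) with hD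
    have hD0 : 0 < D := by positivity
    have h2 : Real.log (2 / D) ≤ L (i + 1) * Δ ^ 2 / 2 := by
      have e : (2 / Δ ^ 2 * Real.log (2 / D)) * (Δ ^ 2 / 2) = Real.log (2 / D) := by field_simp
      rw [← e, mul_div_assoc]
      exact mul_le_mul_of_nonneg_right h1 (by positivity)
    calc 2 * Real.exp (-(L (i + 1) * Δ ^ 2 / 2)) ≤ 2 * Real.exp (-Real.log (2 / D)) := by
          gcongr
      _ = D := by rw [Real.exp_neg, Real.exp_log (by positivity)]; field_simp
  have hsub : {ω | ¬ ∀ i c, calls[i]? = some c →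
      |estimate c.1 c.2.1 c.2.2 (L (i + 1)) (smp ω (i + 1)) - jac c.1 c.2.1 c.2.2| ≤ Δ} ⊆ ⋃ i, F i := by
    intro ω hω
    simp only [Set.mem_ofPred_eq, not_forall, not_le] at hω
    obtain ⟨i, c, hc, hω⟩ := hω
    obtain ⟨hi, rfl⟩ := List.getElem?_eq_some_iff.1 hc
    exact Set.mem_iUnion.2 ⟨⟨i, hi⟩, hω⟩
  have h3 : μ.real (⋃ i, F i) ≤ δ := by
    refine (measureReal_iUnion_fintype_le F).trans ((Finset.sum_le_sum fun i _ => hF1 i).trans ?_)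
    rw [Fin.sum_univ_eq_sum_range (fun i => δ / ((i + 1 : ℕ) * ((i + 1 : ℕ) + 1 : ℝ)))]
    exact sum_inv_le δ hδ.le _
  refine (measure_mono hsub).trans ?_
  rw [← ofReal_measureReal]
  exact ENNReal.ofReal_le_ofReal h3


/-! ### The samples that the machine draws -/

/-- A bijection to a finite set takes the uniform distribution to the uniform distribution. -/
lemma map_uniform {k : ℕ} {α : Type} [MeasurableSpace α] [MeasurableSingletonClass α] [Fintype α]
    (f : Fin (k + 1) → α) (S : Finset α) (hS : ∀ y ∈ S, ∃ x, f x = y) (hc : S.card = k + 1) :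
    (PMF.uniformOfFintype (Fin (k + 1))).toMeasure.map f = uniformOn (S : Set α) := by
  classical
  have himg : Finset.univ.image f = S := by
    refine (Finset.eq_of_subset_of_card_le (fun y hy => ?_) ?_).symm
    · obtain ⟨x, rfl⟩ := hS y hy; simp
    · rw [hc]; exact Finset.card_image_le.trans (by simp)
  have hinj : Function.Injective f := by
    have : (Finset.univ.image f).card = (Finset.univ : Finset (Fin (k + 1))).card := by
      rw [himg, hc]; simp
    simpa using Finset.card_image_iff.1 this
  ext A hA
  have hm : MeasurableSet (f ⁻¹' A) := measurable_of_finite f hA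
  rw [Measure.map_apply (measurable_of_finite f) hA,
    PMF.toMeasure_uniformOfFintype_apply (f ⁻¹' A) hm]
  have hA' : A = (A.toFinset : Set α) := by simp
  conv_rhs => rw [hA']
  rw [uniformOn_apply_finset, hc, Fintype.card_fin]
  congr 2
  have : S ∩ A.toFinset = (Finset.univ.filter fun x => f x ∈ A).image f := by
    rw [← himg]; ext y
    simp only [Finset.mem_inter, Finset.mem_image, Finset.mem_univ, true_and, Set.mem_toFinset,
      Finset.mem_filter]
    exact ⟨fun ⟨⟨x, h⟩, h'⟩ => ⟨x, by rwa [h], h⟩, fun ⟨x, h, h'⟩ => ⟨⟨x, h'⟩, h' ▸ h⟩⟩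
  rw [this, Finset.card_image_of_injective _ hinj, Fintype.card_subtype]
  rfl

instance {n : ℕ} : MeasurableSingletonClass (Fin n ⊕ Fin n) :=
  ⟨fun _ => measurableSet_sum_iff.2 ⟨.of_discrete, .of_discrete⟩⟩

/-- The vertex with a given number. -/
def toFin {n : ℕ} (z : Fin n) (x : ℕ) : Fin n := if h : x < n then ⟨x, h⟩ else z

lemma toFin_val {n : ℕ} (z x : Fin n) : toFin z x = x := by simp [toFin]

/-- The element of the disjoint union of the closed neighbourhoods that is picked for the random
number `x`. -/
def pickSum {n : ℕ} (z : Fin n) (c : ℕ × ℕ × (ℕ → List ℕ)) (x : ℕ) : Fin n ⊕ Fin n :=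
  let y := toFin z (pick c.1 c.2.1 (c.2.2 c.1) (c.2.2 c.2.1) x)
  if x ≤ (c.2.2 c.1).length then .inl y else .inr y

/-- Each element of the disjoint union is picked for exactly one random number. -/
lemma CallRel.map {n : ℕ} {c : ℕ × ℕ × (ℕ → List ℕ)} {s : SimpleGraph (Fin n) × Fin n × Fin n}
    (h : CallRel c s) (z : Fin n) :
    (PMF.uniformOfFintype (Fin ((c.2.2 c.1).length + (c.2.2 c.2.1).length + 1 + 1))).toMeasure.map
      (fun x : Fin ((c.2.2 c.1).length + (c.2.2 c.2.1).length + 1 + 1) => pickSum z c (x : ℕ)) =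
      uniformOn (((closedNbr s.1 s.2.1).disjSum (closedNbr s.1 s.2.2) : Finset (Fin n ⊕ Fin n)) :
        Set (Fin n ⊕ Fin n)) := by
  have hf := h.fst
  have hs := h.snd
  refine map_uniform _ _ (fun y hy => ?_) ?_
  · rcases y with y | y
    · rw [Finset.inl_mem_disjSum, mem_closedNbr, h.adj, ← hf] at hy
      rcases hy with rfl | hy
      · refine ⟨⟨(c.2.2 c.1).length, by omega⟩, ?_⟩
        simp [pickSum, pick, hf, toFin_val]
      · have hi := List.idxOf_lt_length_iff.2 hy
        refine ⟨⟨(c.2.2 c.1).idxOf (y : ℕ), by omega⟩, ?_⟩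
        simp [pickSum, pick, hi, hi.le, toFin_val, List.getElem_idxOf]
    · rw [Finset.inr_mem_disjSum, mem_closedNbr, h.adj, ← hs] at hy
      rcases hy with rfl | hy
      · refine ⟨⟨(c.2.2 c.1).length + (c.2.2 c.2.1).length + 1, by omega⟩, ?_⟩
        simp only [pickSum, pick]
        rw [if_neg (by omega), if_neg (by omega), if_neg (by omega), if_neg (by omega), hs, toFin_val]
      · have hi := List.idxOf_lt_length_iff.2 hy
        refine ⟨⟨(c.2.2 c.1).length + 1 + (c.2.2 c.2.1).idxOf (y : ℕ), by omega⟩, ?_⟩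
        simp only [pickSum, pick]
        rw [if_neg (by omega), if_neg (by omega), if_neg (by omega), if_pos (by omega),
          show (c.2.2 c.1).length + 1 + (c.2.2 c.2.1).idxOf (y : ℕ) - (c.2.2 c.1).length - 1 =
            (c.2.2 c.2.1).idxOf (y : ℕ) by omega]
        simp [hi, toFin_val, List.getElem_idxOf]
  · rw [Finset.card_disjSum, card_closedNbr, card_closedNbr,
      deg_eq (h.nd s.2.1) (h.lt s.2.1) (h.adj s.2.1), deg_eq (h.nd s.2.2) (h.lt s.2.2) (h.adj s.2.2),
      hf, hs]
    omega

section
variable {n : ℕ} (P : Par) (cl : List (ℕ × ℕ × (ℕ → List ℕ))) (z : Fin n)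

/-- The invocation to which the sample `p.2` of the invocation number `p.1` belongs. -/
def callOf (p : ℕ × ℕ) : Option (ℕ × ℕ × (ℕ → List ℕ)) :=
  if 1 ≤ p.1 ∧ p.2 < P.L p.1 then cl[p.1 - 1]? else none

/-- The entry of the tape that is used for a sample. The entries for samples that are never drawn
only have to be distinct; they are single-valued. -/
def coord (p : ℕ × ℕ) : ℕ × ℕ :=
  match callOf P cl p with
  | some c => (P.off (p.1 - 1) + p.2, (c.2.2 c.1).length + (c.2.2 c.2.1).length + 1)
  | none => (Nat.pair p.1 p.2, 0)

/-- The samples in terms of the tape. The list `cl` of invocations is the same for all tapes, so that the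
entries in use are fixed in advance. -/
def sampler (ω : Tape) (i j : ℕ) : Fin n ⊕ Fin n :=
  (match callOf P cl (i, j) with
  | some c => pickSum z c
  | none => fun _ => .inl z) (ω (coord P cl (i, j)) : ℕ)

lemma coord_inj : Function.Injective (coord P cl) := by
  have hoff : ∀ {i j}, i < j → P.off i + P.L (i + 1) ≤ P.off j := fun {i j} h => by
    unfold Par.off
    rw [← Finset.sum_range_succ (fun k => P.L (k + 1))]
    exact Finset.sum_le_sum_of_subset (Finset.range_mono h)
  rintro ⟨i, j⟩ ⟨i', j'⟩ h
  unfold coord callOf at h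
  split_ifs at h with h1 h2 h2
  · rcases hc : cl[i - 1]? with _ | c <;> rcases hc' : cl[i' - 1]? with _ | c' <;>
      simp only [hc, hc', Prod.mk.injEq] at h
    · simpa [Nat.pair_eq_pair] using h
    · omega
    · omega
    · have hi : i - 1 = i' - 1 := by
        rcases lt_trichotomy (i - 1) (i' - 1) with hl | hl | hl
        · have := hoff hl
          rw [Nat.sub_add_cancel h1.1] at this
          have := h1.2; have := h2.2; simp only at *; omega
        · exact hl
        · have := hoff hl
          rw [Nat.sub_add_cancel h2.1] at this
          have := h1.2; have := h2.2; simp only at *; omega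
      rw [hi] at h
      simp only at h1 h2
      rw [Prod.mk.injEq]; omega
  · rcases hc : cl[i - 1]? with _ | c <;> simp only [hc, Prod.mk.injEq] at h
    · simpa [Nat.pair_eq_pair] using h
    · omega
  · rcases hc : cl[i' - 1]? with _ | c <;> simp only [hc, Prod.mk.injEq] at h
    · simpa [Nat.pair_eq_pair] using h
    · omega
  · simpa [Nat.pair_eq_pair] using h

instance : IsProbabilityMeasure tapeMeasure := by unfold tapeMeasure; infer_instance

lemma measurable_sampler (i j : ℕ) : Measurable fun ω => sampler P cl z ω i j :=
  (measurable_of_countable fun x : Fin ((coord P cl (i, j)).2 + 1) =>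
    (match callOf P cl (i, j) with
    | some c => pickSum z c
    | none => fun _ => .inl z) (x : ℕ)).comp (measurable_pi_apply (coord P cl (i, j)))

lemma sampler_eq {i : ℕ} {c : ℕ × ℕ × (ℕ → List ℕ)} (hc : cl[i]? = some c) {j : ℕ}
    (hj : j < P.L (i + 1)) (ω : Tape) : sampler P cl z ω (i + 1) j = pickSum z c
      (ω (P.off i + j, (c.2.2 c.1).length + (c.2.2 c.2.1).length + 1) : ℕ) := by
  have h : callOf P cl (i + 1, j) = some c := by simp [callOf, hj, hc]
  have h2 : coord P cl (i + 1, j) = (P.off i + j, (c.2.2 c.1).length + (c.2.2 c.2.1).length + 1) := by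
    simp [coord, h]
  have e : ∀ {p q : ℕ × ℕ}, p = q → (ω p : ℕ) = ω q := by rintro p _ rfl; rfl
  simp only [sampler, h, e h2]

lemma sampler_isSampling {calls : List (SimpleGraph (Fin n) × Fin n × Fin n)}
    (h : List.Forall₂ CallRel cl calls) : IsSampling tapeMeasure P.L calls (sampler P cl z) := by
  refine ⟨?_, fun i hi j hj => ?_⟩
  · have h1 : iIndepFun (fun (p : ℕ × ℕ) (ω : Tape) => ω p) tapeMeasure :=
      iIndepFun_infinitePi (X := fun p x => x) fun _ => measurable_id
    exact (h1.precomp (coord_inj P cl)).comp (fun p x => (match callOf P cl p with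
      | some c => pickSum z c
      | none => fun _ => .inl z) (x : ℕ)) fun _ => measurable_of_countable _
  · have hi' : i < cl.length := by rw [h.length_eq]; exact hi
    have hc := List.getElem?_eq_getElem hi'
    have hr : CallRel cl[i] calls[i] := (List.forall₂_iff_get.1 h).2 i hi' hi
    have e := Measure.infinitePi_map_eval
      (fun p : ℕ × ℕ => (PMF.uniformOfFintype (Fin (p.2 + 1))).toMeasure)
      (P.off i + j, (cl[i].2.2 cl[i].1).length + (cl[i].2.2 cl[i].2.1).length + 1)
    rw [funext (sampler_eq P cl z hc hj), ← hr.map z]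
    refine Eq.trans ?_ (congrArg (Measure.map fun x : Fin (_ + 1 + 1) => pickSum z cl[i] (x : ℕ)) e)
    exact (Measure.map_map (μ := tapeMeasure)
      (g := fun x : Fin ((cl[i].2.2 cl[i].1).length + (cl[i].2.2 cl[i].2.1).length + 1 + 1) =>
        pickSum z cl[i] (x : ℕ))
      (f := fun ω : Tape => ω (P.off i + j,
        (cl[i].2.2 cl[i].1).length + (cl[i].2.2 cl[i].2.1).length + 1))
      (measurable_of_countable _) (measurable_pi_apply _)).symm

lemma sampler_fromTape (ω : Tape) : FromTape P ω cl (sampler P cl z ω) := by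
  intro i c hc j hj y hy
  rw [sampler_eq P cl z hc hj, ← toFin_val z y, hy]
  unfold pickSum
  split_ifs <;> rfl

end


/-! ### The run on a sequence of updates -/

lemma exists_seq {α β : Type} {I : ℕ → α → Prop} {R : ℕ → α → β → α → Prop} {M : ℕ} {a0 : α}
    [Nonempty β] (h0 : I 0 a0)
    (h : ∀ t < M, ∀ a, I t a → ∃ b a', R t a b a' ∧ I (t + 1) a') :
    ∃ (f : ℕ → α) (g : ℕ → β), f 0 = a0 ∧ (∀ t ≤ M, I t (f t)) ∧
      ∀ t < M, R t (f t) (g t) (f (t + 1)) := by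
  have : Nonempty α := ⟨a0⟩
  have h' : ∀ t a, ∃ b a', t < M → I t a → R t a b a' ∧ I (t + 1) a' := fun t a => by
    by_cases hc : t < M ∧ I t a
    · obtain ⟨b, a', hb⟩ := h t hc.1 a hc.2
      exact ⟨b, a', fun _ _ => hb⟩
    · exact ⟨Classical.arbitrary _, Classical.arbitrary _, fun h1 h2 => absurd ⟨h1, h2⟩ hc⟩
  choose b f' hf using h'
  set f : ℕ → α := fun t => Nat.rec a0 f' t with hfd
  have hI : ∀ t ≤ M, I t (f t) := fun t => by
    induction t with
    | zero => exact fun _ => h0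
    | succ t ih => exact fun ht => (hf t _ ht (ih (by omega))).2
  exact ⟨f, fun t => b t (f t), rfl, hI, fun t ht => (hf t _ ht (hI t ht.le)).1⟩

lemma prefix_of_le {α : Type} {f : ℕ → List α} {M t : ℕ} (h : ∀ k < M, f k <+: f (k + 1))
    (ht : t ≤ M) : f t <+: f M := by
  induction M, ht using Nat.le_induction with
  | base => exact List.prefix_refl _
  | succ M hM ih => exact (ih fun k hk => h k (by omega)).trans (h M (by omega))

lemma Aux.arcs_le {n : ℕ} {A : Aux} {G : SimpleGraph (Fin n)}
    (hG : ∀ u v : Fin n, G.Adj u v ↔ (v : ℕ) ∈ A.E 0 u) : A.arcs n ≤ 2 * G.edgeSet.ncard := by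
  classical
  rw [← SimpleGraph.coe_edgeFinset, Set.ncard_coe_finset, ← G.dart_card_eq_twice_card_edges,
    ← Finset.card_univ]
  refine (Finset.card_le_card (t := Finset.univ.image fun a : G.Dart => ((a.fst : ℕ), (a.snd : ℕ)))
    fun p hp => ?_).trans Finset.card_image_le
  simp only [Finset.mem_filter, Finset.mem_product, Finset.mem_range] at hp
  exact Finset.mem_image.2 ⟨⟨(⟨p.1, hp.1.1⟩, ⟨p.2, hp.1.2⟩), (hG _ _).2 hp.2⟩, Finset.mem_univ _, rfl⟩

lemma ncard_edgeSet_le {V : Type} [Finite V] (G : SimpleGraph V) (x : Update V) :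
    G.edgeSet.ncard ≤ (x.apply G).edgeSet.ncard + 1 := by
  refine (Set.ncard_le_ncard (t := insert s(x.u, x.w) (x.apply G).edgeSet) (fun e he => ?_)
    (Set.toFinite _)).trans (Set.ncard_insert_le _ _)
  unfold Update.apply
  split_ifs
  · simp [he]
  · by_cases h : e = s(x.u, x.w) <;> simp [he, h]

section
variable {n : ℕ} (P : Par) (upd : ℕ → Update (Fin n))

/-- The data after `t` updates, without the labels; they do not depend on the random draws. -/
noncomputable def Aux.run : ℕ → Aux
  | 0 => Dat.init.A
  | t + 1 => (Aux.run t).update P (upd t).ins (upd t).u (upd t).w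

/-- The data after `t` updates. -/
noncomputable def Dat.run (ω : Tape) : ℕ → Dat
  | 0 => Dat.init
  | t + 1 => (Dat.run ω t).update P ω (upd t).ins (upd t).u (upd t).w

lemma Dat.run_A (ω : Tape) (t : ℕ) : (Dat.run P upd ω t).A = Aux.run P upd t := by
  induction t with
  | zero => rfl
  | succ t ih => rw [Dat.run, Dat.update_A, ih, Aux.run]

lemma Aux.run_prefix {t M : ℕ} (h : t ≤ M) : (Aux.run P upd t).calls <+: (Aux.run P upd M).calls :=
  prefix_of_le (f := fun t => (Aux.run P upd t).calls) (fun k _ =>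
    ((Aux.run P upd k).calls_arrive P _ _ _).trans
      ((Aux.calls_scanN P _ _ _).trans (Aux.calls_scanN P _ _ _))) h

/-- After `t` updates, `a.1` is the configuration of a machine with the parameters `m`, and `a.2` the
state of the algorithm. -/
structure Here (ε ρ : ℝ) (ω : Tape) (smp : ℕ → ℕ → Fin n ⊕ Fin n) (m : VM) (t : ℕ)
    (a : Conf × State (Fin n)) : Prop where
  st : Stores m a.1 (Dat.run P upd ω t)
  rest : Rest n t (Dat.run P upd ω t)
  sim : Sim P (Aux.run P upd t).adj (Dat.run P upd ω t) a.2
  live : Live ε ρ P.L smp ∅ a.2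
  graph : a.2.graph = graphAt upd t
  prog : progress a.2 + a.2.calls.length ≤ (2 * (4 / (ρ * ε) + 1) + 1) * t

/-- The run of the machine together with the run of the algorithm. The bound `I` on the number of
invocations comes from the progress of the algorithm, so both are constructed at the same time. -/
lemma exists_run {ε ρ : ℝ} (hε : 0 < ε) (hρ : 0 < ρ) (h0 : P.θ 0 = ε) (h1 : P.θ 1 = ρ * ε / 2)
    (hP : ∀ x < n, P.thr x ≤ n) (hL : ∀ i, 0 < P.L i) {M : ℕ}
    (hupd : ∀ t < M, (upd t).Valid (graphAt upd t)) {ω : Tape} {F : ℕ → VM} {X I B1 Λ Bm W : ℕ}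
    {B : ℕ → ℕ} (hF : ∀ t ≤ M, Fit (F t) P n X I B1)
    (hcap : ∀ t, (F t).cap = 2 * n + 16 * (graphAt upd t).edgeSet.ncard + 56)
    (hω : ∀ t, (F t).ω = ω) (hB : ∀ t, (F t).B = B) (hBm : ∀ t, (F t).Bm = Bm)
    (hW : ∀ t, (F t).W = W) (hI : (2 * (4 / (ρ * ε) + 1) + 1) * M ≤ I) (hX : 3 * M + n + 4 ≤ X)
    (hΛ : ∀ i ≤ I, P.L i * (300 * B1 + 210) + 500 * B1 + 1600 * Bm + 260 ≤ Λ)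
    {smp : ℕ → ℕ → Fin n ⊕ Fin n} (hs : FromTape P ω (Aux.run P upd M).calls smp) :
    ∃ (f : ℕ → Conf × State (Fin n)) (g : ℕ → ℕ), f 0 = (Conf.blank, State.initial _) ∧
      (∀ t ≤ M, Here P upd ε ρ ω smp (F t) t (f t)) ∧
      ∀ t < M, (F (t + 1)).toMach.Ex (updateP P)
          ((f t).1.input (if (upd t).ins then 1 else 0) (upd t).u (upd t).w) (g t) (f (t + 1)).1 ∧
        Step ε ρ P.L smp (upd t) (f t).2 (f (t + 1)).2 ∧ (f t).2.calls <+: (f (t + 1)).2.calls ∧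
        g t + (Aux.run P upd t).ne * (10500 * Bm) + (Aux.run P upd t).calls.length * Λ ≤
          16000 * Bm + (Aux.run P upd (t + 1)).ne * (10500 * Bm) +
            (Aux.run P upd (t + 1)).calls.length * Λ := by
  refine exists_seq (R := fun t (a : Conf × State (Fin n)) k (a' : Conf × State (Fin n)) =>
    (F (t + 1)).toMach.Ex (updateP P)
      (a.1.input (if (upd t).ins then 1 else 0) (upd t).u (upd t).w) k a'.1 ∧
    Step ε ρ P.L smp (upd t) a.2 a'.2 ∧ a.2.calls <+: a'.2.calls ∧
    k + (Aux.run P upd t).ne * (10500 * Bm) + (Aux.run P upd t).calls.length * Λ ≤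
      16000 * Bm + (Aux.run P upd (t + 1)).ne * (10500 * Bm) +
        (Aux.run P upd (t + 1)).calls.length * Λ) ?_ ?_
  · refine ⟨⟨0, Rep.blank (hF 0 (Nat.zero_le _)).good, Counts.zero⟩, Rest.init n, ?_, ?_, rfl, ?_⟩
    · constructor <;> simp [State.initial, Dat.run, Dat.init, Par.off]
    · constructor <;> simp [State.initial]
    · simp [State.initial, progress]
  · rintro t ht ⟨p, s⟩ ⟨hst, hrest, hsim, hlive, hgraph, hprog⟩
    have hA := Dat.run_A P upd ω t
    have hA' := Dat.run_A P upd ω (t + 1)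
    have hx := hupd t ht
    rw [← hgraph] at hx
    rw [← hA] at hsim
    have hcl : ((Dat.run P upd ω t).A.update P (upd t).ins (upd t).u (upd t).w).calls <+:
        (Aux.run P upd M).calls := by
      rw [hA]; exact Aux.run_prefix P upd (t := t + 1) ht
    obtain ⟨s', q1, q2⟩ := hsim.update hrest hP hL h0 h1 hs hx hcl
    obtain ⟨k1, k2, k3, k4⟩ := hlive.step hε hρ hx q1
    have hgraph' : s'.graph = graphAt upd (t + 1) := by rw [k2, hgraph]; rfl
    have hprog' : progress s' + s'.calls.length ≤ (2 * (4 / (ρ * ε) + 1) + 1) * (t + 1 : ℕ) := by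
      push_cast; simp only at hprog; linarith
    have hlen : ((Dat.run P upd ω t).A.update P (upd t).ins (upd t).u (upd t).w).calls.length ≤ I := by
      rw [← Dat.update_A P ω, q2.calls.length_eq, ← Nat.cast_le (α := ℝ)]
      have h3 : ((t + 1 : ℕ) : ℝ) ≤ M := by exact_mod_cast ht
      have h4 := mul_le_mul_of_nonneg_left h3 (show 0 ≤ 2 * (4 / (ρ * ε) + 1) + 1 by positivity)
      have := progress_nonneg s'
      linarith
    have ha0 : (Dat.run P upd ω t).A.arcs n ≤ 2 * s.graph.edgeSet.ncard := Aux.arcs_le hsim.graph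
    have ha1 := Aux.arcs_le q2.graph
    have hm := ncard_edgeSet_le s.graph (upd t)
    rw [← k2] at hm
    rw [Dat.update_A] at ha1
    rw [hgraph'] at hm ha1
    have hc := hcap (t + 1)
    obtain ⟨r, hr1, hr2⟩ := hst
    have hc10 : p.reg 10 ≤ (F (t + 1)).cap := by
      have := hr1.tree.card_le (hrest.inv.sz hrest.lab)
      dsimp only at this ha0
      omega
    obtain ⟨g1, k, p', g2, g3, g4⟩ := (hF (t + 1) ht).update hP (Λ := Λ) (by rw [hBm]; exact hΛ) hrest
      (by omega) (upd t).u.2 (upd t).w.2 (fun e => hx.1 (Fin.ext e))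
      (hx.2.trans (not_congr (hsim.graph _ _))) hlen (by omega) (by omega)
      ⟨r, hr1.rebase (by rw [hB, hB]) (by rw [hBm, hBm]) (by rw [hW, hW]) hc10, hr2⟩
    rw [hω] at g1 g3
    rw [hBm, hA] at g4
    rw [hA] at q2
    exact ⟨k, (p', s'), ⟨g2, q1, k3, g4⟩, g3, g1, q2, k1, hgraph', hprog'⟩

end


/-! ### Word sizes and sample sizes -/

lemma size_le_log {k : ℕ} (hk : 1 ≤ k) : (Nat.size k : ℝ) ≤ 1 + 3 / 2 * Real.log k := by
  have h1 : 2 ^ (Nat.size k - 1) ≤ k := Nat.lt_size.1 (by have := Nat.size_pos.2 hk; omega)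
  have h2 : ((Nat.size k - 1 : ℕ) : ℝ) * Real.log 2 ≤ Real.log k := by
    rw [← Real.log_pow]
    exact Real.log_le_log (by positivity) (by exact_mod_cast h1)
  have h3 := Real.log_two_gt_d9
  have h4 : ((Nat.size k : ℕ) : ℝ) ≤ 1 + (Nat.size k - 1 : ℕ) := by norm_cast; omega
  have h5 : (0 : ℝ) ≤ (Nat.size k - 1 : ℕ) := by positivity
  nlinarith

lemma log_le_size (k : ℕ) : Real.log k ≤ 7 / 10 * Nat.size k := by
  rcases Nat.eq_zero_or_pos k with rfl | hk
  · simp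
  have h1 : (k : ℝ) ≤ 2 ^ Nat.size k := by exact_mod_cast (Nat.lt_size_self k).le
  have h2 := Real.log_le_log (by exact_mod_cast hk) h1
  rw [Real.log_pow] at h2
  nlinarith [Real.log_two_lt_d9, (Nat.cast_nonneg (Nat.size k) : (0 : ℝ) ≤ _)]

/-- The bound on the sizes of the keys, for cells other than those of the alarm lists. -/
def bitsV (n : ℕ) : ℕ := 2 * Nat.size (n + 1) + 5

/-- The bound on the sizes of all keys, for alarms up to `X`. -/
def bitsA (X : ℕ) : ℕ := 4 * Nat.size (X + 1) + 5

/-- The machine with words up to `W`, for alarms up to `X` and a graph with `n` vertices and `k` edges. -/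
def machine (P : Par) (ω : Tape) (W C n X k : ℕ) : VM where
  θ := P.θ
  ω := ω
  W := W
  K := C * (n + k)
  B := fun t => if 3 ≤ t ∧ t < 6 then bitsA X else bitsV n
  Bm := bitsA X
  cap := 2 * n + 16 * k + 56

lemma machine_fit {P : Par} (ω : Tape) {W C n X I k N c : ℕ} (h0 : 0 ≤ P.θ 0 ∧ P.θ 0 ≤ 1)
    (hK : 1 ≤ P.K0) (hD : 1 ≤ P.D) (hn : 1 ≤ n) (hnX : n ≤ X)
    (hnN : n ≤ N) (hX : X + 1 ≤ 4 * N) (hC : 304 ≤ C) (hk : k ≤ n * n) (hI : I ≤ c * N)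
    (hDN : P.D ≤ N) (hW : (131072 + 4 * c + 2 * P.K0 * (c + 1)) * N ^ 4 ≤ W) :
    Fit (machine P ω W C n X k) P n X I (bitsV n) := by
  have hp : ∀ {x a : ℕ}, x + 1 ≤ a → a ^ 2 < (2 ^ Nat.size a) ^ 2 := fun {x a} h =>
    Nat.pow_lt_pow_left (Nat.lt_size_self a) (by norm_num)
  have hbV : 16 * (n + 1) ^ 2 ≤ 2 ^ bitsV n := by
    have := hp (le_refl (n + 1))
    rw [← pow_mul] at this
    unfold bitsV
    rw [pow_add, mul_comm 2]
    omega
  have hbA : 16 * ((X + 1) ^ 2) ^ 2 ≤ 2 ^ bitsA X := by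
    have := Nat.pow_lt_pow_left (hp (le_refl (X + 1))) (n := 2) (by norm_num)
    rw [← pow_mul (2 ^ _), ← pow_mul 2] at this
    unfold bitsA
    rw [pow_add, show 4 * Nat.size (X + 1) = Nat.size (X + 1) * (2 * 2) by ring]
    omega
  have hVA : bitsV n ≤ bitsA X := by
    have := Nat.size_le_size (show n + 1 ≤ X + 1 by omega)
    unfold bitsV bitsA; omega
  have hV7 : 7 ≤ bitsV n := by
    have := Nat.size_pos.2 (show 0 < n + 1 by omega)
    unfold bitsV; omega
  have hN1 : 1 ≤ N := hn.trans hnN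
  have hN2 : N ≤ N ^ 4 := Nat.le_self_pow (by norm_num) N
  have hN3 : N ^ 2 ≤ N ^ 4 := Nat.pow_le_pow_right hN1 (by norm_num)
  have hW' : 131072 * N ^ 4 + 4 * (c * N ^ 4) + 2 * (P.K0 * ((c + 1) * N ^ 4)) ≤ W :=
    le_trans (le_of_eq (by ring)) hW
  have hcN := Nat.mul_le_mul_left c hN2
  have hKN := Nat.mul_le_mul_left P.K0 (Nat.mul_le_mul_left (c + 1) hN2)
  have hXX : (X + 1) ^ 2 ≤ 16 * N ^ 2 := (Nat.pow_le_pow_left hX 2).trans (le_of_eq (by ring))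
  have hnn : n * n ≤ N ^ 2 := by rw [sq]; exact Nat.mul_le_mul hnN hnN
  have hpow : 2 ^ bitsA X ≤ W := by
    have e := pow_size_le (i := X + 1)
    have : 2 ^ Nat.size (X + 1) ≤ 8 * N := by
      have := Nat.lt_size.1 (show Nat.size (X + 1) - 1 < Nat.size (X + 1) by
        have := Nat.size_pos.2 (show 0 < X + 1 by omega); omega)
      have h2 : 2 ^ Nat.size (X + 1) = 2 * 2 ^ (Nat.size (X + 1) - 1) := by
        rw [← pow_succ']; congr 1
        have := Nat.size_pos.2 (show 0 < X + 1 by omega); omega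
      omega
    have h4 := Nat.pow_le_pow_left this 4
    rw [← pow_mul, mul_pow] at h4
    unfold bitsA
    rw [pow_add, mul_comm 4]
    omega
  refine ⟨⟨fun t => ?_, fun t => ?_, hpow, ?_, ?_⟩, rfl, h0, hK, hD, fun {t x i} h2 h3 hx hi =>
    ⟨h2, ?_⟩, fun {t x a i} h2 h3 hx ha hi => ⟨by omega, ?_⟩, fun {x a} hx ha => ?_,
    fun {t} h2 => ?_, hVA, ?_, fun i hi => ?_, ?_⟩
  · simp only [machine]; split_ifs <;> omega
  · simp only [machine]; split_ifs <;> omega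
  · simp only [machine]
    have := Nat.mul_le_mul hC (le_refl (n + k))
    omega
  · simp only [machine]; omega
  · simp only [machine, if_neg h3]
    exact (Nat.mul_le_mul_left 16 (Nat.pow_le_pow_left (by omega) 2)).trans hbV
  · simp only [machine, if_pos (And.intro h2 h3)]
    refine (Nat.mul_le_mul_left 16 (Nat.pow_le_pow_left ?_ 2)).trans hbA
    have h5 := Nat.pair_lt_max_add_one_sq x a
    have h6 : (max x a + 1) ^ 2 ≤ (X + 1) ^ 2 := Nat.pow_le_pow_left (by omega) 2
    have h7 : X + 1 ≤ (X + 1) ^ 2 := Nat.le_self_pow (by norm_num) _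
    omega
  · have h6 : (max x a + 1) ^ 2 ≤ (X + 1) ^ 2 := Nat.pow_le_pow_left (by omega) 2
    simp only [machine]; omega
  · simp [machine, h2]
  · simp only [machine]; omega
  · have h5 : Nat.size i ≤ i := Nat.size_le.2 i.lt_two_pow_self
    have h6 : P.L i ≤ P.K0 * ((c + 1) * N) := Nat.mul_le_mul_left _ (by rw [add_mul]; omega)
    simp only [machine]; omega
  · simp only [machine]; omega

/-- The sample sizes are as required. -/
lemma sample_size {Δ δ : ℝ} (hΔ : 0 < Δ) (hΔ1 : Δ ≤ 1) (hδ : 0 < δ) (hδ1 : δ < 1) {θ : Fin 2 → ℝ}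
    {i : ℕ} (hi : 1 ≤ i) :
    2 / Δ ^ 2 * Real.log (2 / (δ / (i * (i + 1)))) ≤
      (Par.L ⟨θ, ⌈4 / Δ ^ 2⌉₊, ⌈Real.log (1 / δ)⌉₊ + 1⟩ i : ℕ) ∧
    (Par.L ⟨θ, ⌈4 / Δ ^ 2⌉₊, ⌈Real.log (1 / δ)⌉₊ + 1⟩ i : ℕ) ≤
      8 * (2 / Δ ^ 2 * Real.log (2 / (δ / (i * (i + 1))))) := by
  have hi' : (1 : ℝ) ≤ i := by exact_mod_cast hi
  have e : Real.log (2 / (δ / (i * (i + 1)))) =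
      Real.log 2 + Real.log i + Real.log (i + 1) + Real.log (1 / δ) := by
    rw [← Real.log_mul, ← Real.log_mul, ← Real.log_mul] <;> first | positivity | skip
    congr 1
    field_simp
  have hl : 0 ≤ Real.log (1 / δ) := Real.log_nonneg (by rw [le_div_iff₀ hδ]; linarith)
  have h1 := Nat.le_ceil (Real.log (1 / δ))
  have h2 := Nat.ceil_lt_add_one hl
  have h3 : Real.log i ≤ Real.log (i + 1) := Real.log_le_log (by linarith) (by linarith)
  have h10 : Real.log 2 ≤ Real.log (i + 1) := Real.log_le_log (by norm_num) (by linarith)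
  have h4 := size_le_log hi
  have h5 := log_le_size i
  have h6 : Real.log (i + 1) ≤ Real.log i + Real.log 2 := by
    rw [← Real.log_mul (by linarith) (by norm_num)]
    exact Real.log_le_log (by linarith) (by linarith)
  have h7 := Real.log_two_gt_d9
  have h8 := Real.log_two_lt_d9
  have h9 := Real.log_nonneg hi'
  have hs : (0 : ℝ) ≤ Nat.size i := by positivity
  have hd : 1 ≤ 1 / Δ ^ 2 := by rw [le_div_iff₀ (by positivity)]; nlinarith
  have k1 := Nat.le_ceil (4 / Δ ^ 2)
  have k2 := (Nat.ceil_lt_add_one (show 0 ≤ 4 / Δ ^ 2 by positivity)).le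
  have e4 : 4 / Δ ^ 2 = 4 * (1 / Δ ^ 2) := by ring
  have e2 : 2 / Δ ^ 2 = 2 * (1 / Δ ^ 2) := by ring
  rw [e]
  simp only [Par.L]
  push_cast
  rw [e4] at k1 k2 ⊢
  rw [e2]
  set q := 1 / Δ ^ 2
  constructor
  · refine le_trans ?_ (mul_le_mul_of_nonneg_right k1 (by positivity))
    have := mul_le_mul_of_nonneg_left (show Real.log 2 + Real.log i + Real.log (i + 1) +
      Real.log (1 / δ) ≤ 2 * (Nat.size i + (⌈Real.log (1 / δ)⌉₊ + 1)) by linarith)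
      (show 0 ≤ 2 * q by linarith)
    linarith
  · refine (mul_le_mul_of_nonneg_right (k2.trans (show 4 * q + 1 ≤ 5 * q by linarith))
      (by positivity)).trans ?_
    have := mul_le_mul_of_nonneg_left (show (Nat.size i : ℝ) + (⌈Real.log (1 / δ)⌉₊ + 1) ≤
      16 / 5 * (Real.log 2 + Real.log i + Real.log (i + 1) + Real.log (1 / δ)) by linarith)
      (show 0 ≤ 5 * q by linarith)
    linarith


/-! ### The costs -/

/-- The constant in the bound on the costs, for `c` invocations per update. -/
def costC (c K0 : ℕ) : ℕ := 1000000 + 2100000 * c + c * (6000 * K0 * (6 + 3 * c) + 110000)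

lemma bitsV_le {n : ℕ} (hn : 2 ≤ n) : (bitsV n : ℝ) ≤ 17 * Real.log n := by
  have hn' : (2 : ℝ) ≤ n := by exact_mod_cast hn
  have h1 := size_le_log (show 1 ≤ n + 1 by omega)
  have h2 : Real.log (n + 1 : ℕ) ≤ Real.log 2 + Real.log n := by
    rw [← Real.log_mul (by norm_num) (by linarith)]
    push_cast
    exact Real.log_le_log (by linarith) (by linarith)
  have h3 := Real.log_le_log (by norm_num) hn'
  have h4 := Real.log_two_gt_d9
  have h5 := Real.log_two_lt_d9
  unfold bitsV
  push_cast at *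
  linarith

lemma lookup_cost_le {n k C : ℕ} (hn : 2 ≤ n) (hC : 2040 ≤ C) (hk : k ≤ 120 * bitsV n) :
    (k : ℝ) ≤ C * Real.log n := by
  have h1 : (k : ℝ) ≤ 120 * bitsV n := by exact_mod_cast hk
  have h2 : (2040 : ℝ) ≤ C := by exact_mod_cast hC
  nlinarith [bitsV_le hn, Real.log_natCast_nonneg n]

lemma bitsA_le {n M : ℕ} (hn : 2 ≤ n) (hM : 1 ≤ M) :
    (bitsA (3 * M + n + 4) : ℝ) ≤ 40 * (Real.log n + Real.log M) := by
  have hn' : (2 : ℝ) ≤ n := by exact_mod_cast hn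
  have hM' : (1 : ℝ) ≤ M := by exact_mod_cast hM
  have h1 := size_le_log (show 1 ≤ 3 * M + n + 4 + 1 by omega)
  have h2 : Real.log (3 * M + n + 4 + 1 : ℕ) ≤ 3 * Real.log 2 + Real.log n + Real.log M := by
    rw [← Real.log_rpow (by norm_num), ← Real.log_mul (by positivity) (by linarith),
      ← Real.log_mul (by positivity) (by linarith)]
    push_cast
    refine Real.log_le_log (by linarith) ?_
    norm_num
    nlinarith
  have h3 := Real.log_le_log (by norm_num) hn'
  have h4 := Real.log_two_gt_d9
  have h5 := Real.log_two_lt_d9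
  have h6 := Real.log_nonneg hM'
  unfold bitsA
  push_cast at *
  linarith

lemma cost_le {n M c K0 D calls ne T Λ : ℕ} {δ : ℝ} (hn : 2 ≤ n) (hM : 1 ≤ M) (hc : 1 ≤ c)
    (hδ : 0 < δ) (hδ1 : δ < 1) (hD : D = ⌈Real.log (1 / δ)⌉₊ + 1) (hcalls : calls ≤ c * M)
    (hne : 2 * ne ≤ (2 + 2 * Nat.size n) * calls)
    (hΛ : Λ = K0 * (Nat.size (c * M) + D) * (300 * bitsV n + 210) + 500 * bitsV n +
      1600 * bitsA (3 * M + n + 4) + 260)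
    (hT : T ≤ M * (16000 * bitsA (3 * M + n + 4)) + ne * (10500 * bitsA (3 * M + n + 4)) + calls * Λ) :
    (T : ℝ) ≤ costC c K0 * M * (Real.log n ^ 2 + Real.log n * Real.log (M / δ)) := by
  have hn' : (2 : ℝ) ≤ n := by exact_mod_cast hn
  have hM' : (1 : ℝ) ≤ M := by exact_mod_cast hM
  have hc' : (1 : ℝ) ≤ c := by exact_mod_cast hc
  have hB1 := bitsV_le hn
  have hBm := bitsA_le hn hM
  have hl0 : 0 ≤ Real.log (1 / δ) := Real.log_nonneg (by rw [le_div_iff₀ hδ]; linarith)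
  have hD' : (D : ℝ) ≤ Real.log (1 / δ) + 2 := by
    rw [hD]; push_cast; linarith [Nat.ceil_lt_add_one hl0]
  have hs1 := size_le_log (show 1 ≤ c * M from Nat.mul_pos hc hM)
  have hs2 := size_le_log (show 1 ≤ n by omega)
  have hlc : Real.log c ≤ c := (Real.log_le_sub_one_of_pos (by linarith)).trans (by linarith)
  rw [Nat.cast_mul, Real.log_mul (by linarith) (by linarith)] at hs1
  have e : Real.log (M / δ) = Real.log M + Real.log (1 / δ) := by
    rw [← Real.log_mul (by linarith) (by positivity)]; congr 1; ring
  have h3 := Real.log_le_log (by norm_num) hn'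
  have h4 := Real.log_two_gt_d9
  have hm := Real.log_nonneg hM'
  rw [e]
  set x := Real.log n
  set g := x + Real.log M + Real.log (1 / δ) with hg
  have hx : 1 ≤ 29 / 20 * x := by linarith
  have hxg : x ≤ g := by linarith
  have e2 : x ^ 2 + x * (Real.log M + Real.log (1 / δ)) = x * g := by rw [hg]; ring
  rw [e2]
  have hx0 : 0 ≤ x := by linarith
  have hg0 : 0 ≤ g := by linarith
  have hxx : x ≤ 29 / 20 * (x * g) := by nlinarith
  have hgg : g ≤ 29 / 20 * (x * g) := by nlinarith
  have hBm' : (bitsA (3 * M + n + 4) : ℝ) ≤ 40 * g := by linarith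
  have hL : (Nat.size (c * M) : ℝ) + D ≤ (6 + 3 * c) * g := by
    have : (1 + c) * 1 ≤ (1 + c) * (29 / 20 * g) :=
      mul_le_mul_of_nonneg_left (by linarith) (by linarith)
    nlinarith
  have hΛ' : (Λ : ℝ) ≤ (6000 * K0 * (6 + 3 * c) + 110000) * (x * g) := by
    have h1 : (K0 : ℝ) * (Nat.size (c * M) + D) * (300 * bitsV n + 210) ≤
        K0 * ((6 + 3 * c) * g) * (6000 * x) :=
      mul_le_mul (mul_le_mul_of_nonneg_left hL (by positivity)) (by linarith) (by positivity)
        (by positivity)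
    rw [hΛ]
    push_cast
    linarith
  have hne' : (ne : ℝ) ≤ 5 * x * calls := by
    have h1 : (2 * ne : ℝ) ≤ (2 + 2 * Nat.size n) * calls := by exact_mod_cast hne
    have h2 : (2 + 2 * (Nat.size n : ℝ)) * calls ≤ (2 * (5 * x)) * calls :=
      mul_le_mul_of_nonneg_right (by linarith) (by positivity)
    linarith
  -- the three parts of the cost: the updates themselves, the alarms, and the invocations
  have hcalls' : (calls : ℝ) ≤ c * M := by exact_mod_cast hcalls
  have hT' : (T : ℝ) ≤ M * (16000 * bitsA (3 * M + n + 4)) +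
    ne * (10500 * bitsA (3 * M + n + 4)) + calls * Λ := by exact_mod_cast hT
  have t1 : (M : ℝ) * (16000 * bitsA (3 * M + n + 4)) ≤ M * (1000000 * (x * g)) :=
    mul_le_mul_of_nonneg_left (by linarith) (by positivity)
  have t2 : (ne : ℝ) * (10500 * bitsA (3 * M + n + 4)) ≤ 5 * x * (c * M) * (420000 * g) :=
    mul_le_mul (hne'.trans (mul_le_mul_of_nonneg_left hcalls' (by linarith))) (by linarith)
      (by positivity) (by positivity)
  have t3 : (calls : ℝ) * Λ ≤ c * M * ((6000 * K0 * (6 + 3 * c) + 110000) * (x * g)) :=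
    mul_le_mul hcalls' hΛ' (by positivity) (by positivity)
  unfold costC
  push_cast
  linarith


lemma le_pow_word {a N C : ℕ} (hN : 2 ≤ N) (hC : a + 4 ≤ C) : a * N ^ 4 ≤ N ^ C := by
  obtain ⟨d, rfl⟩ := Nat.exists_eq_add_of_le hC
  have h1 : a ≤ N ^ a := (Nat.lt_two_pow_self (n := a)).le.trans (Nat.pow_le_pow_left hN a)
  rw [pow_add, pow_add]
  exact (Nat.mul_le_mul_right _ h1).trans (Nat.le_mul_of_pos_right _ (by positivity))

/-- The number of alarms in a run, from the potential. -/
lemma Aux.run_ne {n : ℕ} {P : Par} {upd : ℕ → Update (Fin n)} {M : ℕ}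
    (hP : ∀ x < n, P.thr x ≤ n)
    (h : ∀ t < M, Inv n t (Aux.run P upd t).adj (Aux.run P upd t) ∧
      Calm (Aux.run P upd t).adj ∅ (Aux.run P upd t) ∧ ((upd t).u : ℕ) ≠ (upd t).w ∧
      ((upd t).ins = true ↔ ¬ (Aux.run P upd t).adj (upd t).u (upd t).w)) :
    2 * (Aux.run P upd M).ne ≤ (2 + 2 * Nat.size n) * (Aux.run P upd M).calls.length := by
  have : ∀ t ≤ M, (Aux.run P upd t).pot n ≤
      (2 + 2 * Nat.size n) * (Aux.run P upd t).calls.length := fun t => by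
    induction t with
    | zero => simp [Aux.run, Dat.init, Aux.pot]
    | succ t ih =>
      intro ht
      obtain ⟨h1, h2, h3, h4⟩ := h t ht
      have := (h1.update hP h2 rfl (upd t).u.2 (upd t).w.2 h3 h4).2.2
      have := ih (by omega)
      rw [Aux.run]
      omega
  have := this M le_rfl
  unfold Aux.pot at this
  omega

end DynELM

theorem theorem5p1 (ε ρ : ℝ) (hε : 0 < ε) (hρ : 0 < ρ) (hρ1 : ρ < 1) (hερ : (1 + ρ) * ε ≤ 1) :
    ∃ C : ℕ, ∀ δ : ℝ, 0 < δ → δ < 1 →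
      ∃ (A : Implementation) (L : ℕ → ℕ),
        -- the sample size of the `i`-th invocation, for `Δ = ρ ε / 2` and `δ_i = δ / (i (i + 1))`
        (∀ i : ℕ, 1 ≤ i →
          2 / (ρ * ε / 2) ^ 2 * Real.log (2 / (δ / (i * (i + 1)))) ≤ (L i : ℝ) ∧
          (L i : ℝ) ≤ C * (2 / (ρ * ε / 2) ^ 2 * Real.log (2 / (δ / (i * (i + 1)))))) ∧
        ∀ (n M : ℕ) (upd : ℕ → Update (Fin n)),
          (∀ t < M, (upd t).Valid (graphAt upd t)) →
          ∃ (W : ℕ) (conf : Tape → ℕ → Conf) (time : Tape → ℕ → ℕ)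
            (smp : Tape → ℕ → ℕ → Fin n ⊕ Fin n) (S : Tape → ℕ → State (Fin n))
            (calls : List (SimpleGraph (Fin n) × Fin n × Fin n)),
            -- words have `O(log (n + M + log (1 / δ)))` bits
            W = (n + M + ⌈Real.log (1 / δ)⌉₊ + 2) ^ C ∧
            -- the machine never faults, and its memory always has `O(n + m)` cells
            (∀ ω, A.IsRun ![ε, ρ * ε / 2] ω W (fun G => C * (n + G.edgeSet.ncard)) upd M
              (conf ω) (time ω)) ∧
            -- `S` is a run of the abstract algorithm on independent samples
            (∀ ω, IsRun ε ρ L (smp ω) upd M (S ω)) ∧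
            (∀ ω, (S ω M).calls = calls) ∧
            IsSampling tapeMeasure L calls smp ∧
            -- each update outputs the set of the edges whose labels flipped
            (∀ ω, ∀ t < M, {e | ∃ p ∈ (conf ω (t + 1)).out, e = s(p.1, p.2)} =
              Sym2.map (fun v : Fin n => (v : ℕ)) '' (S ω (t + 1)).flips) ∧
            -- the labels are stored: at all times each of them can be looked up
            (∀ ω, ∀ t ≤ M, ∀ u v : Fin n, (graphAt upd t).Adj u v →
              ∃ (k : ℕ) (s : Conf),
                Exec ![ε, ρ * ε / 2] ω W (C * (n + (graphAt upd t).edgeSet.ncard)) A.lookup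
                  ((conf ω t).input 0 u v) k s ∧
                (k : ℝ) ≤ C * Real.log n ∧
                (s.reg 0 ≠ 0 ↔ (S ω t).label s(u, v) = true)) ∧
            -- amortized update cost
            (∀ ω, ((∑ t ∈ Finset.range M, time ω t : ℕ) : ℝ) ≤
              C * M * (Real.log n ^ 2 + Real.log n * Real.log (M / δ))) ∧
            -- the failure probability is at most `δ`
            tapeMeasure {ω | ¬ ∀ t ≤ M,
                ValidLabelling (graphAt upd t) ε ρ (S ω t).label ∧
                ∀ μ : ℕ, 1 ≤ μ → CorrectClustering (graphAt upd t) ε ρ μ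
                  (clusters (graphAt upd t) (S ω t).label μ)} ≤ ENNReal.ofReal δ := by
  have hρε : 0 < ρ * ε := mul_pos hρ hε
  have hε1 : ε ≤ 1 := by linarith
  have hθ1 : ρ * ε / 2 ≤ 1 := by nlinarith
  -- the number of invocations per update, from the progress of the tracking instances
  set c := ⌈2 * (4 / (ρ * ε) + 1) + 1⌉₊ with hc
  have hc1 : 1 ≤ c := Nat.one_le_ceil_iff.2 (by positivity)
  set K0 := ⌈4 / (ρ * ε / 2) ^ 2⌉₊ with hK0
  have hK1 : 1 ≤ K0 := Nat.one_le_ceil_iff.2 (by positivity)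
  obtain ⟨C, hC⟩ : ∃ C, C = costC c K0 + (131072 + 4 * c + 2 * K0 * (c + 1)) + 4 := ⟨_, rfl⟩
  have hC1 : 2040 ≤ C := by rw [hC]; omega
  have hC2 : 131072 + 4 * c + 2 * K0 * (c + 1) + 4 ≤ C := by
    rw [hC]; exact Nat.add_le_add_right (Nat.le_add_left _ _) _
  refine ⟨C, fun δ hδ hδ1 => ?_⟩
  set D := ⌈Real.log (1 / δ)⌉₊ + 1 with hD
  set P : Par := ⟨![ε, ρ * ε / 2], K0, D⟩ with hPd
  have hL0 : ∀ i, 0 < P.L i := fun i => Nat.mul_pos hK1 (by simp only [hPd]; omega)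
  have hL : ∀ i : ℕ, 1 ≤ i → _ ∧ _ := fun i hi =>
    sample_size (half_pos hρε) hθ1 hδ hδ1 (θ := ![ε, ρ * ε / 2]) hi
  refine ⟨⟨updateP P, lookupP⟩, P.L, fun i hi => ⟨(hL i hi).1, (hL i hi).2.trans ?_⟩,
    fun n M upd hupd => ?_⟩
  · refine mul_le_mul_of_nonneg_right (by exact_mod_cast (by omega : 8 ≤ C)) ?_
    exact mul_nonneg (by positivity) (Real.log_nonneg (by
      have h1 : (1 : ℝ) ≤ i := by exact_mod_cast hi
      rw [le_div_iff₀ (by positivity), one_mul, div_le_iff₀ (by positivity)]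
      nlinarith))
  -- there is a vertex, even if there are no updates
  set z := (upd 0).u with hz
  have hn1 : 1 ≤ n := z.pos
  have htwo : ∀ {u v : Fin n}, u ≠ v → 2 ≤ n := fun {u v} h => by
    have := Fin.val_ne_of_ne h
    omega
  set N := n + M + ⌈Real.log (1 / δ)⌉₊ + 2 with hN
  set X := 3 * M + n + 4 with hX
  set Λ := K0 * (Nat.size (c * M) + D) * (300 * bitsV n + 210) + 500 * bitsV n + 1600 * bitsA X + 260
    with hΛ
  have hP : ∀ x < n, P.thr x ≤ n := fun x hx => by
    have : ⌊ρ * ε / 2 * (x : ℝ)⌋₊ ≤ x := 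
      Nat.floor_le_of_le (mul_le_of_le_one_left (Nat.cast_nonneg x) hθ1)
    simp only [Par.thr, hPd, Matrix.cons_val_one, Matrix.cons_val_fin_one]
    omega
  have hfit : ∀ (ω : Tape) (G : SimpleGraph (Fin n)),
      Fit (machine P ω (N ^ C) C n X G.edgeSet.ncard) P n X (c * M) (bitsV n) := fun ω G => by
    classical
    have hG : G.edgeSet.ncard ≤ n * n := by
      rw [← SimpleGraph.coe_edgeFinset, Set.ncard_coe_finset]
      refine G.card_edgeFinset_le_card_choose_two.trans ?_
      rw [Fintype.card_fin, Nat.choose_two_right]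
      exact (Nat.div_le_self _ _).trans (Nat.mul_le_mul_left _ (Nat.sub_le _ _))
    exact machine_fit ω ⟨hε.le, hε1⟩ hK1 (Nat.le_add_left _ _) hn1 (by omega)
      (by omega) (by omega) (by omega) hG (Nat.mul_le_mul_left c (show M ≤ N by omega))
      (by simp only [hPd]; omega) (le_pow_word (by omega) hC2)
  set cl := (Aux.run P upd M).calls with hcl
  have hrun := fun ω => exists_run P upd hε hρ rfl rfl hP hL0 hupd
    (F := fun t => machine P ω (N ^ C) C n X (graphAt upd t).edgeSet.ncard) (I := c * M) (Λ := Λ)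
    (Bm := bitsA X)
    (fun t _ => hfit ω _) (fun _ => rfl) (fun _ => rfl) (fun _ => rfl) (fun _ => rfl) (fun _ => rfl)
    (by push_cast; exact mul_le_mul_of_nonneg_right (Nat.le_ceil _) (by positivity)) hX.ge
    (fun i hi => by
      have h1 := Nat.size_le_size hi
      have h2 : P.L i * (300 * bitsV n + 210) ≤
          K0 * (Nat.size (c * M) + D) * (300 * bitsV n + 210) :=
        Nat.mul_le_mul_right _ (Nat.mul_le_mul_left _ (by simp only [hPd]; omega))
      omega) (sampler_fromTape P cl z ω)
  choose f g hf0 hHere hstep using hrun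
  have hcalls : ∀ ω, List.Forall₂ CallRel cl (f ω M).2.calls := fun ω => by
    have := (hHere ω M le_rfl).sim.calls
    rwa [Dat.run_A] at this
  -- the invocations do not depend on the tape
  set calls := (f (fun _ => 0) M).2.calls with hcallsd
  have heq : ∀ ω, (f ω M).2.calls = calls := fun ω =>
    List.right_unique_forall₂' (fun _ _ _ h h' => h.unique h') (hcalls ω) (hcalls _)
  have hsmp : IsSampling tapeMeasure P.L calls (sampler P cl z) := sampler_isSampling P cl z (hcalls _)
  refine ⟨N ^ C, fun ω t => (f ω t).1, g, sampler P cl z, fun ω t => (f ω t).2, calls, rfl,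
    fun ω => ⟨congrArg Prod.fst (hf0 ω), fun t ht => ⟨(hstep ω t ht).1, fun a ha => ?_⟩⟩,
    fun ω => ⟨congrArg Prod.snd (hf0 ω), fun t ht => (hstep ω t ht).2.1⟩, heq, hsmp, fun ω t ht => ?_,
    fun ω t ht u v huv => ?_, fun ω => ?_, ?_⟩
  · obtain ⟨r, hr, -⟩ := (hHere ω (t + 1) ht).st
    exact hr.mem_eq_zero (hfit ω _).good ha
  · obtain ⟨r, hr, -⟩ := (hHere ω (t + 1) ht).st
    rw [← (hHere ω (t + 1) ht).sim.flips, hr.out]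
    rfl
  · have h := hHere ω t ht
    obtain ⟨k, p, h1, h2, h3⟩ := (hfit ω (graphAt upd t)).lookup u.2 v.2 h.st
    have hn2 := htwo huv.ne
    refine ⟨k, p, h1, ?_, ?_⟩
    · exact lookup_cost_le hn2 hC1 h3
    · rw [h2, h.sim.lab]
      cases (f ω t).2.label s(u, v) <;> simp
  · rcases Nat.eq_zero_or_pos M with rfl | hM
    · simp
    have hn2 : 2 ≤ n := htwo (hupd 0 hM).1
    have hne := Aux.run_ne (M := M) hP fun t ht => by
      have h := hHere ω t ht.le
      have hA := Dat.run_A P upd ω t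
      have hx := hupd t ht
      rw [← h.graph] at hx
      rw [← hA]
      exact ⟨h.rest.inv, h.rest.calm, Fin.val_ne_of_ne hx.1, hx.2.trans (not_congr (h.sim.graph _ _))⟩
    have hlen : cl.length ≤ c * M := by
      have h := (hHere ω M le_rfl).prog
      have h2 := progress_nonneg (f ω M).2
      have h3 : (2 * (4 / (ρ * ε) + 1) + 1) * (M : ℝ) ≤ c * M :=
        mul_le_mul_of_nonneg_right (Nat.le_ceil _) (by positivity)
      rw [(hcalls ω).length_eq, ← Nat.cast_le (α := ℝ)]
      push_cast
      linarith
    have hT : ∀ t ≤ M, (∑ k ∈ Finset.range t, g ω k) ≤ t * (16000 * bitsA X) +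
        (Aux.run P upd t).ne * (10500 * bitsA X) + (Aux.run P upd t).calls.length * Λ := fun t => by
      induction t with
      | zero => simp
      | succ t ih =>
        intro ht
        have h1 := ih (by omega)
        have h2 := (hstep ω t ht).2.2.2
        rw [Finset.sum_range_succ, add_mul, one_mul]
        omega
    refine (cost_le hn2 hM hc1 hδ hδ1 hD hlen hne hΛ (hT M le_rfl)).trans ?_
    have h1 : (costC c K0 : ℝ) ≤ C := by
      exact_mod_cast (by rw [hC, add_assoc]; exact Nat.le_add_right _ _ : costC c K0 ≤ C)
    have h2 : 0 ≤ Real.log (M / δ) := Real.log_nonneg (by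
      have : (1 : ℝ) ≤ M := by exact_mod_cast hM
      rw [le_div_iff₀ hδ]; linarith)
    have := Real.log_natCast_nonneg n
    gcongr
  · refine (measure_mono fun ω hω => ?_).trans (sampling_fail hsmp (measurable_sampler P cl z)
      (half_pos hρε) hδ hL0 fun i hi => (hL i hi).1)
    refine fun hgood => hω fun t ht => ?_
    have h := hHere ω t ht
    have hv := h.live.valid hε hρ fun i e he => hgood i e (by
      rw [← heq ω]
      exact getElem?_of_prefix (prefix_of_le (f := fun t => (f ω t).2.calls)
        (fun k hk => (hstep ω k hk).2.2.1) ht) he)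
    rw [h.graph] at hv
    exact ⟨hv, fun μ _ => ⟨_, hv, rfl⟩⟩
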